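/- Let $d,N\ge 1$ be integers. Let $\mathcal B_1\subset\mathbb R^d$ be a measurable set with $0<\mathrm{vol}(\mathcal B_1)<\infty$ which is star-shaped, i.e. $cX\in\mathcal B_1$ for all $X\in\mathcal B_1$ and $c\in[0,1]$, and let $\mathcal B_r=\{rX : X\in\mathcal B_1\}$ for $r>0$. Let $\mathcal Q\subset\mathbb R^d$ be a measurable set (the uncertainties for which the robustness requirement is guaranteed), and $$\mathbb P(r)=\frac{\mathrm{vol}(\mathcal B_r\cap\mathcal Q)}{\mathrm{vol}(\mathcal B_r)} .$$ Let $0<r_1<r_2<\dots<r_m$ be a grid of radii. Samples $X_1,X_2,\dots$ are generated by the sample reuse algorithm: conditionally on $X_1,\dots,X_j$, the next sample $X_{j+1}$ is uniformly distributed on $\mathcal B_{r_\iota}$, where $\iota$ is the largest index such that fewer than $N$ of the samples $X_1,\dots,X_j$ lie in $\mathcal B_{r_\iota}$; the procedure stops after $\boldsymbol n$ samples, as soon as there is no such index. For each $i$, let $\boldsymbol v(i,\boldsymbol n)$ be the number of samples not in $\mathcal Q$ among the first $N$ samples that lie in $\mathcal B_{r_i}$, and let $K_i=N-\boldsymbol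 v(i,\boldsymbol n)$. Let $\delta\in(0,1)$, $\theta=\frac{9}{8\ln(2/\delta)}$ and $$\mathcal L(k)=\frac kN+\frac34\,\frac{1-\frac{2k}{N}-\sqrt{1+4\theta k(1-\frac kN)}}{1+\theta N},\qquad \mathcal U(k)=\frac kN+\frac34\,\frac{1-\frac{2k}{N}+\sqrt{1+4\theta k(1-\frac kN)}}{1+\theta N}.$$ Let $1\le i\le m-1$, $$g(r)=(r_{i+1}-r)\Big(\frac r{r_i}\Big)^{-d}+(r-r_i)\Big(\frac{r_{i+1}}r\Big)^{-d},\qquad \varsigma=1-\frac{g(r_\star)}{r_{i+1}-r_i},$$ where $r_\star$ is the solution, which exists and is unique, in $(r_i,r_{i+1})$ of $$\Big(\frac{r_{i+1}}r\Big)^{-d}\Big[1+\Big(1-\frac{r_i}r\Big)d\Big]-\Big(\frac r{r_i}\Big)^{-d}\Big[1+\Big(\frac{r_{i+1}}r-1\Big)d\Big]=0 .$$ For $r\in[r_i,r_{i+1}]$ put $\zeta=\frac{r-r_i}{r_{i+1}-r_i}$ and $$\overline{\mathbb P}(r)=\zeta\,\mathcal U(K_{i+1})+(1-\zeta)\,\mathcal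 U(K_i)+\varsigma,\qquad \underline{\mathbb P}(r)=\zeta\,\mathcal L(K_{i+1})+(1-\zeta)\,\mathcal L(K_i)-\varsigma .$$ Then $$\Pr\big\{\underline{\mathbb P}(r)<\mathbb P(r)<\overline{\mathbb P}(r)\ \text{ for all } r\in[r_i,r_{i+1}]\big\}>1-\delta .$$ -/

import Mathlib

open scoped Pointwise

noncomputable section

namespace SampleReuse

open MeasureTheory

/-- The uncertainty bounding set `𝓑_ρ = {ρ x | x ∈ 𝓑₁}` of radius `ρ`. -/
def bset {d : ℕ} (B : Set (Fin d → ℝ)) (ρ : ℝ) : Set (Fin d → ℝ) := ρ • B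

/-- The uniform distribution on `𝓑_ρ`: normalized Lebesgue measure. -/
def unif {d : ℕ} (B : Set (Fin d → ℝ)) (ρ : ℝ) : Measure (Fin d → ℝ) :=
  ProbabilityTheory.cond volume (bset B ρ)

/-- `ℙ(ρ)`: the volume fraction of `𝓑_ρ` on which the robustness requirement is guaranteed;
`Q` is the set of all uncertainties for which it is guaranteed. -/
def robustProb {d : ℕ} (B Q : Set (Fin d → ℝ)) (ρ : ℝ) : ℝ :=
  (volume (bset B ρ ∩ Q)).toReal / (volume (bset B ρ)).toReal

/-! The bookkeeping of the experiment. `x 0, x 1, …` is the sequence of samples in the order of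
their generation, `ρ` is the radius of a grid point, `N` the sample size per grid point. -/

/-- The number of the first `ℓ` samples that lie in `𝓑_ρ`. -/
def hits {d : ℕ} (B : Set (Fin d → ℝ)) (ρ : ℝ) (x : ℕ → Fin d → ℝ) (ℓ : ℕ) : ℕ :=
  ∑ k ∈ Finset.range ℓ, (bset B ρ).indicator (fun _ => 1) (x k)

/-- The number of the first `ℓ` samples that lie in `𝓑_ρ` and violate the requirement. -/
def badHits {d : ℕ} (B Q : Set (Fin d → ℝ)) (ρ : ℝ) (x : ℕ → Fin d → ℝ) (ℓ : ℕ) : ℕ :=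
  ∑ k ∈ Finset.range ℓ, (bset B ρ \ Q).indicator (fun _ => 1) (x k)

/-- The largest `ℓ ≤ j` such that at most `N` of the first `ℓ` samples lie in `𝓑_ρ`. -/
def cutoff {d : ℕ} (B : Set (Fin d → ℝ)) (N : ℕ) (ρ : ℝ) (x : ℕ → Fin d → ℝ) (j : ℕ) : ℕ :=
  Nat.findGreatest (fun ℓ => hits B ρ x ℓ ≤ N) j

/-- Accumulated number `s` of samples for radius `ρ` after `j` samples have been generated. -/
def numSamples {d : ℕ} (B : Set (Fin d → ℝ)) (N : ℕ) (ρ : ℝ) (x : ℕ → Fin d → ℝ) (j : ℕ) : ℕ :=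
  hits B ρ x (cutoff B N ρ x j)

/-- Accumulated number `v` of violations for radius `ρ` after `j` samples have been generated. -/
def numViolations {d : ℕ} (B Q : Set (Fin d → ℝ)) (N : ℕ) (ρ : ℝ) (x : ℕ → Fin d → ℝ)
    (j : ℕ) : ℕ :=
  badHits B Q ρ x (cutoff B N ρ x j)

/-- After `j` samples, `i` is the largest grid index whose experiment is not completed. -/
def IsCurrent {d m : ℕ} (B : Set (Fin d → ℝ)) (N : ℕ) (r : Fin m → ℝ) (x : ℕ → Fin d → ℝ)
    (j : ℕ) (i : Fin m) : Prop :=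
  numSamples B N (r i) x j < N ∧ ∀ i', i < i' → numSamples B N (r i') x j = N

/-- After `j` samples, the experiment is completed at every grid point. -/
def IsDone {d m : ℕ} (B : Set (Fin d → ℝ)) (N : ℕ) (r : Fin m → ℝ) (x : ℕ → Fin d → ℝ)
    (j : ℕ) : Prop :=
  ∀ i, numSamples B N (r i) x j = N

/-- The total number `n` of samples generated: the first `j` at which the experiment is completed
at every grid point. -/
def stopTime {d m : ℕ} (B : Set (Fin d → ℝ)) (N : ℕ) (r : Fin m → ℝ) (x : ℕ → Fin d → ℝ) : ℕ :=
  sInf {j | IsDone B N r x j}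

/-- `K = N - v(·, n)`: the number of the `N` samples collected for the radius `ρ` that satisfy the
requirement, at the end of the experiment. -/
def numRobust {d m : ℕ} (B Q : Set (Fin d → ℝ)) (N : ℕ) (r : Fin m → ℝ) (ρ : ℝ)
    (x : ℕ → Fin d → ℝ) : ℝ :=
  (N : ℝ) - (numViolations B Q N ρ x (stopTime B N r x) : ℝ)

/-- The samples `X 0, X 1, …` are generated by the sample reuse algorithm: conditionally on the
first `j` samples, the next one is uniform on `𝓑_{r i}`, where `r i` is the largest radius whose
experiment is not completed. (Nothing is required of what follows the completion.) -/
structure IsSampleReuse {d m : ℕ} {Ω : Type*} [MeasurableSpace Ω] (μ : Measure Ω)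
    (B : Set (Fin d → ℝ)) (N : ℕ) (r : Fin m → ℝ) (X : ℕ → Ω → Fin d → ℝ) : Prop where
  measurable : ∀ j, Measurable (X j)
  law : ∀ (j : ℕ) (i : Fin m) (H : Set (Fin j → Fin d → ℝ)) (A : Set (Fin d → ℝ)),
    MeasurableSet H → MeasurableSet A →
    μ {ω | (fun k : Fin j => X k ω) ∈ H ∧ IsCurrent B N r (fun k => X k ω) j i ∧ X j ω ∈ A} =
      μ {ω | (fun k : Fin j => X k ω) ∈ H ∧ IsCurrent B N r (fun k => X k ω) j i} *
        unif B (r i) A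

/-- `θ = 9 / (8 ln (2/δ))`. -/
def theta (δ : ℝ) : ℝ := 9 / (8 * Real.log (2 / δ))

/-- The lower limit `𝓛(k)`. -/
def lowerLim (N : ℕ) (δ k : ℝ) : ℝ :=
  k / N + 3 / 4 * ((1 - 2 * k / N - √(1 + 4 * theta δ * k * (1 - k / N))) / (1 + theta δ * N))

/-- The upper limit `𝓤(k)`. -/
def upperLim (N : ℕ) (δ k : ℝ) : ℝ :=
  k / N + 3 / 4 * ((1 - 2 * k / N + √(1 + 4 * theta δ * k * (1 - k / N))) / (1 + theta δ * N))

/-- `g(ρ)` for the grid interval `[p, q]`. -/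
def gfun (d : ℕ) (p q ρ : ℝ) : ℝ :=
  (q - ρ) * (ρ / p) ^ (-(d : ℤ)) + (ρ - p) * (q / ρ) ^ (-(d : ℤ))

/-- `ρ ∈ (p, q)` solves the equation that determines `r_⋆` on the grid interval `[p, q]`. -/
def IsStar (d : ℕ) (p q ρ : ℝ) : Prop :=
  ρ ∈ Set.Ioo p q ∧
    (q / ρ) ^ (-(d : ℤ)) * (1 + (1 - p / ρ) * d) - (ρ / p) ^ (-(d : ℤ)) * (1 + (q / ρ - 1) * d) = 0

/-- The interpolation error bound `ς = 1 - g(r_⋆) / (q - p)` on the grid interval `[p, q]`. -/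
def interpErr (d : ℕ) (p q rstar : ℝ) : ℝ := 1 - gfun d p q rstar / (q - p)

/-- Linear interpolation on `[p, q]` of the values `u` at `p` and `w` at `q`. -/
def interp (p q u w ρ : ℝ) : ℝ := (ρ - p) / (q - p) * w + (1 - (ρ - p) / (q - p)) * u

end SampleReuse

end

/-! Let p < q be the two radii, P and R the values of ℙ there, t = (p/q)^d, k = √t, and for ρ in [p,
q] put α = (p/ρ)^d, β = (ρ/q)^d. Replacing Q by its complement turns lower limits into one minus
upper limits (`lowerLim_eq`, `goodCount_compl`), so it is enough that the upper band fails with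
probability less than δ/2 (`Run.band_lt`).

Deterministic side. Nestedness of the balls gives ℙ(ρ) ≤ 1 - α + αP and βℙ(ρ) ≤ R
(`robustProb_mono`). Minimality of g at r_⋆ gives ς ≥ (1-ζ)(1-α) + ζ(1-β) for every ρ, and ς ≥ 1 - k
by taking ρ = √(pq). These bounds leave room: for suitable a, b ≤ 1 and η ≥ 0 depending only on k,
the band holds on the whole interval once 𝓤(K_i) > aP - η and 𝓤(K_{i+1}) > bR - η (`Covers`,
`Run.robustProb_lt_of_thresholds`).

Probabilistic side. The limit 𝓤 inverts Massart's inequality, so each of the thresholds P and R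
alone fails with probability at most δ/2; the two lowered thresholds together must stay below δ/2.
If k ≤ 0.309, take η = 0 and a, b < 1: the two improved tails already add up to less than δ/2
(`Run.upper_lt_of_union`). For larger k the union bound is too crude, because a proportion t of the
samples used at q is reused at p. The martingale `pgfProc` gives the joint generating function of
the counts, E v^{K_i} z^{K_{i+1}} = g^N with g affine in z. Hence, when K_i is tilted exponentially
to mean Nx, the count K_{i+1} stays binomial, with mean N(R - t(P - x)). Splitting the union into
{K_{i+1} low} and {K_i low, K_{i+1} not low} and using convexity of exp gives
`Run.measureReal_union_lt`.

Numerical side. Jensen's inequality for the relative entropy (`ent_jensen`) reduces the requirement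
to an inequality about the deviations at p and q, `Dominated`, in which y enters only through a
variance. Bounding that variance through a slack φ leaves polynomial inequalities in the deviations.
On 0.309 ≤ k ≤ 0.882 they are certified on finitely many intervals with constant a, b, η; for k >
0.88 one takes a = b = 1 and η = u(0.48 - 0.6u) with u = 1 - k, in charts rescaled by u.

A certificate is a subdivision of a box. On each leaf the box is mapped to the positive octant by
projective coordinates, where the numerator has nonnegative coefficients. All coefficients are
tested at once as the digits of a single integer. -/

namespace PolyCert

/-! ### Certified positivity of polynomials on boxes -/

/-- Integer polynomial expressions in three projective coordinates `x/ox`, `y/oy`, `z/oz`. -/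
inductive PE
  | c (n : ℤ) | x | ox | y | oy | z | oz
  | add (p q : PE) | sub (p q : PE) | mul (p q : PE)

namespace PE

/-- Generic in the ring, since the same expression is evaluated at integers, at reals and at
polynomials; `map_eval` passes between these. -/
def eval {R : Type*} [CommRing R] (x ox y oy z oz : R) : PE → R
  | c n => (n : R)
  | .x => x | .ox => ox | .y => y | .oy => oy | .z => z | .oz => oz
  | add p q => eval x ox y oy z oz p + eval x ox y oy z oz q
  | sub p q => eval x ox y oy z oz p - eval x ox y oy z oz q
  | mul p q => eval x ox y oy z oz p * eval x ox y oy z oz q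

/-- Integer evaluation, in a form that reduces quickly. -/
def evZ (x ox y oy z oz : ℤ) : PE → ℤ
  | c n => n
  | .x => x | .ox => ox | .y => y | .oy => oy | .z => z | .oz => oz
  | add p q => Int.add (evZ x ox y oy z oz p) (evZ x ox y oy z oz q)
  | sub p q => Int.sub (evZ x ox y oy z oz p) (evZ x ox y oy z oz q)
  | mul p q => Int.mul (evZ x ox y oy z oz p) (evZ x ox y oy z oz q)

theorem evZ_eq (x ox y oy z oz : ℤ) (p : PE) : evZ x ox y oy z oz p = eval x ox y oy z oz p := by
  induction p with
  | add p q hp hq => simp only [evZ, eval, ← hp, ← hq]; rfl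
  | sub p q hp hq => simp only [evZ, eval, ← hp, ← hq]; rfl
  | mul p q hp hq => simp only [evZ, eval, ← hp, ← hq]; rfl
  | _ => simp [evZ, eval]

theorem map_eval {R S : Type*} [CommRing R] [CommRing S] (f : R →+* S) (x ox y oy z oz : R)
    (p : PE) : f (eval x ox y oy z oz p) = eval (f x) (f ox) (f y) (f oy) (f z) (f oz) p := by
  induction p with
  | add p q hp hq => simp [eval, hp, hq]
  | sub p q hp hq => simp [eval, hp, hq]
  | mul p q hp hq => simp [eval, hp, hq]
  | _ => simp [eval]

/-- The multidegree, provided that the expression is multihomogeneous. -/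
def deg : PE → ℕ × ℕ × ℕ
  | c _ => (0, 0, 0)
  | x => (1, 0, 0) | ox => (1, 0, 0) | y => (0, 1, 0) | oy => (0, 1, 0)
  | z => (0, 0, 1) | oz => (0, 0, 1)
  | add p _ => deg p
  | sub p _ => deg p
  | mul p q => ((deg p).1 + (deg q).1, (deg p).2.1 + (deg q).2.1, (deg p).2.2 + (deg q).2.2)

/-- Sums are admitted only for equal multidegrees, which is why `deg` may ignore the second summand.
-/
def isHom : PE → Bool
  | add p q => isHom p && isHom q && (deg p == deg q)
  | sub p q => isHom p && isHom q && (deg p == deg q)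
  | mul p q => isHom p && isHom q
  | _ => true

theorem eval_scale {R : Type*} [CommRing R] (r s t x ox y oy z oz : R) (p : PE)
    (h : p.isHom = true) :
    eval (r * x) (r * ox) (s * y) (s * oy) (t * z) (t * oz) p =
      r ^ p.deg.1 * s ^ p.deg.2.1 * t ^ p.deg.2.2 * eval x ox y oy z oz p := by
  induction p with
  | add p q hp hq =>
    simp only [isHom, Bool.and_eq_true, beq_iff_eq] at h
    simp only [eval, deg, hp h.1.1, hq h.1.2, h.2]; ring
  | sub p q hp hq =>
    simp only [isHom, Bool.and_eq_true, beq_iff_eq] at h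
    simp only [eval, deg, hp h.1.1, hq h.1.2, h.2]; ring
  | mul p q hp hq =>
    simp only [isHom, Bool.and_eq_true] at h
    simp only [eval, deg, hp h.1, hq h.2]; ring
  | _ => simp [eval, deg]

/-- Replace constants by their absolute values and differences by sums. -/
def abs : PE → PE
  | c n => c |n|
  | add p q => add (abs p) (abs q)
  | sub p q => add (abs p) (abs q)
  | mul p q => mul (abs p) (abs q)
  | p => p

theorem eval_abs_nonneg {x ox y oy z oz : ℤ} (h : 0 ≤ x ∧ 0 ≤ ox ∧ 0 ≤ y ∧ 0 ≤ oy ∧ 0 ≤ z ∧ 0 ≤ oz)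
    (p : PE) : 0 ≤ eval x ox y oy z oz p.abs := by
  obtain ⟨h1, h2, h3, h4, h5, h6⟩ := h
  induction p with
  | add p q hp hq => simp only [abs, eval]; positivity
  | sub p q hp hq => simp only [abs, eval]; positivity
  | mul p q hp hq => simp only [abs, eval]; positivity
  | c n => simp [abs, eval]
  | _ => assumption

theorem eval_abs_mono {x ox y oy z oz x' ox' y' oy' z' oz' : ℤ}
    (h : 0 ≤ x ∧ 0 ≤ ox ∧ 0 ≤ y ∧ 0 ≤ oy ∧ 0 ≤ z ∧ 0 ≤ oz)
    (h' : x ≤ x' ∧ ox ≤ ox' ∧ y ≤ y' ∧ oy ≤ oy' ∧ z ≤ z' ∧ oz ≤ oz') (p : PE) :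
    eval x ox y oy z oz p.abs ≤ eval x' ox' y' oy' z' oz' p.abs := by
  have h0 := fun p => eval_abs_nonneg h p
  obtain ⟨g1, g2, g3, g4, g5, g6⟩ := h'
  have h0' := fun p => eval_abs_nonneg (x := x') (ox := ox') (y := y') (oy := oy') (z := z')
    (oz := oz') (by omega) p
  induction p with
  | add p q hp hq => simp only [abs, eval]; gcongr
  | sub p q hp hq => simp only [abs, eval]; gcongr
  | mul p q hp hq =>
    simp only [abs, eval]
    exact mul_le_mul hp hq (h0 q) (h0' p)
  | c n => simp [abs, eval]
  | _ => assumption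

end PE

open MvPolynomial in
/-- The polynomial of `p` on the box `[x0, x1] × [y0, y1] × [z0, z1]` (unit `1/D`) in the
coordinates of the positive octant. -/
noncomputable def boxPoly (D x0 x1 y0 y1 z0 z1 : ℤ) (p : PE) : MvPolynomial (Fin 3) ℤ :=
  p.eval (C x0 + C x1 * X 0) (C D * (1 + X 0)) (C y0 + C y1 * X 1) (C D * (1 + X 1))
    (C z0 + C z1 * X 2) (C D * (1 + X 2))

open MvPolynomial in
theorem coeff_abs_mul_le {P Q P' Q' : MvPolynomial (Fin 3) ℤ} (hP : ∀ m, |coeff m P| ≤ coeff m P')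
    (hQ : ∀ m, |coeff m Q| ≤ coeff m Q') (m : Fin 3 →₀ ℕ) :
    |coeff m (P * Q)| ≤ coeff m (P' * Q') := by
  classical
  rw [coeff_mul, coeff_mul]
  refine (Finset.abs_sum_le_sum_abs _ _).trans (Finset.sum_le_sum fun a _ => ?_)
  rw [abs_mul]
  exact mul_le_mul (hP _) (hQ _) (abs_nonneg _) ((abs_nonneg _).trans (hP _))

open MvPolynomial in
theorem coeff_abs_add_le {P Q P' Q' : MvPolynomial (Fin 3) ℤ} (hP : ∀ m, |coeff m P| ≤ coeff m P')
    (hQ : ∀ m, |coeff m Q| ≤ coeff m Q') (m : Fin 3 →₀ ℕ) :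
    |coeff m (P + Q)| ≤ coeff m (P' + Q') := by
  rw [coeff_add, coeff_add]
  exact (abs_add_le _ _).trans (add_le_add (hP m) (hQ m))

open MvPolynomial in
theorem coeff_abs_sub_le {P Q P' Q' : MvPolynomial (Fin 3) ℤ} (hP : ∀ m, |coeff m P| ≤ coeff m P')
    (hQ : ∀ m, |coeff m Q| ≤ coeff m Q') (m : Fin 3 →₀ ℕ) :
    |coeff m (P - Q)| ≤ coeff m (P' + Q') := by
  rw [coeff_sub, coeff_add]
  exact (abs_sub _ _).trans (add_le_add (hP m) (hQ m))

open MvPolynomial in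
theorem coeff_C_abs_le (a : ℤ) (m : Fin 3 →₀ ℕ) :
    |coeff m (C a : MvPolynomial (Fin 3) ℤ)| ≤ coeff m (C |a| : MvPolynomial (Fin 3) ℤ) := by
  classical
  simp only [coeff_C]; split_ifs <;> simp

open MvPolynomial in
theorem coeff_X_abs_le (i : Fin 3) (m : Fin 3 →₀ ℕ) :
    |coeff m (X i : MvPolynomial (Fin 3) ℤ)| ≤ coeff m (X i : MvPolynomial (Fin 3) ℤ) := by
  classical
  simp only [coeff_X]; split_ifs <;> simp

open MvPolynomial in
-- Making every sign positive yields a coefficientwise majorant, because majorants are compatible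
-- with sums, differences and products.
theorem coeff_boxPoly_abs_le (D x0 x1 y0 y1 z0 z1 : ℤ) (p : PE) (m : Fin 3 →₀ ℕ) :
    |coeff m (boxPoly D x0 x1 y0 y1 z0 z1 p)| ≤
      coeff m (boxPoly |D| |x0| |x1| |y0| |y1| |z0| |z1| p.abs) := by
  have h1 : ∀ (a b : ℤ) (i : Fin 3) m, |coeff m (C a + C b * X i : MvPolynomial (Fin 3) ℤ)| ≤
      coeff m (C |a| + C |b| * X i : MvPolynomial (Fin 3) ℤ) := fun a b i =>
    coeff_abs_add_le (coeff_C_abs_le a) (coeff_abs_mul_le (coeff_C_abs_le b) (coeff_X_abs_le i))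
  have h2 : ∀ (i : Fin 3) m, |coeff m (C D * (1 + X i) : MvPolynomial (Fin 3) ℤ)| ≤
      coeff m (C |D| * (1 + X i) : MvPolynomial (Fin 3) ℤ) := fun i =>
    coeff_abs_mul_le (coeff_C_abs_le D) (coeff_abs_add_le
      (by simpa using coeff_C_abs_le 1) (coeff_X_abs_le i))
  unfold boxPoly
  induction p generalizing m with
  | add p q hp hq => exact coeff_abs_add_le hp hq m
  | sub p q hp hq => exact coeff_abs_sub_le hp hq m
  | mul p q hp hq => exact coeff_abs_mul_le hp hq m
  | c n => simpa [PE.abs, PE.eval] using coeff_C_abs_le n m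
  | x => exact h1 _ _ _ _
  | y => exact h1 _ _ _ _
  | z => exact h1 _ _ _ _
  | ox => exact h2 _ _
  | oy => exact h2 _ _
  | oz => exact h2 _ _

open MvPolynomial in
theorem coeff_le_eval_one {P : MvPolynomial (Fin 3) ℤ} (h : ∀ m, 0 ≤ coeff m P)
    (m : Fin 3 →₀ ℕ) : coeff m P ≤ MvPolynomial.eval (fun _ => 1) P := by
  classical
  rw [eval_eq]
  simp only [one_pow, Finset.prod_const_one, mul_one]
  by_cases hm : m ∈ P.support
  · exact Finset.single_le_sum (f := fun m => coeff m P) (fun i _ => h i) hm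
  · rw [notMem_support_iff.1 hm]; exact Finset.sum_nonneg fun i _ => h i

open MvPolynomial in
-- A polynomial with nonnegative coefficients has each of them bounded by its value at (1, 1, 1).
-- For the majorant this value is computed from |x0| + |x1| ≤ b and D(1 + 1) = 2D. The bound
-- guarantees that no digit overflows.
theorem coeff_boxPoly_le {D x0 x1 y0 y1 z0 z1 b : ℤ} (hD : 0 ≤ D) (hx : |x0| + |x1| ≤ b)
    (hy : |y0| + |y1| ≤ b) (hz : |z0| + |z1| ≤ b) (p : PE) (m : Fin 3 →₀ ℕ) :
    |coeff m (boxPoly D x0 x1 y0 y1 z0 z1 p)| ≤ p.abs.eval b (2 * D) b (2 * D) b (2 * D) := by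
  refine (coeff_boxPoly_abs_le D x0 x1 y0 y1 z0 z1 p m).trans ?_
  refine (coeff_le_eval_one (fun m => (abs_nonneg _).trans
    (coeff_boxPoly_abs_le D x0 x1 y0 y1 z0 z1 p m)) m).trans ?_
  unfold boxPoly
  rw [PE.map_eval]
  have := abs_nonneg x0; have := abs_nonneg x1; have := abs_nonneg y0; have := abs_nonneg y1
  have := abs_nonneg z0; have := abs_nonneg z1
  refine PE.eval_abs_mono ?_ ?_ p
  · simp only [map_add, map_mul, eval_C, eval_X, map_one, abs_of_nonneg hD]
    refine ⟨?_, ?_, ?_, ?_, ?_, ?_⟩ <;> positivity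
  · simp only [map_add, map_mul, eval_C, eval_X, map_one, abs_of_nonneg hD]
    refine ⟨?_, ?_, ?_, ?_, ?_, ?_⟩ <;> linarith

open MvPolynomial in
-- A coordinate and its denominator both have degree at most one in the chart variable, so the
-- multidegree bounds the degrees.
theorem degreeOf_boxPoly_le (D x0 x1 y0 y1 z0 z1 : ℤ) (p : PE) (h : p.isHom = true) :
    degreeOf 0 (boxPoly D x0 x1 y0 y1 z0 z1 p) ≤ p.deg.1 ∧
    degreeOf 1 (boxPoly D x0 x1 y0 y1 z0 z1 p) ≤ p.deg.2.1 ∧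
    degreeOf 2 (boxPoly D x0 x1 y0 y1 z0 z1 p) ≤ p.deg.2.2 := by
  have hX : ∀ (a b : ℤ) (i j : Fin 3), degreeOf j (C a + C b * X i : MvPolynomial (Fin 3) ℤ) ≤
      if j = i then 1 else 0 := fun a b i j => by
    refine (degreeOf_add_le _ _ _).trans (max_le (by rw [degreeOf_C]; exact Nat.zero_le _) ?_)
    refine (degreeOf_mul_le _ _ _).trans ?_
    rw [degreeOf_C, degreeOf_X, zero_add]
  have hO : ∀ (i j : Fin 3), degreeOf j (C D * (1 + X i) : MvPolynomial (Fin 3) ℤ) ≤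
      if j = i then 1 else 0 := fun i j => by
    refine (degreeOf_mul_le _ _ _).trans ?_
    rw [degreeOf_C, zero_add]
    refine (degreeOf_add_le _ _ _).trans (max_le (by simp [degreeOf_one]) ?_)
    rw [degreeOf_X]
  induction p with
  | add p q hp hq =>
    simp only [PE.isHom, Bool.and_eq_true, beq_iff_eq] at h
    have a := hp h.1.1; have b := hq h.1.2
    rw [← h.2] at b
    exact ⟨(degreeOf_add_le _ _ _).trans (max_le a.1 b.1),
      (degreeOf_add_le _ _ _).trans (max_le a.2.1 b.2.1),
      (degreeOf_add_le _ _ _).trans (max_le a.2.2 b.2.2)⟩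
  | sub p q hp hq =>
    simp only [PE.isHom, Bool.and_eq_true, beq_iff_eq] at h
    have a := hp h.1.1; have b := hq h.1.2
    rw [← h.2] at b
    exact ⟨(degreeOf_sub_le _ _ _).trans (max_le a.1 b.1),
      (degreeOf_sub_le _ _ _).trans (max_le a.2.1 b.2.1),
      (degreeOf_sub_le _ _ _).trans (max_le a.2.2 b.2.2)⟩
  | mul p q hp hq =>
    simp only [PE.isHom, Bool.and_eq_true] at h
    have a := hp h.1; have b := hq h.2
    exact ⟨(degreeOf_mul_le _ _ _).trans (add_le_add a.1 b.1),
      (degreeOf_mul_le _ _ _).trans (add_le_add a.2.1 b.2.1),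
      (degreeOf_mul_le _ _ _).trans (add_le_add a.2.2 b.2.2)⟩
  | c n =>
    have : boxPoly D x0 x1 y0 y1 z0 z1 (.c n) = C n := by simp [boxPoly, PE.eval]
    rw [this]; simp only [degreeOf_C]; simp
  | x => exact ⟨hX _ _ _ _, hX _ _ _ _, hX _ _ _ _⟩
  | y => exact ⟨hX _ _ _ _, hX _ _ _ _, hX _ _ _ _⟩
  | z => exact ⟨hX _ _ _ _, hX _ _ _ _, hX _ _ _ _⟩
  | ox => exact ⟨hO _ _, hO _ _, hO _ _⟩
  | oy => exact ⟨hO _ _, hO _ _, hO _ _⟩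
  | oz => exact ⟨hO _ _, hO _ _, hO _ _⟩

/-- Digits of a number written in base `2 ^ w`, recognised by their leading bits. -/
theorem le_digit_of_land {w : ℕ} (hw : 0 < w) :
    ∀ (K : ℕ) (a : ℕ → ℕ), (∀ n, a n < 2 ^ w) →
      (∑ n ∈ Finset.range K, a n * (2 ^ w) ^ n) &&& (∑ n ∈ Finset.range K, 2 ^ (w - 1) * (2 ^ w) ^ n)
        = ∑ n ∈ Finset.range K, 2 ^ (w - 1) * (2 ^ w) ^ n →
      ∀ n < K, 2 ^ (w - 1) ≤ a n := by
  intro K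
  induction K with
  | zero => intro a _ _ n hn; omega
  | succ K ih =>
    intro a ha h n hn
    have e1 : ∀ b : ℕ → ℕ, ∑ n ∈ Finset.range (K + 1), b n * (2 ^ w) ^ n =
        2 ^ w * (∑ n ∈ Finset.range K, b (n + 1) * (2 ^ w) ^ n) + b 0 := by
      intro b
      rw [Finset.sum_range_succ', Finset.mul_sum]
      simp only [pow_zero, mul_one]
      congr 1
      exact Finset.sum_congr rfl fun i _ => by ring
    have hlt : 2 ^ (w - 1) < 2 ^ w := Nat.pow_lt_pow_right (by norm_num) (by omega)
    rw [e1 a, e1 (fun _ => 2 ^ (w - 1))] at h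
    have hb : ∀ i, (Nat.testBit (2 ^ w * (∑ n ∈ Finset.range K, a (n + 1) * (2 ^ w) ^ n) + a 0) i
        && Nat.testBit (2 ^ w * (∑ n ∈ Finset.range K, 2 ^ (w - 1) * (2 ^ w) ^ n) + 2 ^ (w - 1)) i)
        = Nat.testBit (2 ^ w * (∑ n ∈ Finset.range K, 2 ^ (w - 1) * (2 ^ w) ^ n) + 2 ^ (w - 1)) i := by
      intro i
      rw [← Nat.testBit_and]
      exact congrArg (fun m => Nat.testBit m i) h
    -- The lowest block of w bits is `a 0`, whose leading bit is bit w - 1; deleting this block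
    -- leaves the claim for the shifted digits.
    rcases n with _ | n
    · have := hb (w - 1)
      rw [Nat.testBit_two_pow_mul_add _ (ha 0), Nat.testBit_two_pow_mul_add _ hlt,
        if_pos (by omega), if_pos (by omega)] at this
      simp only [Nat.testBit_two_pow_self, Bool.and_true] at this
      exact Nat.ge_two_pow_of_testBit this
    · refine ih (fun n => a (n + 1)) (fun n => ha _) ?_ n (by omega)
      refine Nat.eq_of_testBit_eq fun i => ?_
      have := hb (w + i)
      rw [Nat.testBit_two_pow_mul_add _ (ha 0), Nat.testBit_two_pow_mul_add _ hlt,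
        if_neg (by omega), if_neg (by omega)] at this
      simpa [Nat.testBit_and] using this

/-- Unit `1 / D`, digits of `w` bits, fewer than `s`, `r`, `s'` powers of the three coordinates,
which are bounded by `b`. -/
structure Cfg where
  D : ℤ
  w : ℕ
  s : ℕ
  r : ℕ
  s' : ℕ
  b : ℤ

structure Box where
  x0 : ℤ
  x1 : ℤ
  y0 : ℤ
  y1 : ℤ
  z0 : ℤ
  z1 : ℤ

/-- All base 2^w digits equal 2^(w-1), summed as a geometric series. It is both the bias that makes
digits nonnegative and the bit pattern that is tested. -/
def mask (g : Cfg) : ℕ :=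
  2 ^ (g.w - 1) * (((2 ^ g.w) ^ (g.s * g.r * g.s') - 1) / (2 ^ g.w - 1))

/-- Kronecker substitution: the box polynomial at M = 2^w, M^s, M^(s r), so that its coefficients
become signed digits to base M. -/
def packed (g : Cfg) (B : Box) (p : PE) : ℤ :=
  PE.evZ (Int.add B.x0 (Int.mul B.x1 (2 ^ g.w : ℕ))) (Int.mul g.D (1 + 2 ^ g.w : ℕ))
    (Int.add B.y0 (Int.mul B.y1 (2 ^ (g.w * g.s) : ℕ))) (Int.mul g.D (1 + 2 ^ (g.w * g.s) : ℕ))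
    (Int.add B.z0 (Int.mul B.z1 (2 ^ (g.w * (g.s * g.r)) : ℕ)))
    (Int.mul g.D (1 + 2 ^ (g.w * (g.s * g.r)) : ℕ)) p

/-- A coefficient plus 2^(w-1) is a digit whose leading bit is set exactly when the coefficient is
nonnegative, so one bitwise conjunction tests all coefficients. -/
def leafOK (g : Cfg) (B : Box) (p : PE) : Bool :=
  Nat.beq (Nat.land (Int.toNat (Int.add (packed g B p) (mask g : ℕ))) (mask g)) (mask g)

def boxOK (g : Cfg) (B : Box) : Bool :=
  decide (B.x0 < B.x1) && decide (B.y0 < B.y1) && decide (B.z0 < B.z1) &&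
  decide (|B.x0| + |B.x1| ≤ g.b) && decide (|B.y0| + |B.y1| ≤ g.b) &&
  decide (|B.z0| + |B.z1| ≤ g.b)

/-- The last conjunct keeps every coefficient below 2^(w-1) in absolute value on each box that
passes `boxOK`. -/
def polyOK (g : Cfg) (p : PE) : Bool :=
  p.isHom && Nat.blt p.deg.1 g.s && Nat.blt p.deg.2.1 g.r && Nat.blt p.deg.2.2 g.s' &&
  decide (PE.evZ g.b (2 * g.D) g.b (2 * g.D) g.b (2 * g.D) p.abs < 2 ^ (g.w - 1))

/-- Follow the subdivision encoded in the digits of `code`; return the unused digits. -/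
def run (g : Cfg) (cls : List (List PE)) : ℕ → Box → ℕ → Option ℕ
  | 0, _, _ => none
  | f + 1, B, code =>
    -- Digits 0, 1, 2 bisect the box in the first, second, third coordinate; digit k + 3 closes it
    -- with the clause of index k.
    match code % 16 with
    | 0 =>
      match run g cls f { B with x1 := (B.x0 + B.x1) / 2 } (code / 16) with
      | none => none
      | some c => run g cls f { B with x0 := (B.x0 + B.x1) / 2 } c
    | 1 =>
      match run g cls f { B with y1 := (B.y0 + B.y1) / 2 } (code / 16) with
      | none => none
      | some c => run g cls f { B with y0 := (B.y0 + B.y1) / 2 } c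
    | 2 =>
      match run g cls f { B with z1 := (B.z0 + B.z1) / 2 } (code / 16) with
      | none => none
      | some c => run g cls f { B with z0 := (B.z0 + B.z1) / 2 } c
    | k + 3 =>
      match cls[k]? with
      | none => none
      | some cl => if boxOK g B && cl.all (leafOK g B) then some (code / 16) else none

/-- The number 40 bounds the depth of the subdivision, not its size. -/
def check (g : Cfg) (cls : List (List PE)) (B : Box) (code : ℕ) : Bool :=
  decide (0 < g.D) && decide (0 < g.w) && cls.all (fun cl => cl.all (polyOK g)) &&
  (run g cls 40 B code).isSome

open MvPolynomial

/-- The exponents of the `n`-th digit. -/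
noncomputable def digitMon (s r n : ℕ) : Fin 3 →₀ ℕ :=
  Finsupp.equivFunOnFinite.symm ![n % s, n / s % r, n / (s * r)]

theorem digitMon_inj {s r n n' : ℕ} (h : digitMon s r n = digitMon s r n') : n = n' := by
  have h := Finsupp.equivFunOnFinite.symm.injective h
  have h0 : n % s = n' % s := congrFun h 0
  have h1 : n / s % r = n' / s % r := congrFun h 1
  have h2 : n / (s * r) = n' / (s * r) := congrFun h 2
  rw [← Nat.div_div_eq_div_mul, ← Nat.div_div_eq_div_mul] at h2
  have h3 : n / s = n' / s := by
    rw [← Nat.div_add_mod (n / s) r, h1, h2, Nat.div_add_mod]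
  rw [← Nat.div_add_mod n s, h0, h3, Nat.div_add_mod]

/-- The exponents (i, j, l) with i < s and j < r correspond to the mixed-radix number i + s(j + r
l), so distinct monomials occupy distinct digits. -/
theorem eval_eq_digits {P : MvPolynomial (Fin 3) ℤ} {s r s' : ℕ} (h0 : degreeOf 0 P < s)
    (h1 : degreeOf 1 P < r) (h2 : degreeOf 2 P < s') (M : ℤ) :
    eval ![M, M ^ s, M ^ (s * r)] P =
      ∑ n ∈ Finset.range (s * r * s'), coeff (digitMon s r n) P * M ^ n := by
  classical
  have hs : 0 < s := by omega
  have hr : 0 < r := by omega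
  rw [eval_eq']
  have hsub : P.support ⊆ (Finset.range (s * r * s')).image (digitMon s r) := by
    intro m hm
    have a0 : m 0 < s := (monomial_le_degreeOf 0 hm).trans_lt h0
    have a1 : m 1 < r := (monomial_le_degreeOf 1 hm).trans_lt h1
    have a2 : m 2 < s' := (monomial_le_degreeOf 2 hm).trans_lt h2
    refine Finset.mem_image.2 ⟨m 0 + s * (m 1 + r * m 2), ?_, ?_⟩
    · rw [Finset.mem_range]
      have : m 0 + s * (m 1 + r * m 2) < s * r * (m 2 + 1) := by nlinarith
      exact this.trans_le (Nat.mul_le_mul_left _ a2)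
    · have e1 : (m 0 + s * (m 1 + r * m 2)) / s = m 1 + r * m 2 := by
        rw [Nat.add_mul_div_left _ _ hs, Nat.div_eq_of_lt a0, zero_add]
      have e2 : (m 1 + r * m 2) / r = m 2 := by
        rw [Nat.add_mul_div_left _ _ hr, Nat.div_eq_of_lt a1, zero_add]
      ext i
      fin_cases i
      · change (m 0 + s * (m 1 + r * m 2)) % s = m 0
        rw [Nat.add_mul_mod_self_left, Nat.mod_eq_of_lt a0]
      · change (m 0 + s * (m 1 + r * m 2)) / s % r = m 1
        rw [e1, Nat.add_mul_mod_self_left, Nat.mod_eq_of_lt a1]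
      · change (m 0 + s * (m 1 + r * m 2)) / (s * r) = m 2
        rw [← Nat.div_div_eq_div_mul, e1, e2]
  rw [Finset.sum_subset hsub, Finset.sum_image fun _ _ _ _ => digitMon_inj]
  · refine Finset.sum_congr rfl fun n _ => ?_
    rw [Fin.prod_univ_three]
    congr 1
    change M ^ (n % s) * (M ^ s) ^ (n / s % r) * (M ^ (s * r)) ^ (n / (s * r)) = M ^ n
    rw [← pow_mul, ← pow_mul, ← pow_add, ← pow_add]
    congr 1
    have := Nat.div_add_mod n s
    have h := Nat.div_add_mod (n / s) r
    rw [Nat.div_div_eq_div_mul] at h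
    nlinarith
  · intro m _ hm
    rw [notMem_support_iff.1 hm, zero_mul]

theorem mask_eq (g : Cfg) (hw : 0 < g.w) :
    mask g = ∑ n ∈ Finset.range (g.s * g.r * g.s'), 2 ^ (g.w - 1) * (2 ^ g.w) ^ n := by
  rw [← Finset.mul_sum, mask, Nat.geomSum_eq]
  exact Nat.pow_le_pow_right (n := 2) (by norm_num) hw

/-- The packed number plus the mask has the biased coefficients as its digits, and
`le_digit_of_land` shows that each is at least the bias. Monomials outside the support are trivial.
-/
theorem coeff_nonneg_of_leafOK {g : Cfg} {B : Box} {p : PE} (hD : 0 ≤ g.D) (hw : 0 < g.w)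
    (hB : boxOK g B = true) (hp : polyOK g p = true) (h : leafOK g B p = true)
    (m : Fin 3 →₀ ℕ) : 0 ≤ coeff m (boxPoly g.D B.x0 B.x1 B.y0 B.y1 B.z0 B.z1 p) := by
  classical
  simp only [boxOK, Bool.and_eq_true, decide_eq_true_eq] at hB
  simp only [polyOK, Bool.and_eq_true, decide_eq_true_eq, Nat.blt_eq] at hp
  obtain ⟨⟨⟨⟨hom, d0⟩, d1⟩, d2⟩, hb⟩ := hp
  set P := boxPoly g.D B.x0 B.x1 B.y0 B.y1 B.z0 B.z1 p with hP
  have hdeg := degreeOf_boxPoly_le g.D B.x0 B.x1 B.y0 B.y1 B.z0 B.z1 p hom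
  have hc : ∀ m, |coeff m P| < 2 ^ (g.w - 1) := fun m =>
    (coeff_boxPoly_le hD hB.1.1.2 hB.1.2 hB.2 p m).trans_lt (by rwa [PE.evZ_eq] at hb)
  have hN : packed g B p = eval ![(2 : ℤ) ^ g.w, (2 ^ g.w) ^ g.s, (2 ^ g.w) ^ (g.s * g.r)] P := by
    rw [packed, PE.evZ_eq, hP, boxPoly, PE.map_eval]
    simp only [map_add, map_mul, eval_C, eval_X, map_one]
    congr 1 <;> simp [pow_mul]
  rw [eval_eq_digits (hdeg.1.trans_lt d0) (hdeg.2.1.trans_lt d1) (hdeg.2.2.trans_lt d2)] at hN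
  have h2 : (2 : ℤ) ^ g.w = 2 * 2 ^ (g.w - 1) := by
    rw [← pow_succ']; congr 1; omega
  set a : ℕ → ℕ := fun n => (coeff (digitMon g.s g.r n) P + 2 ^ (g.w - 1)).toNat with ha
  have ha' : ∀ n, (a n : ℤ) = coeff (digitMon g.s g.r n) P + 2 ^ (g.w - 1) := fun n => by
    rw [ha]; simp only
    rw [Int.toNat_of_nonneg]
    have := (abs_lt.1 (hc (digitMon g.s g.r n))).1; linarith
  have hlt : ∀ n, a n < 2 ^ g.w := fun n => by
    have := (abs_lt.1 (hc (digitMon g.s g.r n))).2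
    zify; rw [ha', h2]; linarith
  have hS : Int.add (packed g B p) (mask g : ℕ) =
      ((∑ n ∈ Finset.range (g.s * g.r * g.s'), a n * (2 ^ g.w) ^ n : ℕ) : ℤ) := by
    change packed g B p + (mask g : ℤ) = _
    rw [hN, mask_eq g hw]
    push_cast
    rw [← Finset.sum_add_distrib]
    exact Finset.sum_congr rfl fun n _ => by rw [ha']; ring
  have hl := Nat.eq_of_beq_eq_true h
  rw [hS, Int.toNat_natCast, mask_eq g hw] at hl
  have key := le_digit_of_land hw _ a hlt hl
  by_cases hm : m ∈ P.support
  · have h0 : degreeOf 0 P < g.s := hdeg.1.trans_lt d0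
    have h1' : degreeOf 1 P < g.r := hdeg.2.1.trans_lt d1
    have hs : 0 < g.s := by omega
    have hr : 0 < g.r := by omega
    have a0 : m 0 < g.s := (monomial_le_degreeOf 0 hm).trans_lt h0
    have a1 : m 1 < g.r := (monomial_le_degreeOf 1 hm).trans_lt (hdeg.2.1.trans_lt d1)
    have a2 : m 2 < g.s' := (monomial_le_degreeOf 2 hm).trans_lt (hdeg.2.2.trans_lt d2)
    have hn : m 0 + g.s * (m 1 + g.r * m 2) < g.s * g.r * g.s' :=
      lt_of_lt_of_le (b := g.s * g.r * (m 2 + 1)) (by nlinarith) (Nat.mul_le_mul_left _ a2)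
    have e := key _ hn
    have e1 : (m 0 + g.s * (m 1 + g.r * m 2)) / g.s = m 1 + g.r * m 2 := by
      rw [Nat.add_mul_div_left _ _ hs, Nat.div_eq_of_lt a0, zero_add]
    have e2 : (m 1 + g.r * m 2) / g.r = m 2 := by
      rw [Nat.add_mul_div_left _ _ hr, Nat.div_eq_of_lt a1, zero_add]
    have em : digitMon g.s g.r (m 0 + g.s * (m 1 + g.r * m 2)) = m := by
      ext i
      fin_cases i
      · change (m 0 + g.s * (m 1 + g.r * m 2)) % g.s = m 0
        rw [Nat.add_mul_mod_self_left, Nat.mod_eq_of_lt a0]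
      · change (m 0 + g.s * (m 1 + g.r * m 2)) / g.s % g.r = m 1
        rw [e1, Nat.add_mul_mod_self_left, Nat.mod_eq_of_lt a1]
      · change (m 0 + g.s * (m 1 + g.r * m 2)) / (g.s * g.r) = m 2
        rw [← Nat.div_div_eq_div_mul, e1, e2]
    zify at e
    rw [ha', em] at e
    linarith
  · rw [notMem_support_iff.1 hm]

/-- The point lies in the box. -/
def Mem (g : Cfg) (B : Box) (x y z : ℝ) : Prop :=
  (B.x0 ≤ x * g.D ∧ x * g.D ≤ B.x1) ∧ (B.y0 ≤ y * g.D ∧ y * g.D ≤ B.y1) ∧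
    (B.z0 ≤ z * g.D ∧ z * g.D ≤ B.z1)

theorem aeval_nonneg {P : MvPolynomial (Fin 3) ℤ} (h : ∀ m, 0 ≤ coeff m P) {v : Fin 3 → ℝ}
    (hv : ∀ i, 0 ≤ v i) : 0 ≤ eval₂ (Int.castRingHom ℝ) v P := by
  rw [eval₂_eq]
  refine Finset.sum_nonneg fun m _ => mul_nonneg ?_ (Finset.prod_nonneg fun i _ => ?_)
  · simpa using h m
  · exact pow_nonneg (hv i) _

/-- The box polynomial is evaluated at the ratios X'/X, Y'/Y, Z'/Z, and homogeneity clears the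
denominators. -/
theorem homog_eval_nonneg {g : Cfg} {B : Box} {p : PE} (hD : 0 ≤ g.D) (hw : 0 < g.w)
    (hB : boxOK g B = true) (hp : polyOK g p = true) (h : leafOK g B p = true) {X X' Y Y' Z Z' : ℝ}
    (hX : 0 < X) (hX' : 0 ≤ X') (hY : 0 < Y) (hY' : 0 ≤ Y') (hZ : 0 < Z) (hZ' : 0 ≤ Z') :
    0 ≤ p.eval (B.x0 * X + B.x1 * X') (g.D * (X + X')) (B.y0 * Y + B.y1 * Y') (g.D * (Y + Y'))
      (B.z0 * Z + B.z1 * Z') (g.D * (Z + Z')) := by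
  have h0 := aeval_nonneg (coeff_nonneg_of_leafOK hD hw hB hp h)
    (v := ![X' / X, Y' / Y, Z' / Z]) (by
      intro i; fin_cases i
      · exact div_nonneg hX' hX.le
      · exact div_nonneg hY' hY.le
      · exact div_nonneg hZ' hZ.le)
  rw [boxPoly, ← coe_eval₂Hom, PE.map_eval] at h0
  simp only [map_add, map_mul, map_one, coe_eval₂Hom, eval₂_C, eval₂_X] at h0
  simp only [polyOK, Bool.and_eq_true] at hp
  have := PE.eval_scale X Y Z ((B.x0 : ℝ) + B.x1 * (X' / X)) (g.D * (1 + X' / X))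
    ((B.y0 : ℝ) + B.y1 * (Y' / Y)) (g.D * (1 + Y' / Y))
    ((B.z0 : ℝ) + B.z1 * (Z' / Z)) (g.D * (1 + Z' / Z)) p hp.1.1.1.1
  have e1 : ∀ (X X' : ℝ), 0 < X → ∀ a b : ℝ, X * (a + b * (X' / X)) = a * X + b * X' := by
    intro X X' hX a b; field_simp
  have e2 : ∀ (X X' : ℝ), 0 < X → ∀ a : ℝ, X * (a * (1 + X' / X)) = a * (X + X') := by
    intro X X' hX a; field_simp
  rw [e1 X X' hX, e1 Y Y' hY, e1 Z Z' hZ, e2 X X' hX, e2 Y Y' hY, e2 Z Z' hZ] at this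
  rw [this]
  refine mul_nonneg (by positivity) ?_
  simpa using h0

theorem eval_continuous (p : PE) : Continuous fun v : ℝ × ℝ × ℝ => p.eval v.1 1 v.2.1 1 v.2.2 1 := by
  induction p with
  | add p q hp hq => exact hp.add hq
  | sub p q hp hq => exact hp.sub hq
  | mul p q hp hq => exact hp.mul hq
  | c n => exact continuous_const
  | _ => simp only [PE.eval]; fun_prop

/-- The chart reaches every point of the box except those on the upper faces; these follow by
continuity. -/
theorem eval_nonneg_of_leafOK {g : Cfg} {B : Box} {p : PE} (hD : 0 < g.D) (hw : 0 < g.w)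
    (hB : boxOK g B = true) (hp : polyOK g p = true) (h : leafOK g B p = true) {x y z : ℝ}
    (hm : Mem g B x y z) : 0 ≤ p.eval x 1 y 1 z 1 := by
  have hB' := hB
  simp only [boxOK, Bool.and_eq_true, decide_eq_true_eq] at hB'
  obtain ⟨⟨⟨⟨⟨hx, hy⟩, hz⟩, -⟩, -⟩, -⟩ := hB'
  have hD' : (0 : ℝ) < g.D := by exact_mod_cast hD
  have hx' : (B.x0 : ℝ) < B.x1 := by exact_mod_cast hx
  have hy' : (B.y0 : ℝ) < B.y1 := by exact_mod_cast hy
  have hz' : (B.z0 : ℝ) < B.z1 := by exact_mod_cast hz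
  have main : ∀ x y z : ℝ, (B.x0 ≤ x * g.D ∧ x * g.D < B.x1) → (B.y0 ≤ y * g.D ∧ y * g.D < B.y1) →
      (B.z0 ≤ z * g.D ∧ z * g.D < B.z1) → 0 ≤ p.eval x 1 y 1 z 1 := by
    intro x y z h1 h2 h3
    have h0 := homog_eval_nonneg hD.le hw hB hp h (X := B.x1 - x * g.D) (X' := x * g.D - B.x0)
      (Y := B.y1 - y * g.D) (Y' := y * g.D - B.y0) (Z := B.z1 - z * g.D) (Z' := z * g.D - B.z0)
      (by linarith [h1.2]) (by linarith [h1.1]) (by linarith [h2.2]) (by linarith [h2.1])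
      (by linarith [h3.2]) (by linarith [h3.1])
    simp only [polyOK, Bool.and_eq_true] at hp
    have := PE.eval_scale (g.D * (B.x1 - B.x0) : ℝ) (g.D * (B.y1 - B.y0)) (g.D * (B.z1 - B.z0))
      x 1 y 1 z 1 p hp.1.1.1.1
    have e : ∀ a b x : ℝ, a * (b - x * g.D) + b * (x * g.D - a) = g.D * (b - a) * x := by
      intros; ring
    have e' : ∀ a b x : ℝ, g.D * (b - x * g.D + (x * g.D - a)) = g.D * (b - a) * 1 := by
      intros; ring
    rw [e, e, e, e', e', e', this] at h0
    refine nonneg_of_mul_nonneg_right h0 ?_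
    have := sub_pos.2 hx'; have := sub_pos.2 hy'; have := sub_pos.2 hz'
    positivity
  -- Moving a point slightly towards the lower corner takes it off all upper faces.
  set c : ℝ × ℝ × ℝ := (B.x0 / g.D, B.y0 / g.D, B.z0 / g.D)
  have hlim : Filter.Tendsto (fun n : ℕ => (fun v : ℝ × ℝ × ℝ => p.eval v.1 1 v.2.1 1 v.2.2 1)
      ((x, y, z) + ((n : ℝ) + 1)⁻¹ • (c - (x, y, z)))) Filter.atTop
      (nhds (p.eval x 1 y 1 z 1)) := by
    have h1 : Filter.Tendsto (fun n : ℕ => ((n : ℝ) + 1)⁻¹) Filter.atTop (nhds 0) :=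
      (tendsto_one_div_add_atTop_nhds_zero_nat (𝕜 := ℝ)).congr fun n => by rw [one_div]
    have h2 : Filter.Tendsto (fun n : ℕ => ((x, y, z) : ℝ × ℝ × ℝ) +
        ((n : ℝ) + 1)⁻¹ • (c - (x, y, z))) Filter.atTop (nhds ((x, y, z) + (0 : ℝ) • (c - (x, y, z)))) :=
      tendsto_const_nhds.add (h1.smul_const _)
    rw [zero_smul, add_zero] at h2
    exact ((eval_continuous p).tendsto (x, y, z)).comp h2
  refine ge_of_tendsto' hlim fun n => ?_
  have hn : (0 : ℝ) < ((n : ℝ) + 1)⁻¹ := by positivity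
  have hn1 : ((n : ℝ) + 1)⁻¹ ≤ 1 := inv_le_one_of_one_le₀ (by linarith [n.cast_nonneg (α := ℝ)])
  have aux : ∀ a b x : ℝ, a < b → a ≤ x * g.D ∧ x * g.D ≤ b →
      a ≤ (x + ((n : ℝ) + 1)⁻¹ * (a / g.D - x)) * g.D ∧
        (x + ((n : ℝ) + 1)⁻¹ * (a / g.D - x)) * g.D < b := by
    intro a b x hab hx
    have e : (x + ((n : ℝ) + 1)⁻¹ * (a / g.D - x)) * g.D =
        x * g.D + ((n : ℝ) + 1)⁻¹ * (a - x * g.D) := by field_simp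
    rw [e]
    constructor
    · nlinarith [hx.1]
    · rcases hx.1.eq_or_lt with h | h
      · rw [← h]; simpa using hab
      · nlinarith [hx.2]
  exact main _ _ _ (aux _ _ _ hx' hm.1) (aux _ _ _ hy' hm.2.1) (aux _ _ _ hz' hm.2.2)

/-- Integer division may round a midpoint, but the two parts still cover the box. A point thus
descends to a leaf, whose clause holds there. -/
theorem run_sound {g : Cfg} {cls : List (List PE)} (hD : 0 < g.D) (hw : 0 < g.w)
    (hcls : ∀ cl ∈ cls, ∀ p ∈ cl, polyOK g p = true) {x y z : ℝ} :
    ∀ (f : ℕ) (B : Box) (code : ℕ), (run g cls f B code).isSome → Mem g B x y z →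
      ∃ cl ∈ cls, ∀ p ∈ cl, 0 ≤ PE.eval x 1 y 1 z 1 p := by
  intro f
  induction f with
  | zero => intro B code h; simp [run] at h
  | succ f ih =>
    intro B code h hm
    obtain ⟨hx, hy, hz⟩ := hm
    rw [run] at h
    split at h
    · split at h
      · simp at h
      · next c hc =>
        rcases le_total (x * g.D) (((B.x0 + B.x1) / 2 : ℤ) : ℝ) with h1 | h1
        · exact ih { B with x1 := (B.x0 + B.x1) / 2 } (code / 16) (by rw [hc]; rfl)
            ⟨⟨hx.1, h1⟩, hy, hz⟩
        · exact ih _ _ h ⟨⟨h1, hx.2⟩, hy, hz⟩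
    · split at h
      · simp at h
      · next c hc =>
        rcases le_total (y * g.D) (((B.y0 + B.y1) / 2 : ℤ) : ℝ) with h1 | h1
        · exact ih { B with y1 := (B.y0 + B.y1) / 2 } (code / 16) (by rw [hc]; rfl)
            ⟨hx, ⟨hy.1, h1⟩, hz⟩
        · exact ih _ _ h ⟨hx, ⟨h1, hy.2⟩, hz⟩
    · split at h
      · simp at h
      · next c hc =>
        rcases le_total (z * g.D) (((B.z0 + B.z1) / 2 : ℤ) : ℝ) with h1 | h1
        · exact ih { B with z1 := (B.z0 + B.z1) / 2 } (code / 16) (by rw [hc]; rfl)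
            ⟨hx, hy, ⟨hz.1, h1⟩⟩
        · exact ih _ _ h ⟨hx, hy, ⟨h1, hz.2⟩⟩
    · split at h
      · simp at h
      · next cl hcl =>
        split at h
        · next hb =>
          simp only [Bool.and_eq_true, List.all_eq_true] at hb
          have hmem := List.mem_of_getElem? hcl
          exact ⟨cl, hmem, fun p hp =>
            eval_nonneg_of_leafOK hD hw hb.1 (hcls cl hmem p hp) (hb.2 p hp) ⟨hx, hy, hz⟩⟩
        · simp at h

/-- A successful subdivision shows that at each point of the box all expressions of some clause
are nonnegative. -/
theorem check_sound {g : Cfg} {cls : List (List PE)} {B : Box} {code : ℕ}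
    (h : check g cls B code = true) {x y z : ℝ} (hm : Mem g B x y z) :
    ∃ cl ∈ cls, ∀ p ∈ cl, 0 ≤ PE.eval x 1 y 1 z 1 p := by
  simp only [check, Bool.and_eq_true, decide_eq_true_eq, List.all_eq_true] at h
  exact run_sound h.1.1.1 h.1.1.2 h.1.2 _ _ _ h.2 hm

/-- Polynomial expressions in three variables; `milli n` stands for `n / 1000`. -/
inductive RE
  | c (n : ℤ) | milli (n : ℤ) | x | y | z
  | add (p q : RE) | sub (p q : RE) | mul (p q : RE)

namespace RE

instance : Add RE := ⟨add⟩
instance : Sub RE := ⟨sub⟩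
instance : Mul RE := ⟨mul⟩

noncomputable def eval (x y z : ℝ) : RE → ℝ
  | c n => (n : ℝ)
  | milli n => (n : ℝ) / 1000
  | .x => x | .y => y | .z => z
  | add p q => eval x y z p + eval x y z q
  | sub p q => eval x y z p - eval x y z q
  | mul p q => eval x y z p * eval x y z q

def padWith (b : PE) : ℕ → PE → PE
  | 0, p => p
  | n + 1, p => .mul b (padWith b n p)

/-- Powers of `1000` and of the three variables. -/
structure Deg where
  s : ℕ
  x : ℕ
  y : ℕ
  z : ℕ

/-- Multiply an expression of multidegree `d` by constants to obtain multidegree `e`. -/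
def pad (p : PE) (d e : Deg) : PE :=
  padWith (.c 1000) (e.s - d.s) (padWith .ox (e.x - d.x) (padWith .oy (e.y - d.y)
    (padWith .oz (e.z - d.z) p)))

def Deg.sup (d e : Deg) : Deg := ⟨max d.s e.s, max d.x e.x, max d.y e.y, max d.z e.z⟩

/-- The multidegree of the homogenization. -/
def deg : RE → Deg
  | c _ => ⟨0, 0, 0, 0⟩
  | milli _ => ⟨1, 0, 0, 0⟩
  | x => ⟨0, 1, 0, 0⟩
  | y => ⟨0, 0, 1, 0⟩
  | z => ⟨0, 0, 0, 1⟩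
  | add p q => p.deg.sup q.deg
  | sub p q => p.deg.sup q.deg
  | mul p q => ⟨p.deg.s + q.deg.s, p.deg.x + q.deg.x, p.deg.y + q.deg.y, p.deg.z + q.deg.z⟩

/-- The multihomogeneous integer expression that results from clearing denominators. -/
def toPE : RE → PE
  | c n => .c n
  | milli n => .c n
  | x => .x
  | y => .y
  | z => .z
  | add p q => .add (pad p.toPE p.deg (p.deg.sup q.deg)) (pad q.toPE q.deg (p.deg.sup q.deg))
  | sub p q => .sub (pad p.toPE p.deg (p.deg.sup q.deg)) (pad q.toPE q.deg (p.deg.sup q.deg))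
  | mul p q => .mul p.toPE q.toPE

theorem eval_padWith {R : Type*} [CommRing R] (x y z : R) (b p : PE) (n : ℕ) :
    (padWith b n p).eval x 1 y 1 z 1 = (b.eval x 1 y 1 z 1) ^ n * p.eval x 1 y 1 z 1 := by
  induction n with
  | zero => simp [padWith]
  | succ n ih => simp only [padWith, PE.eval, ih]; ring

theorem eval_pad (x y z : ℝ) (p : PE) (d e : Deg) :
    (pad p d e).eval x 1 y 1 z 1 = 1000 ^ (e.s - d.s) * p.eval x 1 y 1 z 1 := by
  simp [pad, eval_padWith, PE.eval]

/-- Homogenizing inserts factors that equal 1 when the denominators are 1, so only a positive power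
of 1000 remains and signs are preserved. -/
theorem eval_toPE (x y z : ℝ) (p : RE) :
    p.toPE.eval x 1 y 1 z 1 = 1000 ^ p.deg.s * p.eval x y z := by
  have aux : ∀ {a b : ℕ} {u : ℝ}, a ≤ b → (1000 : ℝ) ^ (b - a) * (1000 ^ a * u) = 1000 ^ b * u := by
    intro a b u h
    rw [← mul_assoc, ← pow_add, Nat.sub_add_cancel h]
  induction p with
  | add p q hp hq =>
    simp only [toPE, PE.eval, eval_pad, hp, hq, deg, eval, Deg.sup, mul_add,
      aux (le_max_left _ _), aux (le_max_right _ _)]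
  | sub p q hp hq =>
    simp only [toPE, PE.eval, eval_pad, hp, hq, deg, eval, Deg.sup, mul_sub,
      aux (le_max_left _ _), aux (le_max_right _ _)]
  | mul p q hp hq => simp only [toPE, PE.eval, hp, hq, deg, eval, pow_add]; ring
  | milli n => simp [toPE, PE.eval, deg, eval]; ring
  | _ => simp [toPE, PE.eval, deg, eval]

end RE

/-- `check` for expressions with rational coefficients. -/
def checkRE (g : Cfg) (cls : List (List RE)) (B : Box) (code : ℕ) : Bool :=
  check g (cls.map fun cl => cl.map RE.toPE) B code

theorem checkRE_sound {g : Cfg} {cls : List (List RE)} {B : Box} {code : ℕ}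
    (h : checkRE g cls B code = true) {x y z : ℝ} (hm : Mem g B x y z) :
    ∃ cl ∈ cls, ∀ p ∈ cl, 0 ≤ p.eval x y z := by
  obtain ⟨cl, hcl, hp⟩ := check_sound h hm
  obtain ⟨cl', hcl', rfl⟩ := List.mem_map.1 hcl
  refine ⟨cl', hcl', fun p hp' => ?_⟩
  have := hp _ (List.mem_map_of_mem hp')
  rw [RE.eval_toPE] at this
  exact nonneg_of_mul_nonneg_right this (by positivity)

end PolyCert

open MeasureTheory PolyCert

namespace SampleReuse

/-! ### The interpolation error -/

theorem zpow_neg_ratio (a b : ℝ) (d : ℕ) : (a / b) ^ (-(d : ℤ)) = (b / a) ^ d := by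
  rw [zpow_neg, zpow_natCast, ← inv_pow, inv_div]

/-- The derivative of `gfun d p q` at `ρ`. -/
noncomputable def gderiv (d : ℕ) (p q ρ : ℝ) : ℝ :=
  (ρ / q) ^ d * (1 + (1 - p / ρ) * d) - (p / ρ) ^ d * (1 + (q / ρ - 1) * d)

theorem gfun_eq (d : ℕ) (p q ρ : ℝ) :
    gfun d p q ρ = (q - ρ) * (p / ρ) ^ d + (ρ - p) * (ρ / q) ^ d := by
  rw [gfun, zpow_neg_ratio, zpow_neg_ratio]

theorem isStar_iff (d : ℕ) (p q ρ : ℝ) :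
    IsStar d p q ρ ↔ ρ ∈ Set.Ioo p q ∧ gderiv d p q ρ = 0 := by
  rw [IsStar, zpow_neg_ratio, zpow_neg_ratio, gderiv]

theorem hasDerivAt_gfun {d : ℕ} (hd : 0 < d) {p q ρ : ℝ} (hq : 0 < q) (hρ : 0 < ρ) :
    HasDerivAt (gfun d p q) (gderiv d p q ρ) ρ := by
  have h1 : HasDerivAt (fun x : ℝ => p / x) (-p / ρ ^ 2) ρ := by
    simpa [div_eq_mul_inv] using (hasDerivAt_inv hρ.ne').const_mul p
  have h2 : HasDerivAt (fun x : ℝ => x / q) (1 / q) ρ := (hasDerivAt_id ρ).div_const q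
  have h := ((((hasDerivAt_id ρ).const_sub q).mul (h1.pow d))).add
    (((hasDerivAt_id ρ).sub_const p).mul (h2.pow d))
  refine (h.congr_deriv ?_).congr_of_eventuallyEq (Filter.Eventually.of_forall fun x => ?_)
  · obtain ⟨n, rfl⟩ : ∃ n, d = n + 1 := ⟨d - 1, by omega⟩
    simp only [id, gderiv, Nat.add_sub_cancel, Pi.pow_apply, div_pow]
    push_cast
    field_simp
    ring
  · simp [gfun_eq]

/-- In g' the term (ρ/q)^d (1 + (1 - p/ρ)d) increases and (p/ρ)^d (1 + (q/ρ - 1)d) decreases, each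
being a product of positive monotone factors. -/
theorem gderiv_strictMonoOn {d : ℕ} (hd : 0 < d) {p q : ℝ} (hp : 0 < p) :
    StrictMonoOn (gderiv d p q) (Set.Icc p q) := by
  intro x hx y hy hxy
  have hx0 : 0 < x := hp.trans_le hx.1
  have hy0 : 0 < y := hx0.trans hxy
  have hq : 0 < q := hy0.trans_le hy.2
  have hd' : (0 : ℝ) < d := by exact_mod_cast hd
  have a1 : (x / q) ^ d < (y / q) ^ d := by gcongr
  have a2 : (p / y) ^ d < (p / x) ^ d := by gcongr
  have a3 : p / y ≤ p / x := by gcongr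
  have a4 : q / y ≤ q / x := by gcongr
  have a5 : p / x ≤ 1 := (div_le_one hx0).2 hx.1
  have a6 : 1 ≤ q / y := (one_le_div hy0).2 hy.2
  have b1 : (x / q) ^ d * (1 + (1 - p / x) * d) < (y / q) ^ d * (1 + (1 - p / y) * d) := by
    apply mul_lt_mul a1
    · gcongr
    · have : 0 ≤ (1 - p / x) * d := mul_nonneg (by linarith) hd'.le
      linarith
    · positivity
  have b2 : (p / y) ^ d * (1 + (q / y - 1) * d) < (p / x) ^ d * (1 + (q / x - 1) * d) := by
    apply mul_lt_mul a2
    · gcongr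
    · have : 0 ≤ (q / y - 1) * d := mul_nonneg (by linarith) hd'.le
      linarith
    · positivity
  unfold gderiv
  linarith

/-- The strictly increasing g' is negative at p and positive at q; its only zero is the minimum of g
on the interval. Minimality is the property of r_⋆ that the probability estimate uses. -/
theorem exists_isStar {d : ℕ} (hd : 0 < d) {p q : ℝ} (hp : 0 < p) (hpq : p < q) :
    ∃ ρ, IsStar d p q ρ ∧ (∀ ρ', IsStar d p q ρ' → ρ' = ρ) ∧
      ∀ x ∈ Set.Icc p q, gfun d p q ρ ≤ gfun d p q x := by
  have hq : 0 < q := hp.trans hpq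
  have hd' : (0 : ℝ) < d := by exact_mod_cast hd
  have hmono := gderiv_strictMonoOn hd (p := p) (q := q) hp
  have hcont : ContinuousOn (gderiv d p q) (Set.Icc p q) := by
    unfold gderiv
    have : ∀ x ∈ Set.Icc p q, x ≠ 0 := fun x hx => (hp.trans_le hx.1).ne'
    fun_prop (disch := assumption)
  have h1 : gderiv d p q p < 0 := by
    have e1 : (p / q) ^ d < 1 := pow_lt_one₀ (by positivity) ((div_lt_one hq).2 hpq) hd.ne'
    have e2 : 0 < (q / p - 1) * d := mul_pos (sub_pos.2 ((one_lt_div hp).2 hpq)) hd'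
    simp only [gderiv, div_self hp.ne', one_pow, sub_self, zero_mul, add_zero, mul_one, one_mul]
    linarith
  have h2 : 0 < gderiv d p q q := by
    have e1 : (p / q) ^ d < 1 := pow_lt_one₀ (by positivity) ((div_lt_one hq).2 hpq) hd.ne'
    have e2 : 0 < (1 - p / q) * d := mul_pos (sub_pos.2 ((div_lt_one hq).2 hpq)) hd'
    simp only [gderiv, div_self hq.ne', one_pow, sub_self, zero_mul, add_zero, mul_one, one_mul]
    linarith
  obtain ⟨ρ, hρ, h0⟩ := intermediate_value_Ioo hpq.le hcont ⟨h1, h2⟩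
  refine ⟨ρ, (isStar_iff d p q ρ).2 ⟨hρ, h0⟩, fun ρ' h => ?_, fun x hx => ?_⟩
  · obtain ⟨m, e⟩ := (isStar_iff d p q ρ').1 h
    exact hmono.injOn (Set.Ioo_subset_Icc_self m) (Set.Ioo_subset_Icc_self hρ) (e.trans h0.symm)
  · have hder : ∀ x ∈ Set.Icc p q, HasDerivAt (gfun d p q) (gderiv d p q x) x := fun x hx =>
      hasDerivAt_gfun hd hq (hp.trans_le hx.1)
    have hρ' := Set.Ioo_subset_Icc_self hρ
    rcases le_total x ρ with hxρ | hxρ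
    · refine antitoneOn_of_deriv_nonpos (convex_Icc p ρ) ?_ ?_ ?_ ⟨hx.1, hxρ⟩ ⟨hρ'.1, le_rfl⟩ hxρ
      · exact fun y hy => (hder y ⟨hy.1, hy.2.trans hρ'.2⟩).continuousAt.continuousWithinAt
      · rw [interior_Icc]
        exact fun y hy => (hder y ⟨hy.1.le, hy.2.le.trans hρ'.2⟩).differentiableAt.differentiableWithinAt
      · rw [interior_Icc]
        intro y hy
        have hy' : y ∈ Set.Icc p q := ⟨hy.1.le, hy.2.le.trans hρ'.2⟩
        rw [(hder y hy').deriv, ← h0]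
        exact (hmono hy' hρ' hy.2).le
    · refine monotoneOn_of_deriv_nonneg (convex_Icc ρ q) ?_ ?_ ?_ ⟨le_rfl, hρ'.2⟩ ⟨hxρ, hx.2⟩ hxρ
      · exact fun y hy => (hder y ⟨hρ'.1.trans hy.1, hy.2⟩).continuousAt.continuousWithinAt
      · rw [interior_Icc]
        exact fun y hy => (hder y ⟨hρ'.1.trans hy.1.le, hy.2.le⟩).differentiableAt.differentiableWithinAt
      · rw [interior_Icc]
        intro y hy
        have hy' : y ∈ Set.Icc p q := ⟨hρ'.1.trans hy.1.le, hy.2.le⟩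
        rw [(hder y hy').deriv, ← h0]
        exact (hmono hρ' hy' hy.1).le

/-- Since g(ρ)/(q - p) = (1-ζ)(p/ρ)^d + ζ(ρ/q)^d, minimality at r_⋆ makes ς an upper bound of the
interpolation defect for every ρ. -/
theorem interpErr_ge {d : ℕ} {p q rs ρ : ℝ} (hpq : p < q)
    (h : gfun d p q rs ≤ gfun d p q ρ) :
    (1 - (ρ - p) / (q - p)) * (1 - (p / ρ) ^ d) + (ρ - p) / (q - p) * (1 - (ρ / q) ^ d) ≤
      interpErr d p q rs := by
  have h0 : 0 < q - p := sub_pos.2 hpq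
  have : gfun d p q rs / (q - p) ≤ gfun d p q ρ / (q - p) := by gcongr
  rw [interpErr]
  rw [gfun_eq d p q ρ] at this
  have e : ((q - ρ) * (p / ρ) ^ d + (ρ - p) * (ρ / q) ^ d) / (q - p) =
      (1 - (ρ - p) / (q - p)) * (p / ρ) ^ d + (ρ - p) / (q - p) * (ρ / q) ^ d := by
    field_simp; ring
  rw [e] at this
  linarith

/-! ### Volumes -/

section Volume
variable {d : ℕ} {B Q : Set (Fin d → ℝ)}

theorem measurableSet_bset (hB : MeasurableSet B) (ρ : ℝ) :
    MeasurableSet (bset B ρ) := hB.const_smul₀ ρ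

theorem volume_bset {ρ : ℝ} (hρ : 0 < ρ) :
    volume (bset B ρ) = ENNReal.ofReal (ρ ^ d) * volume B := by
  rw [bset, Measure.addHaar_smul, Module.finrank_fin_fun, abs_of_pos (by positivity)]

theorem bset_mono (hstar : ∀ x ∈ B, ∀ c ∈ Set.Icc (0 : ℝ) 1, c • x ∈ B) {ρ σ : ℝ} (hρ : 0 < ρ)
    (h : ρ ≤ σ) : bset B ρ ⊆ bset B σ := by
  rintro _ ⟨x, hx, rfl⟩
  have hσ : 0 < σ := hρ.trans_le h
  refine ⟨(ρ / σ) • x, hstar x hx _ ⟨by positivity, (div_le_one hσ).2 h⟩, ?_⟩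
  simp only [smul_smul]
  rw [mul_div_cancel₀ _ hσ.ne']

theorem toReal_volume_bset (hB0 : volume B ≠ 0) (hBtop : volume B ≠ ⊤)
    {ρ : ℝ} (hρ : 0 < ρ) :
    (volume (bset B ρ)).toReal = ρ ^ d * (volume B).toReal ∧ 0 < (volume B).toReal := by
  refine ⟨?_, ENNReal.toReal_pos hB0 hBtop⟩
  rw [volume_bset hρ, ENNReal.toReal_mul, ENNReal.toReal_ofReal (by positivity)]

theorem volume_bset_ne (hB0 : volume B ≠ 0) (hBtop : volume B ≠ ⊤)
    {ρ : ℝ} (hρ : 0 < ρ) : volume (bset B ρ) ≠ 0 ∧ volume (bset B ρ) ≠ ⊤ := by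
  rw [volume_bset hρ]
  exact ⟨mul_ne_zero (by simpa using pow_pos hρ d) hB0, ENNReal.mul_ne_top ENNReal.ofReal_ne_top hBtop⟩

theorem isProbabilityMeasure_unif (hB0 : volume B ≠ 0) (hBtop : volume B ≠ ⊤)
    {ρ : ℝ} (hρ : 0 < ρ) : IsProbabilityMeasure (unif B ρ) :=
  ProbabilityTheory.cond_isProbabilityMeasure_of_finite (volume_bset_ne hB0 hBtop hρ).1
    (volume_bset_ne hB0 hBtop hρ).2

theorem unif_real (hB : MeasurableSet B) (ρ : ℝ) (A : Set (Fin d → ℝ)) :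
    (unif B ρ).real A = (volume (bset B ρ ∩ A)).toReal / (volume (bset B ρ)).toReal := by
  rw [unif, Measure.real, ProbabilityTheory.cond_apply (measurableSet_bset hB ρ),
    ENNReal.toReal_mul, ENNReal.toReal_inv, div_eq_inv_mul]

theorem robustProb_mem (hB0 : volume B ≠ 0) (hBtop : volume B ≠ ⊤)
    {ρ : ℝ} (hρ : 0 < ρ) : robustProb B Q ρ ∈ Set.Icc (0 : ℝ) 1 := by
  have h := volume_bset_ne hB0 hBtop hρ
  refine ⟨by unfold robustProb; positivity, ?_⟩
  refine div_le_one_of_le₀ (ENNReal.toReal_mono h.2 (measure_mono Set.inter_subset_left)) ?_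
  positivity

/-- Under the uniform law on a larger ball, the ball of radius `ρ` and its good part. -/
theorem unif_real_bset (hB0 : volume B ≠ 0) (hBtop : volume B ≠ ⊤)
    (hB : MeasurableSet B)
    (hstar : ∀ x ∈ B, ∀ c ∈ Set.Icc (0 : ℝ) 1, c • x ∈ B) {ρ σ : ℝ} (hρ : 0 < ρ) (h : ρ ≤ σ) :
    (unif B σ).real (bset B ρ) = (ρ / σ) ^ d ∧
    (unif B σ).real (bset B ρ ∩ Q) = (ρ / σ) ^ d * robustProb B Q ρ := by
  have hσ := hρ.trans_le h
  have hsub := bset_mono hstar hρ h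
  rw [unif_real hB σ, unif_real hB σ, ← Set.inter_assoc,
    Set.inter_eq_self_of_subset_right hsub, robustProb, (toReal_volume_bset hB0 hBtop hρ).1,
    (toReal_volume_bset hB0 hBtop hσ).1]
  have := (toReal_volume_bset hB0 hBtop hρ).2
  rw [div_pow]
  constructor <;> field_simp

/-- `ℙ(p)` and `ℙ(q)` determine each other up to the annulus, which is good with fraction `s`. -/
theorem robustProb_mono (hB0 : volume B ≠ 0) (hBtop : volume B ≠ ⊤)
    (hB : MeasurableSet B) (hQ : MeasurableSet Q)
    (hstar : ∀ x ∈ B, ∀ c ∈ Set.Icc (0 : ℝ) 1, c • x ∈ B) {ρ σ : ℝ} (hρ : 0 < ρ) (h : ρ ≤ σ) :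
    (ρ / σ) ^ d * robustProb B Q ρ ≤ robustProb B Q σ ∧
    (ρ / σ) ^ d * (1 - robustProb B Q ρ) ≤ 1 - robustProb B Q σ := by
  have hσ := hρ.trans_le h
  have hsub := bset_mono hstar hρ h
  have : IsProbabilityMeasure (unif B σ) := isProbabilityMeasure_unif hB0 hBtop hσ
  have e1 := unif_real_bset hB0 hBtop (Q := Q) hB hstar hρ h
  have e2 := unif_real_bset hB0 hBtop (Q := Q) hB hstar hσ le_rfl
  rw [div_self hσ.ne', one_pow, one_mul] at e2
  have d1 : (unif B σ).real (bset B ρ \ Q) = (ρ / σ) ^ d * (1 - robustProb B Q ρ) := by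
    have := measureReal_inter_add_sdiff (μ := unif B σ) (s := bset B ρ) hQ
    rw [e1.1, e1.2] at this; linarith
  have d2 : (unif B σ).real (bset B σ \ Q) = 1 - robustProb B Q σ := by
    have := measureReal_inter_add_sdiff (μ := unif B σ) (s := bset B σ) hQ
    rw [e2.1, e2.2] at this; linarith
  rw [← d1, ← d2, ← e1.2, ← e2.2]
  exact ⟨measureReal_mono (Set.inter_subset_inter_left _ hsub),
    measureReal_mono (Set.sdiff_subset_sdiff_left hsub)⟩

theorem robustProb_compl (hB0 : volume B ≠ 0) (hBtop : volume B ≠ ⊤)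
    (hQ : MeasurableSet Q) {ρ : ℝ} (hρ : 0 < ρ) :
    robustProb B Qᶜ ρ = 1 - robustProb B Q ρ := by
  have h := volume_bset_ne hB0 hBtop hρ
  have h1 := measure_inter_add_sdiff (μ := volume) (bset B ρ) hQ
  rw [robustProb, robustProb, ← Set.sdiff_eq, eq_sub_iff_add_eq, ← add_div,
    ← ENNReal.toReal_add, add_comm, h1, div_self]
  · exact (ENNReal.toReal_pos h.1 h.2).ne'
  · exact measure_ne_top_of_subset Set.sdiff_subset h.2
  · exact measure_ne_top_of_subset Set.inter_subset_left h.2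

end Volume

/-! ### The bookkeeping -/

section Count
variable {d : ℕ} {B Q : Set (Fin d → ℝ)} {N : ℕ} {ρ : ℝ} {x : ℕ → Fin d → ℝ} {j : ℕ}

theorem hits_succ : hits B ρ x (j + 1) = hits B ρ x j + (bset B ρ).indicator (fun _ => 1) (x j) :=
  Finset.sum_range_succ _ _

theorem badHits_succ : badHits B Q ρ x (j + 1) =
    badHits B Q ρ x j + (bset B ρ \ Q).indicator (fun _ => 1) (x j) :=
  Finset.sum_range_succ _ _

theorem indicator_one_le (S : Set (Fin d → ℝ)) (y : Fin d → ℝ) :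
    S.indicator (fun _ => 1) y ≤ (1 : ℕ) := by
  by_cases h : y ∈ S <;> simp [h]

theorem cutoff_eq_self (h : hits B ρ x j ≤ N) : cutoff B N ρ x j = j :=
  Nat.findGreatest_eq h

theorem cutoff_succ (h : N < hits B ρ x (j + 1)) : cutoff B N ρ x (j + 1) = cutoff B N ρ x j :=
  Nat.findGreatest_of_not (not_le.2 h)

theorem numSamples_eq : numSamples B N ρ x j = min (hits B ρ x j) N := by
  induction j with
  | zero =>
    have : hits B ρ x 0 = 0 := rfl
    rw [numSamples, cutoff_eq_self (by omega)]; omega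
  | succ j ih =>
    rcases le_or_gt (hits B ρ x (j + 1)) N with h | h
    · rw [numSamples, cutoff_eq_self h]; omega
    · rw [numSamples, cutoff_succ h, ← numSamples, ih]
      have := hits_succ (B := B) (ρ := ρ) (x := x) (j := j)
      have := indicator_one_le (bset B ρ) (x j)
      omega

theorem numSamples_succ : numSamples B N ρ x (j + 1) =
    if numSamples B N ρ x j < N then
      numSamples B N ρ x j + (bset B ρ).indicator (fun _ => 1) (x j)
    else numSamples B N ρ x j := by
  have := hits_succ (B := B) (ρ := ρ) (x := x) (j := j)
  have := indicator_one_le (bset B ρ) (x j)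
  simp only [numSamples_eq]
  split_ifs with h <;> omega

theorem numViolations_succ : numViolations B Q N ρ x (j + 1) =
    if numSamples B N ρ x j < N then
      numViolations B Q N ρ x j + (bset B ρ \ Q).indicator (fun _ => 1) (x j)
    else numViolations B Q N ρ x j := by
  have h1 := hits_succ (B := B) (ρ := ρ) (x := x) (j := j)
  have h2 := indicator_one_le (bset B ρ) (x j)
  rw [numSamples_eq]
  rcases le_or_gt (hits B ρ x (j + 1)) N with h | h
  · rw [numViolations, cutoff_eq_self h, numViolations, cutoff_eq_self (by omega), badHits_succ]
    split_ifs with h3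
    · rfl
    -- The cutoff advances past a completed experiment only if the new sample misses the ball, so no
    -- violation is added.
    · have : (bset B ρ).indicator (fun _ => 1) (x j) = 0 := by omega
      have hx : x j ∉ bset B ρ := by
        intro hx; rw [Set.indicator_of_mem hx] at this; omega
      rw [Set.indicator_of_notMem (fun h => hx h.1), add_zero]
  · rw [numViolations, cutoff_succ h, ← numViolations, if_neg (by omega)]

theorem numSamples_zero : numSamples B N ρ x 0 = 0 := by
  rw [numSamples_eq]; exact Nat.min_eq_left (Nat.zero_le _)

theorem numViolations_zero : numViolations B Q N ρ x 0 = 0 := by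
  have : hits B ρ x 0 ≤ N := Nat.zero_le _
  rw [numViolations, cutoff_eq_self this]; rfl

theorem numSamples_le : numSamples B N ρ x j ≤ N := by rw [numSamples_eq]; omega

theorem indicator_diff_le (S : Set (Fin d → ℝ)) (y : Fin d → ℝ) :
    (S \ Q).indicator (fun _ => 1) y ≤ S.indicator (fun _ => (1 : ℕ)) y :=
  Set.indicator_le_indicator_of_subset Set.sdiff_subset (fun _ => Nat.zero_le _) y

theorem numViolations_le : numViolations B Q N ρ x j ≤ numSamples B N ρ x j := by
  induction j with
  | zero => rw [numViolations_zero]; exact Nat.zero_le _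
  | succ j ih =>
    rw [numViolations_succ, numSamples_succ]
    split_ifs with h
    · exact add_le_add ih (indicator_diff_le _ _)
    · exact ih

theorem numSamples_mono (hstar : ∀ x ∈ B, ∀ c ∈ Set.Icc (0 : ℝ) 1, c • x ∈ B) {σ : ℝ}
    (hρ : 0 < ρ) (h : ρ ≤ σ) : numSamples B N ρ x j ≤ numSamples B N σ x j := by
  rw [numSamples_eq, numSamples_eq]
  have : hits B ρ x j ≤ hits B σ x j := Finset.sum_le_sum fun k _ =>
    Set.indicator_le_indicator_of_subset (bset_mono hstar hρ h) (fun _ => Nat.zero_le _) _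
  omega

theorem numSamples_congr {y : ℕ → Fin d → ℝ} (h : ∀ k < j, x k = y k) :
    numSamples B N ρ x j = numSamples B N ρ y j := by
  induction j with
  | zero => rw [numSamples_zero, numSamples_zero]
  | succ j ih =>
    rw [numSamples_succ, numSamples_succ, ih fun k hk => h k (by omega), h j (by omega)]

theorem numViolations_congr {y : ℕ → Fin d → ℝ} (h : ∀ k < j, x k = y k) :
    numViolations B Q N ρ x j = numViolations B Q N ρ y j := by
  induction j with
  | zero => rw [numViolations_zero, numViolations_zero]
  | succ j ih =>
    rw [numViolations_succ, numViolations_succ, ih fun k hk => h k (by omega), h j (by omega),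
      numSamples_congr fun k hk => h k (by omega)]

theorem numSamples_of_le {n : ℕ} (h : numSamples B N ρ x j = N) (hn : j ≤ n) :
    numSamples B N ρ x n = N := by
  induction n, hn using Nat.le_induction with
  | base => exact h
  | succ n _ ih => rw [numSamples_succ, if_neg (by omega), ih]

theorem numViolations_of_le {n : ℕ} (h : numSamples B N ρ x j = N) (hn : j ≤ n) :
    numViolations B Q N ρ x n = numViolations B Q N ρ x j := by
  induction n, hn using Nat.le_induction with
  | base => rfl
  | succ n hn ih =>
    rw [numViolations_succ, if_neg (by rw [numSamples_of_le h hn]; omega), ih]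

variable {α : Type*} [MeasurableSpace α] {Y : α → ℕ → Fin d → ℝ}

theorem measurable_indicator_one {S : Set (Fin d → ℝ)} (hS : MeasurableSet S) {y : α → Fin d → ℝ}
    (hy : Measurable y) : Measurable fun a => S.indicator (fun _ => (1 : ℕ)) (y a) :=
  (measurable_const.indicator hS).comp hy

theorem measurable_numSamples (hB : MeasurableSet B) (hY : ∀ k, Measurable fun a => Y a k)
    (N : ℕ) (ρ : ℝ) (j : ℕ) : Measurable fun a => numSamples B N ρ (Y a) j := by
  induction j with
  | zero => simp only [numSamples_zero]; exact measurable_const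
  | succ j ih =>
    simp only [numSamples_succ]
    exact Measurable.ite (measurableSet_lt ih measurable_const)
      (ih.add (measurable_indicator_one (measurableSet_bset hB ρ) (hY j))) ih

theorem measurable_numViolations (hB : MeasurableSet B) (hQ : MeasurableSet Q)
    (hY : ∀ k, Measurable fun a => Y a k)
    (N : ℕ) (ρ : ℝ) (j : ℕ) : Measurable fun a => numViolations B Q N ρ (Y a) j := by
  induction j with
  | zero => simp only [numViolations_zero]; exact measurable_const
  | succ j ih =>
    simp only [numViolations_succ]
    exact Measurable.ite (measurableSet_lt (measurable_numSamples hB hY N ρ j) measurable_const)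
      (ih.add (measurable_indicator_one ((measurableSet_bset hB ρ).diff hQ) (hY j))) ih

theorem measurableSet_isCurrent {m : ℕ} {r : Fin m → ℝ} (hB : MeasurableSet B)
    (hY : ∀ k, Measurable fun a => Y a k) (N j : ℕ) (i : Fin m) :
    MeasurableSet {a | IsCurrent B N r (Y a) j i} := by
  have h : ∀ i', Measurable fun a => numSamples B N (r i') (Y a) j := fun i' =>
    measurable_numSamples hB hY N _ j
  have e : {a | IsCurrent B N r (Y a) j i} = {a | numSamples B N (r i) (Y a) j < N} ∩
      ⋂ i', ⋂ (_ : i < i'), {a | numSamples B N (r i') (Y a) j = N} := by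
    ext a; simp [IsCurrent]
  rw [e]
  exact (measurableSet_lt (h i) measurable_const).inter (MeasurableSet.iInter fun i' =>
    MeasurableSet.iInter fun _ => measurableSet_eq_fun (h i') measurable_const)

theorem measurableSet_isDone {m : ℕ} {r : Fin m → ℝ} (hB : MeasurableSet B)
    (hY : ∀ k, Measurable fun a => Y a k) (N j : ℕ) :
    MeasurableSet {a | IsDone B N r (Y a) j} := by
  simp only [IsDone, Set.ofPred_forall]
  exact MeasurableSet.iInter fun i' =>
    measurableSet_eq_fun (measurable_numSamples hB hY N _ j) measurable_const

theorem exists_isCurrent {m : ℕ} {r : Fin m → ℝ} (h : ¬ IsDone B N r x j) :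
    ∃ i, IsCurrent B N r x j i := by
  classical
  have hne : (Finset.univ.filter fun i => numSamples B N (r i) x j < N).Nonempty := by
    simp only [IsDone, not_forall] at h
    obtain ⟨i, hi⟩ := h
    exact ⟨i, by simpa using lt_of_le_of_ne numSamples_le hi⟩
  refine ⟨Finset.max' _ hne, by simpa using Finset.max'_mem _ hne, fun i' hi' => ?_⟩
  by_contra hn
  have := Finset.le_max' (Finset.univ.filter fun i => numSamples B N (r i) x j < N) i'
    (by simpa using lt_of_le_of_ne numSamples_le hn)
  exact absurd this (not_le.2 hi')

theorem isCurrent_unique {m : ℕ} {r : Fin m → ℝ} {i i' : Fin m} (h : IsCurrent B N r x j i)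
    (h' : IsCurrent B N r x j i') : i = i' := by
  rcases lt_trichotomy i i' with hl | hl | hl
  · have := h.2 _ hl; have := h'.1; omega
  · exact hl
  · have := h'.2 _ hl; have := h.1; omega

end Count

/-! ### One step of the algorithm -/

section Step
variable {d m : ℕ} {B Q : Set (Fin d → ℝ)} {N : ℕ} {r : Fin m → ℝ} {Ω : Type*} [MeasurableSpace Ω]
  {μ : Measure Ω} [IsProbabilityMeasure μ] {X : ℕ → Ω → Fin d → ℝ}

/-- The history `h`, followed by `x`. -/
def extend {j : ℕ} (h : Fin j → Fin d → ℝ) (x : Fin d → ℝ) (k : ℕ) : Fin d → ℝ :=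
  if hk : k < j then h ⟨k, hk⟩ else x

theorem extend_self {j : ℕ} (h : Fin j → Fin d → ℝ) (x : Fin d → ℝ) : extend h x j = x := by
  simp [extend]

theorem measurable_extend {j : ℕ} (k : ℕ) :
    Measurable fun a : (Fin j → Fin d → ℝ) × (Fin d → ℝ) => extend a.1 a.2 k := by
  unfold extend
  split_ifs with h
  · exact (measurable_pi_apply _).comp measurable_fst
  · exact measurable_snd

/-- On the event that i is current, history and next sample have a product law. This is the field
`law` read on rectangles, and Fubini's theorem does the rest. -/
theorem setIntegral_step (hX : IsSampleReuse μ B N r X) (hB : MeasurableSet B)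
    (hu : ∀ i, IsProbabilityMeasure (unif B (r i))) {j : ℕ} (i : Fin m)
    {F : (Fin j → Fin d → ℝ) → (Fin d → ℝ) → ℝ} (hF : Measurable (Function.uncurry F)) {C : ℝ}
    (hC : ∀ h x, |F h x| ≤ C) :
    ∫ ω in {ω | IsCurrent B N r (fun k => X k ω) j i}, F (fun k => X k ω) (X j ω) ∂μ =
      ∫ ω in {ω | IsCurrent B N r (fun k => X k ω) j i},
        ∫ x, F (fun k => X k ω) x ∂unif B (r i) ∂μ := by
  have := hu i
  set S := {ω | IsCurrent B N r (fun k => X k ω) j i} with hS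
  have hSm : MeasurableSet S := measurableSet_isCurrent hB hX.measurable N j i
  set H : Ω → Fin j → Fin d → ℝ := fun ω k => X k ω
  have hH : Measurable H := measurable_pi_lambda _ fun k => hX.measurable k
  have hprod : ((μ.restrict S).map H).prod (unif B (r i)) =
      (μ.restrict S).map (fun ω => (H ω, X j ω)) := by
    refine Measure.prod_eq fun s t hs ht => ?_
    rw [Measure.map_apply (hH.prodMk (hX.measurable j)) (hs.prod ht), Measure.map_apply hH hs,
      Measure.restrict_apply ((hH.prodMk (hX.measurable j)) (hs.prod ht)),
      Measure.restrict_apply (hH hs)]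
    have e1 : (fun ω => (H ω, X j ω)) ⁻¹' s ×ˢ t ∩ S = {ω | (fun k : Fin j => X k ω) ∈ s ∧
        IsCurrent B N r (fun k => X k ω) j i ∧ X j ω ∈ t} := by
      ext ω
      change ((H ω ∈ s ∧ X j ω ∈ t) ∧ IsCurrent B N r (fun k => X k ω) j i) ↔ _
      exact ⟨fun h => ⟨h.1.1, h.2, h.1.2⟩, fun h => ⟨⟨h.1, h.2.2⟩, h.2.1⟩⟩
    rw [e1]
    exact hX.law j i s t hs ht
  have e1 : ∫ ω in S, F (H ω) (X j ω) ∂μ =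
      ∫ z, Function.uncurry F z ∂((μ.restrict S).map (fun ω => (H ω, X j ω))) :=
    (integral_map (hH.prodMk (hX.measurable j)).aemeasurable hF.aestronglyMeasurable).symm
  have : IsFiniteMeasure ((μ.restrict S).map H) := Measure.isFiniteMeasure_map _ _
  have hint : Integrable (Function.uncurry F) (((μ.restrict S).map H).prod (unif B (r i))) :=
    Integrable.of_bound hF.aestronglyMeasurable C (Filter.Eventually.of_forall fun z => hC z.1 z.2)
  rw [e1, ← hprod, integral_prod _ hint]
  exact integral_map hH.aemeasurable (hF.stronglyMeasurable.integral_prod_right.aestronglyMeasurable)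

/-- A quantity whose conditional mean does not grow, and which is constant after completion. -/
theorem integral_step_nonpos (hX : IsSampleReuse μ B N r X) (hB : MeasurableSet B)
    (hu : ∀ i, IsProbabilityMeasure (unif B (r i))) {j : ℕ}
    {F : (Fin j → Fin d → ℝ) → (Fin d → ℝ) → ℝ} (hF : Measurable (Function.uncurry F)) {C : ℝ}
    (hC : ∀ h x, |F h x| ≤ C)
    (hdone : ∀ h x, IsDone B N r (extend h x) j → F h x = 0)
    (hcur : ∀ i h, (∀ x, IsCurrent B N r (extend h x) j i) → ∫ x, F h x ∂unif B (r i) ≤ 0) :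
    ∫ ω, F (fun k => X k ω) (X j ω) ∂μ ≤ 0 := by
  classical
  have hext : ∀ (ω) (x : Fin d → ℝ) (k), k < j → X k ω = extend (fun k : Fin j => X k ω) x k := by
    intro ω x k hk; simp [extend, hk]
  have hcur' : ∀ ω i x, IsCurrent B N r (fun k => X k ω) j i →
      IsCurrent B N r (extend (fun k : Fin j => X k ω) x) j i := by
    intro ω i x h
    have hc := fun i' => numSamples_congr (B := B) (N := N) (ρ := r i') (hext ω x)
    exact ⟨by rw [← hc]; exact h.1, fun i' hi' => by rw [← hc]; exact h.2 i' hi'⟩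
  have hdone' : ∀ ω x, IsDone B N r (fun k => X k ω) j →
      IsDone B N r (extend (fun k : Fin j => X k ω) x) j := by
    intro ω x h i
    rw [← numSamples_congr (hext ω x)]; exact h i
  set S : Fin m → Set Ω := fun i => {ω | IsCurrent B N r (fun k => X k ω) j i}
  have hSm : ∀ i, MeasurableSet (S i) := measurableSet_isCurrent hB hX.measurable N j
  have hsum : ∀ ω, F (fun k => X k ω) (X j ω) =
      ∑ i, (S i).indicator (fun ω => F (fun k => X k ω) (X j ω)) ω := by
    intro ω
    by_cases hd : IsDone B N r (fun k => X k ω) j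
    · have h0 := hdone _ (X j ω) (hdone' ω (X j ω) hd)
      rw [h0, Finset.sum_eq_zero]
      intro i _
      refine Set.indicator_of_notMem (s := S i) (fun hi => ?_) _
      have h1 : numSamples B N (r i) (fun k => X k ω) j < N := hi.1
      have h2 := hd i
      omega
    · obtain ⟨i, hi⟩ := exists_isCurrent hd
      rw [Finset.sum_eq_single i]
      · rw [Set.indicator_of_mem (show ω ∈ S i from hi)]
      · intro i' _ hne
        exact Set.indicator_of_notMem (s := S i') (fun hi' => hne (isCurrent_unique hi' hi)) _
      · simp
  have hFm : Measurable fun ω => F (fun k : Fin j => X k ω) (X j ω) :=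
    hF.comp ((measurable_pi_lambda _ fun k : Fin j => hX.measurable k).prodMk (hX.measurable j))
  have hint : Integrable (fun ω => F (fun k : Fin j => X k ω) (X j ω)) μ :=
    Integrable.of_bound hFm.aestronglyMeasurable C (Filter.Eventually.of_forall fun ω => hC _ _)
  rw [integral_congr_ae (Filter.Eventually.of_forall hsum),
    integral_finsetSum _ fun i _ => hint.indicator (hSm i)]
  refine Finset.sum_nonpos fun i _ => ?_
  rw [integral_indicator (hSm i), setIntegral_step hX hB hu i hF hC]
  exact setIntegral_nonpos (hSm i) fun ω hω => hcur i _ fun x => hcur' ω i x hω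

end Step

/-! ### Almost sure termination -/

section Termination
variable {d m : ℕ} {B Q : Set (Fin d → ℝ)} {N : ℕ} {r : Fin (m + 1) → ℝ} {Ω : Type*}
  [MeasurableSpace Ω] {μ : Measure Ω} [IsProbabilityMeasure μ] {X : ℕ → Ω → Fin d → ℝ}

/-- The balls are nested, so the smallest one is filled last. -/
theorem isDone_iff (hstar : ∀ x ∈ B, ∀ c ∈ Set.Icc (0 : ℝ) 1, c • x ∈ B) (hr0 : 0 < r 0)
    (hr : StrictMono r) {x : ℕ → Fin d → ℝ} {j : ℕ} :
    IsDone B N r x j ↔ numSamples B N (r 0) x j = N := by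
  refine ⟨fun h => h 0, fun h i => le_antisymm numSamples_le ?_⟩
  have := numSamples_mono (x := x) (j := j) (N := N) hstar hr0 (hr.monotone (Fin.zero_le i))
  omega

/-- The procedure stops almost surely. -/
theorem ae_exists_isDone (hB : MeasurableSet B)
    (hstar : ∀ x ∈ B, ∀ c ∈ Set.Icc (0 : ℝ) 1, c • x ∈ B) (hB0 : volume B ≠ 0)
    (hBtop : volume B ≠ ⊤) (hr0 : 0 < r 0) (hr : StrictMono r) (hX : IsSampleReuse μ B N r X) :
    ∀ᵐ ω ∂μ, ∃ j, IsDone B N r (fun k => X k ω) j := by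
  classical
  have hpos : ∀ i, 0 < r i := fun i => hr0.trans_le (hr.monotone (Fin.zero_le i))
  have hu : ∀ i, IsProbabilityMeasure (unif B (r i)) := fun i =>
    isProbabilityMeasure_unif hB0 hBtop (hpos i)
  set ε : ℝ := (r 0 / r (Fin.last m)) ^ d with hε
  have hε0 : 0 < ε := pow_pos (div_pos hr0 (hpos _)) d
  have hε1 : ε ≤ 1 := pow_le_one₀ (div_pos hr0 (hpos _)).le
    ((div_le_one (hpos _)).2 (hr.monotone (Fin.zero_le _)))
  have hεi : ∀ i, ε ≤ (r 0 / r i) ^ d := fun i => by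
    have := hr0.le; have := hpos i; have := (hpos (Fin.last m)).le; have := hr.monotone (Fin.le_last i)
    rw [hε]; gcongr
  -- Before completion every draw hits the smallest ball with probability at least ε, and a hit at
  -- least halves L. So the mean of L shrinks by the factor 1 - ε/2 in each step.
  let L : ℕ → (ℕ → Fin d → ℝ) → ℝ := fun j x =>
    if numSamples B N (r 0) x j < N then (1 / 2) ^ numSamples B N (r 0) x j else 0
  have hLmeas : ∀ j {α : Type} [MeasurableSpace α] {Y : α → ℕ → Fin d → ℝ},
      (∀ k, Measurable fun a => Y a k) → Measurable fun a => L j (Y a) := by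
    intro j α _ Y hY
    have := measurable_numSamples hB hY N (r 0) j
    exact Measurable.ite (measurableSet_lt this measurable_const)
      ((measurable_from_top (f := fun n : ℕ => ((1 : ℝ) / 2) ^ n)).comp this) measurable_const
  have hL0 : ∀ j x, 0 ≤ L j x := fun j x => by simp only [L]; split_ifs <;> positivity
  have hL1 : ∀ j x, L j x ≤ 1 := fun j x => by
    simp only [L]; split_ifs
    · exact pow_le_one₀ (by norm_num) (by norm_num)
    · norm_num
  have hLcongr : ∀ j x y, (∀ k < j, x k = y k) → L j x = L j y := fun j x y h => by
    simp only [L, numSamples_congr h]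
  have hbase : ∀ (j : ℕ) (h : Fin j → Fin d → ℝ) (x x' : Fin d → ℝ), ∀ k < j,
      extend h x k = extend h x' k := fun j h x x' k hk => by simp [extend, hk]
  have hbound : ∀ j, ∫ ω, L (j + 1) (fun k => X k ω) ∂μ ≤
      (1 - ε / 2) * ∫ ω, L j (fun k => X k ω) ∂μ := by
    intro j
    let F : (Fin j → Fin d → ℝ) → (Fin d → ℝ) → ℝ := fun h x =>
      L (j + 1) (extend h x) - (1 - ε / 2) * L j (extend h 0)
    have hFm : Measurable (Function.uncurry F) := by
      refine (hLmeas (j + 1) measurable_extend).sub ((hLmeas j ?_).const_mul _)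
      intro k
      exact (measurable_extend k).comp (measurable_fst.prodMk measurable_const)
    have hFb : ∀ h x, |F h x| ≤ 2 := by
      intro h x
      have h1 := hL0 (j + 1) (extend h x); have h2 := hL1 (j + 1) (extend h x)
      have h3 := hL0 j (extend h 0); have h4 := hL1 j (extend h 0)
      simp only [F]
      rw [abs_le]
      constructor <;> nlinarith
    have key := integral_step_nonpos (C := 2) hX hB hu hFm hFb ?_ ?_
    · have e : ∀ ω, F (fun k : Fin j => X k ω) (X j ω) =
          L (j + 1) (fun k => X k ω) - (1 - ε / 2) * L j (fun k => X k ω) := by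
        intro ω
        simp only [F]
        congr 1
        · refine hLcongr _ _ _ fun k hk => ?_
          rcases Nat.lt_succ_iff_lt_or_eq.1 hk with h | rfl
          · simp [extend, h]
          · exact extend_self _ _
        · congr 1
          exact hLcongr _ _ _ fun k hk => by simp [extend, hk]
      have hi : ∀ j, Integrable (fun ω => L j (fun k => X k ω)) μ := fun j => by
        refine Integrable.of_bound (C := 1) ?_ (Filter.Eventually.of_forall fun ω => ?_)
        · have := measurable_numSamples hB hX.measurable N (r 0) j
          exact (Measurable.ite (measurableSet_lt this measurable_const)
            ((measurable_from_top (f := fun n : ℕ => ((1 : ℝ) / 2) ^ n)).comp this)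
            measurable_const).aestronglyMeasurable
        · rw [Real.norm_of_nonneg (hL0 _ _)]; exact hL1 _ _
      rw [integral_congr_ae (Filter.Eventually.of_forall e),
        integral_sub (hi _) ((hi _).const_mul _), integral_const_mul] at key
      linarith
    · intro h x hd
      have hd0 := hd 0
      have h1 : numSamples B N (r 0) (extend h x) (j + 1) = N := numSamples_of_le hd0 (by omega)
      have h2 : numSamples B N (r 0) (extend h 0) j = N := by
        rw [numSamples_congr (hbase j h 0 x)]; exact hd0
      simp [F, L, h1, h2]
    · intro i h hc
      set n := numSamples B N (r 0) (extend h 0) j with hn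
      have hn' : ∀ x, numSamples B N (r 0) (extend h x) j = n := fun x =>
        numSamples_congr (hbase j h x 0)
      have hlt : n < N := by
        have h1 : numSamples B N (r i) (extend h 0) j < N := (hc 0).1
        have h2 := numSamples_mono (x := extend h 0) (j := j) (N := N) hstar hr0
          (hr.monotone (Fin.zero_le i))
        omega
      have hle : ∀ x, F h x ≤ (1 / 2) ^ n * (ε / 2) -
          (1 / 2) ^ n / 2 * (bset B (r 0)).indicator (fun _ => (1 : ℝ)) x := by
        intro x
        have e2 : L j (extend h 0) = (1 / 2) ^ n := by simp only [L]; rw [if_pos hlt]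
        have e1 : L (j + 1) (extend h x) ≤
            (1 / 2) ^ n - (1 / 2) ^ n / 2 * (bset B (r 0)).indicator (fun _ => (1 : ℝ)) x := by
          simp only [L]
          rw [numSamples_succ, hn' x, if_pos hlt, extend_self]
          by_cases hx : x ∈ bset B (r 0)
          · rw [Set.indicator_of_mem hx, Set.indicator_of_mem hx]
            have : (0 : ℝ) < (1 / 2) ^ n := by positivity
            split_ifs
            · rw [pow_succ]; linarith
            · linarith
          · rw [Set.indicator_of_notMem hx, Set.indicator_of_notMem hx, add_zero, if_pos hlt]
            simp
        simp only [F, e2]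
        linarith
      have := hu i
      have hm := measurableSet_bset hB (r 0)
      have hI : Integrable ((bset B (r 0)).indicator fun _ => (1 : ℝ)) (unif B (r i)) :=
        (integrable_const _).indicator hm
      have hIF : Integrable (F h) (unif B (r i)) :=
        Integrable.of_bound (hFm.comp measurable_prodMk_left).aestronglyMeasurable 2
          (Filter.Eventually.of_forall fun x => hFb h x)
      refine (integral_mono hIF ((integrable_const _).sub (hI.const_mul _)) hle).trans ?_
      change ∫ x, ((1 / 2) ^ n * (ε / 2) -
          (1 / 2) ^ n / 2 * (bset B (r 0)).indicator (fun _ => (1 : ℝ)) x) ∂unif B (r i) ≤ 0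
      rw [integral_sub (integrable_const _) (hI.const_mul _),
        integral_const_mul ((1 / 2) ^ n / 2),
        integral_indicator_const _ hm, integral_const,
        (unif_real_bset hB0 hBtop (Q := Set.univ) hB hstar hr0 (hr.monotone (Fin.zero_le i))).1]
      have h1 := hεi i
      have h2 : (0 : ℝ) < (1 / 2) ^ n := by positivity
      simp only [probReal_univ, smul_eq_mul, one_mul, mul_one]
      nlinarith
  have hdecay : ∀ j, ∫ ω, L j (fun k => X k ω) ∂μ ≤ (1 - ε / 2) ^ j := by
    intro j
    induction j with
    | zero =>
      have : ∫ ω, L 0 (fun k => X k ω) ∂μ ≤ ∫ _, (1 : ℝ) ∂μ :=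
        integral_mono_of_nonneg (Filter.Eventually.of_forall fun ω => hL0 _ _)
          (integrable_const _) (Filter.Eventually.of_forall fun ω => hL1 _ _)
      simpa using this
    | succ j ih =>
      rw [pow_succ']
      exact (hbound j).trans (mul_le_mul_of_nonneg_left ih (by linarith))
  set S : Set Ω := {ω | ∀ j, ¬ IsDone B N r (fun k => X k ω) j} with hS
  have hSm : MeasurableSet S := by
    have : S = ⋂ j, {ω | IsDone B N r (fun k => X k ω) j}ᶜ := by ext ω; simp [hS]
    rw [this]
    exact MeasurableSet.iInter fun j => (measurableSet_isDone hB hX.measurable N j).compl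
  -- If the procedure never stops, L never falls below (1/2)^N, whereas its mean tends to zero.
  have hle : ∀ j, (1 / 2) ^ N * μ.real S ≤ (1 - ε / 2) ^ j := by
    intro j
    refine le_trans ?_ (hdecay j)
    have : ∫ ω, S.indicator (fun _ => ((1 : ℝ) / 2) ^ N) ω ∂μ ≤ ∫ ω, L j (fun k => X k ω) ∂μ := by
      refine integral_mono_of_nonneg (Filter.Eventually.of_forall fun ω => ?_) ?_
        (Filter.Eventually.of_forall fun ω => ?_)
      · exact Set.indicator_nonneg (fun _ _ => by positivity) _
      · refine Integrable.of_bound (C := 1) ?_ (Filter.Eventually.of_forall fun ω => ?_)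
        · have := measurable_numSamples hB hX.measurable N (r 0) j
          exact (Measurable.ite (measurableSet_lt this measurable_const)
            ((measurable_from_top (f := fun n : ℕ => ((1 : ℝ) / 2) ^ n)).comp this)
            measurable_const).aestronglyMeasurable
        · rw [Real.norm_of_nonneg (hL0 _ _)]; exact hL1 _ _
      · by_cases hω : ω ∈ S
        swap
        · rw [Set.indicator_of_notMem hω]; exact hL0 _ _
        rw [Set.indicator_of_mem hω]
        have hω' : ∀ j, ¬ IsDone B N r (fun k => X k ω) j := hω
        have h1 : numSamples B N (r 0) (fun k => X k ω) j < N := by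
          have := (isDone_iff hstar hr0 hr).not.1 (hω' j)
          exact lt_of_le_of_ne numSamples_le this
        simp only [L]
        rw [if_pos h1]
        exact pow_le_pow_of_le_one (by norm_num) (by norm_num) h1.le
    rwa [integral_indicator_const _ hSm, smul_eq_mul, mul_comm] at this
  have hlim : Filter.Tendsto (fun j : ℕ => (1 - ε / 2) ^ j) Filter.atTop (nhds 0) :=
    tendsto_pow_atTop_nhds_zero_of_lt_one (by linarith) (by linarith)
  have h0 : (1 / 2) ^ N * μ.real S ≤ 0 := ge_of_tendsto' hlim hle
  have h1 : μ.real S = 0 := by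
    have : (0 : ℝ) < (1 / 2) ^ N := by positivity
    have := measureReal_nonneg (μ := μ) (s := S)
    nlinarith
  have h2 : μ S = 0 := (measureReal_eq_zero_iff).1 h1
  refine measure_mono_null (fun ω hω => ?_) h2
  simpa [hS] using hω

end Termination

/-! ### Joint generating function of the counts at consecutive radii -/

/-- The number of samples counted for the radius `ρ` that satisfy the requirement. -/
noncomputable def numGood {d : ℕ} (B Q : Set (Fin d → ℝ)) (N : ℕ) (ρ : ℝ) (x : ℕ → Fin d → ℝ) (j : ℕ) : ℕ :=
  numSamples B N ρ x j - numViolations B Q N ρ x j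

section NumGood
variable {d N : ℕ} {B Q : Set (Fin d → ℝ)} {ρ : ℝ} {x : ℕ → Fin d → ℝ} {j : ℕ}

theorem numGood_zero : numGood B Q N ρ x 0 = 0 := by simp [numGood, numSamples_zero]

theorem numGood_succ : numGood B Q N ρ x (j + 1) =
    if numSamples B N ρ x j < N then
      numGood B Q N ρ x j + (bset B ρ ∩ Q).indicator (fun _ => 1) (x j)
    else numGood B Q N ρ x j := by
  have h := numViolations_le (B := B) (Q := Q) (N := N) (ρ := ρ) (x := x) (j := j)
  simp only [numGood, numSamples_succ, numViolations_succ]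
  split_ifs with h1
  · by_cases hB : x j ∈ bset B ρ <;> by_cases hQ : x j ∈ Q <;>
      simp [Set.indicator, hB, hQ] <;> omega
  · rfl

theorem numGood_congr {y : ℕ → Fin d → ℝ} (h : ∀ k < j, x k = y k) :
    numGood B Q N ρ x j = numGood B Q N ρ y j := by
  simp only [numGood, numSamples_congr h, numViolations_congr h]

theorem numGood_of_le {n : ℕ} (h : numSamples B N ρ x j = N) (hn : j ≤ n) :
    numGood B Q N ρ x n = numGood B Q N ρ x j := by
  simp only [numGood, numSamples_of_le h hn, numViolations_of_le h hn, h]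

theorem measurable_numGood {α : Type*} [MeasurableSpace α] {Y : α → ℕ → Fin d → ℝ}
    (hB : MeasurableSet B) (hQ : MeasurableSet Q) (hY : ∀ k, Measurable fun a => Y a k)
    (N : ℕ) (ρ : ℝ) (j : ℕ) : Measurable fun a => numGood B Q N ρ (Y a) j :=
  (measurable_numSamples hB hY N ρ j).sub (measurable_numViolations hB hQ hY N ρ j)

/-- The number of the `N` samples collected for `ρ` that satisfy the requirement. -/
noncomputable def goodCount {m : ℕ} (B Q : Set (Fin d → ℝ)) (N : ℕ) (r : Fin m → ℝ) (ρ : ℝ)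
    (x : ℕ → Fin d → ℝ) : ℕ :=
  N - numViolations B Q N ρ x (stopTime B N r x)

theorem goodCount_le {m : ℕ} {r : Fin m → ℝ} : goodCount B Q N r ρ x ≤ N := Nat.sub_le _ _

theorem numRobust_eq {m : ℕ} (r : Fin m → ℝ) :
    numRobust B Q N r ρ x = goodCount B Q N r ρ x := by
  rw [numRobust, goodCount, Nat.cast_sub (numViolations_le.trans numSamples_le)]

theorem numGood_eq_goodCount {m : ℕ} {r : Fin m → ℝ} (h : IsDone B N r x j) (i : Fin m) :
    numGood B Q N (r i) x j = goodCount B Q N r (r i) x := by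
  have hs : IsDone B N r x (stopTime B N r x) := Nat.sInf_mem (s := {j | IsDone B N r x j}) ⟨j, h⟩
  rw [numGood_of_le (hs i) (Nat.sInf_le h), numGood, goodCount, hs i]

end NumGood

section Pgf
variable {d m : ℕ} {B Q : Set (Fin d → ℝ)} {N : ℕ} {r : Fin (m + 1) → ℝ} {Ω : Type*}
  [MeasurableSpace Ω] {μ : Measure Ω} [IsProbabilityMeasure μ] {X : ℕ → Ω → Fin d → ℝ}

/-- The martingale that yields the joint generating function of the counts at `p` and `q`. -/
noncomputable def pgfProc (B Q : Set (Fin d → ℝ)) (N : ℕ) (p q v z g c : ℝ) (x : ℕ → Fin d → ℝ) (j : ℕ) : ℝ :=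
  v ^ numGood B Q N p x j * z ^ numGood B Q N q x j * g ^ (N - numSamples B N q x j) *
    c ^ (numSamples B N q x j - numSamples B N p x j)

variable {p q v z g c : ℝ} {x : ℕ → Fin d → ℝ} {j : ℕ}

theorem pgfProc_congr {y : ℕ → Fin d → ℝ} (h : ∀ k < j, x k = y k) :
    pgfProc B Q N p q v z g c x j = pgfProc B Q N p q v z g c y j := by
  simp only [pgfProc, numGood_congr h, numSamples_congr h]

theorem abs_pgfProc_le (hv : v ∈ Set.Icc (0 : ℝ) 1) (hz : z ∈ Set.Icc (0 : ℝ) 1)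
    (hg : g ∈ Set.Icc (0 : ℝ) 1) (hc : c ∈ Set.Icc (0 : ℝ) 1) :
    |pgfProc B Q N p q v z g c x j| ≤ 1 := by
  have aux : ∀ {y : ℝ} (n : ℕ), y ∈ Set.Icc (0 : ℝ) 1 → 0 ≤ y ^ n ∧ y ^ n ≤ 1 :=
    fun n hy => ⟨pow_nonneg hy.1 n, pow_le_one₀ hy.1 hy.2⟩
  have h1 := aux (numGood B Q N p x j) hv
  have h2 := aux (numGood B Q N q x j) hz
  have h3 := aux (N - numSamples B N q x j) hg
  have h4 := aux (numSamples B N q x j - numSamples B N p x j) hc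
  unfold pgfProc
  rw [abs_of_nonneg (mul_nonneg (mul_nonneg (mul_nonneg h1.1 h2.1) h3.1) h4.1)]
  exact mul_le_one₀ (mul_le_one₀ (mul_le_one₀ h1.2 h2.1 h2.2) h3.1 h3.2) h4.1 h4.2

theorem measurable_pgfProc {α : Type*} [MeasurableSpace α] {Y : α → ℕ → Fin d → ℝ}
    (hB : MeasurableSet B) (hQ : MeasurableSet Q) (hY : ∀ k, Measurable fun a => Y a k) :
    Measurable fun a => pgfProc B Q N p q v z g c (Y a) j := by
  have e : ∀ (y : ℝ) {f : α → ℕ}, Measurable f → Measurable fun a => y ^ f a := fun y f hf =>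
    (measurable_from_top (f := fun n : ℕ => y ^ n)).comp hf
  have s := fun ρ => measurable_numSamples hB hY N ρ j
  have k := fun ρ => measurable_numGood hB hQ hY N ρ j
  exact (((e v (k p)).mul (e z (k q))).mul (e g (measurable_const.sub (s q)))).mul
    (e c ((s q).sub (s p)))

/-- Every sample still missing at q carries a factor g, and every sample by which p lags behind q
carries a factor c. The bracket lists the outcomes of a draw: g outside 𝓑_q; vz or 1 for a good or
bad point of 𝓑_p; zc or c for a good or bad point of 𝓑_q outside 𝓑_p. -/
theorem pgfProc_succ_of_lt (hpq : bset B p ⊆ bset B q)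
    (hle : numSamples B N p x j ≤ numSamples B N q x j) (h : numSamples B N q x j < N) :
    pgfProc B Q N p q v z g c x (j + 1) =
      v ^ numGood B Q N p x j * z ^ numGood B Q N q x j * g ^ (N - numSamples B N q x j - 1) *
        c ^ (numSamples B N q x j - numSamples B N p x j) *
      (g - (bset B q).indicator (fun _ => 1) (x j) * g +
        (bset B p ∩ Q).indicator (fun _ => 1) (x j) * (v * z) +
        ((bset B p).indicator (fun _ => 1) (x j) - (bset B p ∩ Q).indicator (fun _ => 1) (x j)) +
        ((bset B q ∩ Q).indicator (fun _ => 1) (x j) -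
          (bset B p ∩ Q).indicator (fun _ => 1) (x j)) * (z * c) +
        ((bset B q).indicator (fun _ => 1) (x j) - (bset B p).indicator (fun _ => 1) (x j) -
          (bset B q ∩ Q).indicator (fun _ => 1) (x j) +
          (bset B p ∩ Q).indicator (fun _ => 1) (x j)) * c) := by
  obtain ⟨n, hn⟩ : ∃ n, N - numSamples B N q x j = n + 1 := ⟨_, (Nat.succ_pred (by omega)).symm⟩
  have h2 : numSamples B N p x j < N := by omega
  simp only [pgfProc, numSamples_succ, numGood_succ, if_pos h, if_pos h2]
  generalize numGood B Q N p x j = kp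
  generalize numGood B Q N q x j = kq
  obtain ⟨l, hl⟩ : ∃ l, numSamples B N q x j = numSamples B N p x j + l :=
    Nat.exists_eq_add_of_le hle
  have e1 : N - (numSamples B N q x j + 1) = n := by omega
  have e2 : N - numSamples B N q x j - 1 = n := by omega
  have e3 : numSamples B N q x j - numSamples B N p x j = l := by omega
  have e4 : numSamples B N q x j + 1 - (numSamples B N p x j + 1) = l := by omega
  have e5 : numSamples B N q x j + 1 - numSamples B N p x j = l + 1 := by omega
  by_cases hq : x j ∈ bset B q
  · by_cases hp : x j ∈ bset B p <;> by_cases hQ : x j ∈ Q <;>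
      simp [Set.indicator, hp, hq, hQ, hn, e1, e3, e4, e5] <;> ring
  · have hp : x j ∉ bset B p := fun h => hq (hpq h)
    simp [Set.indicator, hp, hq, hn, e3]
    ring

/-- Once q is full, only p still collects, and the factor c of one missing sample becomes v, 1, or
stays c. -/
theorem pgfProc_succ_of_eq (h : numSamples B N q x j = N) (h2 : numSamples B N p x j < N) :
    pgfProc B Q N p q v z g c x (j + 1) =
      v ^ numGood B Q N p x j * z ^ numGood B Q N q x j *
        c ^ (N - numSamples B N p x j - 1) *
      (c - (bset B p).indicator (fun _ => 1) (x j) * c +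
        (bset B p ∩ Q).indicator (fun _ => 1) (x j) * v +
        ((bset B p).indicator (fun _ => 1) (x j) -
          (bset B p ∩ Q).indicator (fun _ => 1) (x j))) := by
  obtain ⟨n, hn⟩ : ∃ n, N - numSamples B N p x j = n + 1 := ⟨_, (Nat.succ_pred (by omega)).symm⟩
  simp only [pgfProc, numSamples_succ, numGood_succ, h, lt_irrefl, if_false, if_pos h2,
    Nat.sub_self, pow_zero, mul_one]
  have e1 : N - (numSamples B N p x j + 1) = n := by omega
  by_cases hp : x j ∈ bset B p <;> by_cases hQ : x j ∈ Q <;>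
      simp [Set.indicator, hp, hQ, hn, e1] <;> ring

end Pgf

section Pgf
variable {d m : ℕ} {B Q : Set (Fin d → ℝ)} {N : ℕ} {r : Fin (m + 1) → ℝ} {Ω : Type*}
  [MeasurableSpace Ω] {μ : Measure Ω} [IsProbabilityMeasure μ] {X : ℕ → Ω → Fin d → ℝ}

/-- The numbers g and c are the means of the factors that replace them. While q is not full, the
current ball contains 𝓑_q, and a draw that lands in 𝓑_q is uniform there; once q is full but p is
not, the current ball is 𝓑_p itself. -/
theorem integral_pgfProc_succ (hB : MeasurableSet B) (hQ : MeasurableSet Q)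
    (hstar : ∀ x ∈ B, ∀ c ∈ Set.Icc (0 : ℝ) 1, c • x ∈ B) (hB0 : volume B ≠ 0)
    (hBtop : volume B ≠ ⊤) (hr0 : 0 < r 0) (hr : StrictMono r) (hX : IsSampleReuse μ B N r X)
    (i : Fin m) {p q : ℝ} (hp : r i.castSucc = p) (hq : r i.succ = q) {P R t v z g c : ℝ}
    (hP : robustProb B Q p = P) (hR : robustProb B Q q = R) (ht : (p / q) ^ d = t)
    (hv : v ∈ Set.Icc (0 : ℝ) 1) (hz : z ∈ Set.Icc (0 : ℝ) 1)
    (hg : g ∈ Set.Icc (0 : ℝ) 1) (hc : c ∈ Set.Icc (0 : ℝ) 1)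
    (hgdef : g = t * P * v * z + t * (1 - P) + c * ((R - t * P) * z + (1 - R) - t * (1 - P)))
    (hcdef : c = 1 - P + P * v) (j : ℕ) :
    ∫ ω, pgfProc B Q N p q v z g c (fun k => X k ω) (j + 1) ∂μ =
      ∫ ω, pgfProc B Q N p q v z g c (fun k => X k ω) j ∂μ := by
  have hpos : ∀ i, 0 < r i := fun i => hr0.trans_le (hr.monotone (Fin.zero_le i))
  have hu : ∀ i, IsProbabilityMeasure (unif B (r i)) := fun i =>
    isProbabilityMeasure_unif hB0 hBtop (hpos i)
  have hpp : 0 < p := hp ▸ hpos _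
  have hpq : p ≤ q := by rw [← hp, ← hq]; exact hr.monotone (Fin.castSucc_lt_succ).le
  have hqq : 0 < q := hpp.trans_le hpq
  let W := fun (j : ℕ) (x : ℕ → Fin d → ℝ) => pgfProc B Q N p q v z g c x j
  have hW : ∀ j x, |W j x| ≤ 1 := fun j x => abs_pgfProc_le hv hz hg hc
  have hbase : ∀ (j : ℕ) (h : Fin j → Fin d → ℝ) (x x' : Fin d → ℝ), ∀ k < j,
      extend h x k = extend h x' k := fun j h x x' k hk => by simp [extend, hk]
  let F : (Fin j → Fin d → ℝ) → (Fin d → ℝ) → ℝ := fun h x =>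
    W (j + 1) (extend h x) - W j (extend h 0)
  have hFm : Measurable (Function.uncurry F) := by
    refine (measurable_pgfProc hB hQ measurable_extend).sub (measurable_pgfProc hB hQ fun k => ?_)
    exact (measurable_extend k).comp (measurable_fst.prodMk measurable_const)
  have hFb : ∀ h x, |F h x| ≤ 2 := fun h x => by
    have h1 := abs_sub (W (j + 1) (extend h x)) (W j (extend h 0))
    have := hW (j + 1) (extend h x); have := hW j (extend h 0)
    simp only [F]; linarith
  have hdone : ∀ h x, IsDone B N r (extend h x) j → F h x = 0 := by
    intro h x hd
    have h1 : numSamples B N p (extend h x) j = N := hp ▸ hd i.castSucc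
    have h2 : numSamples B N q (extend h x) j = N := hq ▸ hd i.succ
    simp only [F, W]
    rw [pgfProc_congr (hbase j h 0 x)]
    simp only [pgfProc, numSamples_of_le h1 (Nat.le_succ j), numSamples_of_le h2 (Nat.le_succ j),
      numGood_of_le h1 (Nat.le_succ j), numGood_of_le h2 (Nat.le_succ j), h1, h2, sub_self]
  have hI : ∀ {S : Set (Fin d → ℝ)} (i), MeasurableSet S →
      Integrable (S.indicator fun _ => (1 : ℝ)) (unif B (r i)) := fun i hS =>
    have := hu i; (integrable_const _).indicator hS
  have hmp := measurableSet_bset hB p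
  have hmq := measurableSet_bset hB q
  have hcur : ∀ i0 h, (∀ x, IsCurrent B N r (extend h x) j i0) →
      ∫ x, F h x ∂unif B (r i0) = 0 := by
    intro i0 h hcu
    have := hu i0
    have hle : ∀ x, numSamples B N p x j ≤ numSamples B N q x j := fun x =>
      numSamples_mono hstar hpp hpq
    have hcurr := hcu 0
    rcases lt_or_eq_of_le (numSamples_le (B := B) (N := N) (ρ := q) (x := extend h 0) (j := j))
      with hlt | heq
    · have hqi : q ≤ r i0 := by
        rw [← hq]
        refine hr.monotone (le_of_not_gt fun hlt' => ?_)
        have := hcurr.2 _ hlt'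
        rw [hq] at this; omega
      obtain ⟨a1, a2⟩ := unif_real_bset hB0 hBtop (Q := Q) hB hstar hpp (hpq.trans hqi)
      obtain ⟨a3, a4⟩ := unif_real_bset hB0 hBtop (Q := Q) hB hstar hqq hqi
      have hα : (p / r i0) ^ d = t * (q / r i0) ^ d := by
        rw [← ht, ← mul_pow]; congr 1; field_simp
      have hF : ∀ x, F h x = v ^ numGood B Q N p (extend h 0) j *
          z ^ numGood B Q N q (extend h 0) j * g ^ (N - numSamples B N q (extend h 0) j - 1) *
          c ^ (numSamples B N q (extend h 0) j - numSamples B N p (extend h 0) j) *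
          ((bset B q).indicator (fun _ => (1 : ℝ)) x * (c - g) +
            (bset B p).indicator (fun _ => (1 : ℝ)) x * (1 - c) +
            (bset B q ∩ Q).indicator (fun _ => (1 : ℝ)) x * (z * c - c) +
            (bset B p ∩ Q).indicator (fun _ => (1 : ℝ)) x * (v * z - 1 - z * c + c)) := by
        intro x
        have hco := hbase j h x 0
        obtain ⟨n, hn⟩ : ∃ n, N - numSamples B N q (extend h 0) j = n + 1 :=
          ⟨_, (Nat.succ_pred (by omega)).symm⟩
        simp only [F, W]
        rw [pgfProc_succ_of_lt (bset_mono hstar hpp hpq) (hle _)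
          (by rw [numSamples_congr hco]; exact hlt), extend_self, numGood_congr hco,
          numGood_congr hco, numSamples_congr hco, numSamples_congr hco, pgfProc, hn,
          Nat.add_sub_cancel, pow_succ]
        ring
      simp only [hF]
      rw [integral_const_mul, integral_add, integral_add, integral_add, integral_mul_const,
        integral_mul_const, integral_mul_const, integral_mul_const, integral_indicator_const _ hmq,
        integral_indicator_const _ hmp, integral_indicator_const _ (hmp.inter hQ),
        integral_indicator_const _ (hmq.inter hQ), a1, a2, a3, a4, hα, hP, hR]
      · simp only [smul_eq_mul, mul_one]
        rw [mul_eq_zero]; right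
        rw [hgdef, hcdef]; ring
      all_goals
        first
        | exact (hI i0 hmq).mul_const _
        | exact (hI i0 hmp).mul_const _
        | exact (hI i0 (hmq.inter hQ)).mul_const _
        | exact (hI i0 (hmp.inter hQ)).mul_const _
        | exact ((hI i0 hmq).mul_const _).add ((hI i0 hmp).mul_const _)
        | exact (((hI i0 hmq).mul_const _).add ((hI i0 hmp).mul_const _)).add
            ((hI i0 (hmq.inter hQ)).mul_const _)
    rcases lt_or_eq_of_le (numSamples_le (B := B) (N := N) (ρ := p) (x := extend h 0) (j := j))
      with hlt' | heq'
    · have hi0 : i0 = i.castSucc := by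
        refine le_antisymm ?_ (le_of_not_gt fun hlt2 => ?_)
        · by_contra hcon
          have h1 : i.succ ≤ i0 := by
            rw [not_le, Fin.lt_def] at hcon
            rw [Fin.le_def]; simpa using hcon
          have h2 := numSamples_mono (x := extend h 0) (j := j) (N := N) hstar (hpos _)
            (hr.monotone h1)
          have := hcurr.1
          rw [hq, heq] at h2; omega
        · have := hcurr.2 _ hlt2
          rw [hp] at this; omega
      have hri : r i0 = p := by rw [hi0, hp]
      obtain ⟨a1, a2⟩ := unif_real_bset hB0 hBtop (Q := Q) hB hstar hpp le_rfl
      rw [div_self hpp.ne', one_pow] at a1 a2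
      have hF : ∀ x, F h x = v ^ numGood B Q N p (extend h 0) j *
          z ^ numGood B Q N q (extend h 0) j *
          c ^ (N - numSamples B N p (extend h 0) j - 1) *
          ((bset B p).indicator (fun _ => (1 : ℝ)) x * (1 - c) +
            (bset B p ∩ Q).indicator (fun _ => (1 : ℝ)) x * (v - 1)) := by
        intro x
        have hco := hbase j h x 0
        obtain ⟨n, hn⟩ : ∃ n, N - numSamples B N p (extend h 0) j = n + 1 :=
          ⟨_, (Nat.succ_pred (by omega)).symm⟩
        simp only [F, W]
        rw [pgfProc_succ_of_eq (by rw [numSamples_congr hco]; exact heq)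
          (by rw [numSamples_congr hco]; exact hlt'), extend_self, numGood_congr hco,
          numGood_congr hco, numSamples_congr hco, pgfProc, heq, hn,
          Nat.add_sub_cancel, pow_succ, Nat.sub_self]
        ring
      have hIp := hI i0 hmp
      have hIq := hI i0 (hmp.inter hQ)
      rw [hri] at hIp hIq ⊢
      simp only [hF]
      rw [integral_const_mul, integral_add (hIp.mul_const _) (hIq.mul_const _), integral_mul_const,
        integral_mul_const, integral_indicator_const _ hmp,
        integral_indicator_const _ (hmp.inter hQ), a1, a2, hP, mul_eq_zero]
      right
      simp only [smul_eq_mul, mul_one]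
      rw [hcdef]; ring
    · have : ∀ x, F h x = 0 := by
        intro x
        have h1 : numSamples B N p (extend h x) j = N := by
          rw [numSamples_congr (hbase j h x 0)]; exact heq'
        have h2 : numSamples B N q (extend h x) j = N := by
          rw [numSamples_congr (hbase j h x 0)]; exact heq
        simp only [F, W]
        rw [pgfProc_congr (hbase j h 0 x)]
        simp only [pgfProc, numSamples_of_le h1 (Nat.le_succ j),
          numSamples_of_le h2 (Nat.le_succ j), numGood_of_le h1 (Nat.le_succ j),
          numGood_of_le h2 (Nat.le_succ j), h1, h2, sub_self]
      simp [this]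
  -- The one-step inequality is applied to the increment and to its negative.
  have k1 := integral_step_nonpos (C := 2) hX hB hu hFm hFb hdone fun i h hc => (hcur i h hc).le
  have k2 := integral_step_nonpos (F := fun h x => - F h x) (C := 2) hX hB hu hFm.neg
    (fun h x => by rw [abs_neg]; exact hFb h x) (fun h x hd => by rw [hdone h x hd, neg_zero])
    fun i h hc => by rw [integral_neg, hcur i h hc, neg_zero]
  rw [integral_neg] at k2
  have e : ∀ ω, F (fun k : Fin j => X k ω) (X j ω) =
      W (j + 1) (fun k => X k ω) - W j (fun k => X k ω) := by
    intro ω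
    simp only [F, W]
    congr 1
    · refine pgfProc_congr fun k hk => ?_
      rcases Nat.lt_succ_iff_lt_or_eq.1 hk with h | rfl
      · simp [extend, h]
      · exact extend_self _ _
    · exact pgfProc_congr fun k hk => by simp [extend, hk]
  have hi : ∀ j, Integrable (fun ω => W j (fun k => X k ω)) μ := fun j =>
    Integrable.of_bound (C := 1) (measurable_pgfProc hB hQ hX.measurable).aestronglyMeasurable
      (Filter.Eventually.of_forall fun ω => hW j _)
  have k3 := le_antisymm k1 (by linarith)
  rw [integral_congr_ae (Filter.Eventually.of_forall e), integral_sub (hi _) (hi _)] at k3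
  linarith

/-- The joint generating function of the counts at two consecutive grid points. -/
theorem integral_pow_goodCount (hB : MeasurableSet B) (hQ : MeasurableSet Q)
    (hstar : ∀ x ∈ B, ∀ c ∈ Set.Icc (0 : ℝ) 1, c • x ∈ B) (hB0 : volume B ≠ 0)
    (hBtop : volume B ≠ ⊤) (hr0 : 0 < r 0) (hr : StrictMono r) (hX : IsSampleReuse μ B N r X)
    (i : Fin m) {p q : ℝ} (hp : r i.castSucc = p) (hq : r i.succ = q) {P R t v z g c : ℝ}
    (hP : robustProb B Q p = P) (hR : robustProb B Q q = R) (ht : (p / q) ^ d = t)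
    (hv : v ∈ Set.Icc (0 : ℝ) 1) (hz : z ∈ Set.Icc (0 : ℝ) 1)
    (hg : g ∈ Set.Icc (0 : ℝ) 1) (hc : c ∈ Set.Icc (0 : ℝ) 1)
    (hgdef : g = t * P * v * z + t * (1 - P) + c * ((R - t * P) * z + (1 - R) - t * (1 - P)))
    (hcdef : c = 1 - P + P * v) :
    ∫ ω, v ^ goodCount B Q N r p (fun k => X k ω) * z ^ goodCount B Q N r q (fun k => X k ω) ∂μ =
      g ^ N := by
  have h0 : ∀ j, ∫ ω, pgfProc B Q N p q v z g c (fun k => X k ω) j ∂μ = g ^ N := by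
    intro j
    induction j with
    | zero => simp [pgfProc, numGood_zero, numSamples_zero]
    | succ j ih =>
      rw [integral_pgfProc_succ hB hQ hstar hB0 hBtop hr0 hr hX i hp hq hP hR ht hv hz hg hc hgdef
        hcdef, ih]
  -- The process is bounded by 1 and eventually equals its terminal value almost surely; its mean is
  -- g^N at every time.
  have lim := tendsto_integral_of_dominated_convergence (μ := μ)
    (F := fun j ω => pgfProc B Q N p q v z g c (fun k => X k ω) j)
    (f := fun ω => v ^ goodCount B Q N r p (fun k => X k ω) *
      z ^ goodCount B Q N r q (fun k => X k ω)) (bound := fun _ => 1)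
    (fun j => (measurable_pgfProc hB hQ hX.measurable).aestronglyMeasurable)
    (integrable_const _)
    (fun j => Filter.Eventually.of_forall fun ω => abs_pgfProc_le hv hz hg hc) ?_
  · simp only [h0] at lim
    exact tendsto_nhds_unique lim tendsto_const_nhds
  · filter_upwards [ae_exists_isDone hB hstar hB0 hBtop hr0 hr hX] with ω ⟨j, hj⟩
    refine tendsto_atTop_of_eventually_const (i₀ := j) fun n hn => ?_
    have hd : IsDone B N r (fun k => X k ω) n := fun i => numSamples_of_le (hj i) hn
    have h1 := hd i.castSucc
    have h2 := hd i.succ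
    have h3 := numGood_eq_goodCount (Q := Q) hd i.castSucc
    have h4 := numGood_eq_goodCount (Q := Q) hd i.succ
    rw [hp] at h1 h3; rw [hq] at h2 h4
    simp only [pgfProc, h1, h2, h3, h4, Nat.sub_self, pow_zero, mul_one]

end Pgf

/-! ### Joint law of the two counts -/

/-- The binomial probability mass function. -/
noncomputable def binom (N : ℕ) (y : ℝ) (j : ℕ) : ℝ := N.choose j * y ^ j * (1 - y) ^ (N - j)

theorem binom_nonneg {N : ℕ} {y : ℝ} (hy : y ∈ Set.Icc (0 : ℝ) 1) (j : ℕ) : 0 ≤ binom N y j :=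
  mul_nonneg (mul_nonneg (Nat.cast_nonneg _) (pow_nonneg hy.1 _))
    (pow_nonneg (sub_nonneg.2 hy.2) _)

theorem sum_binom (N : ℕ) (y : ℝ) : ∑ j ∈ Finset.range (N + 1), binom N y j = 1 := by
  have := add_pow y (1 - y) N
  rw [add_sub_cancel, one_pow] at this
  rw [this]
  exact Finset.sum_congr rfl fun j _ => by rw [binom]; ring

theorem coeff_eq_of_sum_eq_pow {N : ℕ} {a : ℕ → ℝ} {x y : ℝ}
    (h : ∀ z ∈ Set.Icc (0 : ℝ) 1, ∑ j ∈ Finset.range (N + 1), a j * z ^ j = (x * z + y) ^ N)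
    {j : ℕ} (hj : j ≤ N) : a j = N.choose j * x ^ j * y ^ (N - j) := by
  open Polynomial in
  have key : ∑ j ∈ Finset.range (N + 1), Polynomial.monomial j (a j) =
      ∑ j ∈ Finset.range (N + 1), Polynomial.monomial j (N.choose j * x ^ j * y ^ (N - j)) := by
    refine Polynomial.eq_of_infinite_eval_eq _ _
      ((Set.Icc_infinite (zero_lt_one' ℝ)).mono fun z hz => ?_)
    simp only [Set.mem_ofPred_eq, Polynomial.eval_finsetSum, Polynomial.eval_monomial]
    rw [h z hz, add_pow]
    exact Finset.sum_congr rfl fun j _ => by ring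
  have := congrArg (fun f => Polynomial.coeff f j) key
  simpa [Polynomial.finsetSum_coeff, Polynomial.coeff_monomial, Nat.lt_succ_iff, hj] using this

section Law
variable {d m : ℕ} {B Q : Set (Fin d → ℝ)} {N : ℕ} {r : Fin (m + 1) → ℝ} {Ω : Type*}
  [MeasurableSpace Ω] {μ : Measure Ω} [IsProbabilityMeasure μ] {X : ℕ → Ω → Fin d → ℝ}

theorem aemeasurable_goodCount (hB : MeasurableSet B) (hQ : MeasurableSet Q)
    (hstar : ∀ x ∈ B, ∀ c ∈ Set.Icc (0 : ℝ) 1, c • x ∈ B) (hB0 : volume B ≠ 0)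
    (hBtop : volume B ≠ ⊤) (hr0 : 0 < r 0) (hr : StrictMono r) (hX : IsSampleReuse μ B N r X)
    (i : Fin (m + 1)) :
    AEMeasurable (fun ω => goodCount B Q N r (r i) fun k => X k ω) μ := by
  refine aemeasurable_of_tendsto_metrizable_ae (f := fun j ω => numGood B Q N (r i)
    (fun k => X k ω) j) Filter.atTop
    (fun j => (measurable_numGood hB hQ hX.measurable N (r i) j).aemeasurable) ?_
  filter_upwards [ae_exists_isDone hB hstar hB0 hBtop hr0 hr hX] with ω ⟨j, hj⟩
  refine tendsto_atTop_of_eventually_const (i₀ := j) fun n hn => ?_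
  exact numGood_eq_goodCount (fun i => numSamples_of_le (hj i) hn) i

/-- The number g is affine in z, so the generating function is the N-th power of a linear polynomial
in z, and the coefficient of z^j is read off. Under the weight v^{K_p} the count at q is therefore
an unnormalized binomial variable. -/
theorem integral_pow_goodCount_ite (hB : MeasurableSet B) (hQ : MeasurableSet Q)
    (hstar : ∀ x ∈ B, ∀ c ∈ Set.Icc (0 : ℝ) 1, c • x ∈ B) (hB0 : volume B ≠ 0)
    (hBtop : volume B ≠ ⊤) (hr0 : 0 < r 0) (hr : StrictMono r) (hX : IsSampleReuse μ B N r X)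
    (i : Fin m) {p q : ℝ} (hp : r i.castSucc = p) (hq : r i.succ = q) {P R t v : ℝ}
    (hP : robustProb B Q p = P) (hR : robustProb B Q q = R) (ht : (p / q) ^ d = t)
    (hv : v ∈ Set.Icc (0 : ℝ) 1) {j : ℕ} (hj : j ≤ N) :
    ∫ ω, v ^ goodCount B Q N r p (fun k => X k ω) *
        (if goodCount B Q N r q (fun k => X k ω) = j then (1 : ℝ) else 0) ∂μ =
      N.choose j * (t * P * v + (1 - P + P * v) * (R - t * P)) ^ j *
        (t * (1 - P) + (1 - P + P * v) * ((1 - R) - t * (1 - P))) ^ (N - j) := by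
  have hpos : ∀ i, 0 < r i := fun i => hr0.trans_le (hr.monotone (Fin.zero_le i))
  have hpp : 0 < p := hp ▸ hpos _
  have hpq : p ≤ q := by rw [← hp, ← hq]; exact hr.monotone (Fin.castSucc_lt_succ).le
  have hqq : 0 < q := hpp.trans_le hpq
  have hP01 := robustProb_mem hB0 hBtop (Q := Q) hpp
  have hmono := robustProb_mono hB0 hBtop hB hQ hstar hpp hpq
  rw [hP] at hP01; rw [hP, hR, ht] at hmono
  have ht0 : 0 ≤ t := ht ▸ (pow_pos (div_pos hpp hqq) d).le
  have hc : 1 - P + P * v ∈ Set.Icc (0 : ℝ) 1 := by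
    constructor <;> nlinarith [hP01.1, hP01.2, hv.1, hv.2, mul_nonneg hP01.1 hv.1,
      mul_nonneg hP01.1 (sub_nonneg.2 hv.2)]
  have hmq := aemeasurable_goodCount hB hQ hstar hB0 hBtop hr0 hr hX i.succ
  have hmp := aemeasurable_goodCount hB hQ hstar hB0 hBtop hr0 hr hX i.castSucc
  rw [hq] at hmq; rw [hp] at hmp
  have hint : ∀ j, Integrable (fun ω => v ^ goodCount B Q N r p (fun k => X k ω) *
        (if goodCount B Q N r q (fun k => X k ω) = j then (1 : ℝ) else 0)) μ := by
    intro j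
    refine Integrable.of_bound (C := 1) (AEMeasurable.aestronglyMeasurable ?_)
      (Filter.Eventually.of_forall fun ω => ?_)
    · exact ((measurable_from_top (f := fun n : ℕ => v ^ n)).comp_aemeasurable hmp).mul
        ((measurable_from_top (f := fun n : ℕ => if n = j then (1 : ℝ) else 0)).comp_aemeasurable
          hmq)
    · rw [Real.norm_eq_abs, abs_mul, abs_of_nonneg (pow_nonneg hv.1 _)]
      refine mul_le_one₀ (pow_le_one₀ hv.1 hv.2) (abs_nonneg _) ?_
      split_ifs <;> simp
  refine coeff_eq_of_sum_eq_pow (a := fun j => ∫ ω, v ^ goodCount B Q N r p (fun k => X k ω) *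
        (if goodCount B Q N r q (fun k => X k ω) = j then (1 : ℝ) else 0) ∂μ) (fun z hz => ?_) hj
  rw [← integral_pow_goodCount (c := 1 - P + P * v) (z := z) hB hQ hstar hB0 hBtop hr0 hr hX i
    hp hq hP hR ht hv hz (g := (t * P * v + (1 - P + P * v) * (R - t * P)) * z +
      (t * (1 - P) + (1 - P + P * v) * ((1 - R) - t * (1 - P)))) ?_ hc (by ring) rfl]
  · simp only [← integral_mul_const]
    rw [← integral_finsetSum _ fun j _ => (hint j).mul_const _]
    refine integral_congr_ae (Filter.Eventually.of_forall fun ω => ?_)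
    simp only [mul_assoc]
    rw [← Finset.mul_sum, Finset.sum_eq_single (goodCount B Q N r q fun k => X k ω)]
    · simp
    · intro b _ hb; simp [hb.symm]
    · intro hb; exact absurd (Finset.mem_range.2 (Nat.lt_succ_of_le goodCount_le)) hb
  · have h1 : 0 ≤ R - t * P := by linarith [hmono.1]
    have h2 : 0 ≤ (1 - R) - t * (1 - P) := by linarith [hmono.2]
    have h3 : 0 ≤ t * P * v := mul_nonneg (mul_nonneg ht0 hP01.1) hv.1
    have h4 : 0 ≤ t * (1 - P) := mul_nonneg ht0 (sub_nonneg.2 hP01.2)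
    have h5 : 0 ≤ t * P * v + (1 - P + P * v) * (R - t * P) := add_nonneg h3 (mul_nonneg hc.1 h1)
    have h6 := mul_nonneg hc.1 h2
    constructor
    · exact add_nonneg (mul_nonneg h5 hz.1) (add_nonneg h4 h6)
    · have : (t * P * v + (1 - P + P * v) * (R - t * P)) * z ≤
        t * P * v + (1 - P + P * v) * (R - t * P) := mul_le_of_le_one_right h5 hz.2
      have h7 : t * P * v + (1 - P + P * v) * (R - t * P) +
          (t * (1 - P) + (1 - P + P * v) * ((1 - R) - t * (1 - P))) = 1 - P + P * v := by ring
      linarith [hc.2]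

/-- The union is {K_q ∈ S} together with {K_p ≤ jp, K_q ∉ S}, and on the second event 1 ≤ v^{K_p -
jp} because v ≤ 1. The first part uses the law of K_q, the second its weighted law, which is
binomial with parameter y up to the factor (1 - P + Pv)^N. -/
theorem measureReal_goodCount_le (hB : MeasurableSet B) (hQ : MeasurableSet Q)
    (hstar : ∀ x ∈ B, ∀ c ∈ Set.Icc (0 : ℝ) 1, c • x ∈ B) (hB0 : volume B ≠ 0)
    (hBtop : volume B ≠ ⊤) (hr0 : 0 < r 0) (hr : StrictMono r) (hX : IsSampleReuse μ B N r X)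
    (i : Fin m) {p q : ℝ} (hp : r i.castSucc = p) (hq : r i.succ = q) {P R t v : ℝ}
    (hP : robustProb B Q p = P) (hR : robustProb B Q q = R) (ht : (p / q) ^ d = t)
    (hv : v ∈ Set.Icc (0 : ℝ) 1) {jp : ℕ} (hvj : 0 < v ^ jp) (S : Finset ℕ)
    (hS : S ⊆ Finset.range (N + 1)) {C y : ℝ} (hy : y ∈ Set.Icc (0 : ℝ) 1)
    (hC : (1 - P + P * v) ^ N ≤ C * v ^ jp)
    (hyv : y * (1 - P + P * v) = t * P * v + (1 - P + P * v) * (R - t * P)) :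
    μ.real {ω | goodCount B Q N r p (fun k => X k ω) ≤ jp ∨
        goodCount B Q N r q (fun k => X k ω) ∈ S} ≤
      ∑ j ∈ S, binom N R j + C * ∑ j ∈ Finset.range (N + 1) \ S, binom N y j := by
  have hmq := aemeasurable_goodCount hB hQ hstar hB0 hBtop hr0 hr hX i.succ
  have hmp := aemeasurable_goodCount hB hQ hstar hB0 hBtop hr0 hr hX i.castSucc
  rw [hq] at hmq; rw [hp] at hmp
  set Kp := fun ω => goodCount B Q N r p (fun k => X k ω) with hKp
  set Kq := fun ω => goodCount B Q N r q (fun k => X k ω) with hKq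
  have e : ∀ v ∈ Set.Icc (0 : ℝ) 1, ∀ j, j ≤ N →
      ∫ ω, v ^ Kp ω * (if Kq ω = j then (1 : ℝ) else 0) ∂μ = N.choose j *
        (t * P * v + (1 - P + P * v) * (R - t * P)) ^ j *
        (t * (1 - P) + (1 - P + P * v) * ((1 - R) - t * (1 - P))) ^ (N - j) := fun v hv j hj =>
    integral_pow_goodCount_ite hB hQ hstar hB0 hBtop hr0 hr hX i hp hq hP hR ht hv hj
  have hint : ∀ v ∈ Set.Icc (0 : ℝ) 1, ∀ j,
      Integrable (fun ω => v ^ Kp ω * (if Kq ω = j then (1 : ℝ) else 0)) μ := by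
    intro v hv j
    refine Integrable.of_bound (C := 1) (AEMeasurable.aestronglyMeasurable ?_)
      (Filter.Eventually.of_forall fun ω => ?_)
    · exact ((measurable_from_top (f := fun n : ℕ => v ^ n)).comp_aemeasurable hmp).mul
        ((measurable_from_top (f := fun n : ℕ => if n = j then (1 : ℝ) else 0)).comp_aemeasurable
          hmq)
    · rw [Real.norm_eq_abs, abs_mul, abs_of_nonneg (pow_nonneg hv.1 _)]
      refine mul_le_one₀ (pow_le_one₀ hv.1 hv.2) (abs_nonneg _) ?_
      split_ifs <;> simp
  have h1 : (1 : ℝ) ∈ Set.Icc (0 : ℝ) 1 := ⟨zero_le_one, le_rfl⟩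
  have e1 : ∀ j ∈ S, ∫ ω, 1 ^ Kp ω * (if Kq ω = j then (1 : ℝ) else 0) ∂μ = binom N R j := by
    intro j hj
    rw [e 1 h1 j (Nat.lt_succ_iff.1 (Finset.mem_range.1 (hS hj))), binom]
    congr 2 <;> ring
  have e2 : ∀ j ∈ Finset.range (N + 1) \ S,
      ∫ ω, v ^ Kp ω * (if Kq ω = j then (1 : ℝ) else 0) ∂μ =
        (1 - P + P * v) ^ N * binom N y j := by
    intro j hj
    have hjN := Nat.lt_succ_iff.1 (Finset.mem_range.1 (Finset.mem_sdiff.1 hj).1)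
    have h3 : t * (1 - P) + (1 - P + P * v) * ((1 - R) - t * (1 - P)) =
        (1 - y) * (1 - P + P * v) := by linarith
    have h4 : (1 - P + P * v) ^ N = (1 - P + P * v) ^ j * (1 - P + P * v) ^ (N - j) := by
      rw [← pow_add, Nat.add_sub_cancel' hjN]
    rw [e v hv j hjN, binom, ← hyv, h3, mul_pow, mul_pow, h4]
    ring
  have hmeas : NullMeasurableSet {ω | Kp ω ≤ jp ∨ Kq ω ∈ S} μ :=
    (hmp.nullMeasurable (MeasurableSet.of_discrete (s := {n | n ≤ jp}))).union
      (hmq.nullMeasurable (MeasurableSet.of_discrete (s := {n | n ∈ S})))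
  calc μ.real {ω | Kp ω ≤ jp ∨ Kq ω ∈ S}
      = ∫ ω, {ω | Kp ω ≤ jp ∨ Kq ω ∈ S}.indicator (fun _ => (1 : ℝ)) ω ∂μ := by
        rw [integral_indicator₀ hmeas]; simp
    _ ≤ ∫ ω, (∑ j ∈ S, 1 ^ Kp ω * (if Kq ω = j then (1 : ℝ) else 0) + (v ^ jp)⁻¹ *
          ∑ j ∈ Finset.range (N + 1) \ S, v ^ Kp ω * (if Kq ω = j then (1 : ℝ) else 0)) ∂μ := by
        refine integral_mono_of_nonneg (Filter.Eventually.of_forall fun ω =>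
          Set.indicator_nonneg (fun _ _ => zero_le_one) _)
          ((integrable_finsetSum _ fun j _ => hint 1 h1 j).add
            ((integrable_finsetSum _ fun j _ => hint v hv j).const_mul _))
          (Filter.Eventually.of_forall fun ω => ?_)
        have n1 : 0 ≤ ∑ j ∈ S, 1 ^ Kp ω * (if Kq ω = j then (1 : ℝ) else 0) :=
          Finset.sum_nonneg fun j _ => by positivity
        have n2 : 0 ≤ (v ^ jp)⁻¹ * ∑ j ∈ Finset.range (N + 1) \ S,
            v ^ Kp ω * (if Kq ω = j then (1 : ℝ) else 0) :=
          mul_nonneg (inv_nonneg.2 hvj.le) (Finset.sum_nonneg fun j _ =>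
            mul_nonneg (pow_nonneg hv.1 _) (by positivity))
        by_cases hω : ω ∈ {ω | Kp ω ≤ jp ∨ Kq ω ∈ S}
        · rw [Set.indicator_of_mem hω]
          by_cases hqS : Kq ω ∈ S
          · have : ∑ j ∈ S, 1 ^ Kp ω * (if Kq ω = j then (1 : ℝ) else 0) = 1 := by
              simp [hqS]
            dsimp only
            linarith
          · have hle : Kp ω ≤ jp := hω.resolve_right hqS
            have hm : Kq ω ∈ Finset.range (N + 1) \ S :=
              Finset.mem_sdiff.2 ⟨Finset.mem_range.2 (Nat.lt_succ_of_le goodCount_le), hqS⟩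
            have : ∑ j ∈ Finset.range (N + 1) \ S, v ^ Kp ω * (if Kq ω = j then (1 : ℝ) else 0) =
                v ^ Kp ω := by
              rw [← Finset.mul_sum, Finset.sum_ite_eq, if_pos hm, mul_one]
            dsimp only
            rw [this]
            have : 1 ≤ (v ^ jp)⁻¹ * v ^ Kp ω := by
              rw [inv_mul_eq_div, one_le_div hvj]
              exact pow_le_pow_of_le_one hv.1 hv.2 hle
            linarith
        · rw [Set.indicator_of_notMem hω]; exact add_nonneg n1 n2
    _ = ∑ j ∈ S, binom N R j + (v ^ jp)⁻¹ *
          ∑ j ∈ Finset.range (N + 1) \ S, (1 - P + P * v) ^ N * binom N y j := by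
        rw [integral_add (integrable_finsetSum _ fun j _ => hint 1 h1 j)
          ((integrable_finsetSum _ fun j _ => hint v hv j).const_mul _), integral_const_mul,
          integral_finsetSum _ fun j _ => hint 1 h1 j,
          integral_finsetSum _ fun j _ => hint v hv j, Finset.sum_congr rfl e1,
          Finset.sum_congr rfl e2]
    _ ≤ _ := by
        rw [← Finset.mul_sum, ← mul_assoc]
        gcongr
        · exact Finset.sum_nonneg fun j _ => binom_nonneg hy j
        · rw [inv_mul_le_iff₀ hvj, mul_comm _ C]; exact hC

end Law

/-! ### Relative entropy of Bernoulli laws -/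

/-- The cross entropy; differences of its values are differences of relative entropies. -/
noncomputable def ent (x s : ℝ) : ℝ := -(x * Real.log s) - (1 - x) * Real.log (1 - s)

/-- The likelihood ratio of b against a ≤ b increases with the count, so up to N x it is bounded by
its value at N x. For a = 0 the hypothesis `h0` leaves only the count zero. -/
theorem binom_le_exp_mul {N j : ℕ} {a b x : ℝ} (ha : 0 ≤ a) (hab : a ≤ b) (hb : b < 1)
    (h0 : a = 0 → x = 0) (hj : (j : ℝ) ≤ N * x) (hjN : j ≤ N) :
    binom N b j ≤ Real.exp (-N * (ent x b - ent x a)) * binom N a j := by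
  rcases ha.eq_or_lt with rfl | ha
  · have hx := h0 rfl
    subst hx
    have : j = 0 := by
      rw [mul_zero] at hj; exact_mod_cast le_antisymm hj (Nat.cast_nonneg _)
    subst this
    have e : Real.exp (-N * (ent 0 b - ent 0 0)) = (1 - b) ^ N := by
      rw [← Real.exp_log (sub_pos.2 hb), ← Real.exp_nat_mul]
      simp [ent]
    rw [e]; simp [binom]
  · have hb0 := ha.trans_le hab
    have e : ∀ y : ℝ, 0 < y → y < 1 → binom N y j =
        N.choose j * Real.exp (j * Real.log y + (N - j : ℕ) * Real.log (1 - y)) := by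
      intro y h0 h1
      rw [binom, Real.exp_add, Real.exp_nat_mul, Real.exp_nat_mul, Real.exp_log h0,
        Real.exp_log (sub_pos.2 h1), mul_assoc]
    rw [e b hb0 hb, e a ha (hab.trans_lt hb), mul_left_comm, ← Real.exp_add]
    refine mul_le_mul_of_nonneg_left (Real.exp_le_exp.2 ?_) (Nat.cast_nonneg _)
    have h1 := Real.log_le_log ha hab
    have h2 := Real.log_le_log (sub_pos.2 hb) (sub_le_sub_left hab 1)
    rw [Nat.cast_sub hjN]
    simp only [ent]
    nlinarith [mul_nonneg (sub_nonneg.2 hj) (add_nonneg (sub_nonneg.2 h1) (sub_nonneg.2 h2))]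

theorem hasDerivAt_ent (x : ℝ) {s : ℝ} (h0 : 0 < s) (h1 : s < 1) :
    HasDerivAt (ent x) ((s - x) / (s * (1 - s))) s := by
  have h2 : 1 - s ≠ 0 := by linarith
  have := (((Real.hasDerivAt_log h0.ne').const_mul x).neg).sub
    ((((hasDerivAt_id s).const_sub 1).log h2).const_mul (1 - x))
  refine this.congr_deriv ?_
  have := h0.ne'
  simp only [id]
  field_simp
  ring

theorem continuousOn_ent {x : ℝ} (hx : 0 ≤ x) : ContinuousOn (ent x) (Set.Ico x 1) := by
  have h2 : ContinuousOn (fun s => (1 - x) * Real.log (1 - s)) (Set.Ico x 1) :=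
    continuousOn_const.mul (ContinuousOn.log (continuousOn_const.sub continuousOn_id)
      fun s hs => (sub_pos.2 hs.2).ne')
  rcases hx.eq_or_lt with rfl | hx
  · have : ent 0 = fun s => 0 - (1 - 0) * Real.log (1 - s) := by funext s; simp [ent]
    rw [this]; exact continuousOn_const.sub h2
  · exact (continuousOn_const.mul (ContinuousOn.log continuousOn_id
      fun s hs => (hx.trans_le hs.1).ne')).neg.sub h2

/-- Convexity of `ent x` to the right of x: after cross-multiplication the difference is (s' - s)((s
- x)(s' - x) + x(1 - x)). -/
theorem entDeriv_mono {x s s' : ℝ} (hx0 : 0 ≤ x) (hx : x ≤ s) (hs0 : 0 < s) (hs : s ≤ s')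
    (h1 : s' < 1) : (s - x) / (s * (1 - s)) ≤ (s' - x) / (s' * (1 - s')) := by
  have a1 : 0 < s * (1 - s) := mul_pos hs0 (by linarith)
  have a2 : 0 < s' * (1 - s') := mul_pos (by linarith) (by linarith)
  rw [div_le_div_iff₀ a1 a2]
  have := mul_nonneg (sub_nonneg.2 hs) (add_nonneg (mul_nonneg (sub_nonneg.2 hx)
    (sub_nonneg.2 (hx.trans hs))) (mul_nonneg hx0 (show 0 ≤ 1 - x by linarith)))
  nlinarith

theorem entDeriv_nonneg {x s : ℝ} (hx : x ≤ s) (hs0 : 0 < s) (h1 : s < 1) :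
    0 ≤ (s - x) / (s * (1 - s)) :=
  div_nonneg (sub_nonneg.2 hx) (mul_pos hs0 (sub_pos.2 h1)).le

/-- As a function of the base point s, the difference has derivative ent'(s + E) - κ ent'(s + D). It
is nonnegative because ent' is nonnegative and increasing and κ ≤ 1. -/
theorem ent_shift {x w E D κ : ℝ} (hx : 0 ≤ x) (hw : x ≤ w) (hD : 0 ≤ D) (hDE : D ≤ E)
    (h1 : w + E < 1) (hκ : κ ≤ 1) :
    ent x (x + E) - κ * ent x (x + D) ≤ ent x (w + E) - κ * ent x (w + D) := by
  have hc : ∀ c, 0 ≤ c → c ≤ E → ContinuousOn (fun s => ent x (s + c)) (Set.Icc x w) := by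
    intro c h0 hc
    refine (continuousOn_ent hx).comp (continuousOn_id.add continuousOn_const) fun s hs => ?_
    exact ⟨by linarith [hs.1], by linarith [hs.2]⟩
  have hd : ∀ c, 0 ≤ c → c ≤ E → ∀ s ∈ Set.Ioo x w, HasDerivAt (fun s => ent x (s + c))
      ((s + c - x) / ((s + c) * (1 - (s + c)))) s := by
    intro c h0 hc s hs
    exact (hasDerivAt_ent x (by linarith [hs.1]) (by linarith [hs.2])).comp_add_const s c
  have key : MonotoneOn (fun s => ent x (s + E) - κ * ent x (s + D)) (Set.Icc x w) := by
    refine monotoneOn_of_deriv_nonneg (convex_Icc _ _)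
      ((hc E (hD.trans hDE) le_rfl).sub (continuousOn_const.mul (hc D hD hDE))) ?_ ?_
    · rw [interior_Icc]
      exact fun s hs => ((hd E (hD.trans hDE) le_rfl s hs).sub
        ((hd D hD hDE s hs).const_mul κ)).differentiableAt.differentiableWithinAt
    · rw [interior_Icc]
      intro s hs
      have hder := ((hd E (hD.trans hDE) le_rfl s hs).sub ((hd D hD hDE s hs).const_mul κ)).deriv
      have hder' : deriv (fun s => ent x (s + E) - κ * ent x (s + D)) s = _ := hder
      rw [hder']
      have h2 := entDeriv_mono (x := x) (s := s + D) (s' := s + E) hx (by linarith [hs.1])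
        (by linarith [hs.1]) (by linarith) (by linarith [hs.2])
      have h3 := entDeriv_nonneg (x := x) (s := s + D) (by linarith [hs.1])
        (by linarith [hs.1]) (by linarith [hs.2])
      nlinarith
  exact key (Set.left_mem_Icc.2 hw) (Set.right_mem_Icc.2 hw) hw

theorem ent_tangent {x s s' : ℝ} (hx0 : 0 ≤ x) (hx : x ≤ s) (hs0 : 0 < s) (hs : s ≤ s')
    (h1 : s' < 1) : (s - x) / (s * (1 - s)) * (s' - s) ≤ ent x s' - ent x s := by
  set k := (s - x) / (s * (1 - s)) with hk
  have hd : ∀ y ∈ Set.Icc s s', HasDerivAt (fun y => ent x y - k * y)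
      ((y - x) / (y * (1 - y)) - k * 1) y := fun y hy =>
    (hasDerivAt_ent x (hs0.trans_le hy.1) (hy.2.trans_lt h1)).sub ((hasDerivAt_id y).const_mul k)
  have key : MonotoneOn (fun y => ent x y - k * y) (Set.Icc s s') := by
    refine monotoneOn_of_deriv_nonneg (convex_Icc _ _)
      (fun y hy => (hd y hy).continuousAt.continuousWithinAt) ?_ ?_
    · rw [interior_Icc]
      exact fun y hy => (hd y (Set.Ioo_subset_Icc_self hy)).differentiableAt.differentiableWithinAt
    · rw [interior_Icc]
      intro y hy
      rw [(hd y (Set.Ioo_subset_Icc_self hy)).deriv, mul_one, sub_nonneg]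
      exact entDeriv_mono hx0 hx hs0 hy.1.le (hy.2.trans h1)
  have := key (Set.left_mem_Icc.2 hs) (Set.right_mem_Icc.2 hs) hs
  simp only at this
  linarith

/-- The reciprocal variance is convex, hence lies above its tangent at M. -/
theorem inv_var_tangent {s M : ℝ} (hs0 : 0 < s) (hs1 : s < 1) (hM0 : 0 < M) (hM1 : M < 1) :
    1 / (M * (1 - M)) - (1 - 2 * M) / (M * (1 - M)) ^ 2 * (s - M) ≤ 1 / (s * (1 - s)) := by
  have h1 : 0 < 1 - s := by linarith
  have h2 : 0 < 1 - M := by linarith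
  have e : 1 / (s * (1 - s)) - (1 / (M * (1 - M)) - (1 - 2 * M) / (M * (1 - M)) ^ 2 * (s - M)) =
      (s - M) ^ 2 * ((1 - s) * (1 - M) ^ 2 + s * M ^ 2) / (s * (1 - s) * (M * (1 - M)) ^ 2) := by
    field_simp
    ring
  have : 0 ≤ (s - M) ^ 2 * ((1 - s) * (1 - M) ^ 2 + s * M ^ 2) /
      (s * (1 - s) * (M * (1 - M)) ^ 2) := by positivity
  linarith

/-- The point at which Jensen's inequality is applied in `ent_jensen`. -/
theorem jensen_point_mem {x E D κ W M : ℝ} (hD : 0 ≤ D) (hDE : D ≤ E)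
    (hκ0 : 0 ≤ κ) (hκ : κ ≤ 1) (hW : W = E ^ 2 - κ * D ^ 2) (hW0 : 0 < W)
    (hM : M * (3 * W) = x * (3 * W) + 2 * (E ^ 3 - κ * D ^ 3)) : x < M ∧ M ≤ x + E := by
  have hE : 0 < E := by
    rcases hD.eq_or_lt with rfl | h
    · refine lt_of_le_of_ne hDE ?_
      rintro rfl; simp [hW] at hW0
    · linarith
  constructor
  · have h3 : 0 < E ^ 3 - κ * D ^ 3 := by
      have : κ * D ^ 3 ≤ E * (κ * D ^ 2) := by
        have := mul_nonneg (mul_nonneg hκ0 (sq_nonneg D)) (sub_nonneg.2 hDE); nlinarith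
      nlinarith
    by_contra hcon
    have := mul_le_mul_of_nonneg_right (not_lt.1 hcon) (show 0 ≤ 3 * W by linarith)
    linarith
  · by_contra hcon
    have h2 := mul_lt_mul_of_pos_right (not_le.1 hcon) (show 0 < 3 * W by linarith)
    have h3 : 0 ≤ E ^ 3 - 3 * E * κ * D ^ 2 + 2 * κ * D ^ 3 := by
      have e : E ^ 3 - 3 * E * κ * D ^ 2 + 2 * κ * D ^ 3 =
        (1 - κ) * E ^ 3 + κ * ((E - D) ^ 2 * (E + 2 * D)) := by ring
      rw [e]
      have : 0 ≤ 1 - κ := by linarith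
      positivity
    rw [hM, hW] at h2
    nlinarith

/-- Jensen's inequality for the relative entropy as an integral of `1 / (s (1 - s))`. -/
theorem ent_jensen {x E D κ W M : ℝ} (hx : 0 ≤ x) (hD : 0 ≤ D) (hDE : D ≤ E) (h1 : x + E < 1)
    (hκ0 : 0 ≤ κ) (hκ : κ ≤ 1) (hW : W = E ^ 2 - κ * D ^ 2) (hW0 : 0 < W)
    (hM : M * (3 * W) = x * (3 * W) + 2 * (E ^ 3 - κ * D ^ 3)) :
    W / 2 / (M * (1 - M)) ≤
      ent x (x + E) - ent x x - κ * (ent x (x + D) - ent x x) := by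
  obtain ⟨hMx, hME⟩ := jensen_point_mem hD hDE hκ0 hκ hW hW0 hM
  have hM0 : 0 < M := hx.trans_lt hMx
  have hM1 : M < 1 := hME.trans_lt h1
  set A := 1 / (M * (1 - M)) with hA
  set C := (1 - 2 * M) / (M * (1 - M)) ^ 2 with hC
  -- The primitive, vanishing at x, of (s - x) times the tangent line at M.
  let I : ℝ → ℝ := fun u => A * (u - x) ^ 2 / 2 -
    C * ((u - x) ^ 3 / 3 + (x - M) * (u - x) ^ 2 / 2)
  have hId : ∀ s, HasDerivAt I ((s - x) * (A - C * (s - M))) s := by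
    intro s
    have h0 : HasDerivAt (fun u => u - x) 1 s := (hasDerivAt_id s).sub_const x
    have := (((h0.pow 2).const_mul A).div_const 2).sub
      ((((h0.pow 3).div_const 3).add (((h0.pow 2).const_mul (x - M)).div_const 2)).const_mul C)
    refine this.congr_deriv ?_
    push_cast
    ring
  have key : MonotoneOn (fun s => ent x s - I s) (Set.Ico x 1) := by
    refine monotoneOn_of_deriv_nonneg (convex_Ico _ _)
      ((continuousOn_ent hx).sub fun s _ => (hId s).continuousAt.continuousWithinAt) ?_ ?_
    · rw [interior_Ico]
      exact fun s hs => ((hasDerivAt_ent x (hx.trans_lt hs.1) hs.2).sub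
        (hId s)).differentiableAt.differentiableWithinAt
    · rw [interior_Ico]
      intro s hs
      have hs0 := hx.trans_lt hs.1
      have e := ((hasDerivAt_ent x hs0 hs.2).sub (hId s)).deriv
      have e' : deriv (fun s => ent x s - I s) s = _ := e
      rw [e', sub_nonneg, div_eq_mul_one_div]
      exact mul_le_mul_of_nonneg_left (inv_var_tangent hs0 hs.2 hM0 hM1) (sub_nonneg.2 hs.1.le)
  have k1 := key (a := x) ⟨le_rfl, by linarith⟩ (b := x + D) ⟨by linarith, by linarith⟩
    (by linarith)
  have k2 := key (a := x + D) ⟨by linarith, by linarith⟩ (b := x + E) ⟨by linarith, by linarith⟩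
    (by linarith)
  have hIx : I x = 0 := by simp [I]
  simp only [hIx] at k1
  -- The point M is the barycentre of the weight s - x on [x, x + E] minus κ times that weight on
  -- [x, x + D], so the linear part of the tangent contributes nothing.
  have e : W / 2 / (M * (1 - M)) = I (x + E) - κ * I (x + D) := by
    have : I (x + E) - κ * I (x + D) =
        A * (W / 2) - C * ((x * (3 * W) + 2 * (E ^ 3 - κ * D ^ 3)) - M * (3 * W)) / 6 := by
      simp only [I, add_sub_cancel_left, hW]; ring
    rw [this, hM, hA]; ring
  rw [e]
  have k3 : 0 ≤ ent x (x + D) - I (x + D) - ent x x := by linarith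
  have := mul_le_mul_of_nonneg_right hκ k3
  linarith

/-- Massart's inequality. -/
theorem ent_massart {x E : ℝ} (hx : 0 ≤ x) (hE : 0 < E) (h1 : x + E < 1) :
    E ^ 2 / 2 / ((x + 2 / 3 * E) * (1 - (x + 2 / 3 * E))) ≤ ent x (x + E) - ent x x := by
  have := ent_jensen (D := 0) (κ := 0) (W := E ^ 2) (M := x + 2 / 3 * E) hx le_rfl hE.le h1 le_rfl
    zero_le_one (by ring) (by positivity) (by ring)
  simpa using this

/-- Shift the base from x1 to x, use Massart up to x + e, which yields ℓ, and continue along the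
tangent at x + e. Its slope is at least e/(3V/2) with V = (x + 2e/3)(1 - x - 2e/3), and ℓ = e²/(2V)
turns the second contribution into (4/3)ℓ(E/e - 1). -/
theorem ent_sub_ge {x x1 e E ℓ : ℝ} (hx : 0 ≤ x) (hx1 : x ≤ x1) (he : 0 < e) (heE : e ≤ E)
    (h1 : x1 + E < 1)
    (hℓ : e ^ 2 = 2 * ℓ * ((x + 2 / 3 * e) * (1 - (x + 2 / 3 * e)))) :
    ℓ * (1 + 4 / 3 * (E / e - 1)) ≤ ent x (x1 + E) - ent x x1 := by
  set V := (x + 2 / 3 * e) * (1 - (x + 2 / 3 * e)) with hV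
  have hV0 : 0 < V := mul_pos (by linarith) (by linarith)
  have hℓe : ℓ = e ^ 2 / 2 / V := by rw [hℓ]; field_simp
  have h2 := ent_shift (κ := 1) (D := 0) hx hx1 le_rfl (he.le.trans heE) h1 le_rfl
  have h3 := ent_massart hx he (by linarith)
  have h4 := ent_tangent (s := x + e) (s' := x + E) hx (by linarith) (by linarith) (by linarith)
    (by linarith)
  simp only [add_zero, one_mul] at h2
  have hV' : (x + e) * (1 - (x + e)) ≤ 3 / 2 * V := by
    rw [hV]; nlinarith [mul_nonneg hx (show 0 ≤ 1 - x by linarith), sq_nonneg e]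
  have hVp : 0 < (x + e) * (1 - (x + e)) := mul_pos (by linarith) (by linarith)
  have h5 : e / (3 / 2 * V) * (E - e) ≤ (x + e - x) / ((x + e) * (1 - (x + e))) * (x + E - (x + e)) := by
    rw [add_sub_cancel_left, add_sub_add_left_eq_sub]
    exact mul_le_mul_of_nonneg_right (div_le_div_of_nonneg_left he.le hVp hV') (by linarith)
  have e6 : ℓ * (1 + 4 / 3 * (E / e - 1)) = e ^ 2 / 2 / V + e / (3 / 2 * V) * (E - e) := by
    rw [hℓe]; field_simp; ring
  rw [e6]
  rw [← hV] at h3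
  linarith

/-! ### Tail bounds for the two counts -/

section Bounds
variable {d m : ℕ} {B Q : Set (Fin d → ℝ)} {N : ℕ} {r : Fin (m + 1) → ℝ} {Ω : Type*}
  [MeasurableSpace Ω] {μ : Measure Ω} [IsProbabilityMeasure μ] {X : ℕ → Ω → Fin d → ℝ}

/-- The tilting parameter that moves the mean of a Bernoulli law from `P` to `x`. -/
theorem exists_tilt {P x0 x : ℝ} (hP0 : 0 < P) (hP1 : P < 1) (hx : 0 ≤ x) (hxP : x ≤ P)
    (h0 : x = 0 → x0 = 0) {jp : ℕ} (hj : (jp : ℝ) ≤ N * x0) (hjN : jp ≤ N) :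
    ∃ v ∈ Set.Icc (0 : ℝ) 1, 0 < v ^ jp ∧ x * (1 - P + P * v) = P * v ∧
      (1 - P + P * v) ^ N ≤ Real.exp (-N * (ent x0 P - ent x0 x)) * v ^ jp := by
  have a1 : 0 < 1 - P := by linarith
  have a2 : 0 < 1 - x := by linarith
  have hγ : 1 - P + P * (x * (1 - P) / (P * (1 - x))) = (1 - P) / (1 - x) := by field_simp; ring
  -- The tilt is the odds ratio of x and P.
  refine ⟨x * (1 - P) / (P * (1 - x)), ⟨by positivity, ?_⟩, ?_, ?_, ?_⟩
  · rw [div_le_one (by positivity)]; nlinarith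
  · rcases hx.eq_or_lt with rfl | hx
    · rw [h0 rfl, mul_zero] at hj
      have : jp = 0 := by exact_mod_cast le_antisymm hj (Nat.cast_nonneg _)
      simp [this]
    · positivity
  · rw [hγ]; field_simp
  · rw [hγ]
    have key := binom_le_exp_mul (N := N) hx hxP hP1 h0 hj hjN
    set E := Real.exp (-N * (ent x0 P - ent x0 x))
    have hch : (0 : ℝ) < N.choose jp := by exact_mod_cast Nat.choose_pos hjN
    have k2 : P ^ jp * (1 - P) ^ (N - jp) ≤ E * (x ^ jp * (1 - x) ^ (N - jp)) := by
      simp only [binom] at key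
      refine le_of_mul_le_mul_left ?_ hch
      calc _ = N.choose jp * P ^ jp * (1 - P) ^ (N - jp) := by ring
        _ ≤ _ := key
        _ = _ := by ring
    obtain ⟨l, rfl⟩ := Nat.exists_eq_add_of_le hjN
    rw [Nat.add_sub_cancel_left] at k2
    rw [div_pow, div_pow, mul_pow, mul_pow, pow_add, pow_add,
      div_le_iff₀ (by positivity)]
    have e : E * (x ^ jp * (1 - P) ^ jp / (P ^ jp * (1 - x) ^ jp)) *
        ((1 - x) ^ jp * (1 - x) ^ l) = E * (x ^ jp * (1 - x) ^ l) * ((1 - P) ^ jp / P ^ jp) := by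
      field_simp
    rw [e]
    refine le_trans (le_of_eq ?_) (mul_le_mul_of_nonneg_right k2 (by positivity))
    field_simp

/-- The data of the experiment at two consecutive grid points: `P`, `R` are the values of `ℙ`
there and `t` is the ratio of the volumes of the bounding sets. -/
structure Run (μ : Measure Ω) (B Q : Set (Fin d → ℝ)) (N : ℕ) (r : Fin (m + 1) → ℝ)
    (X : ℕ → Ω → Fin d → ℝ) (i : Fin m) (P R t : ℝ) : Prop where
  measB : MeasurableSet B
  measQ : MeasurableSet Q
  star : ∀ x ∈ B, ∀ c ∈ Set.Icc (0 : ℝ) 1, c • x ∈ B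
  vol_ne_zero : volume B ≠ 0
  vol_ne_top : volume B ≠ ⊤
  pos : 0 < r 0
  mono : StrictMono r
  reuse : IsSampleReuse μ B N r X
  prob_fst : robustProb B Q (r i.castSucc) = P
  prob_snd : robustProb B Q (r i.succ) = R
  ratio : (r i.castSucc / r i.succ) ^ d = t

variable {i : Fin m} {P R t : ℝ}

theorem Run.radius_pos (h : Run μ B Q N r X i P R t) (j : Fin (m + 1)) : 0 < r j :=
  h.pos.trans_le (h.mono.monotone (Fin.zero_le j))

theorem Run.radius_le (_h : Run μ B Q N r X i P R t) : r i.castSucc ≤ r i.succ :=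
  _h.mono.monotone (Fin.castSucc_lt_succ).le

theorem Run.fst_mem (h : Run μ B Q N r X i P R t) : P ∈ Set.Icc (0 : ℝ) 1 :=
  h.prob_fst ▸ robustProb_mem h.vol_ne_zero h.vol_ne_top (h.radius_pos _)

theorem Run.snd_mem (h : Run μ B Q N r X i P R t) : R ∈ Set.Icc (0 : ℝ) 1 :=
  h.prob_snd ▸ robustProb_mem h.vol_ne_zero h.vol_ne_top (h.radius_pos _)

theorem Run.ratio_nonneg (h : Run μ B Q N r X i P R t) : 0 ≤ t :=
  h.ratio ▸ (pow_pos (div_pos (h.radius_pos _) (h.radius_pos _)) d).le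

theorem Run.growth (h : Run μ B Q N r X i P R t) : t * P ≤ R ∧ t * (1 - P) ≤ 1 - R := by
  have := robustProb_mono h.vol_ne_zero h.vol_ne_top h.measB h.measQ h.star (h.radius_pos _)
    h.radius_le
  rwa [h.prob_fst, h.prob_snd, h.ratio] at this

theorem goodCount_le_iff {ρ : ℝ} {x : ℕ → Fin d → ℝ} {y : ℝ} (hy : 0 ≤ y) :
    (goodCount B Q N r ρ x : ℝ) ≤ y ↔ goodCount B Q N r ρ x ≤ min ⌊y⌋₊ N := by
  rw [le_min_iff, Nat.le_floor_iff hy]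
  exact ⟨fun h => ⟨h, goodCount_le⟩, fun h => h.1⟩

theorem goodCount_le_iff_mem {ρ : ℝ} {x : ℕ → Fin d → ℝ} {y : ℝ} :
    (goodCount B Q N r ρ x : ℝ) ≤ y ↔
      goodCount B Q N r ρ x ∈ (Finset.range (N + 1)).filter fun j : ℕ => (j : ℝ) ≤ y := by
  rw [Finset.mem_filter, Finset.mem_range, Nat.lt_succ_iff]
  exact ⟨fun h => ⟨goodCount_le, h⟩, fun h => h.2⟩

/-- Tilting at p replaces P by x there. It affects only the proportion t of the q-samples that lie
in 𝓑_p, so the parameter at q moves from R to R - t(P - x). The threshold x0 and the target x of the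
tilt may differ. -/
theorem Run.measureReal_le (h : Run μ B Q N r X i P R t) {x0 x : ℝ} (hP0 : 0 < P) (hP1 : P < 1)
    (hx0 : 0 ≤ x0) (hx : 0 ≤ x) (hxP : x ≤ P) (hx0' : x = 0 → x0 = 0) (S : Finset ℕ)
    (hS : S ⊆ Finset.range (N + 1)) :
    μ.real {ω | (goodCount B Q N r (r i.castSucc) (fun k => X k ω) : ℝ) ≤ N * x0 ∨
        goodCount B Q N r (r i.succ) (fun k => X k ω) ∈ S} ≤
      ∑ j ∈ S, binom N R j + Real.exp (-N * (ent x0 P - ent x0 x)) *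
        ∑ j ∈ Finset.range (N + 1) \ S, binom N (R - t * (P - x)) j := by
  have hN : 0 ≤ N * x0 := mul_nonneg (Nat.cast_nonneg _) hx0
  have hj : ((min ⌊N * x0⌋₊ N : ℕ) : ℝ) ≤ N * x0 :=
    (Nat.cast_le.2 (min_le_left _ _)).trans (Nat.floor_le hN)
  obtain ⟨v, hv, hvj, hvx, hC⟩ := exists_tilt hP0 hP1 hx hxP hx0' hj (min_le_right _ _)
  have hg := h.growth
  have ht := h.ratio_nonneg
  have hR := h.snd_mem
  have hy : R - t * (P - x) ∈ Set.Icc (0 : ℝ) 1 :=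
    ⟨by nlinarith [mul_nonneg ht hx], by linarith [mul_nonneg ht (sub_nonneg.2 hxP), hR.2]⟩
  have := measureReal_goodCount_le h.measB h.measQ h.star h.vol_ne_zero h.vol_ne_top h.pos h.mono
    h.reuse i rfl rfl h.prob_fst h.prob_snd h.ratio hv hvj S hS hy hC
    (by linear_combination t * hvx)
  simpa only [goodCount_le_iff hN] using this

theorem Run.measureReal_fst_le (h : Run μ B Q N r X i P R t) {x0 : ℝ} (hP0 : 0 < P) (hP1 : P < 1)
    (hx0 : 0 ≤ x0) (hx0P : x0 ≤ P) :
    μ.real {ω | (goodCount B Q N r (r i.castSucc) (fun k => X k ω) : ℝ) ≤ N * x0} ≤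
      Real.exp (-N * (ent x0 P - ent x0 x0)) := by
  have := h.measureReal_le hP0 hP1 hx0 hx0 hx0P id ∅ (Finset.empty_subset _)
  simpa only [Finset.notMem_empty, or_false, Finset.sum_empty, zero_add, Finset.sdiff_empty,
    sum_binom, mul_one] using this

/-- For P = 1 the tilt of `exists_tilt` is not available. The generating-function bound with C = v
and arbitrarily small v shows that almost surely all N samples counted at p are good. -/
theorem Run.measureReal_fst_eq_zero (h : Run μ B Q N r X i P R t) {x0 : ℝ} (hP : P = 1)
    (hx0 : x0 < 1) (hN : 0 < N) :
    μ.real {ω | (goodCount B Q N r (r i.castSucc) (fun k => X k ω) : ℝ) ≤ N * x0} = 0 := by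
  refine le_antisymm (le_of_forall_pos_le_add fun ε hε => ?_) measureReal_nonneg
  set v := min ε 1 with hv
  have hv0 : 0 < v := lt_min hε one_pos
  have hv1 : v ≤ 1 := min_le_right _ _
  have hN' : (0 : ℝ) < N := by exact_mod_cast hN
  have hsub : {ω | (goodCount B Q N r (r i.castSucc) (fun k => X k ω) : ℝ) ≤ N * x0} ⊆
      {ω | goodCount B Q N r (r i.castSucc) (fun k => X k ω) ≤ N - 1 ∨
        goodCount B Q N r (r i.succ) (fun k => X k ω) ∈ (∅ : Finset ℕ)} := by
    intro ω hω
    left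
    have h1 : (goodCount B Q N r (r i.castSucc) (fun k => X k ω) : ℝ) < N := by
      refine lt_of_le_of_lt hω ?_
      nlinarith
    have : goodCount B Q N r (r i.castSucc) (fun k => X k ω) < N := by exact_mod_cast h1
    exact Nat.le_sub_one_of_lt this
  have hR := h.snd_mem
  have hg := h.growth
  have ht := h.ratio_nonneg
  rw [hP] at hg
  have hy : t + R - t ∈ Set.Icc (0 : ℝ) 1 := by rwa [add_sub_cancel_left]
  have := measureReal_goodCount_le h.measB h.measQ h.star h.vol_ne_zero h.vol_ne_top h.pos h.mono
    h.reuse i rfl rfl h.prob_fst h.prob_snd h.ratio (v := v) ⟨hv0.le, hv1⟩ (jp := N - 1)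
    (pow_pos hv0 _) ∅ (Finset.empty_subset _) (C := v) hy
    (by rw [hP, sub_self, zero_add, one_mul, ← pow_succ', Nat.sub_add_cancel hN])
    (by rw [hP]; ring)
  simp only [Finset.sum_empty, zero_add, Finset.sdiff_empty, sum_binom, mul_one] at this
  exact (measureReal_mono hsub).trans (this.trans ((min_le_left _ _).trans (by rw [zero_add])))

theorem Run.measureReal_snd_mem_le (h : Run μ B Q N r X i P R t) (S : Finset ℕ)
    (hS : S ⊆ Finset.range (N + 1)) :
    μ.real {ω | goodCount B Q N r (r i.succ) (fun k => X k ω) ∈ S} ≤ ∑ j ∈ S, binom N R j := by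
  have hm := aemeasurable_goodCount h.measB h.measQ h.star h.vol_ne_zero h.vol_ne_top h.pos h.mono
    h.reuse i.succ
  have hmeas : NullMeasurableSet {ω | goodCount B Q N r (r i.succ) (fun k => X k ω) ∈ S} μ :=
    hm.nullMeasurable (MeasurableSet.of_discrete (s := {n | n ∈ S}))
  have e : ∀ j ∈ S, binom N R j = ∫ ω, (1 : ℝ) ^ goodCount B Q N r (r i.castSucc) (fun k => X k ω) *
      (if goodCount B Q N r (r i.succ) (fun k => X k ω) = j then (1 : ℝ) else 0) ∂μ := by
    intro j hj
    rw [integral_pow_goodCount_ite h.measB h.measQ h.star h.vol_ne_zero h.vol_ne_top h.pos h.mono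
      h.reuse i rfl rfl h.prob_fst h.prob_snd h.ratio ⟨zero_le_one, le_rfl⟩
      (Nat.lt_succ_iff.1 (Finset.mem_range.1 (hS hj))), binom]
    congr 2 <;> ring
  rw [Finset.sum_congr rfl e, ← integral_finsetSum]
  · refine le_of_eq ?_
    have : ∀ ω, ∑ j ∈ S, (1 : ℝ) ^ goodCount B Q N r (r i.castSucc) (fun k => X k ω) *
        (if goodCount B Q N r (r i.succ) (fun k => X k ω) = j then (1 : ℝ) else 0) =
        {ω | goodCount B Q N r (r i.succ) (fun k => X k ω) ∈ S}.indicator (fun _ => (1 : ℝ)) ω := by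
      intro ω
      simp [Set.indicator]
    simp only [this]
    rw [integral_indicator₀ hmeas]; simp
  · intro j _
    refine Integrable.of_bound (C := 1) (AEMeasurable.aestronglyMeasurable ?_)
      (Filter.Eventually.of_forall fun ω => ?_)
    · simp only [one_pow, one_mul]
      exact (measurable_from_top (f := fun n : ℕ => if n = j then (1 : ℝ) else 0)).comp_aemeasurable
          hm
    · rw [one_pow, one_mul]; split_ifs <;> simp

/-- Chernoff's bound: compare b with x term by term and drop the upper tail of the law with
parameter x. -/
theorem sum_binom_le {b x : ℝ} (hx : 0 ≤ x) (hxb : x ≤ b) (hb : b < 1) {N : ℕ} :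
    ∑ j ∈ (Finset.range (N + 1)).filter (fun j : ℕ => (j : ℝ) ≤ N * x), binom N b j ≤
      Real.exp (-N * (ent x b - ent x x)) := by
  have hx1 : x ∈ Set.Icc (0 : ℝ) 1 := ⟨hx, hxb.trans hb.le⟩
  calc _ ≤ ∑ j ∈ (Finset.range (N + 1)).filter (fun j : ℕ => (j : ℝ) ≤ N * x),
        Real.exp (-N * (ent x b - ent x x)) * binom N x j := by
        refine Finset.sum_le_sum fun j hj => ?_
        rw [Finset.mem_filter, Finset.mem_range, Nat.lt_succ_iff] at hj
        exact binom_le_exp_mul hx hxb hb id hj.2 hj.1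
    _ ≤ Real.exp (-N * (ent x b - ent x x)) * 1 := by
        rw [← Finset.mul_sum]
        refine mul_le_mul_of_nonneg_left ?_ (Real.exp_pos _).le
        rw [← sum_binom N x]
        exact Finset.sum_le_sum_of_subset_of_nonneg (Finset.filter_subset _ _)
          fun j _ _ => binom_nonneg hx1 j
    _ = _ := mul_one _

theorem Run.measureReal_snd_le (h : Run μ B Q N r X i P R t) {y0 : ℝ} (hR1 : R < 1)
    (hy0 : 0 ≤ y0) (hy0R : y0 ≤ R) :
    μ.real {ω | (goodCount B Q N r (r i.succ) (fun k => X k ω) : ℝ) ≤ N * y0} ≤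
      Real.exp (-N * (ent y0 R - ent y0 y0)) := by
  simp only [goodCount_le_iff_mem]
  exact (h.measureReal_snd_mem_le _ (Finset.filter_subset _ _)).trans (sum_binom_le hy0 hy0R hR1)

theorem Run.measureReal_snd_eq_zero (h : Run μ B Q N r X i P R t) {y0 : ℝ} (hR1 : R = 1)
    (hy0 : y0 < 1) (hN : 0 < N) :
    μ.real {ω | (goodCount B Q N r (r i.succ) (fun k => X k ω) : ℝ) ≤ N * y0} = 0 := by
  have hN' : (0 : ℝ) < N := by exact_mod_cast hN
  refine le_antisymm ?_ measureReal_nonneg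
  simp only [goodCount_le_iff_mem]
  refine (h.measureReal_snd_mem_le _ (Finset.filter_subset _ _)).trans (le_of_eq ?_)
  refine Finset.sum_eq_zero fun j hj => ?_
  rw [Finset.mem_filter] at hj
  have h1 : (j : ℝ) < N := by nlinarith [hj.2]
  have h2 : j < N := by exact_mod_cast h1
  simp [binom, hR1, Nat.sub_ne_zero_of_lt h2]

/-- The bound for the union of the two lower tails that uses the dependence of the counts. -/
theorem Run.measureReal_union_lt (h : Run μ B Q N r X i P R t) {x0 x y0 κ T : ℝ} (hP0 : 0 < P)
    (hP1 : P < 1) (hR1 : R < 1) (hx0 : 0 ≤ x0) (hx : 0 ≤ x) (hxP : x ≤ P) (hx0' : x = 0 → x0 = 0)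
    (hy0 : 0 ≤ y0) (hy : y0 ≤ R - t * (P - x)) (hκ0 : 0 ≤ κ) (hκ1 : κ < 1) (hT : 0 < T)
    (hp : Real.exp (-N * (ent x0 P - ent x0 x)) < κ * T)
    (hG : Real.exp (-N * (ent y0 R - ent y0 y0)) < T)
    (hq : Real.exp (-N * (ent y0 R - ent y0 y0)) ≤
      T * Real.exp (κ * (-N * (ent y0 (R - t * (P - x)) - ent y0 y0)))) :
    μ.real {ω | (goodCount B Q N r (r i.castSucc) (fun k => X k ω) : ℝ) ≤ N * x0 ∨
        (goodCount B Q N r (r i.succ) (fun k => X k ω) : ℝ) ≤ N * y0} < T := by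
  have ht := h.ratio_nonneg
  set y := R - t * (P - x) with hyd
  have hyR : y ≤ R := by linarith [mul_nonneg ht (sub_nonneg.2 hxP)]
  have hy1 : y < 1 := hyR.trans_lt hR1
  have hyI : y ∈ Set.Icc (0 : ℝ) 1 := ⟨hy0.trans hy, hy1.le⟩
  simp only [goodCount_le_iff_mem (ρ := r i.succ)]
  set S := (Finset.range (N + 1)).filter (fun j : ℕ => (j : ℝ) ≤ N * y0) with hS
  refine (h.measureReal_le hP0 hP1 hx0 hx hxP hx0' S (Finset.filter_subset _ _)).trans_lt ?_
  set c := Real.exp (-N * (ent x0 P - ent x0 x))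
  set V := ∑ j ∈ S, binom N y j with hV
  set G := Real.exp (-N * (ent y0 R - ent y0 y)) with hGd
  set z := Real.exp (-N * (ent y0 y - ent y0 y0)) with hz
  -- The total is now at most G V + c(1 - V), where V is the lower tail at q under the tilted
  -- parameter y and G bounds the likelihood ratio of R against y.
  have h1 : ∑ j ∈ S, binom N R j ≤ G * V := by
    rw [hV, Finset.mul_sum]
    refine Finset.sum_le_sum fun j hj => ?_
    rw [hS, Finset.mem_filter, Finset.mem_range, Nat.lt_succ_iff] at hj
    exact binom_le_exp_mul hyI.1 hyR hR1 (fun h0 => le_antisymm (h0 ▸ hy) hy0) hj.2 hj.1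
  have h2 : ∑ j ∈ Finset.range (N + 1) \ S, binom N y j = 1 - V := by
    rw [← sum_binom N y, hV, ← Finset.sum_sdiff (Finset.filter_subset _ _ : S ⊆ _)]
    ring
  have hVz : V ≤ z := sum_binom_le hy0 hy hy1
  have hV0 : 0 ≤ V := Finset.sum_nonneg fun j _ => binom_nonneg hyI j
  have hV1 : V ≤ 1 := by
    rw [hV, ← sum_binom N y]
    exact Finset.sum_le_sum_of_subset_of_nonneg (Finset.filter_subset _ _)
      fun j _ _ => binom_nonneg hyI j
  rw [h2]
  have hc : c < T := hp.trans_le (by nlinarith)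
  rcases le_or_gt G c with hGc | hGc
  · nlinarith
  have hGz : G * z = Real.exp (-N * (ent y0 R - ent y0 y0)) := by
    rw [hGd, hz, ← Real.exp_add]; congr 1; ring
  -- Convexity of exp gives z^κ ≤ κ z + 1 - κ. Since G z ≤ T z^κ and c < κ T, the mixture G z + c(1
  -- - z) stays below T when z < 1; for z = 1 the bound on G z itself is strict.
  have hb : Real.exp (κ * (-N * (ent y0 y - ent y0 y0))) ≤ κ * z + (1 - κ) := by
    have := convexOn_exp.2 (Set.mem_univ (-N * (ent y0 y - ent y0 y0))) (Set.mem_univ (0 : ℝ)) hκ0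
      (sub_nonneg.2 hκ1.le) (by ring)
    simp only [smul_eq_mul, mul_zero, add_zero, Real.exp_zero, mul_one] at this
    exact this
  have hz1 : c < κ * T := hp
  have h3 : G * V + c * (1 - V) ≤ G * z + c * (1 - z) := by nlinarith
  have hznn : 0 ≤ z := (Real.exp_pos _).le
  have h4 : Real.exp (κ * (-N * (ent y0 y - ent y0 y0))) * T ≤ (κ * z + (1 - κ)) * T :=
    mul_le_mul_of_nonneg_right hb hT.le
  rw [← hGz] at hq hG
  have hz1' : z ≤ 1 := by
    rw [hz, Real.exp_le_one_iff]
    have h5 : 0 ≤ ent y0 y - ent y0 y0 := by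
      rcases hy.eq_or_lt with he | hlt
      · rw [← he, sub_self]
      · have := ent_massart (x := y0) (E := y - y0) hy0 (by linarith) (by linarith)
        rw [add_sub_cancel] at this
        refine le_trans (div_nonneg (by positivity) (mul_pos ?_ ?_).le) this <;> linarith
    have := mul_nonneg (Nat.cast_nonneg N : (0 : ℝ) ≤ N) h5
    linarith
  rcases hz1'.eq_or_lt with h6 | h6
  · rw [h6, sub_self, mul_zero] at h3
    rw [h6] at hG
    linarith
  · have := mul_lt_mul_of_pos_right hz1 (sub_pos.2 h6)
    linarith

end Bounds

/-! ### The confidence limits as inverses of Massart's exponent -/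

section Limits

/-- Both limits depend on k symmetrically under k ↦ N - k, so the lower limit for Q comes from the
upper limit for its complement. -/
theorem lowerLim_eq {N : ℕ} (hN : 0 < N) (δ k : ℝ) :
    lowerLim N δ k = 1 - upperLim N δ (N - k) := by
  have hN' : (N : ℝ) ≠ 0 := by positivity
  have e1 : ((N : ℝ) - k) / N = 1 - k / N := by field_simp
  have e2 : 1 + 4 * theta δ * (N - k) * (1 - (N - k) / N) = 1 + 4 * theta δ * k * (1 - k / N) := by
    rw [e1]; field_simp; ring
  have e3 : 2 * ((N : ℝ) - k) / N = 2 - 2 * k / N := by field_simp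
  rw [lowerLim, upperLim, e2, e1, e3]
  ring

/-- The right-hand side of Massart's inequality vanishes to the order of the upper limit. -/
theorem upperLim_le_iff_aux {N : ℕ} (hN : 0 < N) {δ : ℝ} (hδ : δ ∈ Set.Ioo (0 : ℝ) 1) {k p : ℝ}
    (hk : k ∈ Set.Icc (0 : ℝ) N) (hp : p < 1) (h : upperLim N δ k ≤ p) :
    k / N < p ∧ 2 * (Real.log (2 / δ) / N) *
      ((2 * p + k / N) / 3 * (1 - (2 * p + k / N) / 3)) ≤ (p - k / N) ^ 2 := by
  have hN' : (0 : ℝ) < N := by exact_mod_cast hN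
  set x := k / N with hx
  have hx0 : 0 ≤ x := div_nonneg hk.1 hN'.le
  have hx1 : x ≤ 1 := (div_le_one hN').2 hk.2
  have hkx : k = N * x := by rw [hx]; field_simp
  have hL : 0 < Real.log (2 / δ) := Real.log_pos (by
    rw [lt_div_iff₀ hδ.1]; linarith [hδ.2])
  have hc0 : 0 < theta δ * N := by rw [theta]; positivity
  -- The choice of θ makes Massart's inequality quadratic with this constant.
  have hcl : 2 * (Real.log (2 / δ) / N) * (4 * (theta δ * N)) = 9 := by
    rw [theta]; field_simp; ring
  set c := theta δ * N with hc
  set s := √(1 + 4 * c * (x * (1 - x))) with hs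
  have hU : upperLim N δ k = x + 3 / 4 * ((1 - 2 * x + s) / (1 + c)) := by
    rw [upperLim, ← hx, hs, hc, hkx]
    have e1 : 4 * theta δ * (N * x) * (1 - x) = 4 * (theta δ * N) * (x * (1 - x)) := by ring
    have e2 : 2 * (N * x) / N = 2 * x := by field_simp
    rw [e1, e2]
  rw [hU] at h
  have hVx : 0 ≤ x * (1 - x) := mul_nonneg hx0 (by linarith)
  have hs0 : 0 ≤ s := Real.sqrt_nonneg _
  have hs2 : s ^ 2 = 1 + 4 * c * (x * (1 - x)) := Real.sq_sqrt (by positivity)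
  have hs1 : 1 ≤ s := by rw [hs, Real.one_le_sqrt]; nlinarith [mul_nonneg hc0.le hVx]
  have h1 : 0 ≤ (1 - 2 * x + s) / (1 + c) := div_nonneg (by linarith) (by linarith)
  have h2 : 3 / 4 * (1 - 2 * x + s) ≤ (1 + c) * (p - x) := by
    have h3 : 3 / 4 * ((1 - 2 * x + s) / (1 + c)) ≤ p - x := by linarith
    have := mul_le_mul_of_nonneg_left h3 (show 0 ≤ 1 + c by linarith)
    calc _ = (1 + c) * (3 / 4 * ((1 - 2 * x + s) / (1 + c))) := by field_simp
      _ ≤ _ := this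
  refine ⟨?_, ?_⟩
  · rcases hx0.eq_or_lt with h0 | h0
    · rw [← h0] at h2 ⊢
      nlinarith
    · have hxp : x ≤ p := by linarith
      have hlt : 1 < s := by
        rw [hs, Real.lt_sqrt zero_le_one]
        have := mul_pos hc0 (mul_pos h0 (show 0 < 1 - x by linarith)); linarith
      nlinarith
  · have h3 : 0 ≤ ((1 + c) * (p - x) - 3 / 4 * (1 - 2 * x + s)) *
        ((1 + c) * (p - x) - 3 / 4 * (1 - 2 * x - s)) :=
      mul_nonneg (by linarith) (by linarith)
    have h4 : 0 ≤ (1 + c) * ((1 + c) * (p - x) ^ 2 - 3 / 2 * (1 - 2 * x) * (p - x) -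
        9 / 4 * (x * (1 - x))) := by
      calc (0 : ℝ) ≤ _ := h3
        _ = (1 + c) ^ 2 * (p - x) ^ 2 - 3 / 2 * (1 + c) * (p - x) * (1 - 2 * x) +
          9 / 16 * ((1 - 2 * x) ^ 2 - s ^ 2) := by ring
        _ = _ := by rw [hs2]; ring
    have h5 := nonneg_of_mul_nonneg_right h4 (show 0 < 1 + c by linarith)
    refine le_of_mul_le_mul_left ?_ hc0
    have e : c * (2 * (Real.log (2 / δ) / N) * ((2 * p + x) / 3 * (1 - (2 * p + x) / 3))) =
        9 / 4 * ((2 * p + x) / 3 * (1 - (2 * p + x) / 3)) := by rw [← hcl]; ring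
    rw [e]
    nlinarith

theorem upperLim_pos {N : ℕ} (hN : 0 < N) {δ : ℝ} (hδ : δ ∈ Set.Ioo (0 : ℝ) 1) {k : ℝ}
    (hk : k ∈ Set.Icc (0 : ℝ) N) : 0 < upperLim N δ k := by
  by_contra h
  have := (upperLim_le_iff_aux hN hδ hk zero_lt_one (not_lt.1 h)).1
  linarith [div_nonneg hk.1 (Nat.cast_nonneg (α := ℝ) N)]

/-- As a function of x, f(x) = (p - x)² - 2L m(1 - m) with m = (2p + x)/3 is a quadratic with
positive leading coefficient and f(p) < 0. If f(0) < 0, no count makes the limit drop to p.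
Otherwise f has a root in [0, p); there Massart's exponent is exactly L, and only counts up to N
times this root are possible. -/
theorem exists_threshold {N : ℕ} (hN : 0 < N) {δ : ℝ} (hδ : δ ∈ Set.Ioo (0 : ℝ) 1) {p : ℝ}
    (hp : p < 1) :
    (∀ k ∈ Set.Icc (0 : ℝ) N, p < upperLim N δ k) ∨
      ∃ x e : ℝ, 0 ≤ x ∧ 0 < e ∧ x + e = p ∧
        e ^ 2 = 2 * (Real.log (2 / δ) / N) * ((x + 2 / 3 * e) * (1 - (x + 2 / 3 * e))) ∧
        ∀ k ∈ Set.Icc (0 : ℝ) N, upperLim N δ k ≤ p → k ≤ N * x := by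
  have hN' : (0 : ℝ) < N := by exact_mod_cast hN
  have hL : 0 < Real.log (2 / δ) / N := div_pos (Real.log_pos (by
    rw [lt_div_iff₀ hδ.1]; linarith [hδ.2])) hN'
  set L := Real.log (2 / δ) / N with hLd
  rcases le_or_gt p 0 with hp0 | hp0
  · exact Or.inl fun k hk => hp0.trans_lt (upperLim_pos hN hδ hk)
  let f : ℝ → ℝ := fun x => (p - x) ^ 2 - 2 * L * ((2 * p + x) / 3 * (1 - (2 * p + x) / 3))
  have hfp : f p < 0 := by
    have : f p = -(2 * L * (p * (1 - p))) := by simp only [f]; ring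
    rw [this]
    have := mul_pos (mul_pos two_pos hL) (mul_pos hp0 (sub_pos.2 hp)); linarith
  have hconv : ∀ x y : ℝ, x < y → y ≤ p → f x ≤ 0 → f y ≤ 0 → ∀ z ∈ Set.Icc x y, f z ≤ 0 := by
    intro x y hxy _ hx hy z hz
    have e : (y - x) * f z = (y - z) * f x + (z - x) * f y -
        (1 + 2 * L / 9) * ((y - x) * (z - x) * (y - z)) := by simp only [f]; ring
    have h1 := mul_nonneg (sub_nonneg.2 hz.2) (neg_nonneg.2 hx)
    have h2 := mul_nonneg (sub_nonneg.2 hz.1) (neg_nonneg.2 hy)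
    have h3 : 0 ≤ (1 + 2 * L / 9) * ((y - x) * (z - x) * (y - z)) :=
      mul_nonneg (by linarith) (mul_nonneg (mul_nonneg (sub_pos.2 hxy).le (sub_nonneg.2 hz.1))
        (sub_nonneg.2 hz.2))
    by_contra hcon
    have := mul_pos (sub_pos.2 hxy) (not_le.1 hcon)
    nlinarith
  have hconv' : ∀ x : ℝ, x < p → f x ≤ 0 → ∀ z ∈ Set.Ioo x p, f z < 0 := by
    intro x hx hfx z hz
    have e : (p - x) * f z = (p - z) * f x + (z - x) * f p -
        (1 + 2 * L / 9) * ((p - x) * (z - x) * (p - z)) := by simp only [f]; ring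
    have h1 := mul_nonneg (sub_nonneg.2 hz.2.le) (neg_nonneg.2 hfx)
    have h2 := mul_pos (sub_pos.2 hz.1) (neg_pos.2 hfp)
    have h3 : 0 ≤ (1 + 2 * L / 9) * ((p - x) * (z - x) * (p - z)) :=
      mul_nonneg (by linarith) (mul_nonneg (mul_nonneg (sub_pos.2 hx).le (sub_pos.2 hz.1).le)
        (sub_pos.2 hz.2).le)
    by_contra hcon
    have := mul_nonneg (sub_pos.2 hx).le (not_lt.1 hcon)
    nlinarith
  have haux : ∀ k ∈ Set.Icc (0 : ℝ) N, upperLim N δ k ≤ p → k / N < p ∧ 0 ≤ f (k / N) :=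
    fun k hk h => by
      obtain ⟨h1, h2⟩ := upperLim_le_iff_aux hN hδ hk hp h
      exact ⟨h1, sub_nonneg.2 h2⟩
  rcases lt_or_ge (f 0) 0 with h0 | h0
  · left
    intro k hk
    by_contra hcon
    obtain ⟨h1, h2⟩ := haux k hk (not_lt.1 hcon)
    rcases (div_nonneg hk.1 hN'.le).eq_or_lt with h3 | h3
    · rw [← h3] at h2; linarith
    · linarith [hconv' 0 hp0 h0.le _ ⟨h3, h1⟩]
  · right
    have hcont : ContinuousOn f (Set.Icc 0 p) := by fun_prop
    obtain ⟨x, hx, hfx⟩ := intermediate_value_Icc' hp0.le hcont ⟨hfp.le, h0⟩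
    have hxp : x < p := lt_of_le_of_ne hx.2 fun h => by rw [h] at hfx; linarith
    refine ⟨x, p - x, hx.1, sub_pos.2 hxp, by ring, ?_, fun k hk h => ?_⟩
    · have : x + 2 / 3 * (p - x) = (2 * p + x) / 3 := by ring
      rw [this]; exact sub_eq_zero.1 hfx
    · obtain ⟨h1, h2⟩ := haux k hk h
      rw [mul_comm, ← div_le_iff₀ hN']
      by_contra hcon
      linarith [hconv' x hxp hfx.le _ ⟨not_le.1 hcon, h1⟩]

end Limits

/-! ### Tails at lowered thresholds -/

section Tails
variable {d m : ℕ} {B Q : Set (Fin d → ℝ)} {N : ℕ} {r : Fin (m + 1) → ℝ} {Ω : Type*}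
  [MeasurableSpace Ω] {μ : Measure Ω} [IsProbabilityMeasure μ] {X : ℕ → Ω → Fin d → ℝ}
  {i : Fin m} {P R t : ℝ}

/-- Because 2/δ ≥ 2, the improvement of the tail can be stated without δ. -/
theorem exp_neg_log_div {N : ℕ} (hN : 0 < N) {δ : ℝ} (hδ : δ ∈ Set.Ioo (0 : ℝ) 1) (s : ℝ)
    (hs : 0 ≤ s) :
    Real.exp (-N * (Real.log (2 / δ) / N * (1 + s))) ≤ δ / 2 * Real.exp (-(s * Real.log 2)) := by
  have hN' : (0 : ℝ) < N := by exact_mod_cast hN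
  have e : -N * (Real.log (2 / δ) / N * (1 + s)) = Real.log (δ / 2) + s * -Real.log (2 / δ) := by
    rw [← Real.log_inv (2 / δ), inv_div]
    rw [← inv_div δ 2, Real.log_inv]; field_simp
  have h2 : Real.log 2 ≤ Real.log (2 / δ) := by
    refine Real.log_le_log two_pos ?_
    rw [le_div_iff₀ hδ.1]; linarith [hδ.2]
  rw [e, Real.exp_add, Real.exp_log (by linarith [hδ.1])]
  refine mul_le_mul_of_nonneg_left (Real.exp_le_exp.2 ?_) (by linarith [hδ.1])
  nlinarith

/-- From x + e = aP - η one gets P = x/a + (e + η)/a, so `ent_sub_ge` applies with base x/a and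
deviation (e + η)/a. The second claim allows the base x to be used instead. -/
theorem exp_ent_le {N : ℕ} (hN : 0 < N) {δ : ℝ} (hδ : δ ∈ Set.Ioo (0 : ℝ) 1) {x e a η P : ℝ}
    (ha0 : 0 < a) (ha : a ≤ 1) (hη : 0 ≤ η) (hx : 0 ≤ x) (he : 0 < e) (hP : x + e = a * P - η)
    (hP1 : P < 1)
    (hV : e ^ 2 = 2 * (Real.log (2 / δ) / N) * ((x + 2 / 3 * e) * (1 - (x + 2 / 3 * e)))) :
    Real.exp (-N * (ent x P - ent x (x / a))) ≤
        δ / 2 * Real.exp (-(4 / 3 * ((e + η) / a / e - 1) * Real.log 2)) ∧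
      ent x x ≤ ent x (x / a) := by
  have hPe : P = x / a + (e + η) / a := by field_simp; linarith
  have hxa : x ≤ x / a := by rw [le_div_iff₀ ha0]; nlinarith
  have heE : e ≤ (e + η) / a := by rw [le_div_iff₀ ha0]; nlinarith
  have hh : 0 ≤ 4 / 3 * ((e + η) / a / e - 1) := by
    have : 1 ≤ (e + η) / a / e := (one_le_div he).2 heE
    linarith
  constructor
  · refine le_trans ?_ (exp_neg_log_div hN hδ _ hh)
    have h2 := ent_sub_ge (x1 := x / a) hx hxa he heE (by rw [← hPe]; exact hP1) hV
    rw [← hPe] at h2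
    refine Real.exp_le_exp.2 ?_
    have := mul_le_mul_of_nonneg_left h2 (Nat.cast_nonneg N : (0 : ℝ) ≤ N)
    linarith
  · rcases hxa.eq_or_lt with h4 | h4
    · rw [← h4]
    · have hx1 : x / a < 1 := by linarith
      have := ent_massart (E := x / a - x) hx (sub_pos.2 h4) (by rw [add_sub_cancel]; exact hx1)
      rw [add_sub_cancel] at this
      have h5 : 0 ≤ (x / a - x) ^ 2 / 2 / ((x + 2 / 3 * (x / a - x)) *
          (1 - (x + 2 / 3 * (x / a - x)))) :=
        div_nonneg (by positivity) (mul_pos (by linarith) (by linarith)).le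
      linarith

theorem exp_neg_log {N : ℕ} (hN : 0 < N) {δ : ℝ} (hδ : δ ∈ Set.Ioo (0 : ℝ) 1) :
    Real.exp (-N * (Real.log (2 / δ) / N)) = δ / 2 := by
  have hN' : (0 : ℝ) < N := by exact_mod_cast hN
  have e1 : -N * (Real.log (2 / δ) / N) = Real.log (δ / 2) := by
    rw [← inv_div 2 δ, Real.log_inv]; field_simp
  rw [e1, Real.exp_log (by linarith [hδ.1])]

theorem exp_ent_lt {N : ℕ} (hN : 0 < N) {δ : ℝ} (hδ : δ ∈ Set.Ioo (0 : ℝ) 1) {x e a η P : ℝ}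
    (ha0 : 0 < a) (ha : a ≤ 1) (hη : 0 < η) (hx : 0 ≤ x) (he : 0 < e) (hP : x + e = a * P - η)
    (hP1 : P < 1)
    (hV : e ^ 2 = 2 * (Real.log (2 / δ) / N) * ((x + 2 / 3 * e) * (1 - (x + 2 / 3 * e)))) :
    Real.exp (-N * (ent x P - ent x x)) < δ / 2 := by
  obtain ⟨h1, h2⟩ := exp_ent_le hN hδ ha0 ha hη.le hx he hP hP1 hV
  have hsh : 0 < (e + η) / a / e - 1 := by
    have : 1 < (e + η) / a / e := by
      rw [one_lt_div he, lt_div_iff₀ ha0]; nlinarith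
    linarith
  refine (Real.exp_le_exp.2 ?_).trans_lt (h1.trans_lt ?_)
  · have := mul_le_mul_of_nonneg_left h2 (Nat.cast_nonneg N : (0 : ℝ) ≤ N)
    linarith
  · refine mul_lt_of_lt_one_right (by linarith [hδ.1]) (Real.exp_lt_one_iff.2 ?_)
    have := mul_pos hsh (Real.log_pos one_lt_two)
    linarith

theorem Run.tail_fst (h : Run μ B Q N r X i P R t) (hN : 0 < N) {δ : ℝ}
    (hδ : δ ∈ Set.Ioo (0 : ℝ) 1) {x e a η : ℝ} (ha0 : 0 < a) (ha : a ≤ 1) (hη : 0 ≤ η) (hx : 0 ≤ x)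
    (he : 0 < e) (hP : x + e = a * P - η)
    (hV : e ^ 2 = 2 * (Real.log (2 / δ) / N) * ((x + 2 / 3 * e) * (1 - (x + 2 / 3 * e)))) :
    μ.real {ω | (goodCount B Q N r (r i.castSucc) (fun k => X k ω) : ℝ) ≤ N * x} ≤
      δ / 2 * Real.exp (-(4 / 3 * ((e + η) / a / e - 1) * Real.log 2)) := by
  have hPI := h.fst_mem
  have hxP : x + e ≤ P := by nlinarith [hPI.1]
  rcases hPI.2.eq_or_lt with h1 | h1
  · rw [h.measureReal_fst_eq_zero h1 (by linarith) hN]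
    have := hδ.1; positivity
  · refine (h.measureReal_fst_le (by linarith) h1 hx (by linarith)).trans ?_
    obtain ⟨h2, h3⟩ := exp_ent_le hN hδ ha0 ha hη hx he hP h1 hV
    refine le_trans (Real.exp_le_exp.2 ?_) h2
    have := mul_le_mul_of_nonneg_left h3 (Nat.cast_nonneg N : (0 : ℝ) ≤ N)
    linarith

theorem Run.tail_snd (h : Run μ B Q N r X i P R t) (hN : 0 < N) {δ : ℝ}
    (hδ : δ ∈ Set.Ioo (0 : ℝ) 1) {x e a η : ℝ} (ha0 : 0 < a) (ha : a ≤ 1) (hη : 0 ≤ η) (hx : 0 ≤ x)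
    (he : 0 < e) (hP : x + e = a * R - η)
    (hV : e ^ 2 = 2 * (Real.log (2 / δ) / N) * ((x + 2 / 3 * e) * (1 - (x + 2 / 3 * e)))) :
    μ.real {ω | (goodCount B Q N r (r i.succ) (fun k => X k ω) : ℝ) ≤ N * x} ≤
      δ / 2 * Real.exp (-(4 / 3 * ((e + η) / a / e - 1) * Real.log 2)) := by
  have hPI := h.snd_mem
  have hxP : x + e ≤ R := by nlinarith [hPI.1]
  rcases hPI.2.eq_or_lt with h1 | h1
  · rw [h.measureReal_snd_eq_zero h1 (by linarith) hN]
    have := hδ.1; positivity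
  · refine (h.measureReal_snd_le h1 hx (by linarith)).trans ?_
    obtain ⟨h2, h3⟩ := exp_ent_le hN hδ ha0 ha hη hx he hP h1 hV
    refine le_trans (Real.exp_le_exp.2 ?_) h2
    have := mul_le_mul_of_nonneg_left h3 (Nat.cast_nonneg N : (0 : ℝ) ≤ N)
    linarith

/-- The factor by which shifting a threshold by `a P - η` improves a tail bound. -/
noncomputable def gain (h : ℝ) : ℝ := 1 / (1 + 0.92 * h + 0.4267 * h ^ 2)

/-- Use exp y ≥ 1 + y + y²/2 with y = (4/3)h ln 2: the constant (4/3) ln 2 exceeds 0.92419, and half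
its square exceeds 0.4267. -/
theorem exp_lt_gain {h : ℝ} (hh : 0 < h) : Real.exp (-(4 / 3 * h * Real.log 2)) < gain h := by
  rw [gain, Real.exp_neg, ← one_div]
  have h0 : 0 < 1 + 0.92 * h + 0.4267 * h ^ 2 := by positivity
  refine one_div_lt_one_div_of_lt h0 ?_
  have hl := Real.log_two_gt_d9
  have h1 : 0 ≤ 4 / 3 * h * Real.log 2 := mul_nonneg (by positivity) (by linarith)
  refine lt_of_lt_of_le ?_ (Real.quadratic_le_exp_of_nonneg h1)
  have h2 : 0.92419 * h ≤ 4 / 3 * h * Real.log 2 := by nlinarith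
  have h3 : (0.92419 * h) ^ 2 ≤ (4 / 3 * h * Real.log 2) ^ 2 :=
    pow_le_pow_left₀ (by positivity) h2 2
  nlinarith

/-- The shift of the base from w to y is followed by Jensen's inequality; e² = 2LV says that L is
the exponent to be reached, and `hlt` compares the two variances. -/
theorem le_ent_sub {y w E D κ W M L V e : ℝ} (hy : 0 ≤ y) (hyw : y ≤ w) (hD : 0 ≤ D) (hDE : D ≤ E)
    (h1 : w + E < 1) (hκ0 : 0 ≤ κ) (hκ : κ ≤ 1) (hW : W = E ^ 2 - κ * D ^ 2) (hW0 : 0 < W)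
    (hM : M * (3 * W) = y * (3 * W) + 2 * (E ^ 3 - κ * D ^ 3)) (hV : e ^ 2 = 2 * L * V)
    (hV0 : 0 < V) (hlt : e ^ 2 * (M * (1 - M)) ≤ W * V) :
    L ≤ ent y (w + E) - ent y y - κ * (ent y (w + D) - ent y y) := by
  have h2 := ent_shift hy hyw hD hDE h1 hκ
  have h3 := ent_jensen hy hD hDE (by linarith) hκ0 hκ hW hW0 hM
  obtain ⟨h7, h8⟩ := jensen_point_mem hD hDE hκ0 hκ hW hW0 hM
  have hVM : 0 < M * (1 - M) := mul_pos (by linarith) (by linarith)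
  have h4 : L ≤ W / 2 / (M * (1 - M)) := by
    rw [le_div_iff₀ hVM]
    rw [hV] at hlt
    have : 2 * (L * (M * (1 - M))) ≤ W :=
      le_of_mul_le_mul_right (by linarith) hV0
    linarith
  linarith

/-- The numerical condition under which the two lower tails together have probability less than
`δ / 2`, by means of the union bound that exploits the dependence of the counts. -/
def Dominated (t a b η : ℝ) : Prop :=
  ∀ x e y e' : ℝ, 0 ≤ x → 0 < e → 0 ≤ y → 0 < e' → x + e + η < a → y + e' + η < b →
    e ^ 2 * ((y + 2 / 3 * e') * (1 - (y + 2 / 3 * e'))) =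
      e' ^ 2 * ((x + 2 / 3 * e) * (1 - (x + 2 / 3 * e))) →
    t * ((x + e + η) / a) ≤ (y + e' + η) / b →
    t * (1 - (x + e + η) / a) ≤ 1 - (y + e' + η) / b →
    ∀ κ E D W : ℝ, κ = gain ((e + η) / a / e - 1) → E = (e' + η) / b →
      D = E - t * ((e + η) / a) → W = E ^ 2 - κ * D ^ 2 →
      0 ≤ D ∧ ∀ M, M * (3 * W) = y * (3 * W) + 2 * (E ^ 3 - κ * D ^ 3) →
        e' ^ 2 * (M * (1 - M)) ≤ W * ((y + 2 / 3 * e') * (1 - (y + 2 / 3 * e')))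

theorem Run.union_lt_of_dominated (h : Run μ B Q N r X i P R t) (hN : 0 < N) {δ : ℝ}
    (hδ : δ ∈ Set.Ioo (0 : ℝ) 1) {x e y e' a b η : ℝ} (ha0 : 0 < a) (ha : a ≤ 1) (hb0 : 0 < b)
    (hb : b ≤ 1) (hη : 0 < η) (hx : 0 ≤ x) (he : 0 < e) (hP : x + e = a * P - η)
    (hV : e ^ 2 = 2 * (Real.log (2 / δ) / N) * ((x + 2 / 3 * e) * (1 - (x + 2 / 3 * e))))
    (hy : 0 ≤ y) (he' : 0 < e') (hR : y + e' = b * R - η)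
    (hV' : e' ^ 2 = 2 * (Real.log (2 / δ) / N) * ((y + 2 / 3 * e') * (1 - (y + 2 / 3 * e'))))
    (hP1 : P < 1) (hR1 : R < 1) (hd : Dominated t a b η) :
    μ.real {ω | (goodCount B Q N r (r i.castSucc) (fun k => X k ω) : ℝ) ≤ N * x ∨
      (goodCount B Q N r (r i.succ) (fun k => X k ω) : ℝ) ≤ N * y} < δ / 2 := by
  have hPI := h.fst_mem
  have hRI := h.snd_mem
  have hN' : (0 : ℝ) < N := by exact_mod_cast hN
  set L := Real.log (2 / δ) / N with hL
  have hxP : x + e ≤ P := by nlinarith [hPI.1]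
  have ePx : P = x / a + (e + η) / a := by field_simp; linarith
  have eRy : R = y / b + (e' + η) / b := by field_simp; linarith
  have hxa : x ≤ x / a := by rw [le_div_iff₀ ha0]; nlinarith
  have hyb : y ≤ y / b := by rw [le_div_iff₀ hb0]; nlinarith
  have hsh : 0 < (e + η) / a / e - 1 := by
    have : 1 < (e + η) / a / e := by
      rw [one_lt_div he, lt_div_iff₀ ha0]; nlinarith
    linarith
  have hT : 0 < δ / 2 := by linarith [hδ.1]
  set κ := gain ((e + η) / a / e - 1) with hκ
  have hκ0 : 0 < κ := by
    have := hsh.le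
    rw [hκ, gain]; positivity
  have hκ1 : κ < 1 := by
    rw [hκ, gain, div_lt_one (by positivity)]; nlinarith [sq_nonneg ((e + η) / a / e - 1)]
  set E := (e' + η) / b with hE
  set D := E - t * ((e + η) / a) with hD
  have hE0 : 0 < E := by positivity
  have eP : (x + e + η) / a = P := by field_simp; linarith
  have eR : (y + e' + η) / b = R := by field_simp; linarith
  have hxa' : x + e + η < a := by nlinarith [mul_lt_mul_of_pos_left hP1 ha0]
  have hyb' : y + e' + η < b := by nlinarith [mul_lt_mul_of_pos_left hR1 hb0]
  have hVV : e ^ 2 * ((y + 2 / 3 * e') * (1 - (y + 2 / 3 * e'))) =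
      e' ^ 2 * ((x + 2 / 3 * e) * (1 - (x + 2 / 3 * e))) := by rw [hV, hV']; ring
  have hgr := h.growth
  rw [← eP, ← eR] at hgr
  obtain ⟨hD0, hWM⟩ := hd x e y e' hx he hy he' hxa' hyb' hVV hgr.1 hgr.2 κ E D _ rfl rfl
    rfl rfl
  set W := E ^ 2 - κ * D ^ 2 with hW
  have hDE : D ≤ E := by
    have := mul_nonneg h.ratio_nonneg (show 0 ≤ (e + η) / a by positivity); linarith
  have hWpos : 0 < W := by
    rw [hW]
    have h1 := pow_le_pow_left₀ hD0 hDE 2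
    have h2 := mul_le_mul_of_nonneg_left h1 hκ0.le
    have h3 := mul_pos (sub_pos.2 hκ1) (pow_pos hE0 2)
    linarith
  set M := (y * (3 * W) + 2 * (E ^ 3 - κ * D ^ 3)) / (3 * W) with hM
  have hMe : M * (3 * W) = y * (3 * W) + 2 * (E ^ 3 - κ * D ^ 3) := by rw [hM]; field_simp
  have hlt := hWM M hMe
  -- Tilting p to x/a puts the parameter at q at y/b + D, while R itself is y/b + E.
  have eyD : R - t * (P - x / a) = y / b + D := by rw [eRy, ePx, hD]; ring
  refine h.measureReal_union_lt (x := x / a) (κ := κ) (by linarith) hP1 hR1 hx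
    (div_nonneg hx ha0.le) ?_ ?_ hy ?_ hκ0.le hκ1 hT ?_ ?_ ?_
  · rw [ePx]; linarith [show 0 < (e + η) / a by positivity]
  · intro h0; linarith
  · rw [eyD]; linarith
  · refine (exp_ent_le hN hδ ha0 ha hη.le hx he hP hP1 hV).1.trans_lt ?_
    rw [mul_comm]
    exact mul_lt_mul_of_pos_right (exp_lt_gain hsh) hT
  · exact exp_ent_lt hN hδ hb0 hb hη hy he' hR hR1 hV'
  · have hR' : y / b + E < 1 := by rw [← eRy]; exact hR1
    have h6 := le_ent_sub hy hyb hD0 hDE hR' hκ0.le hκ1.le hW hWpos hMe hV'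
      (mul_pos (by linarith only [hy, he']) (by linarith only [hyb', hb, hη, he'])) hlt
    rw [← eRy, ← eyD] at h6
    have h5 : δ / 2 = Real.exp (-N * L) := (exp_neg_log hN hδ).symm
    rw [h5, ← Real.exp_add, Real.exp_le_exp]
    have := mul_le_mul_of_nonneg_left h6 hN'.le
    linarith only [this]

end Tails

/-! ### From thresholds to the confidence band -/

section Upper
variable {d m : ℕ} {B Q : Set (Fin d → ℝ)} {N : ℕ} {r : Fin (m + 1) → ℝ} {Ω : Type*}
  [MeasurableSpace Ω] {μ : Measure Ω} [IsProbabilityMeasure μ] {X : ℕ → Ω → Fin d → ℝ}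
  {i : Fin m} {P R t : ℝ}

theorem goodCount_mem (ρ : ℝ) (x : ℕ → Fin d → ℝ) :
    (goodCount B Q N r ρ x : ℝ) ∈ Set.Icc (0 : ℝ) N :=
  ⟨Nat.cast_nonneg _, Nat.cast_le.2 goodCount_le⟩

/-- A threshold that no count violates, or a probability equal to 1, leaves at most one event of
positive probability, and a single tail is strictly below δ/2. Only the remaining case is left to
`hboth`. -/
theorem Run.measureReal_upper_or_lt (h : Run μ B Q N r X i P R t) (hN : 0 < N) {δ : ℝ}
    (hδ : δ ∈ Set.Ioo (0 : ℝ) 1) {a b η : ℝ} (ha0 : 0 < a) (ha : a ≤ 1) (hb0 : 0 < b) (hb : b ≤ 1)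
    (hη : 0 ≤ η) (ha1 : a < 1 ∨ 0 < η) (hb1 : b < 1 ∨ 0 < η)
    (hboth : ∀ x e y e' : ℝ, 0 ≤ x → 0 < e → x + e = a * P - η →
      e ^ 2 = 2 * (Real.log (2 / δ) / N) * ((x + 2 / 3 * e) * (1 - (x + 2 / 3 * e))) →
      0 ≤ y → 0 < e' → y + e' = b * R - η →
      e' ^ 2 = 2 * (Real.log (2 / δ) / N) * ((y + 2 / 3 * e') * (1 - (y + 2 / 3 * e'))) →
      P < 1 → R < 1 →
      μ.real {ω | (goodCount B Q N r (r i.castSucc) (fun k => X k ω) : ℝ) ≤ N * x ∨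
        (goodCount B Q N r (r i.succ) (fun k => X k ω) : ℝ) ≤ N * y} < δ / 2) :
    μ.real {ω |
      upperLim N δ (goodCount B Q N r (r i.castSucc) fun k => X k ω) ≤ a * P - η ∨
      upperLim N δ (goodCount B Q N r (r i.succ) fun k => X k ω) ≤ b * R - η} < δ / 2 := by
  have hT : 0 < δ / 2 := by linarith [hδ.1]
  have hlt : ∀ {c e : ℝ}, 0 < c → c ≤ 1 → (c < 1 ∨ 0 < η) → 0 < e →
      δ / 2 * Real.exp (-(4 / 3 * ((e + η) / c / e - 1) * Real.log 2)) < δ / 2 := by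
    intro c e hc0 hc hc1 he
    refine mul_lt_of_lt_one_right hT ?_
    refine Real.exp_lt_one_iff.2 ?_
    have : 1 < (e + η) / c / e := by
      rw [one_lt_div he, lt_div_iff₀ hc0]
      rcases hc1 with h1 | h1 <;> nlinarith
    have hl := Real.log_pos one_lt_two
    have := mul_pos (show 0 < 4 / 3 * ((e + η) / c / e - 1) by linarith) hl
    linarith
  have hp1 : a * P - η < 1 := by
    have := h.fst_mem
    rcases ha1 with h1 | h1 <;> nlinarith [this.1, this.2]
  have hq1 : b * R - η < 1 := by
    have := h.snd_mem
    rcases hb1 with h1 | h1 <;> nlinarith [this.1, this.2]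
  have mono : ∀ {S S' : Set Ω}, S ⊆ S' → μ.real S' < δ / 2 → μ.real S < δ / 2 :=
    fun hs h' => (measureReal_mono hs).trans_lt h'
  rcases exists_threshold hN hδ hp1 with hp | ⟨x, e, hx, he, hxe, hV, hp⟩ <;>
    rcases exists_threshold hN hδ hq1 with hq | ⟨y, e', hy, he', hye, hV', hq⟩
  · refine mono (S' := ∅) (fun ω hω => ?_) (by simpa using hT)
    rcases hω with h1 | h1
    · exact absurd h1 (not_le.2 (hp _ (goodCount_mem _ _)))
    · exact absurd h1 (not_le.2 (hq _ (goodCount_mem _ _)))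
  · refine mono (fun ω hω => ?_) ((h.tail_snd hN hδ hb0 hb hη hy he' hye hV').trans_lt
      (hlt hb0 hb hb1 he'))
    rcases hω with h1 | h1
    · exact absurd h1 (not_le.2 (hp _ (goodCount_mem _ _)))
    · exact hq _ (goodCount_mem _ _) h1
  · refine mono (fun ω hω => ?_) ((h.tail_fst hN hδ ha0 ha hη hx he hxe hV).trans_lt
      (hlt ha0 ha ha1 he))
    rcases hω with h1 | h1
    · exact hp _ (goodCount_mem _ _) h1
    · exact absurd h1 (not_le.2 (hq _ (goodCount_mem _ _)))
  · have hP1 := h.fst_mem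
    have hR1 := h.snd_mem
    have hsub : {ω |
        upperLim N δ (goodCount B Q N r (r i.castSucc) fun k => X k ω) ≤ a * P - η ∨
        upperLim N δ (goodCount B Q N r (r i.succ) fun k => X k ω) ≤ b * R - η} ⊆
        {ω | (goodCount B Q N r (r i.castSucc) (fun k => X k ω) : ℝ) ≤ N * x} ∪
        {ω | (goodCount B Q N r (r i.succ) (fun k => X k ω) : ℝ) ≤ N * y} := fun ω hω =>
      hω.imp (hp _ (goodCount_mem _ _)) (hq _ (goodCount_mem _ _))
    rcases hP1.2.eq_or_lt with hP | hP
    · refine (measureReal_mono hsub).trans_lt ((measureReal_union_le _ _).trans_lt ?_)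
      rw [h.measureReal_fst_eq_zero hP (by linarith) hN, zero_add]
      exact (h.tail_snd hN hδ hb0 hb hη hy he' hye hV').trans_lt (hlt hb0 hb hb1 he')
    rcases hR1.2.eq_or_lt with hR | hR
    · refine (measureReal_mono hsub).trans_lt ((measureReal_union_le _ _).trans_lt ?_)
      rw [h.measureReal_snd_eq_zero hR (by linarith) hN, add_zero]
      exact (h.tail_fst hN hδ ha0 ha hη hx he hxe hV).trans_lt (hlt ha0 ha ha1 he)
    exact mono hsub (hboth x e y e' hx he hxe hV hy he' hye hV' hP hR)

theorem Run.upper_lt_of_dominated (h : Run μ B Q N r X i P R t) (hN : 0 < N) {δ : ℝ}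
    (hδ : δ ∈ Set.Ioo (0 : ℝ) 1) {a b η : ℝ} (ha0 : 0 < a) (ha : a ≤ 1) (hb0 : 0 < b) (hb : b ≤ 1)
    (hη : 0 < η) (hd : Dominated t a b η) :
    μ.real {ω |
      upperLim N δ (goodCount B Q N r (r i.castSucc) fun k => X k ω) ≤ a * P - η ∨
      upperLim N δ (goodCount B Q N r (r i.succ) fun k => X k ω) ≤ b * R - η} < δ / 2 :=
  h.measureReal_upper_or_lt hN hδ ha0 ha hb0 hb hη.le (Or.inr hη) (Or.inr hη)
    fun _ _ _ _ hx he hP hV hy he' hR hV' hP1 hR1 =>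
      h.union_lt_of_dominated hN hδ ha0 ha hb0 hb hη hx he hP hV hy he' hR hV' hP1 hR1 hd

/-- With η = 0 the gains depend only on a and b, and `hab` says that they add up to less than 1. -/
theorem Run.upper_lt_of_union (h : Run μ B Q N r X i P R t) (hN : 0 < N) {δ : ℝ}
    (hδ : δ ∈ Set.Ioo (0 : ℝ) 1) {a b : ℝ} (ha0 : 0 < a) (ha : a < 1) (hb0 : 0 < b) (hb : b < 1)
    (hab : Real.exp (-(4 / 3 * (1 / a - 1) * Real.log 2)) +
      Real.exp (-(4 / 3 * (1 / b - 1) * Real.log 2)) < 1) :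
    μ.real {ω |
      upperLim N δ (goodCount B Q N r (r i.castSucc) fun k => X k ω) ≤ a * P ∨
      upperLim N δ (goodCount B Q N r (r i.succ) fun k => X k ω) ≤ b * R} < δ / 2 := by
  have key := h.measureReal_upper_or_lt hN hδ ha0 ha.le hb0 hb.le le_rfl (Or.inl ha) (Or.inl hb)
    fun x e y e' hx he hP hV hy he' hR hV' hP1 hR1 => by
      refine (measureReal_union_le
        {ω | (goodCount B Q N r (r i.castSucc) (fun k => X k ω) : ℝ) ≤ N * x}
        {ω | (goodCount B Q N r (r i.succ) (fun k => X k ω) : ℝ) ≤ N * y}).trans_lt ?_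
      have h1 := h.tail_fst hN hδ ha0 ha.le le_rfl hx he hP hV
      have h2 := h.tail_snd hN hδ hb0 hb.le le_rfl hy he' hR hV'
      have e1 : (e + 0) / a / e = 1 / a := by field_simp; ring
      have e2 : (e' + 0) / b / e' = 1 / b := by field_simp; ring
      rw [e1] at h1; rw [e2] at h2
      have := mul_lt_mul_of_pos_left hab (show 0 < δ / 2 by linarith [hδ.1])
      linarith
  simpa only [sub_zero] using key

/-- The interpolated upper bound holds as soon as both thresholds are exceeded. -/
theorem Run.robustProb_lt_of_thresholds (h : Run μ B Q N r X i P R t) {a b η ς u w ρ : ℝ}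
    (hρ : ρ ∈ Set.Icc (r i.castSucc) (r i.succ)) (hu : a * P - η < u) (hw : b * R - η < w)
    (hpq : r i.castSucc < r i.succ) {ζ : ℝ}
    (hζ : ζ = (ρ - r i.castSucc) / (r i.succ - r i.castSucc)) (hb : 0 ≤ b) (hb1 : b ≤ 1)
    (h0 : (1 - (r i.castSucc / ρ) ^ d) * (1 - b * ζ * (ρ / r i.succ) ^ d) ≤ ς - η)
    (h1 : 1 - b * ζ * (ρ / r i.succ) ^ d ≤ ς - η + (1 - ζ) * a) :
    robustProb B Q ρ < interp (r i.castSucc) (r i.succ) u w ρ + ς := by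
  set p := r i.castSucc with hp
  set q := r i.succ with hq
  have hp0 : 0 < p := h.radius_pos _
  have hρ0 : 0 < ρ := hp0.trans_le hρ.1
  have hP := h.fst_mem
  have hζ0 : 0 ≤ ζ := hζ ▸ div_nonneg (sub_nonneg.2 hρ.1) (sub_pos.2 hpq).le
  have hζ1 : ζ ≤ 1 := by rw [hζ, div_le_one (sub_pos.2 hpq)]; linarith [hρ.2]
  have m1 := (robustProb_mono h.vol_ne_zero h.vol_ne_top h.measB h.measQ h.star hp0 hρ.1).2
  have m2 := (robustProb_mono h.vol_ne_zero h.vol_ne_top h.measB h.measQ h.star hρ0 hρ.2).1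
  rw [hp, h.prob_fst, ← hp] at m1
  rw [hq, h.prob_snd, ← hq] at m2
  set α := (p / ρ) ^ d
  set β := (ρ / q) ^ d with hβ
  set s := robustProb B Q ρ
  have hβ0 : 0 ≤ β := pow_nonneg (div_nonneg hρ0.le (hρ0.le.trans hρ.2)) d
  have hβ1 : β ≤ 1 := pow_le_one₀ (div_nonneg hρ0.le (hρ0.le.trans hρ.2))
    ((div_le_one (hρ0.trans_le hρ.2)).2 hρ.2)
  have hc : 0 ≤ 1 - b * ζ * β := by
    have := mul_le_one₀ (mul_le_one₀ hb1 hζ0 hζ1) hβ0 hβ1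
    linarith
  have k1 : s * (1 - b * ζ * β) ≤ (1 - α + α * P) * (1 - b * ζ * β) :=
    mul_le_mul_of_nonneg_right (by linarith) hc
  -- Both sides are affine in P, so the ends P = 0 and P = 1 suffice: these are `h0` and `h1`.
  have k2 : (1 - α + α * P) * (1 - b * ζ * β) ≤ ς - η + (1 - ζ) * a * P := by
    have e : (1 - α + α * P) * (1 - b * ζ * β) =
      (1 - P) * ((1 - α) * (1 - b * ζ * β)) + P * (1 - b * ζ * β) := by ring
    rw [e]
    have := mul_le_mul_of_nonneg_left h0 (sub_nonneg.2 hP.2)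
    have := mul_le_mul_of_nonneg_left h1 hP.1
    nlinarith
  have k3 : b * ζ * (β * s) ≤ b * ζ * R := mul_le_mul_of_nonneg_left m2 (mul_nonneg hb hζ0)
  rw [interp, ← hζ]
  have k4 : ζ * (b * R - η) + (1 - ζ) * (a * P - η) < ζ * w + (1 - ζ) * u := by
    rcases hζ0.eq_or_lt with h' | h'
    · rw [← h']; linarith
    · nlinarith
  nlinarith

end Upper

/-! ### Polynomial form of the domination condition -/

/-- The quantities that enter the tail conditions; lengths are measured in units of `U`. -/
structure Par (α : Type*) where
  U : α
  es : α
  ep : α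
  dl : α
  cl : α
  a : α
  b : α
  t : α

namespace Par
variable {α : Type*} [Add α] [Sub α] [Mul α] (k : ℤ → α) (f : Par α)

/-- With e = U es, e' = U ep, η = U cl, these are numerators: E = U X/b, E - e' = U Xb/b, D = U
Yb/(ab), E - D = U U3/(ab) and κ = 10⁴ (a es)²/K2. Only ring operations occur, so the formulas serve
both for reals and for symbolic expressions. -/
def X : α := f.ep + f.cl
def Xb : α := (k 1 - f.b) * f.ep + f.cl
def S1 : α := f.es + f.cl
def N1 : α := (k 1 - f.a) * f.es + f.cl
def K2 : α := k 10000 * (f.a * f.es) * (f.a * f.es) + k 9200 * (f.a * f.es) * f.N1 k +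
  k 4267 * (f.N1 k * f.N1 k)
def U3 : α := f.b * f.t * f.S1
def Yb : α := f.a * f.X - f.U3
def BB : α := f.es * f.Yb * (f.es * f.Yb)
def G0 : α := f.K2 k * (f.Xb k * (f.X + f.b * f.ep)) - k 10000 * f.BB
-- The inequality of `core_of_mul_le` for φ = U n/m, cleared of denominators. `G0` is the case φ = 0
-- without its positive factor, `G1` is the case φ = U ep n/m without a factor ep, and `S` is a
-- simpler sufficient condition.
def G (n m : α) : α :=
  f.a * f.K2 k * (f.Xb k * ((f.X + f.b * f.ep) * m - f.b * n)) *
      (f.b * (f.ep * f.ep) * m + n * f.Xb k) -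
    k 10000 * f.BB * (f.a * f.b * (f.ep * f.ep) * m + n * (f.a * f.Xb k + f.U3)) * m
def G1 (n m : α) : α :=
  f.a * f.K2 k * (f.Xb k * ((f.X + f.b * f.ep) * m - f.b * f.ep * n)) *
      (f.b * f.ep * m + n * f.Xb k) -
    k 10000 * f.BB * (f.a * f.b * f.ep * m + n * (f.a * f.Xb k + f.U3)) * m
def S (n m : α) : α :=
  f.a * f.K2 k * (f.Xb k * f.Xb k) * ((f.X + f.b * f.ep) * m - f.b * n) -
    k 10000 * f.BB * (f.a * f.Xb k + f.U3) * m
-- The quotients of `nI`, `nII`, `nIII` by `dI`, `dII`, `dIII` give bounds of the slack: from e'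
-- alone (times ep), for p + 2e/3-type points below the middle, and above it. `nII'` (times es) is a
-- cruder form of `nII`.
def nI : α := f.b * (k 3 - k 4 * (f.U * f.ep)) - k 2 * (f.U * f.Xb k)
def dI : α := f.b * (k 3 - k 2 * (f.U * f.ep))
def Q : α := f.dl * (k 2 * f.es + f.dl)
def nII : α := f.b * (f.es * (k 3 - k 4 * (f.U * f.es)) - k 4 * (f.U * f.Q k)) -
  k 2 * (f.U * f.Xb k * f.es)
def nII' : α := f.b * (k 3 - k 4 * (f.U * f.es)) - k 2 * (f.U * f.Xb k)
def dII : α := f.b * (k 3 - k 2 * (f.U * f.es))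
def C : α := f.U * f.a * f.dl * (k 5 * f.es + k 2 * f.dl) -
  k 3 * f.es * (f.a * f.b * (k 1 - f.t) - (f.a - f.b * f.t) * f.U * f.S1)
def J3 : α := k 3 * (f.a - f.b * f.t) + f.U * f.dl
def c3 : α := f.U * f.es + k 3 * (k 1 - f.a) + k 3 * (f.U * f.cl)
def w3 : α := k 3 - k 2 * f.c3 k
def C1 : α := k 4 * f.Q k * (f.c3 k * (k 3 - f.c3 k)) - f.es * f.w3 k * (f.es * f.w3 k)
def C2 : α := f.Q k * (f.c3 k * (k 3 - f.c3 k)) - f.es * f.es * (f.J3 k * (f.w3 k - f.J3 k))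
def C2' : α := f.w3 k - k 2 * f.J3 k
def C3 : α := f.Q k * (k 9 - k 4 * (f.J3 k * f.J3 k)) - k 4 * (f.es * f.J3 k * (f.es * f.J3 k))
def C3' : α := k 3 - k 2 * f.J3 k
def nIII : α := k 8 * f.U * (f.ep * f.ep) * (f.b * f.J3 k - k 2 * (f.U * f.Xb k))
def dIII : α := f.b * (k 9 - f.J3 k * f.J3 k)
def r1 : α := f.U * f.S1 - f.a
def r2 : α := f.U * f.X - f.b

/-- If all entries of one inner list are nonnegative, then either the condition holds or the
deviations are inadmissible. `r1`, `r2`, `C`, `C1`, `C2`, `C3` exclude points; entries with 10 or 40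
replace the slack by e'/10 or e'/40. -/
def lessI : List (List α) :=
  [[f.G1 k (f.nI k) (f.dI k), f.nI k], [f.r1], [k 100 * f.ep - k 101 * f.es], [k (-1) * f.Yb],
    [f.dI k - k 10 * f.nI k, f.G1 k (k 1) (k 10)]]

def moreLow : List (List α) :=
  [[f.G k (f.nII k) (f.dII k), f.nII k], [f.C k], [f.r1], [f.r2],
    [f.ep * f.dII k - k 10 * f.nII k, f.G1 k (k 1) (k 10)],
    [f.S k (f.nII k) (f.dII k), f.nII k],
    [f.S k (f.es * f.nII' k) (f.dII k), f.nII' k],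
    [f.ep * f.dII k - k 40 * f.nII k, f.G1 k (k 1) (k 40)]]

def moreHigh : List (List α) :=
  [[f.G0 k], [f.C1 k], [f.C2 k, f.C2' k], [f.r1], [f.r2]]

def moreMid : List (List α) :=
  [[f.G k (f.nIII k) (f.dIII k), f.nIII k], [f.C1 k], [f.C2 k, f.C2' k], [f.r1], [f.r2],
    [f.C3 k, f.C3' k], [f.ep * f.dIII k - k 10 * f.nIII k, f.G1 k (k 1) (k 10)],
    [f.G1 k (f.nI k) (f.dI k), f.nI k], [f.S k (f.nIII k) (f.dIII k), f.nIII k],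
    [f.dI k - k 10 * f.nI k, f.G1 k (k 1) (k 10)]]

def map {β : Type*} (g : α → β) (f : Par α) : Par β :=
  ⟨g f.U, g f.es, g f.ep, g f.dl, g f.cl, g f.a, g f.b, g f.t⟩

end Par

theorem Par.eval_lessI (x y z : ℝ) (f : Par RE) :
    (f.lessI RE.c).map (List.map (RE.eval x y z)) =
      (f.map (RE.eval x y z)).lessI (fun n : ℤ => (n : ℝ)) := rfl

theorem Par.eval_moreMid (x y z : ℝ) (f : Par RE) :
    (f.moreMid RE.c).map (List.map (RE.eval x y z)) =
      (f.map (RE.eval x y z)).moreMid (fun n : ℤ => (n : ℝ)) := rfl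

/-- The tail condition, with Massart's variance replaced by the slack `φ`. -/
def Core (E κ D e φ : ℝ) : Prop :=
  0 ≤ φ ∧ φ * ((E - e) * (E ^ 2 - κ * D ^ 2) + κ * D ^ 2 * (E - D)) ≤
    (E ^ 2 - κ * D ^ 2 - e ^ 2) * (E ^ 2 - κ * D ^ 2)

section Core
variable {E κ D D0 e φ : ℝ}

/-- Put Z = κD², A = (E - e)(E + e - φ), q = e² + φ(E - e). Then E² - Z = q + (A - Z), the
hypothesis reads φZ(E - D) ≤ (A - Z)q, and the square (A - Z)² is discarded. -/
theorem core_of_mul_le (hκ : 0 ≤ κ) (he : 0 < e) (hE : e ≤ E) (hD : D ≤ E) (hφ : 0 ≤ φ)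
    (h : κ * D ^ 2 * (e ^ 2 + φ * (E - e) + φ * (E - D)) ≤
      (E - e) * (E + e - φ) * (e ^ 2 + φ * (E - e))) : Core E κ D e φ := by
  refine ⟨hφ, ?_⟩
  set Z := κ * D ^ 2 with hZ
  have hZ0 : 0 ≤ Z := by positivity
  set A := (E - e) * (E + e - φ) with hA
  set q := e ^ 2 + φ * (E - e) with hq
  have hq0 : 0 < q := by
    have := mul_nonneg hφ (sub_nonneg.2 hE); positivity
  have h1 : φ * Z * (E - D) ≤ (A - Z) * q := by linarith
  have h2 : 0 ≤ φ * Z * (E - D) := mul_nonneg (mul_nonneg hφ hZ0) (sub_nonneg.2 hD)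
  have h3 : 0 ≤ A - Z := nonneg_of_mul_nonneg_left (h2.trans h1) hq0
  have hW : E ^ 2 - Z = q + (A - Z) := by rw [hq, hA]; ring
  have h4 : E ^ 2 - Z - e ^ 2 = φ * (E - e) + (A - Z) := by rw [hA]; ring
  rw [h4]
  have h5 : (A - Z) * q ≤ (A - Z) * (E ^ 2 - Z) :=
    mul_le_mul_of_nonneg_left (by rw [hW]; linarith) h3
  linarith

theorem Core.mono {φ' : ℝ} (h : Core E κ D e φ) (h0 : 0 ≤ φ') (hφ : φ' ≤ φ) (hκ : 0 ≤ κ)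
    (hE : e ≤ E) (hD : D ≤ E) (hW : 0 ≤ E ^ 2 - κ * D ^ 2) : Core E κ D e φ' := by
  refine ⟨h0, le_trans (mul_le_mul_of_nonneg_right hφ ?_) h.2⟩
  have h1 := mul_nonneg (sub_nonneg.2 hE) hW
  have h2 := mul_nonneg (mul_nonneg hκ (sq_nonneg D)) (sub_nonneg.2 hD)
  linarith

/-- Lowering D0 to D raises the right side by (W - W0)(W + W0 - e²) and the left by at most φ(W -
W0)(3D0/2 - e); φ ≤ 2e makes the comparison possible. It is needed because t is replaced by a lower
bound. -/
theorem Core.antitone (h : Core E κ D0 e φ) (hκ : 0 ≤ κ) (he : 0 < e) (hE : e ≤ E) (hD : 0 ≤ D)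
    (hDD : D ≤ D0) (hD0 : D0 ≤ E) (hφ : φ ≤ 2 * e) (hW : 0 < E ^ 2 - κ * D0 ^ 2) :
    Core E κ D e φ := by
  refine ⟨h.1, ?_⟩
  obtain ⟨h0, h1⟩ := h
  set W0 := E ^ 2 - κ * D0 ^ 2 with hW0
  set W := E ^ 2 - κ * D ^ 2 with hWd
  have hw : W - W0 = κ * (D0 ^ 2 - D ^ 2) := by rw [hW0, hWd]; ring
  have hw0 : 0 ≤ W - W0 := by
    rw [hw]; exact mul_nonneg hκ (sub_nonneg.2 (pow_le_pow_left₀ hD hDD 2))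
  have h2 : e ^ 2 + φ * (E - e) ≤ W0 := by
    have h3 : 0 ≤ φ * (κ * D0 ^ 2 * (E - D0)) :=
      mul_nonneg h0 (mul_nonneg (mul_nonneg hκ (sq_nonneg _)) (sub_nonneg.2 hD0))
    have : (φ * (E - e)) * W0 ≤ (W0 - e ^ 2) * W0 := by linarith
    linarith [le_of_mul_le_mul_right this hW]
  have h3 : κ * D ^ 2 * (E - D) - κ * D0 ^ 2 * (E - D0) ≤ (W - W0) * (3 / 2 * D0 - E) := by
    rw [hw]
    have h4 : 0 ≤ κ * ((D0 - D) * ((D0 - D) * (D0 + 2 * D))) :=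
      mul_nonneg hκ (mul_nonneg (sub_nonneg.2 hDD) (mul_nonneg (sub_nonneg.2 hDD) (by linarith)))
    linarith
  have h5 : φ * (3 / 2 * D0 - e) ≤ W + W0 - e ^ 2 := by
    have h6 : φ * (3 / 2 * D0 - e) ≤ φ * (1 / 2 * e + 3 / 2 * (E - e)) :=
      mul_le_mul_of_nonneg_left (by linarith) h0
    have h7 : φ * e ≤ 2 * e * e := mul_le_mul_of_nonneg_right hφ he.le
    have h8 : 0 ≤ φ * (E - e) := mul_nonneg h0 (sub_nonneg.2 hE)
    linarith
  have h6 := mul_le_mul_of_nonneg_left h5 hw0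
  have h7 := mul_le_mul_of_nonneg_left h3 h0
  have e1 : (W - e ^ 2) * W = (W0 - e ^ 2) * W0 + (W - W0) * (W + W0 - e ^ 2) := by ring
  rw [e1]
  linarith

/-- Put m = y + 2e/3 and M = m + g. Then M(1 - M) = m(1 - m) + g(1 - 2m - g), 3Wg = 2((E - e)W +
κD²(E - D)) and g ≥ 2(E - e)/3. So y enters only through the quotient of 2e²(1 - 2m - 2(E - e)/3) by
3m(1 - m), which φ bounds. -/
theorem Core.variance_le {y W M : ℝ} (hc : Core E κ D0 e φ) (hκ0 : 0 ≤ κ) (hκ1 : κ < 1)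
    (he : 0 < e) (hE : e ≤ E) (hD : 0 ≤ D) (hDD : D ≤ D0) (hD0 : D0 ≤ E) (hy : 0 ≤ y)
    (hy1 : y + e < 1)
    (hφ : 2 * e ^ 2 * (1 - 2 * (y + 2 / 3 * e) - 2 / 3 * (E - e)) ≤
      3 * φ * ((y + 2 / 3 * e) * (1 - (y + 2 / 3 * e))))
    (hW : W = E ^ 2 - κ * D ^ 2) (hM : M * (3 * W) = y * (3 * W) + 2 * (E ^ 3 - κ * D ^ 3)) :
    e ^ 2 * (M * (1 - M)) ≤ W * ((y + 2 / 3 * e) * (1 - (y + 2 / 3 * e))) := by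
  set m := y + 2 / 3 * e with hm
  have hV : 0 < m * (1 - m) := mul_pos (by linarith) (by linarith)
  have hpos : ∀ D', 0 ≤ D' → D' ≤ E → 0 < E ^ 2 - κ * D' ^ 2 := fun D' h0 h1 => by
    have h2 := mul_le_mul_of_nonneg_left (pow_le_pow_left₀ h0 h1 2) hκ0
    have h3 := mul_pos (sub_pos.2 hκ1) (pow_pos (he.trans_le hE) 2)
    linarith
  have hW0 : 0 < W := hW ▸ hpos D hD (hDD.trans hD0)
  set s := 2 * e ^ 2 * (1 - 2 * m - 2 / 3 * (E - e)) with hs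
  -- The least admissible slack. It is at most 2e because m ≥ 2e/3, as `Core.antitone` requires.
  set ψ := max 0 (s / (3 * (m * (1 - m)))) with hψ
  have hψ0 : 0 ≤ ψ := le_max_left _ _
  have hψφ : ψ ≤ φ := max_le hc.1 (by rw [div_le_iff₀ (by positivity)]; linarith)
  have hψe : ψ ≤ 2 * e := by
    refine max_le (by linarith) ?_
    rw [div_le_iff₀ (by positivity), hs]
    have h1 : 0 ≤ e * (E - e) := mul_nonneg he.le (sub_nonneg.2 hE)
    have h2 : 0 ≤ e * (m * (1 - m)) := by positivity
    have hme : 2 / 3 * e ≤ m := by linarith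
    have h3 : e * (1 - 2 * m) ≤ 3 * (m * (1 - m)) := by
      rcases le_or_gt (1 - 2 * m) 0 with h4 | h4
      · have := mul_nonneg he.le (neg_nonneg.2 h4); nlinarith
      · have := mul_le_mul_of_nonneg_right hme h4.le; nlinarith
    have h5 := mul_le_mul_of_nonneg_left h3 (show 0 ≤ 2 * e by linarith)
    have h6 : 0 ≤ e * (e * (E - e)) := mul_nonneg he.le h1
    linarith
  have hψs : s ≤ 3 * ψ * (m * (1 - m)) := by
    have := le_max_right 0 (s / (3 * (m * (1 - m))))
    rw [← hψ, div_le_iff₀ (by positivity)] at this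
    linarith
  obtain ⟨-, h1⟩ := ((hc.mono hψ0 hψφ hκ0 hE hD0 (hpos _ (hD.trans hDD) hD0).le).antitone hκ0 he hE hD
    hDD hD0 hψe (hpos _ (hD.trans hDD) hD0))
  rw [← hW] at h1
  set H := (E - e) * W + κ * D ^ 2 * (E - D) with hH
  have hH0 : 0 ≤ H := by
    have h2 := mul_nonneg (sub_nonneg.2 hE) hW0.le
    have h3 := mul_nonneg (mul_nonneg hκ0 (sq_nonneg D)) (sub_nonneg.2 (hDD.trans hD0))
    linarith
  have hMm : (M - m) * (3 * W) = 2 * H := by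
    have : (M - m) * (3 * W) = M * (3 * W) - (y * (3 * W) + 2 * e * W) := by rw [hm]; ring
    rw [this, hM, hH]
    rw [show (E ^ 3 - κ * D ^ 3) = E * W + κ * D ^ 2 * (E - D) by rw [hW]; ring]
    ring
  set g := M - m with hg
  have hg0 : 0 ≤ g := by
    have : 0 ≤ g * (3 * W) := by rw [hMm]; linarith
    exact nonneg_of_mul_nonneg_left this (by linarith)
  have hg1 : 2 / 3 * (E - e) ≤ g := by
    have h2 : 0 ≤ κ * D ^ 2 * (E - D) :=
      mul_nonneg (mul_nonneg hκ0 (sq_nonneg D)) (sub_nonneg.2 (hDD.trans hD0))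
    have : (2 / 3 * (E - e)) * (3 * W) ≤ g * (3 * W) := by rw [hMm, hH]; linarith
    exact le_of_mul_le_mul_right this (by linarith)
  have hMV : M * (1 - M) = m * (1 - m) + g * (1 - 2 * m - g) := by
    rw [show M = m + g by rw [hg]; ring]; ring
  have h2 : e ^ 2 * (g * (1 - 2 * m - g)) ≤ (W - e ^ 2) * (m * (1 - m)) := by
    refine le_of_mul_le_mul_right ?_ (show 0 < 6 * W by linarith)
    have h3 : e ^ 2 * (g * (1 - 2 * m - g)) ≤ g * (s / 2) := by
      have := mul_nonneg (mul_nonneg (sq_nonneg e) hg0) (sub_nonneg.2 hg1)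
      rw [hs]; linarith
    have h4 : g * (s / 2) ≤ g * (3 * ψ * (m * (1 - m)) / 2) :=
      mul_le_mul_of_nonneg_left (by linarith) hg0
    calc e ^ 2 * (g * (1 - 2 * m - g)) * (6 * W)
        ≤ g * (3 * ψ * (m * (1 - m)) / 2) * (6 * W) :=
          mul_le_mul_of_nonneg_right (h3.trans h4) (by linarith)
      _ = 6 * (ψ * H) * (m * (1 - m)) := by
          linear_combination (3 * ψ * (m * (1 - m))) * hMm
      _ ≤ 6 * ((W - e ^ 2) * W) * (m * (1 - m)) :=
          mul_le_mul_of_nonneg_right (by linarith) hV.le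
      _ = _ := by ring
  rw [hMV]
  linarith

end Core

/-- Positivity of the parameters. -/
structure Par.Pos (f : Par ℝ) : Prop where
  U : 0 < f.U
  es : 0 < f.es
  ep : 0 < f.ep
  cl : 0 < f.cl
  dl : f.dl = f.ep - f.es
  a : 0 < f.a
  a_le : f.a ≤ 1
  b : 0 < f.b
  b_le : f.b ≤ 1
  t : 0 ≤ f.t

namespace Par
variable (f : Par ℝ)

noncomputable def E : ℝ := f.U * (f.ep + f.cl) / f.b
noncomputable def κ : ℝ := 10000 * (f.a * f.es) ^ 2 / f.K2 (fun n : ℤ => (n : ℝ))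
noncomputable def D : ℝ := f.U * f.Yb / (f.a * f.b)

variable {f} (h : f.Pos) {n m : ℝ}

theorem Pos.Xb (h : f.Pos) : 0 < f.Xb (fun n : ℤ => (n : ℝ)) := by
  have := mul_nonneg (sub_nonneg.2 h.b_le) h.ep.le
  have := h.cl
  simp only [Par.Xb]; push_cast; linarith

theorem Pos.K2 (h : f.Pos) : 0 < f.K2 (fun n : ℤ => (n : ℝ)) := by
  have h1 : 0 ≤ f.N1 (fun n : ℤ => (n : ℝ)) := by
    have := mul_nonneg (sub_nonneg.2 h.a_le) h.es.le
    have := h.cl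
    simp only [Par.N1]; push_cast; linarith
  have := mul_pos h.a h.es
  simp only [Par.K2]; push_cast; positivity

theorem Pos.κ_nonneg (h : f.Pos) : 0 ≤ f.κ := by
  have := h.K2; rw [Par.κ]; positivity

theorem Pos.E_sub (h : f.Pos) : f.E - f.U * f.ep = f.U * f.Xb (fun n : ℤ => (n : ℝ)) / f.b := by
  have := h.b.ne'
  simp only [Par.E, Par.Xb]; push_cast; field_simp; ring

theorem Pos.le_E (h : f.Pos) : f.U * f.ep ≤ f.E := by
  have := h.E_sub
  have h1 : 0 < f.U * f.Xb (fun n : ℤ => (n : ℝ)) / f.b := div_pos (mul_pos h.U h.Xb) h.b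
  linarith

theorem Pos.E_sub_D (h : f.Pos) : f.E - f.D = f.U * f.U3 / (f.a * f.b) := by
  have := h.b.ne'
  have := h.a.ne'
  simp only [Par.E, Par.D, Par.Yb, Par.X]; field_simp; ring

theorem Pos.U3_nonneg (h : f.Pos) : 0 ≤ f.U3 :=
  mul_nonneg (mul_nonneg h.b.le h.t) (add_pos h.es h.cl).le

theorem Pos.D_le (h : f.Pos) : f.D ≤ f.E := by
  have h1 : 0 ≤ f.U * f.U3 / (f.a * f.b) :=
    div_nonneg (mul_nonneg h.U.le h.U3_nonneg) (mul_pos h.a h.b).le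
  linarith [h.E_sub_D]

theorem Pos.κ_mul (h : f.Pos) : f.κ * f.D ^ 2 * f.K2 (fun n : ℤ => (n : ℝ)) * f.b ^ 2 =
    f.U ^ 2 * (10000 * f.BB) := by
  have := h.K2.ne'
  have := h.b.ne'
  have := h.a.ne'
  simp only [Par.κ, Par.D, Par.BB]; field_simp

theorem Pos.core_of_G (h : f.Pos) (hm : 0 < m) (hn : 0 ≤ n)
    (hG : 0 ≤ f.G (fun n : ℤ => (n : ℝ)) n m) :
    Core f.E f.κ f.D (f.U * f.ep) (f.U * n / m) := by
  have hU := h.U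
  have ha := h.a
  have hb := h.b
  refine core_of_mul_le h.κ_nonneg (mul_pos h.U h.ep) h.le_E h.D_le (by positivity) ?_
  have hK := h.K2
  have hκ := h.κ_mul
  have e1 := h.E_sub
  have e2 := h.E_sub_D
  have e3 : f.E + f.U * f.ep - f.U * n / m = f.U * ((f.X + f.b * f.ep) * m - f.b * n) / (f.b * m) := by
    simp only [Par.E, Par.X]; field_simp
  rw [e3, e1, e2]
  simp only [Par.G] at hG
  push_cast at hG
  set K := f.K2 (fun n : ℤ => (n : ℝ))
  set B := f.BB
  set Xb := f.Xb (fun n : ℤ => (n : ℝ))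
  set X := f.X
  set U3 := f.U3
  set Z := f.κ * f.D ^ 2
  rw [← sub_nonneg]
  have e4 : f.U * Xb / f.b * (f.U * ((X + f.b * f.ep) * m - f.b * n) / (f.b * m)) *
      ((f.U * f.ep) ^ 2 + f.U * n / m * (f.U * Xb / f.b)) -
      Z * ((f.U * f.ep) ^ 2 + f.U * n / m * (f.U * Xb / f.b) +
        f.U * n / m * (f.U * U3 / (f.a * f.b))) =
      f.U ^ 4 / (f.a * f.b ^ 3 * m ^ 2 * K) * (f.a * K * (Xb * ((X + f.b * f.ep) * m - f.b * n)) *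
        (f.b * (f.ep * f.ep) * m + n * Xb) -
        10000 * B * (f.a * f.b * (f.ep * f.ep) * m + n * (f.a * Xb + U3)) * m) := by
    have hZ : Z = f.U ^ 2 * (10000 * B) / (K * f.b ^ 2) := by
      rw [eq_div_iff (by positivity)]; linarith
    rw [hZ]; field_simp; ring
  rw [e4]
  exact mul_nonneg (by positivity) hG

theorem Pos.core_of_G1 (h : f.Pos) (hm : 0 < m) (hn : 0 ≤ n)
    (hG : 0 ≤ f.G1 (fun n : ℤ => (n : ℝ)) n m) :
    Core f.E f.κ f.D (f.U * f.ep) (f.U * (f.ep * n) / m) := by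
  refine h.core_of_G hm (mul_nonneg h.ep.le hn) ?_
  have := mul_nonneg h.ep.le hG
  refine this.trans_eq ?_
  simp only [Par.G, Par.G1]; ring

theorem Pos.core_of_G0 (h : f.Pos) (hG : 0 ≤ f.G0 (fun n : ℤ => (n : ℝ))) :
    Core f.E f.κ f.D (f.U * f.ep) 0 := by
  have := h.core_of_G (n := 0) one_pos le_rfl (by
    have h1 := h.a
    have h2 := h.b
    have h3 := h.ep
    refine (mul_nonneg (show 0 ≤ f.a * f.b * (f.ep * f.ep) by positivity) hG).trans_eq ?_
    simp only [Par.G, Par.G0]; ring)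
  simpa using this

/-- The difference of Xb · G and (b ep² m + n Xb) · S is a product of nonnegative factors. -/
theorem Pos.core_of_S (h : f.Pos) (hm : 0 < m) (hn : 0 ≤ n)
    (hS : 0 ≤ f.S (fun n : ℤ => (n : ℝ)) n m) :
    Core f.E f.κ f.D (f.U * f.ep) (f.U * n / m) := by
  refine h.core_of_G hm hn ?_
  have hX := h.Xb
  have hK := h.K2
  have ha := h.a
  have hb := h.b
  have hep := h.ep
  have hU3 := h.U3_nonneg
  have hB : 0 ≤ f.BB := mul_self_nonneg _
  simp only [Par.S, Par.G] at hS ⊢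
  push_cast at hS ⊢
  set K := f.K2 (fun n : ℤ => (n : ℝ))
  set B := f.BB
  set Xb := f.Xb (fun n : ℤ => (n : ℝ))
  set T := (f.X + f.b * f.ep) * m - f.b * n
  refine nonneg_of_mul_nonneg_right (a := Xb) ?_ hX
  have h1 : 0 ≤ 10000 * B * U3 f * m * (f.b * (f.ep * f.ep) * m) := by positivity
  have h2 := mul_nonneg (show 0 ≤ f.b * (f.ep * f.ep) * m + n * Xb by positivity) hS
  linarith

theorem Pos.core_of_D (h : f.Pos) (hD : f.D = 0) :
    Core f.E f.κ f.D (f.U * f.ep) (2 * (f.U * f.ep)) := by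
  have he := mul_pos h.U h.ep
  refine core_of_mul_le h.κ_nonneg he h.le_E h.D_le (by positivity) ?_
  rw [hD]
  have h1 := sub_nonneg.2 h.le_E
  have : (f.E - f.U * f.ep) * (f.E + f.U * f.ep - 2 * (f.U * f.ep)) =
    (f.E - f.U * f.ep) * (f.E - f.U * f.ep) := by ring
  rw [this]
  have h2 := mul_nonneg (mul_pos two_pos he).le h1
  nlinarith [mul_nonneg (mul_nonneg h1 h1) (show 0 ≤ (f.U * f.ep) ^ 2 + 2 * (f.U * f.ep) *
    (f.E - f.U * f.ep) by positivity)]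

end Par

/-- A pair of thresholds `x`, `y` with deviations `e = U es`, `e' = U ep` as in `Dominated`, where
`f.t` is a lower bound of the ratio `t` of the volumes. -/
structure Tail (f : Par ℝ) (t x y : ℝ) : Prop where
  pos : f.Pos
  t_le : f.t ≤ t
  lam : f.b * t ≤ f.a
  x_nonneg : 0 ≤ x
  y_nonneg : 0 ≤ y
  x_lt : x + f.U * f.es + f.U * f.cl < f.a
  y_lt : y + f.U * f.ep + f.U * f.cl < f.b
  V : (f.U * f.es) ^ 2 * ((y + 2 / 3 * (f.U * f.ep)) * (1 - (y + 2 / 3 * (f.U * f.ep)))) =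
    (f.U * f.ep) ^ 2 * ((x + 2 / 3 * (f.U * f.es)) * (1 - (x + 2 / 3 * (f.U * f.es))))
  fst : f.b * t * (x + f.U * f.es + f.U * f.cl) ≤ f.a * (y + f.U * f.ep + f.U * f.cl)
  snd : f.b * t * (f.a - (x + f.U * f.es + f.U * f.cl)) ≤
    f.a * (f.b - (y + f.U * f.ep + f.U * f.cl))

/-- There is an admissible bound of Massart's variance. -/
def Good (f : Par ℝ) (y : ℝ) : Prop :=
  ∃ φ, Core f.E f.κ f.D (f.U * f.ep) φ ∧
    2 * (f.U * f.ep) ^ 2 * (1 - 2 * (y + 2 / 3 * (f.U * f.ep)) - 2 / 3 * (f.E - f.U * f.ep)) ≤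
      3 * φ * ((y + 2 / 3 * (f.U * f.ep)) * (1 - (y + 2 / 3 * (f.U * f.ep))))

/-- The bound `U n / q` of Massart's variance is admissible if it is nonnegative. -/
def Bound (f : Par ℝ) (y n q : ℝ) : Prop :=
  0 < q ∧ (0 < 1 - 2 * (y + 2 / 3 * (f.U * f.ep)) - 2 / 3 * (f.E - f.U * f.ep) →
    2 * (f.U * f.ep) ^ 2 * (1 - 2 * (y + 2 / 3 * (f.U * f.ep)) - 2 / 3 * (f.E - f.U * f.ep)) * q ≤
      3 * (f.U * n) * ((y + 2 / 3 * (f.U * f.ep)) * (1 - (y + 2 / 3 * (f.U * f.ep)))))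

namespace Tail
variable {f : Par ℝ} {t x y : ℝ}

theorem V_pos (h : Tail f t x y) :
    0 < (y + 2 / 3 * (f.U * f.ep)) * (1 - (y + 2 / 3 * (f.U * f.ep))) := by
  have h1 := mul_pos h.pos.U h.pos.ep
  have h2 := mul_pos h.pos.U h.pos.cl
  have h3 := h.y_lt
  have h4 := h.pos.b_le
  have h5 := h.y_nonneg
  exact mul_pos (by linarith) (by linarith)

theorem good_of_bound (h : Tail f t x y) {n q φ : ℝ} (hB : Bound f y n q) (hφ : f.U * n ≤ φ * q)
    (hc : Core f.E f.κ f.D (f.U * f.ep) φ) : Good f y := by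
  refine ⟨φ, hc, ?_⟩
  have hV := h.V_pos
  set V := (y + 2 / 3 * (f.U * f.ep)) * (1 - (y + 2 / 3 * (f.U * f.ep)))
  rcases le_or_gt (1 - 2 * (y + 2 / 3 * (f.U * f.ep)) - 2 / 3 * (f.E - f.U * f.ep)) 0 with h1 | h1
  · refine (mul_nonpos_of_nonneg_of_nonpos (by positivity) h1).trans ?_
    exact mul_nonneg (by linarith [hc.1]) hV.le
  · refine le_of_mul_le_mul_right ((hB.2 h1).trans ?_) hB.1
    change 3 * (f.U * n) * V ≤ 3 * φ * V * q
    have := mul_le_mul_of_nonneg_right hφ hV.le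
    linarith

theorem good_of_G (h : Tail f t x y) {n q : ℝ} (hB : Bound f y n q) (hn : 0 ≤ n)
    (hG : 0 ≤ f.G (fun n : ℤ => (n : ℝ)) n q) : Good f y := by
  refine h.good_of_bound hB ?_ (h.pos.core_of_G hB.1 hn hG)
  rw [div_mul_cancel₀ _ hB.1.ne']

theorem good_of_G1 (h : Tail f t x y) {n q : ℝ} (hB : Bound f y (f.ep * n) q) (hn : 0 ≤ n)
    (hG : 0 ≤ f.G1 (fun n : ℤ => (n : ℝ)) n q) : Good f y := by
  refine h.good_of_bound hB ?_ (h.pos.core_of_G1 hB.1 hn hG)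
  rw [div_mul_cancel₀ _ hB.1.ne']

theorem good_of_S (h : Tail f t x y) {n q : ℝ} (hB : Bound f y n q) (hn : 0 ≤ n)
    (hG : 0 ≤ f.S (fun n : ℤ => (n : ℝ)) n q) : Good f y := by
  refine h.good_of_bound hB ?_ (h.pos.core_of_S hB.1 hn hG)
  rw [div_mul_cancel₀ _ hB.1.ne']

/-- Rounding the slack up to e'/k leaves a simpler polynomial to certify. -/
theorem good_of_ladder (h : Tail f t x y) {n q k : ℝ} (hB : Bound f y n q) (hk : 0 < k)
    (hn : 0 ≤ f.ep * q - k * n) (hG : 0 ≤ f.G1 (fun n : ℤ => (n : ℝ)) 1 k) : Good f y := by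
  refine h.good_of_bound hB ?_ (h.pos.core_of_G1 hk zero_le_one hG)
  have hU := h.pos.U
  rw [mul_one, div_mul_eq_mul_div, le_div_iff₀ hk]
  have := mul_nonneg hU.le hn
  linarith

/-- Only y ≥ 0 is used: the worst case is m = 2e'/3. -/
theorem bound_ep (h : Tail f t x y) :
    Bound f y (f.ep * f.nI (fun n : ℤ => (n : ℝ))) (f.dI (fun n : ℤ => (n : ℝ))) := by
  have he := mul_pos h.pos.U h.pos.ep
  have hη := mul_pos h.pos.U h.pos.cl
  have h3 := h.y_lt
  have hb := h.pos.b
  have h4 := h.pos.b_le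
  have h5 := h.y_nonneg
  have hX : f.U * f.Xb (fun n : ℤ => (n : ℝ)) = f.b * (f.E - f.U * f.ep) := by
    rw [h.pos.E_sub]; field_simp
  have hd : f.dI (fun n : ℤ => (n : ℝ)) = f.b * (3 - 2 * (f.U * f.ep)) := by
    simp only [Par.dI]; push_cast; ring
  have hn : f.U * (f.ep * f.nI (fun n : ℤ => (n : ℝ))) =
      f.b * (f.U * f.ep * (3 - 4 * (f.U * f.ep) - 2 * (f.E - f.U * f.ep))) := by
    simp only [Par.nI]; push_cast; linear_combination (-2 * f.U * f.ep) * hX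
  rw [Bound, hd, hn]
  refine ⟨mul_pos hb (by linarith), fun hc => ?_⟩
  set e := f.U * f.ep
  set g := f.E - f.U * f.ep with hg
  have hg0 : 0 ≤ g := sub_nonneg.2 h.pos.le_E
  set m := y + 2 / 3 * e with hm
  have h6 : (2 / 3 * e) * (1 - 2 / 3 * e) ≤ m * (1 - m) := by
    have := mul_nonneg (show 0 ≤ m - 2 / 3 * e by linarith) (show 0 ≤ 1 - m - 2 / 3 * e by linarith)
    linarith
  have h7 : (2 / 3 * e) * (1 - 2 / 3 * e) * (1 - 2 * m - 2 / 3 * g) ≤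
      m * (1 - m) * (1 - 4 / 3 * e - 2 / 3 * g) :=
    mul_le_mul h6 (by linarith) hc.le (h.V_pos.le)
  have := mul_le_mul_of_nonneg_left h7 (show 0 ≤ 9 * f.b * e by positivity)
  linarith

/-- Equality of the two Massart exponents, with m(1 - m) - p(1 - p) factored as (m - p)(1 - m - p)
for m = y + 2e'/3 and p = x + 2e/3. -/
theorem sq_sub (h : Tail f t x y) :
    (f.U * f.es) ^ 2 * ((y + 2 / 3 * (f.U * f.ep) - (x + 2 / 3 * (f.U * f.es))) *
      (1 - (y + 2 / 3 * (f.U * f.ep)) - (x + 2 / 3 * (f.U * f.es)))) =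
    (f.U * f.dl * (2 * (f.U * f.es) + f.U * f.dl)) *
      ((x + 2 / 3 * (f.U * f.es)) * (1 - (x + 2 / 3 * (f.U * f.es)))) := by
  have h1 := h.V
  rw [h.pos.dl]
  linear_combination h1

/-- The deviation that remains after the comparison of the two volumes is nonnegative. -/
theorem dev_nonneg (h : Tail f t x y)
    (hsq : (f.b * t) ^ 2 * (1 - f.a + f.U * f.cl) ≤ f.a ^ 2 * (1 - f.b + f.U * f.cl)) :
    0 ≤ f.a * (f.U * f.ep + f.U * f.cl) - f.b * t * (f.U * f.es + f.U * f.cl) := by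
  have hx := h.x_nonneg
  have hy := h.y_nonneg
  have ha := h.pos.a
  have hb := h.pos.b
  have ht : 0 ≤ t := h.pos.t.trans h.t_le
  have hV := h.V
  have h1 := h.fst
  have h2 := h.snd
  have hlam := h.lam
  have he0 := mul_pos h.pos.U h.pos.es
  have he0' := mul_pos h.pos.U h.pos.ep
  have hη0 := mul_pos h.pos.U h.pos.cl
  have hxa := h.x_lt
  have hyb := h.y_lt
  have ha1 := h.pos.a_le
  have hb1 := h.pos.b_le
  generalize f.U * f.es = e at *
  generalize f.U * f.ep = e' at *
  generalize f.U * f.cl = η at *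
  generalize f.a = a at *
  generalize f.b = b at *
  by_contra hcon
  rw [not_le] at hcon
  set l := b * t / a with hl
  have hla : b * t = l * a := by rw [hl]; field_simp
  have hl0 : 0 ≤ l := by positivity
  have hl1 : l ≤ 1 := by rw [hl, div_le_one ha]; exact hlam
  rw [hla] at h1 h2 hcon hsq
  have h1' : l * (x + e + η) ≤ y + e' + η := by
    refine le_of_mul_le_mul_left ?_ ha; linarith
  have h2' : l * (a - (x + e + η)) ≤ b - (y + e' + η) := by
    refine le_of_mul_le_mul_left ?_ ha; linarith
  have hcon' : e' + η < l * (e + η) := by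
    refine lt_of_mul_lt_mul_left ?_ ha.le; linarith
  have hsq' : l ^ 2 * (1 - a + η) ≤ 1 - b + η := by
    refine le_of_mul_le_mul_left ?_ (pow_pos ha 2); linarith
  -- A negative deviation forces r < l. With m(1 - m) = r² p(1 - p) and m > rp this gives 1 - m <
  -- r(1 - p), hence p < m, hence 1 - m < r²(1 - p), against `hsq'`.
  set r := e' / e with hr
  have hre : e' = r * e := by rw [hr]; field_simp
  have hr0 : 0 < r := by positivity
  have hrl : r < l := by
    rw [hr, div_lt_iff₀ he0]
    have := mul_le_mul_of_nonneg_right hl1 hη0.le; linarith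
  set m := y + 2 / 3 * e' with hm
  set p := x + 2 / 3 * e with hp
  have hp0 : 0 < p := by linarith
  have hm0 : 0 < m := by linarith
  have hp1 : p < 1 := by linarith
  have hV' : m * (1 - m) = r ^ 2 * (p * (1 - p)) := by
    refine mul_left_cancel₀ (pow_pos he0 2).ne' ?_
    rw [hV, hre]; ring
  have hmr : r * p < m := by
    have h3 : r * x ≤ l * x := mul_le_mul_of_nonneg_right hrl.le hx
    rw [hp, hm, hre]; linarith
  have hr1 : r < 1 := hrl.trans_le hl1
  have h4 : 1 - m < r * (1 - p) := by
    by_contra h5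
    have h6 : r * p * (r * (1 - p)) < m * (1 - m) :=

      mul_lt_mul hmr (not_lt.1 h5) (mul_pos hr0 (sub_pos.2 hp1)) hm0.le
    linarith
  have hpm : p < m := by
    have := mul_lt_mul_of_pos_right hr1 (sub_pos.2 hp1); linarith
  have h5 : 1 - m < r ^ 2 * (1 - p) := by
    by_contra h6
    have h7 := mul_le_mul_of_nonneg_left (not_lt.1 h6) hm0.le
    have h8 := mul_lt_mul_of_pos_right hpm (mul_pos (pow_pos hr0 2) (sub_pos.2 hp1))
    linarith
  have hrr : r ^ 2 ≤ l ^ 2 := pow_le_pow_left₀ hr0.le hrl.le 2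
  have h6 : r ^ 2 * (1 - a + η) ≤ 1 - b + η :=
    (mul_le_mul_of_nonneg_right hrr (by linarith)).trans hsq'
  have hrr' : r ^ 2 ≤ r := by
    rw [pow_two]; exact mul_le_of_le_one_right hr0.le hr1.le
  have h7 : r ^ 2 * (a - x - e - η) ≤ l * (a - x - e - η) := by
    exact mul_le_mul_of_nonneg_right (hrr'.trans hrl.le) (by linarith)
  have h8 : r ^ 2 * e ≤ e' := by
    rw [hre]; exact mul_le_mul_of_nonneg_right hrr' he0.le
  rw [hm, hp] at h5
  linarith

theorem fst_lt_false (h : Tail f t x y) (hp : 0 ≤ f.r1) : False := by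
  have h1 := h.x_lt
  have h2 := h.x_nonneg
  simp only [Par.r1, Par.S1] at hp
  linarith

theorem snd_lt_false (h : Tail f t x y) (hp : 0 ≤ f.r2) : False := by
  have h1 := h.y_lt
  have h2 := h.y_nonneg
  simp only [Par.r2, Par.X] at hp
  linarith

theorem good_of_less (h : Tail f t x y) (hle : f.ep ≤ f.es)
    (hdev : 0 ≤ f.a * (f.U * f.ep + f.U * f.cl) - f.b * t * (f.U * f.es + f.U * f.cl))
    {cl : List ℝ} (hcl : cl ∈ f.lessI (fun n : ℤ => (n : ℝ))) (hp : ∀ p ∈ cl, 0 ≤ p) :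
    Good f y := by
  have hep := h.pos.ep
  have hB := h.bound_ep
  simp only [Par.lessI, List.mem_cons, List.not_mem_nil, or_false] at hcl
  rcases hcl with rfl | rfl | rfl | rfl | rfl <;>
    simp only [List.mem_cons, List.not_mem_nil, or_false, forall_eq_or_imp, forall_eq] at hp
  · exact h.good_of_G1 hB hp.2 hp.1
  · exact (h.fst_lt_false hp).elim
  · push_cast at hp; linarith
  -- The nonnegative deviation makes Yb nonnegative, the clause makes it nonpositive. For D = 0 the
  -- slack 2e' is admissible.
  · have hD : f.D = 0 := by
      have h1 : 0 ≤ f.U * f.Yb := by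
        have h2 := mul_nonneg (mul_nonneg h.pos.b.le (sub_nonneg.2 h.t_le))
          (mul_pos h.pos.U (add_pos h.pos.es h.pos.cl)).le
        simp only [Par.Yb, Par.X, Par.U3, Par.S1]
        linarith
      have h2 : 0 ≤ f.Yb := nonneg_of_mul_nonneg_right h1 h.pos.U
      push_cast at hp
      have h3 : f.Yb = 0 := by linarith
      rw [Par.D, h3]; simp
    refine ⟨_, h.pos.core_of_D hD, ?_⟩
    have he := mul_pos h.pos.U h.pos.ep
    have h5 := h.y_nonneg
    have h6 := h.pos.le_E
    have hV := h.V_pos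
    set e := f.U * f.ep
    have h7 : e * (1 - 2 * (y + 2 / 3 * e) - 2 / 3 * (f.E - e)) ≤
        3 * ((y + 2 / 3 * e) * (1 - (y + 2 / 3 * e))) := by
      rcases le_or_gt (1 - 2 * (y + 2 / 3 * e) - 2 / 3 * (f.E - e)) 0 with h8 | h8
      · have := mul_nonneg he.le (neg_nonneg.2 h8); linarith
      · have h9 : e * (1 - 2 * (y + 2 / 3 * e) - 2 / 3 * (f.E - e)) ≤
            3 * (y + 2 / 3 * e) * (1 - (y + 2 / 3 * e)) :=
          mul_le_mul (by linarith) (by linarith) h8.le (by linarith)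
        linarith
    have := mul_le_mul_of_nonneg_left h7 (show 0 ≤ 2 * e by linarith)
    linarith
  · refine h.good_of_ladder (k := 10) hB (by norm_num) ?_ (by simpa using hp.2)
    have := mul_nonneg hep.le hp.1
    push_cast at this; linarith

/-- The point at which the variance of the second threshold is taken. -/
theorem low_mem (h : Tail f t x y) (hdl : 0 < f.dl) (hlow : x + 2 / 3 * (f.U * f.es) < 1 / 2) :
    x + 2 / 3 * (f.U * f.es) < y + 2 / 3 * (f.U * f.ep) ∧
      y + 2 / 3 * (f.U * f.ep) + (x + 2 / 3 * (f.U * f.es)) < 1 := by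
  have h1 := h.sq_sub
  have he := mul_pos h.pos.U h.pos.es
  have hd := mul_pos h.pos.U hdl
  have hx := h.x_nonneg
  set p := x + 2 / 3 * (f.U * f.es) with hp
  set m := y + 2 / 3 * (f.U * f.ep)
  have hp0 : 0 < p := by linarith
  have h2 : 0 < (m - p) * (1 - m - p) := by
    refine pos_of_mul_pos_right (a := (f.U * f.es) ^ 2) ?_ (by positivity)
    rw [h1]
    exact mul_pos (by positivity) (mul_pos hp0 (by linarith))
  rcases pos_and_pos_or_neg_and_neg_of_mul_pos h2 with h3 | h3
  · exact ⟨by linarith, by linarith⟩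
  · linarith

theorem high_mem (h : Tail f t x y) (hdl : 0 < f.dl) (hx1 : x + 2 / 3 * (f.U * f.es) < 1)
    (hhigh : 1 / 2 < x + 2 / 3 * (f.U * f.es)) :
    y + 2 / 3 * (f.U * f.ep) < x + 2 / 3 * (f.U * f.es) ∧
      1 < y + 2 / 3 * (f.U * f.ep) + (x + 2 / 3 * (f.U * f.es)) := by
  have h1 := h.sq_sub
  have he := mul_pos h.pos.U h.pos.es
  have hd := mul_pos h.pos.U hdl
  set p := x + 2 / 3 * (f.U * f.es)
  set m := y + 2 / 3 * (f.U * f.ep)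
  have h2 : 0 < (m - p) * (1 - m - p) := by
    refine pos_of_mul_pos_right (a := (f.U * f.es) ^ 2) ?_ (by positivity)
    rw [h1]
    exact mul_pos (by positivity) (mul_pos (by linarith) (by linarith))
  rcases pos_and_pos_or_neg_and_neg_of_mul_pos h2 with h3 | h3
  · linarith
  · exact ⟨by linarith, by linarith⟩

/-- The bound of Massart's variance for a lower bound `m₀` of the second point. -/
theorem bound_low (h : Tail f t x y) (hlow : x + 2 / 3 * (f.U * f.es) < 1 / 2) {m₀ n : ℝ}
    (hm : m₀ ≤ y + 2 / 3 * (f.U * f.ep))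
    (hn : f.U * n = f.b * (3 * (f.U * f.es) * (1 - 2 * m₀ - 2 / 3 * (f.E - f.U * f.ep)))) :
    Bound f y n (f.dII (fun n : ℤ => (n : ℝ))) := by
  have he := mul_pos h.pos.U h.pos.es
  have he' := mul_pos h.pos.U h.pos.ep
  have hb := h.pos.b
  have hx := h.x_nonneg
  have hV := h.V
  have hd : f.dII (fun n : ℤ => (n : ℝ)) = f.b * (3 - 2 * (f.U * f.es)) := by
    simp only [Par.dII]; push_cast; ring
  rw [Bound, hd, hn]
  refine ⟨mul_pos hb (by linarith), fun hc => ?_⟩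
  set e := f.U * f.es
  set e' := f.U * f.ep
  set g := f.E - e'
  set p := x + 2 / 3 * e with hp
  set m := y + 2 / 3 * e'
  have h1 : (2 / 3 * e) * (1 - 2 / 3 * e) ≤ p * (1 - p) := by
    have := mul_nonneg (show 0 ≤ p - 2 / 3 * e by linarith) (show 0 ≤ 1 - p - 2 / 3 * e by linarith)
    linarith
  have h2 : (2 / 3 * e) * (1 - 2 / 3 * e) * (1 - 2 * m - 2 / 3 * g) ≤
      p * (1 - p) * (1 - 2 * m₀ - 2 / 3 * g) :=
    mul_le_mul h1 (by linarith) hc.le (mul_nonneg (by linarith) (by linarith))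
  refine le_of_mul_le_mul_left ?_ (pow_pos he 2)
  have h3 := mul_le_mul_of_nonneg_left h2 (show 0 ≤ 9 * f.b * e * e' ^ 2 by positivity)
  calc _ = 9 * f.b * e * e' ^ 2 * (2 / 3 * e * (1 - 2 / 3 * e) * (1 - 2 * m - 2 / 3 * g)) := by ring
    _ ≤ _ := h3
    _ = 9 * f.b * e * (1 - 2 * m₀ - 2 / 3 * g) * (e' ^ 2 * (p * (1 - p))) := by ring
    _ = _ := by rw [← hV]; ring

/-- In `sq_sub` the factor 1 - m - p is smaller than 1 - p, so m - p is bounded below; then p ≥ 2e/3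
removes p. -/
theorem low_dist (h : Tail f t x y) (hdl : 0 < f.dl) (hlow : x + 2 / 3 * (f.U * f.es) < 1 / 2) :
    2 * (f.U * f.dl * (2 * (f.U * f.es) + f.U * f.dl)) <
      3 * (f.U * f.es * (y + 2 / 3 * (f.U * f.ep) - (x + 2 / 3 * (f.U * f.es)))) := by
  have he := mul_pos h.pos.U h.pos.es
  have hx := h.x_nonneg
  obtain ⟨hm1, hm2⟩ := h.low_mem hdl hlow
  have hd := mul_pos h.pos.U hdl
  set e := f.U * f.es with hedef
  set d := f.U * f.dl with hddef
  set p := x + 2 / 3 * e with hpdef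
  set m := y + 2 / 3 * (f.U * f.ep) with hmdef
  have hm3 : p * (d * (2 * e + d)) < e ^ 2 * (m - p) := by
    have h1 := h.sq_sub
    have h2 : (1 - m - p) * (e ^ 2 * (m - p)) = (1 - p) * (p * (d * (2 * e + d))) := by
      linear_combination h1
    have h3 : 0 < p * (d * (2 * e + d)) := by
      have : 0 < p := by linarith
      positivity
    by_contra h4
    have h5 := mul_le_mul_of_nonneg_left (not_lt.1 h4) (show 0 ≤ 1 - m - p by linarith)
    have h6 := mul_lt_mul_of_pos_right (show 1 - m - p < 1 - p by linarith) h3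
    linarith
  have h1 : 2 / 3 * e * (d * (2 * e + d)) ≤ p * (d * (2 * e + d)) :=
    mul_le_mul_of_nonneg_right (by linarith) (by positivity)
  have h2 : e * (2 * (d * (2 * e + d))) < e * (3 * (e * (m - p))) := by linarith
  exact lt_of_mul_lt_mul_left h2 he.le

/-- The constraint on the deviations below the middle. -/
theorem C_neg (h : Tail f t x y) (hdl : 0 < f.dl) (hlow : x + 2 / 3 * (f.U * f.es) < 1 / 2) :
    f.C (fun n : ℤ => (n : ℝ)) < 0 := by
  by_contra hp
  rw [not_lt] at hp
  have he := mul_pos h.pos.U h.pos.es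
  have hb := h.pos.b
  have ha := h.pos.a
  have hx := h.x_nonneg
  have hU := h.pos.U
  have hm4 := h.low_dist hdl hlow
  set e := f.U * f.es with hedef
  set d := f.U * f.dl with hddef
  have hed : f.U * f.ep = e + d := by rw [hedef, hddef, h.pos.dl]; ring
  set p := x + 2 / 3 * e with hpdef
  set m := y + 2 / 3 * (f.U * f.ep) with hmdef
  have h1 := h.snd
  have h2 := h.x_lt
  have h3 := h.t_le
  have h4 := h.lam
  simp only [Par.C, Par.S1] at hp
  push_cast at hp
  have hη := mul_pos h.pos.U h.pos.cl
  have hC : 0 ≤ f.a * d * (5 * e + 2 * d) - 3 * e * (f.a * f.b * (1 - f.t) -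
      (f.a - f.b * f.t) * (e + f.U * f.cl)) := by
    have := mul_nonneg hU.le hp
    rw [hedef, hddef]; linarith
  rw [hed] at h1
  have h5 : f.a * (e * (m - p)) ≤ f.a * f.b * (1 - t) * e - (f.a - f.b * t) * (e + f.U * f.cl) * e -
      f.a * e * d / 3 := by
    have h6 : 0 ≤ (f.a - f.b * t) * (x * e) :=
      mul_nonneg (sub_nonneg.2 h4) (mul_nonneg hx he.le)
    have h7 := mul_le_mul_of_nonneg_right h1 he.le
    rw [hmdef, hpdef, hed]
    linarith
  have h6 : 0 ≤ (t - f.t) * (f.b * (f.a - (e + f.U * f.cl)) * e) :=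
    mul_nonneg (sub_nonneg.2 h3) (mul_nonneg (mul_nonneg hb.le (by linarith)) he.le)
  have h7 := mul_lt_mul_of_pos_left hm4 ha
  linarith

theorem good_of_moreLow (h : Tail f t x y) (hdl : 0 < f.dl)
    (hlow : x + 2 / 3 * (f.U * f.es) < 1 / 2) {cl : List ℝ}
    (hcl : cl ∈ f.moreLow (fun n : ℤ => (n : ℝ))) (hp : ∀ p ∈ cl, 0 ≤ p) : Good f y := by
  have he := mul_pos h.pos.U h.pos.es
  have hb := h.pos.b
  have hx := h.x_nonneg
  have hes := h.pos.es
  obtain ⟨hm1, hm2⟩ := h.low_mem hdl hlow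
  have hm4 := h.low_dist hdl hlow
  have hd := mul_pos h.pos.U hdl
  have hX : f.U * f.Xb (fun n : ℤ => (n : ℝ)) = f.b * (f.E - f.U * f.ep) := by
    rw [h.pos.E_sub]; field_simp
  set e := f.U * f.es with hedef
  set d := f.U * f.dl with hddef
  have hed : f.U * f.ep = e + d := by rw [hedef, hddef, h.pos.dl]; ring
  set p := x + 2 / 3 * e with hpdef
  set m := y + 2 / 3 * (f.U * f.ep) with hmdef
  have hB : Bound f y (f.nII (fun n : ℤ => (n : ℝ))) (f.dII (fun n : ℤ => (n : ℝ))) := by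
    refine h.bound_low hlow (m₀ := 2 / 3 * e + 2 / 3 * (d * (2 * e + d) / e)) ?_ ?_
    · have h1 : 2 / 3 * (d * (2 * e + d) / e) ≤ m - p := by
        rw [mul_div_assoc', div_le_iff₀ he]; linarith
      linarith
    · have h1 : e * (d * (2 * e + d) / e) = d * (2 * e + d) := by field_simp
      simp only [Par.nII, Par.Q]; push_cast
      linear_combination (-2 * e) * hX + (4 * f.b) * h1
  have hB' : Bound f y (f.es * f.nII' (fun n : ℤ => (n : ℝ))) (f.dII (fun n : ℤ => (n : ℝ))) := by
    refine h.bound_low hlow (m₀ := 2 / 3 * e) (by linarith) ?_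
    simp only [Par.nII']; push_cast
    linear_combination (-2 * e) * hX
  simp only [Par.moreLow, List.mem_cons, List.not_mem_nil, or_false] at hcl
  rcases hcl with rfl | rfl | rfl | rfl | rfl | rfl | rfl | rfl <;>
    simp only [List.mem_cons, List.not_mem_nil, or_false, forall_eq_or_imp, forall_eq] at hp
  · exact h.good_of_G hB hp.2 hp.1
  · exact ((h.C_neg hdl hlow).not_ge hp).elim
  · exact (h.fst_lt_false hp).elim
  · exact (h.snd_lt_false hp).elim
  · exact h.good_of_ladder (k := 10) hB (by norm_num) (by simpa using hp.1) (by simpa using hp.2)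
  · exact h.good_of_S hB hp.2 hp.1
  · exact h.good_of_S hB' (mul_nonneg hes.le hp.2) hp.1
  · exact h.good_of_ladder (k := 40) hB (by norm_num) (by simpa using hp.1) (by simpa using hp.2)

/-- The distance of the two points is bounded by means of the growth of the volumes. -/
theorem sub_lt (h : Tail f t x y) (hdl : 0 < f.dl) :
    3 * (x + 2 / 3 * (f.U * f.es) - (y + 2 / 3 * (f.U * f.ep))) ≤ f.J3 (fun n : ℤ => (n : ℝ)) := by
  have h1 := h.fst
  have h2 := h.x_lt
  have h3 := h.t_le
  have h4 := h.lam
  have ha := h.pos.a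
  have hb := h.pos.b
  have hed : f.U * f.ep = f.U * f.es + f.U * f.dl := by rw [h.pos.dl]; ring
  rw [hed] at h1 ⊢
  have h5 := mul_nonneg (sub_nonneg.2 h4) (sub_pos.2 h2).le
  have h6 := mul_nonneg hb.le (sub_nonneg.2 h3)
  have h7 := mul_nonneg ha.le h6
  simp only [Par.J3]; push_cast
  refine le_of_mul_le_mul_left ?_ ha
  linarith

/-- The constraint on the deviations above the middle. -/
theorem dev_lt (h : Tail f t x y) (hdl : 0 < f.dl) (hhigh : 1 / 2 < x + 2 / 3 * (f.U * f.es)) :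
    f.Q (fun n : ℤ => (n : ℝ)) * (f.c3 (fun n : ℤ => (n : ℝ)) * (3 - f.c3 (fun n : ℤ => (n : ℝ)))) <
      f.es ^ 2 * (3 * (x + 2 / 3 * (f.U * f.es) - (y + 2 / 3 * (f.U * f.ep))) *
        (f.w3 (fun n : ℤ => (n : ℝ)) -
          3 * (x + 2 / 3 * (f.U * f.es) - (y + 2 / 3 * (f.U * f.ep))))) := by
  have hes := h.pos.es
  have hU := h.pos.U
  have he := mul_pos h.pos.U h.pos.es
  have hη := mul_pos h.pos.U h.pos.cl
  have ha1 := h.pos.a_le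
  have hx1 := h.x_lt
  obtain ⟨hm1, hm2⟩ := h.high_mem hdl (by linarith) hhigh
  have hc : f.c3 (fun n : ℤ => (n : ℝ)) = 3 * (f.U * f.es / 3 + (1 - f.a) + f.U * f.cl) := by
    simp only [Par.c3]; push_cast; ring
  have hw : f.w3 (fun n : ℤ => (n : ℝ)) = 3 * (1 - 2 * (f.U * f.es / 3 + (1 - f.a) + f.U * f.cl)) := by
    simp only [Par.w3, hc]; push_cast; ring
  have hQ : f.U ^ 2 * f.Q (fun n : ℤ => (n : ℝ)) = f.U * f.dl * (2 * (f.U * f.es) + f.U * f.dl) := by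
    simp only [Par.Q]; push_cast; ring
  have hQ0 : 0 < f.Q (fun n : ℤ => (n : ℝ)) := by
    simp only [Par.Q]; push_cast; positivity
  have h1 := h.sq_sub
  rw [← hQ] at h1
  rw [hc, hw]
  set p := x + 2 / 3 * (f.U * f.es) with hp
  set m := y + 2 / 3 * (f.U * f.ep)
  -- The bound x + e + η < a gives c < 1 - p < 1/2, so p(1 - p) > c(1 - c).
  set c := f.U * f.es / 3 + (1 - f.a) + f.U * f.cl with hcd
  have hcp : c < 1 - p := by rw [hcd, hp]; linarith
  have h2 : c * (1 - c) < p * (1 - p) := by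
    have := mul_pos (show 0 < 1 - p - c by linarith) (show 0 < p - c by linarith)
    linarith
  have h3 : (p - m) * (p + m - 1) < (p - m) * (1 - 2 * c - (p - m)) :=
    mul_lt_mul_of_pos_left (by linarith) (by linarith)
  have h4 : f.es ^ 2 * ((p - m) * (p + m - 1)) = f.Q (fun n : ℤ => (n : ℝ)) * (p * (1 - p)) := by
    refine mul_left_cancel₀ (pow_pos hU 2).ne' ?_
    linear_combination h1
  have h5 := mul_lt_mul_of_pos_left h2 hQ0
  have h6 := mul_lt_mul_of_pos_left h3 (pow_pos hes 2)
  linarith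

/-- The right side of `dev_lt` is quadratic in j = 3(p - m) and never exceeds its maximum, attained
at j = w3/2. -/
theorem C1_false (h : Tail f t x y) (hdl : 0 < f.dl) (hhigh : 1 / 2 < x + 2 / 3 * (f.U * f.es))
    (hp : 0 ≤ f.C1 (fun n : ℤ => (n : ℝ))) : False := by
  have h1 := h.dev_lt hdl hhigh
  simp only [Par.C1] at hp
  push_cast at hp
  set j := 3 * (x + 2 / 3 * (f.U * f.es) - (y + 2 / 3 * (f.U * f.ep)))
  nlinarith [mul_nonneg (sq_nonneg f.es) (sq_nonneg (f.w3 (fun n : ℤ => (n : ℝ)) - 2 * j))]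

/-- For J3 ≤ w3/2 the quadratic of `dev_lt` is increasing up to J3, and j ≤ J3 by `sub_lt`. -/
theorem C2_false (h : Tail f t x y) (hdl : 0 < f.dl) (hhigh : 1 / 2 < x + 2 / 3 * (f.U * f.es))
    (hp : 0 ≤ f.C2 (fun n : ℤ => (n : ℝ))) (hp' : 0 ≤ f.C2' (fun n : ℤ => (n : ℝ))) : False := by
  have h1 := h.dev_lt hdl hhigh
  have h2 := h.sub_lt hdl
  simp only [Par.C2, Par.C2'] at hp hp'
  push_cast at hp hp'
  set j := 3 * (x + 2 / 3 * (f.U * f.es) - (y + 2 / 3 * (f.U * f.ep)))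
  set J := f.J3 (fun n : ℤ => (n : ℝ))
  have h3 : 0 ≤ f.es ^ 2 * ((J - j) * (f.w3 (fun n : ℤ => (n : ℝ)) - J - j)) :=
    mul_nonneg (sq_nonneg _) (mul_nonneg (by linarith) (by linarith))
  linarith

/-- When m ≥ 1/2 the variance no longer grows to the right of m, so slack zero suffices. -/
theorem good_of_moreHigh (h : Tail f t x y) (hdl : 0 < f.dl)
    (hhigh : 1 / 2 < x + 2 / 3 * (f.U * f.es)) (hm : 1 / 2 ≤ y + 2 / 3 * (f.U * f.ep)) {cl : List ℝ}
    (hcl : cl ∈ f.moreHigh (fun n : ℤ => (n : ℝ))) (hp : ∀ p ∈ cl, 0 ≤ p) : Good f y := by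
  simp only [Par.moreHigh, List.mem_cons, List.not_mem_nil, or_false] at hcl
  rcases hcl with rfl | rfl | rfl | rfl | rfl <;>
    simp only [List.mem_cons, List.not_mem_nil, or_false, forall_eq_or_imp, forall_eq] at hp
  · refine ⟨0, h.pos.core_of_G0 hp, ?_⟩
    rw [mul_zero, zero_mul]
    have := h.pos.le_E
    exact mul_nonpos_of_nonneg_of_nonpos (by positivity) (by linarith)
  · exact (h.C1_false hdl hhigh hp).elim
  · exact (h.C2_false hdl hhigh hp.1 hp.2).elim
  · exact (h.fst_lt_false hp).elim
  · exact (h.snd_lt_false hp).elim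

/-- Here p + m > 1, hence 3(1 - 2m) < 3(p - m) ≤ J3. This bounds m(1 - m) from below and produces
the third bound of the slack. -/
theorem good_of_moreMid (h : Tail f t x y) (hdl : 0 < f.dl)
    (hhigh : 1 / 2 < x + 2 / 3 * (f.U * f.es)) (hm : y + 2 / 3 * (f.U * f.ep) < 1 / 2)
    (hJ : f.J3 (fun n : ℤ => (n : ℝ)) < 3) {cl : List ℝ}
    (hcl : cl ∈ f.moreMid (fun n : ℤ => (n : ℝ))) (hp : ∀ p ∈ cl, 0 ≤ p) : Good f y := by
  have hx1 := h.x_lt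
  have he := mul_pos h.pos.U h.pos.es
  have hη := mul_pos h.pos.U h.pos.cl
  have ha1 := h.pos.a_le
  have hb := h.pos.b
  have hU := h.pos.U
  obtain ⟨hm1, hm2⟩ := h.high_mem hdl (by linarith) hhigh
  have hJ1 := h.sub_lt hdl
  have hJ0 : 0 < f.J3 (fun n : ℤ => (n : ℝ)) := by linarith
  have hB : Bound f y (f.nIII (fun n : ℤ => (n : ℝ))) (f.dIII (fun n : ℤ => (n : ℝ))) := by
    have hX : f.U * f.Xb (fun n : ℤ => (n : ℝ)) = f.b * (f.E - f.U * f.ep) := by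
      rw [h.pos.E_sub]; field_simp
    have hn : f.U * f.nIII (fun n : ℤ => (n : ℝ)) = f.b * (8 * (f.U * f.ep) ^ 2 *
        (f.J3 (fun n : ℤ => (n : ℝ)) - 2 * (f.E - f.U * f.ep))) := by
      simp only [Par.nIII]; push_cast
      linear_combination (-16 * (f.U * f.ep) ^ 2) * hX
    have hd : f.dIII (fun n : ℤ => (n : ℝ)) = f.b * (9 - f.J3 (fun n : ℤ => (n : ℝ)) ^ 2) := by
      simp only [Par.dIII]; push_cast; ring
    rw [Bound, hn, hd]
    set J := f.J3 (fun n : ℤ => (n : ℝ))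
    have hJJ : 0 < 9 - J ^ 2 := by nlinarith
    refine ⟨mul_pos hb hJJ, fun hc => ?_⟩
    set e' := f.U * f.ep
    set g := f.E - e'
    set m := y + 2 / 3 * e'
    have h1 : 9 - J ^ 2 ≤ 36 * (m * (1 - m)) := by
      have := mul_nonneg (show 0 ≤ J - 3 * (1 - 2 * m) by linarith) (show 0 ≤ J + 3 * (1 - 2 * m) by
        linarith)
      linarith
    have h2 : (1 - 2 * m - 2 / 3 * g) * (9 - J ^ 2) ≤ (1 / 3 * J - 2 / 3 * g) * (36 * (m * (1 - m))) :=
      mul_le_mul (by linarith) h1 hJJ.le (by linarith)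
    have := mul_le_mul_of_nonneg_left h2 (show 0 ≤ 2 * f.b * e' ^ 2 by positivity)
    linarith
  have hB' := h.bound_ep
  simp only [Par.moreMid, List.mem_cons, List.not_mem_nil, or_false] at hcl
  rcases hcl with rfl | rfl | rfl | rfl | rfl | rfl | rfl | rfl | rfl | rfl <;>
    simp only [List.mem_cons, List.not_mem_nil, or_false, forall_eq_or_imp, forall_eq] at hp
  · exact h.good_of_G hB hp.2 hp.1
  · exact (h.C1_false hdl hhigh hp).elim
  · exact (h.C2_false hdl hhigh hp.1 hp.2).elim
  · exact (h.fst_lt_false hp).elim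
  · exact (h.snd_lt_false hp).elim
  -- Since m < 1/2, the distance p - 1/2 is less than J3/3, which is too small for the variance
  -- relation under this clause.
  · exfalso
    have h1 := h.sq_sub
    have hQ : f.U ^ 2 * f.Q (fun n : ℤ => (n : ℝ)) =
        f.U * f.dl * (2 * (f.U * f.es) + f.U * f.dl) := by
      simp only [Par.Q]; push_cast; ring
    have hQ0 : 0 < f.Q (fun n : ℤ => (n : ℝ)) := by
      have := h.pos.es
      simp only [Par.Q]; push_cast; positivity
    rw [← hQ] at h1
    simp only [Par.C3, Par.C3'] at hp
    push_cast at hp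
    set p := x + 2 / 3 * (f.U * f.es)
    set m := y + 2 / 3 * (f.U * f.ep)
    set J := f.J3 (fun n : ℤ => (n : ℝ))
    set Q := f.Q (fun n : ℤ => (n : ℝ))
    have h2 : f.es ^ 2 * ((p - 1 / 2) ^ 2 - (1 / 2 - m) ^ 2) = Q * (1 / 4 - (p - 1 / 2) ^ 2) := by
      refine mul_left_cancel₀ (pow_pos hU 2).ne' ?_
      linear_combination h1
    have h3 : (p - 1 / 2) ^ 2 < (J / 3) ^ 2 := by
      refine pow_lt_pow_left₀ ?_ (by linarith) two_ne_zero
      linarith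
    have h4 := mul_lt_mul_of_pos_left h3 hQ0
    have h5 := mul_lt_mul_of_pos_left h3 (pow_pos h.pos.es 2)
    have h6 := mul_nonneg (sq_nonneg f.es) (sq_nonneg (1 / 2 - m))
    linarith [hp.1]
  · exact h.good_of_ladder (k := 10) hB (by norm_num) (by simpa using hp.1) (by simpa using hp.2)
  · exact h.good_of_G1 hB' hp.2 hp.1
  · exact h.good_of_S hB hp.2 hp.1
  · refine h.good_of_ladder (k := 10) hB' (by norm_num) ?_ (by simpa using hp.2)
    have := mul_nonneg h.pos.ep.le hp.1
    push_cast at this; linarith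

end Tail

/-- The parameters `f` represent the given deviations. -/
structure Par.Rep (f : Par ℝ) (e e' η a b t₀ : ℝ) : Prop where
  U : 0 < f.U
  es : f.U * f.es = e
  ep : f.U * f.ep = e'
  dl : f.dl = f.ep - f.es
  cl : f.U * f.cl = η
  a : f.a = a
  b : f.b = b
  t : f.t = t₀

variable {t t₀ a b η : ℝ}

/-- The parameters with unit length one. -/
def Par.unit (e e' η a b t₀ : ℝ) : Par ℝ := ⟨1, e, e', e' - e, η, a, b, t₀⟩

theorem Tail.of_rep {f : Par ℝ} {e e' x y : ℝ} (h : Tail (Par.unit e e' η a b t₀) t x y)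
    (hf : f.Rep e e' η a b t₀) : Tail f t x y := by
  obtain ⟨hU, rfl, rfl, hdl, rfl, rfl, rfl, rfl⟩ := hf
  obtain ⟨⟨-, h1, h2, h3, -, h4, h5, h6, h7, h8⟩, h9, h10, h11, h12, h13, h14, h15, h16, h17⟩ := h
  simp only [Par.unit, one_mul] at *
  exact ⟨⟨hU, pos_of_mul_pos_right h1 hU.le, pos_of_mul_pos_right h2 hU.le,
    pos_of_mul_pos_right h3 hU.le, hdl, h4, h5, h6, h7, h8⟩, h9, h10, h11, h12, h13, h14, h15, h16,
    h17⟩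

/-- The cases are e' ≤ e, and e < e' with p = x + 2e/3 below or above 1/2; in the last one m = y +
2e'/3 may lie on either side of 1/2. Each case may use its own chart `f`. -/
theorem dominated_of_clauses (ha0 : 0 < a) (ha : a ≤ 1) (hb0 : 0 < b) (hb : b ≤ 1) (hη : 0 < η)
    (ht0 : 0 ≤ t₀) (ht : t₀ ≤ t) (hlam : b * t ≤ a)
    (hsq : (b * t) ^ 2 * (1 - a + η) ≤ a ^ 2 * (1 - b + η))
    (H1 : ∀ x e y e', Tail (Par.unit e e' η a b t₀) t x y → e' ≤ e →
      0 ≤ a * (e' + η) - b * t * (e + η) →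
      ∃ f : Par ℝ, f.Rep e e' η a b t₀ ∧ ∃ cl ∈ f.lessI (fun n : ℤ => (n : ℝ)), ∀ p ∈ cl, 0 ≤ p)
    (H2 : ∀ x e y e', Tail (Par.unit e e' η a b t₀) t x y → e < e' → x + 2 / 3 * e < 1 / 2 →
      ∃ f : Par ℝ, f.Rep e e' η a b t₀ ∧ ∃ cl ∈ f.moreLow (fun n : ℤ => (n : ℝ)), ∀ p ∈ cl, 0 ≤ p)
    (H3 : ∀ x e y e', Tail (Par.unit e e' η a b t₀) t x y → e < e' → 1 / 2 < x + 2 / 3 * e →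
      ∃ f : Par ℝ, f.Rep e e' η a b t₀ ∧ ∃ cl ∈ f.moreHigh (fun n : ℤ => (n : ℝ)), ∀ p ∈ cl, 0 ≤ p)
    (H4 : ∀ x e y e', Tail (Par.unit e e' η a b t₀) t x y → e < e' → 1 / 2 < x + 2 / 3 * e →
      ∃ f : Par ℝ, f.Rep e e' η a b t₀ ∧ f.J3 (fun n : ℤ => (n : ℝ)) < 3 ∧
        ∃ cl ∈ f.moreMid (fun n : ℤ => (n : ℝ)), ∀ p ∈ cl, 0 ≤ p) :
    Dominated t a b η := by
  intro x e y e' hx he hy he' hxa hyb hV hP hR κ E D W hκ hE hD hW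
  have htail : Tail (Par.unit e e' η a b t₀) t x y := by
    refine ⟨⟨one_pos, he, he', hη, rfl, ha0, ha, hb0, hb, ht0⟩, ht, hlam, hx, hy, ?_, ?_, ?_, ?_, ?_⟩ <;>
      simp only [Par.unit, one_mul]
    · exact hxa
    · exact hyb
    · exact hV
    · rw [mul_div_assoc', div_le_div_iff₀ ha0 hb0] at hP
      linarith
    · have h1 : t * (1 - (x + e + η) / a) * (a * b) ≤ (1 - (y + e' + η) / b) * (a * b) :=
        mul_le_mul_of_nonneg_right hR (by positivity)
      have e1 : t * (1 - (x + e + η) / a) * (a * b) = b * t * (a - (x + e + η)) := by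
        field_simp
      have e2 : (1 - (y + e' + η) / b) * (a * b) = a * (b - (y + e' + η)) := by
        field_simp
      linarith
  have hdev : 0 ≤ a * (e' + η) - b * t * (e + η) := by
    rcases le_or_gt e' e with _ | hlt
    · have := htail.dev_nonneg (by simpa [Par.unit] using hsq)
      simpa [Par.unit] using this
    · have h1 := mul_le_mul_of_nonneg_right hlam (add_pos he hη).le
      have h2 := mul_le_mul_of_nonneg_left hlt.le ha0.le
      linarith
  obtain ⟨f, hf, hgood⟩ : ∃ f : Par ℝ, f.Rep e e' η a b t₀ ∧ Good f y := by
    rcases le_or_gt e' e with hle | hlt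
    · obtain ⟨f, hf, cl, hcl, hp⟩ := H1 x e y e' htail hle hdev
      refine ⟨f, hf, (htail.of_rep hf).good_of_less ?_ ?_ hcl hp⟩
      · refine le_of_mul_le_mul_left ?_ hf.U
        rw [hf.es, hf.ep]; exact hle
      · rw [hf.es, hf.ep, hf.cl, hf.a, hf.b]; exact hdev
    · have hdl : ∀ {f : Par ℝ}, f.Rep e e' η a b t₀ → 0 < f.dl := fun {f} hf => by
        refine pos_of_mul_pos_right (a := f.U) ?_ hf.U.le
        rw [hf.dl, mul_sub, hf.es, hf.ep]; linarith
      rcases lt_trichotomy (x + 2 / 3 * e) (1 / 2) with hμ | hμ | hμ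
      · obtain ⟨f, hf, cl, hcl, hp⟩ := H2 x e y e' htail hlt hμ
        exact ⟨f, hf, (htail.of_rep hf).good_of_moreLow (hdl hf) (by rw [hf.es]; exact hμ) hcl hp⟩
      -- At p = 1/2 the variance is maximal, so equal exponents are incompatible with e < e'.
      · exfalso
        rw [hμ] at hV
        have h1 : (y + 2 / 3 * e') * (1 - (y + 2 / 3 * e')) ≤ 1 / 4 := by
          nlinarith [sq_nonneg (y + 2 / 3 * e' - 1 / 2)]
        have h2 := mul_le_mul_of_nonneg_left h1 (sq_nonneg e)
        have h3 := pow_lt_pow_left₀ hlt he.le two_ne_zero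
        linarith
      · rcases le_or_gt (1 / 2) (y + 2 / 3 * e') with hm | hm
        · obtain ⟨f, hf, cl, hcl, hp⟩ := H3 x e y e' htail hlt hμ
          exact ⟨f, hf, (htail.of_rep hf).good_of_moreHigh (hdl hf) (by rw [hf.es]; exact hμ)
            (by rw [hf.ep]; exact hm) hcl hp⟩
        · obtain ⟨f, hf, hJ, cl, hcl, hp⟩ := H4 x e y e' htail hlt hμ
          exact ⟨f, hf, (htail.of_rep hf).good_of_moreMid (hdl hf) (by rw [hf.es]; exact hμ)
            (by rw [hf.ep]; exact hm) hJ hcl hp⟩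
  obtain ⟨φ, hcore, hφ⟩ := hgood
  have hpos := (htail.of_rep hf).pos
  have hfE : f.E = E := by
    rw [hE, Par.E, mul_add, hf.ep, hf.cl, hf.b]
  have hfκ : f.κ = κ := by
    have h1 := hpos.K2
    have hU := hf.U
    have hes := hpos.es
    have hfa := hpos.a
    have h0 : 0 ≤ f.N1 (fun n : ℤ => (n : ℝ)) := by
      have := mul_nonneg (sub_nonneg.2 hpos.a_le) hes.le
      have := hpos.cl
      simp only [Par.N1]; push_cast; linarith
    have h2 : (e + η) / a / e - 1 = f.N1 (fun n : ℤ => (n : ℝ)) / (f.a * f.es) := by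
      rw [← hf.es, ← hf.cl, ← hf.a]
      simp only [Par.N1]; push_cast; field_simp; ring
    rw [hκ, gain, h2, Par.κ]
    set n := f.N1 (fun n : ℤ => (n : ℝ))
    have h3 : f.K2 (fun n : ℤ => (n : ℝ)) = 10000 * (f.a * f.es) * (f.a * f.es) +
        9200 * (f.a * f.es) * n + 4267 * (n * n) := by
      simp only [Par.K2]; push_cast; rfl
    rw [h3, div_eq_div_iff (by positivity) (by positivity)]
    field_simp
    ring
  have hfD : f.D = E - t₀ * ((e + η) / a) := by
    rw [hE, ← hf.ep, ← hf.es, ← hf.cl, ← hf.a, ← hf.b, ← hf.t]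
    have h1 := hpos.a.ne'
    have h2 := hpos.b.ne'
    simp only [Par.D, Par.Yb, Par.X, Par.U3, Par.S1]
    field_simp
  rw [hfE, hf.ep] at hφ
  have hcore' := hcore
  rw [hfE, hfκ, hf.ep] at hcore'
  have hs : 0 < (e + η) / a / e - 1 := by
    have : 1 < (e + η) / a / e := by
      rw [one_lt_div he, lt_div_iff₀ ha0]; nlinarith
    linarith
  have hκ1 : κ < 1 := by
    rw [hκ, gain, div_lt_one (by positivity)]; nlinarith [sq_nonneg ((e + η) / a / e - 1)]
  have hD0 : 0 ≤ D := by
    rw [hD, hE]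
    have : (e' + η) / b - t * ((e + η) / a) = (a * (e' + η) - b * t * (e + η)) / (a * b) := by
      field_simp
    rw [this]; positivity
  refine ⟨hD0, fun M hM => ?_⟩
  refine hcore'.variance_le (hfκ ▸ hpos.κ_nonneg) hκ1 he' ?_ hD0 ?_ ?_ hy (by linarith) hφ hW hM
  · rw [← hfE, ← hf.ep]; exact hpos.le_E
  · rw [hfD, hD]
    have := mul_le_mul_of_nonneg_right ht (show 0 ≤ (e + η) / a by positivity)
    linarith
  · rw [← hfE]; exact hpos.D_le

/-! ### Ratios of volumes and the room left by the interpolation error -/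

/-- The relations among the relative position `ζ` of a radius, the two ratios of volumes, and the
interpolation error bound; `k ^ 2` is the ratio of the volumes at the ends. -/
structure Arc (k ζ α β ς : ℝ) : Prop where
  k_pos : 0 < k
  k_lt : k < 1
  ζ_nonneg : 0 ≤ ζ
  ζ_le : ζ ≤ 1
  mul : α * β = k ^ 2
  le_β : k ^ 2 ≤ β
  β_le : β ≤ 1
  chord : β - k ^ 2 ≤ ζ * (1 - k ^ 2)
  geom : k ^ (2 * (1 - ζ)) ≤ β
  err : (1 - ζ) * (1 - α) + ζ * (1 - β) ≤ ς
  err_mid : 1 - k ≤ ς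

/-- Since ρ/q is the mean of p/q and 1 with weights 1 - ζ and ζ, convexity of the d-th power gives
`chord` and the weighted AM-GM inequality gives `geom`. At ρ = √(pq) both ratios equal k, whence
`err_mid`. -/
theorem arc_of_mem {d : ℕ} (hd : 0 < d) {p q rs ρ : ℝ} (hp : 0 < p) (hpq : p < q)
    (hrs : ∀ x ∈ Set.Icc p q, gfun d p q rs ≤ gfun d p q x) (hρ : ρ ∈ Set.Icc p q) :
    Arc (√((p / q) ^ d)) ((ρ - p) / (q - p)) ((p / ρ) ^ d) ((ρ / q) ^ d) (interpErr d p q rs) := by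
  have hq : 0 < q := hp.trans hpq
  have hρ0 : 0 < ρ := hp.trans_le hρ.1
  have ht0 : 0 < (p / q) ^ d := pow_pos (div_pos hp hq) d
  have ht1 : (p / q) ^ d < 1 := pow_lt_one₀ (div_pos hp hq).le ((div_lt_one hq).2 hpq) hd.ne'
  have hk : √((p / q) ^ d) ^ 2 = (p / q) ^ d := Real.sq_sqrt ht0.le
  have hζ0 : 0 ≤ (ρ - p) / (q - p) := div_nonneg (sub_nonneg.2 hρ.1) (sub_pos.2 hpq).le
  have hζ1 : (ρ - p) / (q - p) ≤ 1 := by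
    rw [div_le_one (sub_pos.2 hpq)]; linarith [hρ.2]
  have hρq : ρ / q = (1 - (ρ - p) / (q - p)) * (p / q) + (ρ - p) / (q - p) * 1 := by
    have := (sub_pos.2 hpq).ne'
    field_simp; ring
  refine ⟨Real.sqrt_pos.2 ht0, ?_, hζ0, hζ1, ?_, ?_, ?_, ?_, ?_, interpErr_ge hpq (hrs _ hρ), ?_⟩
  · rw [Real.sqrt_lt' one_pos]; simpa using ht1
  · rw [hk, ← mul_pow]; congr 1; field_simp
  · rw [hk]
    exact pow_le_pow_left₀ (div_pos hp hq).le (div_le_div_of_nonneg_right hρ.1 hq.le) d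
  · exact pow_le_one₀ (div_pos hρ0 hq).le ((div_le_one hq).2 hρ.2)
  · rw [hk]
    have h1 := (convexOn_pow d).2 (x := p / q) (y := 1) (Set.mem_Ici.2 (div_pos hp hq).le)
      (Set.mem_Ici.2 zero_le_one) (sub_nonneg.2 hζ1) hζ0 (by ring)
    simp only [smul_eq_mul] at h1
    rw [← hρq, one_pow] at h1
    linarith
  · have h1 := Real.geom_mean_le_arith_mean2_weighted (sub_nonneg.2 hζ1) hζ0 (div_pos hp hq).le
      zero_le_one (by ring)
    rw [← hρq, Real.one_rpow, mul_one] at h1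
    have h2 := pow_le_pow_left₀ (by positivity) h1 d
    refine le_of_eq_of_le ?_ h2
    rw [Real.rpow_mul (Real.sqrt_nonneg _), Real.rpow_two, hk, ← Real.rpow_natCast,
      ← Real.rpow_natCast, ← Real.rpow_mul (div_pos hp hq).le, ← Real.rpow_mul (div_pos hp hq).le,
      mul_comm]
  · have hs : √(p * q) ^ 2 = p * q := Real.sq_sqrt (by positivity)
    have hs0 : 0 < √(p * q) := Real.sqrt_pos.2 (by positivity)
    have h1 : p ≤ √(p * q) := Real.le_sqrt_of_sq_le (by nlinarith)
    have h2 : √(p * q) ≤ q := by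
      rw [Real.sqrt_le_left hq.le]; nlinarith
    have h3 := interpErr_ge hpq (hrs _ ⟨h1, h2⟩)
    have h4 : (p / √(p * q)) ^ d = √((p / q) ^ d) := by
      symm
      rw [Real.sqrt_eq_iff_mul_self_eq ht0.le (by positivity), ← mul_pow]
      congr 1
      rw [div_mul_div_comm, ← pow_two (√(p * q)), hs]
      field_simp
    have h5 : (√(p * q) / q) ^ d = √((p / q) ^ d) := by
      symm
      rw [Real.sqrt_eq_iff_mul_self_eq ht0.le (by positivity), ← mul_pow]
      congr 1
      rw [div_mul_div_comm, ← pow_two (√(p * q)), hs]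
      field_simp
    rw [h4, h5] at h3
    linarith

/-- Thresholds for which the interpolated bounds are valid on the whole interval. -/
def Covers (k a b η : ℝ) : Prop :=
  ∀ ζ α β ς, Arc k ζ α β ς →
    (1 - α) * (1 - b * ζ * β) ≤ ς - η ∧ 1 - b * ζ * β ≤ ς - η + (1 - ζ) * a

section Forms
variable {A : Type*} [Add A] [Sub A] [Mul A]

def slackFst (c : ℤ → A) (k b η w : A) : A :=
  k * k + b * ((c 1 - k * k) * (w * w)) * (k * k + (c 1 - k * k) * w) -
    (k + η) * (k * k + (c 1 - k * k) * w)

def slackFst' (c : ℤ → A) (k b w : A) : A :=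
  k * k * (c 1 - b * (k * k + (c 1 - k * k) * w)) -
    (c 1 - b) * ((k * k + (c 1 - k * k) * w) * (k * k + (c 1 - k * k) * w))

def pow8 (s : A) : A := s * s * (s * s) * (s * s * (s * s))

def slackSnd (c : ℤ → A) (s a b η v : A) : A :=
  b * ((c 1 - v) * (pow8 s * pow8 s)) -
    (pow8 s + η - v * a) * (pow8 (v + s * (c 1 - v)) * pow8 (v + s * (c 1 - v)))

def slackNear (c : ℤ → A) (u η z : A) : A :=
  (u - η) * ((c 1 - z * u) * (c 1 - z * u)) - z * (c 1 - z) * (c 2 - u - z * u) * u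

end Forms

variable {k ζ α β ς a b η : ℝ}

/-- The chord bound replaces ζ by the smaller w with β = k² + (1 - k²)w exactly. The first
alternative uses ς ≥ 1 - k; the second, for η = 0, uses the interpolation defect at ρ itself. -/
theorem Arc.fst_le (h : Arc k ζ α β ς) (hb : 0 ≤ b)
    (hs : ∀ w ∈ Set.Icc (0 : ℝ) 1, 0 ≤ slackFst (fun n : ℤ => (n : ℝ)) k b η w ∨
      η = 0 ∧ 0 ≤ slackFst' (fun n : ℤ => (n : ℝ)) k b w) :
    (1 - α) * (1 - b * ζ * β) ≤ ς - η := by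
  obtain ⟨hk0, hk1, hζ0, hζ1, hm, hβ, hβ1, hch, -, he, he'⟩ := h
  have ht : 0 < 1 - k ^ 2 := by nlinarith
  have hβ0 : 0 < β := (pow_pos hk0 2).trans_le hβ
  have hα : α ≤ 1 := by
    refine le_of_mul_le_mul_right ?_ hβ0; linarith
  set w := (β - k ^ 2) / (1 - k ^ 2) with hw
  have hβw : k * k + (1 - k * k) * w = β := by rw [hw]; field_simp; ring
  have hw0 : 0 ≤ w := div_nonneg (sub_nonneg.2 hβ) ht.le
  have hwζ : w ≤ ζ := by rw [hw, div_le_iff₀ ht]; exact hch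
  rcases hs w ⟨hw0, hwζ.trans hζ1⟩ with h1 | ⟨rfl, h1⟩
  · simp only [slackFst, Int.cast_one] at h1
    rw [hβw] at h1
    have h2 : (1 - α) * (1 - b * ζ * β) ≤ (1 - α) * (1 - b * w * β) := by
      refine mul_le_mul_of_nonneg_left ?_ (sub_nonneg.2 hα)
      have := mul_le_mul_of_nonneg_right (mul_le_mul_of_nonneg_left hwζ hb) hβ0.le
      linarith
    have h3 : (1 - α) * (1 - b * w * β) * β ≤ (1 - k - η) * β := by
      have e1 : (1 - α) * (1 - b * w * β) * β = (β - k ^ 2) * (1 - b * w * β) := by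
        rw [← hm]; ring
      rw [e1]
      have e2 : β - k ^ 2 = (1 - k * k) * w := by linarith
      have e3 : (β - k ^ 2) * (1 - b * w * β) = β - k ^ 2 - (1 - k * k) * w * (b * w * β) := by
        rw [← e2]; ring
      rw [e3]; linarith
    linarith [le_of_mul_le_mul_right h3 hβ0]
  · simp only [slackFst', Int.cast_one] at h1
    rw [hβw] at h1
    have h2 : (1 - α) * (1 - b * β) ≤ 1 - β := by
      refine le_of_mul_le_mul_right ?_ hβ0
      have e1 : (1 - α) * (1 - b * β) * β = (β - k ^ 2) * (1 - b * β) := by rw [← hm]; ring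
      rw [e1]; linarith
    have := mul_le_mul_of_nonneg_left h2 hζ0
    linarith

/-- Only ς ≥ 1 - k and β ≥ k^(2(1-ζ)) are used. With s = k^(1/8) and v = 1 - ζ, Bernoulli's
inequality gives s ≤ s^v (v + s(1 - v)), whose 16th power is a rational lower bound for β. Passing
to the eighth root brings s close to 1, where Bernoulli is sharp. -/
theorem Arc.snd_le (h : Arc k ζ α β ς) (hb : 0 ≤ b) {s : ℝ} (hs0 : 0 < s) (hsk : s ^ 8 = k)
    (hs : 0 ≤ slackSnd (fun n : ℤ => (n : ℝ)) s a b η (1 - ζ)) :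
    1 - b * ζ * β ≤ ς - η + (1 - ζ) * a := by
  obtain ⟨hk0, hk1, hζ0, hζ1, -, hβ, hβ1, -, hg, -, he'⟩ := h
  set v := 1 - ζ with hv
  have hv0 : 0 ≤ v := sub_nonneg.2 hζ1
  have hv1 : v ≤ 1 := by linarith
  have hc : 0 < v + s * (1 - v) := by
    rcases hv0.eq_or_lt with h0 | h0
    · rw [← h0]; simpa using hs0
    · have := mul_nonneg hs0.le (sub_nonneg.2 hv1); linarith
  have h1 : s ≤ s ^ v * (v + s * (1 - v)) := by
    have h2 := rpow_one_add_le_one_add_mul_self (s := 1 / s - 1) (p := v)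
      (by linarith [one_div_pos.2 hs0]) hv0 hv1
    rw [add_sub_cancel, Real.div_rpow zero_le_one hs0.le, Real.one_rpow] at h2
    have h3 : 0 < s ^ v := Real.rpow_pos_of_pos hs0 v
    have h4 := mul_le_mul_of_nonneg_left h2 (mul_pos h3 hs0).le
    have e1 : s ^ v * s * (1 / s ^ v) = s := by field_simp
    have e2 : s ^ v * s * (1 + v * (1 / s - 1)) = s ^ v * (v + s * (1 - v)) := by
      field_simp; ring
    rw [e1, e2] at h4; exact h4
  have h2 : s ^ 16 ≤ β * (v + s * (1 - v)) ^ 16 := by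
    have h3 := pow_le_pow_left₀ hs0.le h1 16
    rw [mul_pow] at h3
    refine h3.trans (mul_le_mul_of_nonneg_right (le_of_eq_of_le ?_ hg) (pow_pos hc 16).le)
    rw [← hsk, ← Real.rpow_natCast, ← Real.rpow_natCast, ← Real.rpow_mul hs0.le,
      ← Real.rpow_mul hs0.le]
    congr 1; push_cast; ring
  simp only [slackSnd, pow8, Int.cast_one] at hs
  have h3 : (k + η - v * a) * (v + s * (1 - v)) ^ 16 ≤ b * (1 - v) * s ^ 16 := by
    rw [← hsk]; linarith
  have h4 : b * (1 - v) * s ^ 16 ≤ b * (1 - v) * (β * (v + s * (1 - v)) ^ 16) :=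
    mul_le_mul_of_nonneg_left h2 (mul_nonneg hb (sub_nonneg.2 hv1))
  have h5 : k + η - v * a ≤ b * (1 - v) * β := by
    refine le_of_mul_le_mul_right ?_ (pow_pos hc 16); linarith
  have h6 : 1 - v = ζ := by rw [hv]; ring
  rw [h6] at h5
  linarith

/-- For k near 1 Bernoulli's inequality applied to k itself suffices: k^ζ ≤ 1 - ζ(1 - k). -/
theorem Arc.snd_le_near (h : Arc k ζ α β ς)
    (hs : 0 ≤ slackNear (fun n : ℤ => (n : ℝ)) (1 - k) η ζ) :
    1 - 1 * ζ * β ≤ ς - η + (1 - ζ) * 1 := by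
  obtain ⟨hk0, hk1, hζ0, hζ1, -, hβ, hβ1, -, hg, -, he'⟩ := h
  have hc : 0 < 1 - ζ * (1 - k) := by nlinarith
  have h1 : k ^ ζ ≤ 1 - ζ * (1 - k) := by
    have := rpow_one_add_le_one_add_mul_self (s := k - 1) (p := ζ) (by linarith) hζ0 hζ1
    rw [add_sub_cancel] at this; linarith
  have h2 : k ^ 2 ≤ β * (1 - ζ * (1 - k)) ^ 2 := by
    have h3 : k ^ 2 = k ^ (2 * (1 - ζ)) * (k ^ ζ) ^ 2 := by
      rw [← Real.rpow_natCast, ← Real.rpow_natCast, ← Real.rpow_mul hk0.le, ← Real.rpow_add hk0]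
      congr 1; push_cast; ring
    have h4 : 0 < k ^ ζ := Real.rpow_pos_of_pos hk0 ζ
    rw [h3]
    exact mul_le_mul hg (pow_le_pow_left₀ h4.le h1 2) (by positivity) (by linarith [pow_pos hk0 2])
  simp only [slackNear, Int.cast_one, Int.cast_ofNat] at hs
  have h3 : ζ * (1 - β) ≤ 1 - k - η := by
    refine le_of_mul_le_mul_right ?_ (pow_pos hc 2)
    have := mul_le_mul_of_nonneg_left h2 hζ0
    linarith
  linarith

/-! ### Charts and the certified conditions -/

/-- The parameters as polynomials in `e = x`, `e' = y`. -/
def Par.less (k a b η : ℤ) : Par RE :=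
  ⟨.c 1, .x, .y, .y - .x, .milli η, .milli a, .milli b, .milli k * .milli k⟩

/-- The parameters as polynomials in `e = x`, `e' - e = y`. -/
def Par.more (k a b η : ℤ) : Par RE :=
  ⟨.c 1, .x, .x + .y, .y, .milli η, .milli a, .milli b, .milli k * .milli k⟩

/-- Certificates for the four case distinctions on the unit square; the parameters are given in
thousandths. -/
def certified (k a b η : ℤ) (c₁ c₂ c₃ c₄ : ℕ) : Bool :=
  checkRE ⟨1024, 288, 6, 6, 1, 2048⟩ ((Par.less k a b η).lessI .c) ⟨0, 1024, 0, 1024, 0, 1024⟩ c₁ &&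
  checkRE ⟨1024, 336, 9, 7, 1, 2048⟩ ((Par.more k a b η).moreLow .c) ⟨0, 1024, 0, 1024, 0, 1024⟩ c₂ &&
  checkRE ⟨1024, 176, 5, 3, 1, 2048⟩ ((Par.more k a b η).moreHigh .c) ⟨0, 1024, 0, 1024, 0, 1024⟩ c₃ &&
  checkRE ⟨1024, 488, 11, 9, 1, 2048⟩ ((Par.more k a b η).moreMid .c) ⟨0, 1024, 0, 1024, 0, 1024⟩ c₄

/-- Small `e`, with `1 - k = x`, `e = x y`, `e' = x z`. -/
def Par.nearLess : Par RE :=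
  ⟨.x, .y, .z, .z - .y, .milli 480 - .milli 600 * .x, .c 1, .c 1, (.c 1 - .x) * (.c 1 - .x)⟩

/-- Small `e`, with `1 - k = x`, `e = x y`, `e' - e = x z`. -/
def Par.nearMore : Par RE :=
  ⟨.x, .y, .y + .z, .z, .milli 480 - .milli 600 * .x, .c 1, .c 1, (.c 1 - .x) * (.c 1 - .x)⟩

/-- Large `e`, with `e = y`, `1 - k = x y`, `e' = e (1 - x z)`. -/
def Par.farLess : Par RE :=
  ⟨.y, .c 1, .c 1 - .x * .z, .c (-1) * (.x * .z), .x * (.milli 480 - .milli 600 * (.x * .y)),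
    .c 1, .c 1, (.c 1 - .x * .y) * (.c 1 - .x * .y)⟩

/-- Large `e`, with `e = y`, `1 - k = x y`, `e' = e (1 + x z)`. -/
def Par.farMore : Par RE :=
  ⟨.y, .c 1, .c 1 + .x * .z, .x * .z, .x * (.milli 480 - .milli 600 * (.x * .y)),
    .c 1, .c 1, (.c 1 - .x * .y) * (.c 1 - .x * .y)⟩

/-- The clauses in the chart for large `e`, where only `1 - k ≤ 0.12` matters. -/
def far (l : List (List RE)) : List (List RE) := [.x * .y - .milli 120] :: l

/-- There are thresholds that cover the whole interval, while the counts fail to exceed them with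
probability less than `δ / 2`. -/
def Splits (k : ℝ) : Prop :=
  ∃ a b η, 0 < a ∧ a ≤ 1 ∧ 0 < b ∧ b ≤ 1 ∧ Covers k a b η ∧
    (0 < η ∧ Dominated (k ^ 2) a b η ∨ η = 0 ∧ a < 1 ∧ b < 1 ∧
      Real.exp (-(4 / 3 * (1 / a - 1) * Real.log 2)) +
        Real.exp (-(4 / 3 * (1 / b - 1) * Real.log 2)) < 1)

/-- Certificates for `Covers`; `s₀`, `s₁` are bounds of the eighth roots in units of `1 / 1048576`. -/
def coversCertified (k₀ k₁ a b η s₀ s₁ : ℤ) (c₁ c₂ : ℕ) : Bool :=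
  checkRE ⟨1048576, 176, 5, 4, 1, 2097152⟩
    ([slackFst .c .x (.milli b) (.milli η) .y] ::
      if η = 0 then [[slackFst' .c .x (.milli b) .y]] else [])
    ⟨k₀ * 1048576 / 1000, k₁ * 1048576 / 1000 + 1, 0, 1048576, 0, 1048576⟩ c₁ &&
  checkRE ⟨1048576, 912, 25, 18, 1, 2097152⟩
    [[slackSnd .c .x (.milli a) (.milli b) (.milli η) .y]]
    ⟨s₀, s₁, 0, 1048576, 0, 1048576⟩ c₂ &&
  decide (0 < s₀ ∧ 0 < s₁ ∧ 1000 * s₀ ^ 8 ≤ k₀ * 1048576 ^ 8 ∧ k₁ * 1048576 ^ 8 ≤ 1000 * s₁ ^ 8)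

/-- The certificates for the thresholds `a P - η` and `b R - η` in the range `[k₀, k₁]`; the
parameters are given in thousandths. -/
def pieceCertified (k₀ k₁ a b η s₀ s₁ : ℤ) (c₁ c₂ c₃ c₄ c₅ c₆ : ℕ) : Bool :=
  decide (0 < k₀ ∧ 0 < a ∧ a ≤ 1000 ∧ 0 < b ∧ b ≤ 1000 ∧ 0 < η ∧
    b * k₁ ^ 2 ≤ a * 10 ^ 6 ∧
    (b * k₁ ^ 2) ^ 2 * (1000 - a + η) ≤ (a * 10 ^ 6) ^ 2 * (1000 - b + η) ∧
    3 * (a * 10 ^ 6 - b * k₀ ^ 2) ≤ 2 * 10 ^ 9) &&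
  coversCertified k₀ k₁ a b η s₀ s₁ c₅ c₆ && certified k₀ a b η c₁ c₂ c₃ c₄

section Eval
variable (x y z : ℝ)

theorem Par.eval_clauses {l : List (List RE)} {g : List (List ℝ)}
    (hl : l.map (List.map (RE.eval x y z)) = g) (h : ∃ cl ∈ l, ∀ p ∈ cl, 0 ≤ p.eval x y z) :
    ∃ cl ∈ g, ∀ p ∈ cl, 0 ≤ p := by
  obtain ⟨cl, hcl, hp⟩ := h
  refine ⟨_, hl ▸ List.mem_map_of_mem hcl, fun p hp' => ?_⟩
  obtain ⟨p', hp'', rfl⟩ := List.mem_map.1 hp'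
  exact hp p' hp''

theorem Par.eval_moreLow (f : Par RE) :
    (f.moreLow RE.c).map (List.map (RE.eval x y z)) =
      (f.map (RE.eval x y z)).moreLow (fun n : ℤ => (n : ℝ)) := rfl

theorem Par.eval_moreHigh (f : Par RE) :
    (f.moreHigh RE.c).map (List.map (RE.eval x y z)) =
      (f.map (RE.eval x y z)).moreHigh (fun n : ℤ => (n : ℝ)) := rfl

theorem eval_slackFst (k b η w : RE) : (slackFst RE.c k b η w).eval x y z =
    slackFst (fun n : ℤ => (n : ℝ)) (k.eval x y z) (b.eval x y z) (η.eval x y z)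
      (w.eval x y z) := rfl

theorem eval_slackFst' (k b w : RE) : (slackFst' RE.c k b w).eval x y z =
    slackFst' (fun n : ℤ => (n : ℝ)) (k.eval x y z) (b.eval x y z) (w.eval x y z) := rfl

theorem eval_slackSnd (s a b η v : RE) : (slackSnd RE.c s a b η v).eval x y z =
    slackSnd (fun n : ℤ => (n : ℝ)) (s.eval x y z) (a.eval x y z) (b.eval x y z) (η.eval x y z)
      (v.eval x y z) := rfl

theorem eval_slackNear (u η v : RE) : (slackNear RE.c u η v).eval x y z =
    slackNear (fun n : ℤ => (n : ℝ)) (u.eval x y z) (η.eval x y z) (v.eval x y z) := rfl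

end Eval

/-- The ratio t = k² is replaced by its lower bound (k₀/1000)², so that one certificate serves a
whole interval of k. The upper end k₁ enters only through two arithmetic side conditions. -/
theorem dominated_of_certified {k₀ k₁ a b η : ℤ} {c₁ c₂ c₃ c₄ : ℕ}
    (hc : certified k₀ a b η c₁ c₂ c₃ c₄ = true) (hk₀ : 0 < k₀) (ha0 : 0 < a) (ha : a ≤ 1000)
    (hb0 : 0 < b) (hb : b ≤ 1000) (hη : 0 < η) (hl : b * k₁ ^ 2 ≤ a * 10 ^ 6)
    (hs : (b * k₁ ^ 2) ^ 2 * (1000 - a + η) ≤ (a * 10 ^ 6) ^ 2 * (1000 - b + η))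
    (hJ : 3 * (a * 10 ^ 6 - b * k₀ ^ 2) ≤ 2 * 10 ^ 9) {k : ℝ}
    (hk : k ∈ Set.Icc ((k₀ : ℝ) / 1000) (k₁ / 1000)) :
    Dominated (k ^ 2) (a / 1000) (b / 1000) (η / 1000) := by
  simp only [certified, Bool.and_eq_true] at hc
  obtain ⟨⟨⟨h1, h2⟩, h3⟩, h4⟩ := hc
  have hk₀' : (0 : ℝ) < k₀ := by exact_mod_cast hk₀
  have ha0' : (0 : ℝ) < a := by exact_mod_cast ha0
  have hb0' : (0 : ℝ) < b := by exact_mod_cast hb0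
  have hη' : (0 : ℝ) < η := by exact_mod_cast hη
  have ha' : (a : ℝ) ≤ 1000 := by exact_mod_cast ha
  have hb' : (b : ℝ) ≤ 1000 := by exact_mod_cast hb
  have hl' : (b : ℝ) * k₁ ^ 2 ≤ a * 10 ^ 6 := by exact_mod_cast hl
  have hs' : ((b : ℝ) * k₁ ^ 2) ^ 2 * (1000 - a + η) ≤ (a * 10 ^ 6) ^ 2 * (1000 - b + η) := by
    exact_mod_cast hs
  have hJ' : 3 * ((a : ℝ) * 10 ^ 6 - b * k₀ ^ 2) ≤ 2 * 10 ^ 9 := by exact_mod_cast hJ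
  have hk0 : 0 < k := (div_pos hk₀' (by norm_num)).trans_le hk.1
  have hkk : k ^ 2 ≤ (k₁ / 1000 : ℝ) ^ 2 := pow_le_pow_left₀ hk0.le hk.2 2
  have hlk : (b : ℝ) / 1000 * k ^ 2 ≤ b * k₁ ^ 2 / 10 ^ 9 :=
    (mul_le_mul_of_nonneg_left hkk (by positivity)).trans_eq (by ring)
  have mem : ∀ {x y : ℝ}, 0 ≤ x → x ≤ 1 → 0 ≤ y → y ≤ 1 → ∀ w s r s' β,
      Mem ⟨1024, w, s, r, s', β⟩ ⟨0, 1024, 0, 1024, 0, 1024⟩ x y 0 := by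
    intro x y hx0 hx1 hy0 hy1 w s r s' β
    simp only [Mem]
    refine ⟨⟨?_, ?_⟩, ⟨?_, ?_⟩, ?_, ?_⟩ <;> push_cast <;> linarith
  have rep : ∀ {e e' : ℝ} {f : Par ℝ}, f.U = ((1 : ℤ) : ℝ) → f.es = e → f.ep = e' →
      f.dl = e' - e → f.cl = (η : ℝ) / 1000 → f.a = (a : ℝ) / 1000 → f.b = (b : ℝ) / 1000 →
      f.t = (k₀ : ℝ) / 1000 * ((k₀ : ℝ) / 1000) →
      f.Rep e e' (η / 1000) (a / 1000) (b / 1000) ((k₀ / 1000 : ℝ) ^ 2) := by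
    intro e e' f h0 h1 h2 h3 h4 h5 h6 h7
    have h0' : f.U = 1 := by rw [h0]; simp
    exact ⟨by rw [h0']; exact one_pos, by rw [h0', h1, one_mul], by rw [h0', h2, one_mul],
      by rw [h1, h2, h3], by rw [h0', h4, one_mul], h5, h6, by rw [h7]; ring⟩
  have bd : ∀ {x e y e' : ℝ}, Tail (Par.unit e e' (η / 1000) (a / 1000) (b / 1000)
      ((k₀ / 1000 : ℝ) ^ 2)) (k ^ 2) x y → 0 < e ∧ e < 1 ∧ 0 < e' ∧ e' < 1 := by
    intro x e y e' h
    have h1 := h.x_lt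
    have h2 := h.y_lt
    have h3 := h.x_nonneg
    have h4 := h.y_nonneg
    have h5 := h.pos.es
    have h6 := h.pos.ep
    simp only [Par.unit, one_mul] at h1 h2 h5 h6
    exact ⟨h5, by linarith, h6, by linarith⟩
  refine dominated_of_clauses (t₀ := ((k₀ : ℝ) / 1000) ^ 2) (by positivity) (by linarith)
    (by positivity) (by linarith) (by positivity) (by positivity)
    (pow_le_pow_left₀ (by positivity) hk.1 2) ?_ ?_ ?_ ?_ ?_ ?_
  · linarith
  · have h5 : ((b : ℝ) / 1000 * k ^ 2) ^ 2 ≤ (b * k₁ ^ 2 / 10 ^ 9) ^ 2 :=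
      pow_le_pow_left₀ (by positivity) hlk 2
    have h6 := mul_le_mul_of_nonneg_right h5
      (show (0 : ℝ) ≤ 1 - a / 1000 + η / 1000 by
        have : 0 < (η : ℝ) / 1000 := by positivity
        linarith)
    refine h6.trans ?_
    linarith
  · intro x e y e' ht hle _
    obtain ⟨he0, he1, he0', he1'⟩ := bd ht
    refine ⟨_, rep (by rfl) (by rfl) (by rfl) (by rfl) (by rfl) (by rfl) (by rfl) (by rfl),
      Par.eval_clauses _ _ _ (Par.eval_lessI e e' 0 _) (checkRE_sound h1 (mem he0.le he1.le he0'.le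
        he1'.le _ _ _ _ _))⟩
  · intro x e y e' ht hlt _
    obtain ⟨he0, he1, he0', he1'⟩ := bd ht
    refine ⟨_, rep (by rfl) (by rfl) ?_ (by rfl) (by rfl) (by rfl) (by rfl) (by rfl),
      Par.eval_clauses _ _ _ (Par.eval_moreLow e (e' - e) 0 _) (checkRE_sound h2 (mem he0.le he1.le
        (by linarith) (by linarith) _ _ _ _ _))⟩
    exact add_sub_cancel e e'
  · intro x e y e' ht hlt _
    obtain ⟨he0, he1, he0', he1'⟩ := bd ht
    refine ⟨_, rep (by rfl) (by rfl) ?_ (by rfl) (by rfl) (by rfl) (by rfl) (by rfl),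
      Par.eval_clauses _ _ _ (Par.eval_moreHigh e (e' - e) 0 _) (checkRE_sound h3 (mem he0.le he1.le
        (by linarith) (by linarith) _ _ _ _ _))⟩
    exact add_sub_cancel e e'
  · intro x e y e' ht hlt _
    obtain ⟨he0, he1, he0', he1'⟩ := bd ht
    refine ⟨_, rep (by rfl) (by rfl) ?_ (by rfl) (by rfl) (by rfl) (by rfl) (by rfl), ?_,
      Par.eval_clauses _ _ _ (Par.eval_moreMid e (e' - e) 0 _) (checkRE_sound h4 (mem he0.le he1.le
        (by linarith) (by linarith) _ _ _ _ _))⟩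
    · exact add_sub_cancel e e'
    · rw [Par.more, Par.J3]
      change ((3 : ℤ) : ℝ) * ((a : ℝ) / 1000 - (b : ℝ) / 1000 * ((k₀ : ℝ) / 1000 * (k₀ / 1000))) +
        ((1 : ℤ) : ℝ) * (e' - e) < 3
      push_cast
      linarith

/-- Here k, or its eighth root, is a coordinate of the box; the ends are rounded outwards to the
grid. -/
theorem covers_of_certified {k₀ k₁ a b η s₀ s₁ : ℤ} {c₁ c₂ : ℕ}
    (hc : coversCertified k₀ k₁ a b η s₀ s₁ c₁ c₂ = true) (hk₀ : 0 < k₀) (hb0 : 0 < b) {k : ℝ}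
    (hk : k ∈ Set.Icc ((k₀ : ℝ) / 1000) (k₁ / 1000)) :
    Covers k (a / 1000) (b / 1000) (η / 1000) := by
  simp only [coversCertified, Bool.and_eq_true, decide_eq_true_eq] at hc
  obtain ⟨⟨h1, h2⟩, hs0, hs0', hs1, hs2⟩ := hc
  have hb0' : (0 : ℝ) < b := by exact_mod_cast hb0
  have hk₀' : (0 : ℝ) < k₀ := by exact_mod_cast hk₀
  have hk0 : 0 < k := (div_pos hk₀' (by norm_num)).trans_le hk.1
  intro ζ α β ς h
  constructor
  · refine h.fst_le (by positivity) fun w hw => ?_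
    have h3 : Mem ⟨1048576, 176, 5, 4, 1, 2097152⟩
        ⟨k₀ * 1048576 / 1000, k₁ * 1048576 / 1000 + 1, 0, 1048576, 0, 1048576⟩ k w 0 := by
      have e1 : ((k₀ * 1048576 / 1000 : ℤ) : ℝ) ≤ k₀ * 1048576 / 1000 := by
        rw [le_div_iff₀ (by norm_num)]
        exact_mod_cast Int.ediv_mul_le (k₀ * 1048576) (by norm_num : (1000 : ℤ) ≠ 0)
      have e2 : (k₁ : ℝ) * 1048576 / 1000 ≤ ((k₁ * 1048576 / 1000 + 1 : ℤ) : ℝ) := by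
        rw [div_le_iff₀ (by norm_num)]
        exact_mod_cast (Int.lt_ediv_add_one_mul_self (k₁ * 1048576) (by norm_num : (0 : ℤ) < 1000)).le
      have hk1 := hk.1
      have hk2 := hk.2
      have hw1 := hw.1
      have hw2 := hw.2
      simp only [Mem]
      generalize (k₀ * 1048576 / 1000 : ℤ) = A at *
      generalize (k₁ * 1048576 / 1000 + 1 : ℤ) = C at *
      refine ⟨⟨?_, ?_⟩, ⟨?_, ?_⟩, ?_, ?_⟩ <;> push_cast <;> linarith
    obtain ⟨cl, hcl, hp⟩ := checkRE_sound h1 h3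
    rw [List.mem_cons] at hcl
    rcases hcl with rfl | hcl
    · left
      have := hp _ (List.mem_singleton.2 rfl)
      rw [eval_slackFst] at this
      exact this
    · right
      split_ifs at hcl with hη
      · rw [List.mem_singleton] at hcl
        subst hcl
        have := hp _ (List.mem_singleton.2 rfl)
        rw [eval_slackFst'] at this
        exact ⟨by simp [hη], this⟩
      · simp at hcl
  · set s := k ^ ((1 : ℝ) / 8) with hs
    have hspos : 0 < s := Real.rpow_pos_of_pos hk0 _
    have hs8 : s ^ 8 = k := by
      rw [hs, ← Real.rpow_natCast, ← Real.rpow_mul hk0.le]; norm_num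
    refine h.snd_le (by positivity) hspos hs8 ?_
    have hs1p : (0 : ℝ) < s₁ := by exact_mod_cast hs0'
    have hs0r : (0 : ℝ) < s₀ := by exact_mod_cast hs0
    have hs1r : 1000 * (s₀ : ℝ) ^ 8 ≤ k₀ * 1048576 ^ 8 := by exact_mod_cast hs1
    have hs2r : (k₁ : ℝ) * 1048576 ^ 8 ≤ 1000 * (s₁ : ℝ) ^ 8 := by exact_mod_cast hs2
    have hs3 : (s₀ : ℝ) ≤ s * 1048576 := by
      refine le_of_pow_le_pow_left₀ (n := 8) (by norm_num) (by positivity) ?_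
      rw [mul_pow, hs8]
      have := mul_le_mul_of_nonneg_right hk.1 (show (0 : ℝ) ≤ 1048576 ^ 8 by positivity)
      linarith
    have hs4 : s * 1048576 ≤ s₁ := by
      refine le_of_pow_le_pow_left₀ (n := 8) (by norm_num) hs1p.le ?_
      rw [mul_pow, hs8]
      have := mul_le_mul_of_nonneg_right hk.2 (show (0 : ℝ) ≤ 1048576 ^ 8 by positivity)
      linarith
    have h3 : Mem ⟨1048576, 912, 25, 18, 1, 2097152⟩ ⟨s₀, s₁, 0, 1048576, 0, 1048576⟩ s (1 - ζ) 0 := by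
      have := h.ζ_nonneg
      have := h.ζ_le
      simp only [Mem]
      refine ⟨⟨?_, ?_⟩, ⟨?_, ?_⟩, ?_, ?_⟩ <;> push_cast <;> linarith
    obtain ⟨cl, hcl, hp⟩ := checkRE_sound h2 h3
    rw [List.mem_singleton] at hcl
    subst hcl
    have := hp _ (List.mem_singleton.2 rfl)
    rw [eval_slackSnd] at this
    exact this

theorem splits_of_certified {k₀ k₁ a b η s₀ s₁ : ℤ} {c₁ c₂ c₃ c₄ c₅ c₆ : ℕ}
    (h : pieceCertified k₀ k₁ a b η s₀ s₁ c₁ c₂ c₃ c₄ c₅ c₆ = true) {k : ℝ}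
    (hk : k ∈ Set.Icc ((k₀ : ℝ) / 1000) (k₁ / 1000)) : Splits k := by
  simp only [pieceCertified, Bool.and_eq_true, decide_eq_true_eq] at h
  obtain ⟨⟨⟨hk₀, ha0, ha, hb0, hb, hη, hl, hs, hJ⟩, h1⟩, h2⟩ := h
  have ha0' : (0 : ℝ) < a := by exact_mod_cast ha0
  have hb0' : (0 : ℝ) < b := by exact_mod_cast hb0
  have hη' : (0 : ℝ) < η := by exact_mod_cast hη
  have ha' : (a : ℝ) ≤ 1000 := by exact_mod_cast ha
  have hb' : (b : ℝ) ≤ 1000 := by exact_mod_cast hb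
  exact ⟨a / 1000, b / 1000, η / 1000, by positivity, by linarith, by positivity, by linarith,
    covers_of_certified h1 hk₀ hb0 hk, Or.inl ⟨by positivity,
      dominated_of_certified h2 hk₀ ha0 ha hb0 hb hη hl hs hJ hk⟩⟩

/-- `Splits` holds on an interval given in thousandths. -/
def SplitsOn (k₀ k₁ : ℤ) : Prop := ∀ k : ℝ, k ∈ Set.Icc ((k₀ : ℝ) / 1000) (k₁ / 1000) → Splits k

theorem SplitsOn.trans {k₀ k₁ k₂ : ℤ} (h : SplitsOn k₀ k₁) (h' : SplitsOn k₁ k₂) :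
    SplitsOn k₀ k₂ := fun k hk =>
  (le_total k (k₁ / 1000)).elim (fun hl => h k ⟨hk.1, hl⟩) fun hl => h' k ⟨hl, hk.2⟩

/-- In each application the six long numerals encode the subdivisions for `lessI`, `moreLow`,
`moreHigh`, `moreMid`, `slackFst` and `slackSnd`, in this order. -/
theorem splitsOn_of_certified {k₀ k₁ a b η s₀ s₁ : ℤ} {c₁ c₂ c₃ c₄ c₅ c₆ : ℕ}
    (h : pieceCertified k₀ k₁ a b η s₀ s₁ c₁ c₂ c₃ c₄ c₅ c₆ = true) : SplitsOn k₀ k₁ :=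
  fun _ hk => splits_of_certified h hk

/-! ### Certificates for k between 0.309 and 0.882 -/

theorem splitsOn_309 : SplitsOn 309 339 :=
  splitsOn_of_certified (show pieceCertified 309 339 447 746 5 905407 915958
    32879520619406671573073126468994784852097990683787418742722938256660568740191011088
    611282202173158645612863956568718259793512255917042292984481617604910437630224
    3
    105132304
    3518403515153 53678385 = true by decide +kernel)

theorem splitsOn_339 : SplitsOn 339 369 :=
  splitsOn_of_certified (show pieceCertified 339 369 495 739 10 915955 925718
    456294998928267674581214240383902192572924380893772823801589989648
    2387834905731594954791241916129793716697068130095755960409597513040745464080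
    3
    26915049744
    900719352943377 209201 = true by decide +kernel)

theorem splitsOn_369 : SplitsOn 369 399 :=
  splitsOn_of_certified (show pieceCertified 369 399 543 729 14 925715 934808
    3371635549785601889727541977523604138148050654480099981034710786142110744833
    624093420899032619144947607068575984614867296513290816036610543597773331929338776416243837255003668497
    3
    1380925146389078345025392897
    3518401549073 817 = true by decide +kernel)

theorem splitsOn_399 : SplitsOn 399 429 :=
  splitsOn_of_certified (show pieceCertified 399 429 594 719 18 934805 943317
    3619732391462345922776381364478074051111664930602253958021164737918070876162129677779201
    212182001241875735419063629713429290678440967622410503198645496841343118647996591801985535406084916632113284431790978823645366577180520218641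
    3
    22196900091693218511257340140851217
    3518401549073 209681 = true by decide +kernel)

theorem splitsOn_429 : SplitsOn 429 459 :=
  splitsOn_of_certified (show pieceCertified 429 459 637 751 28 943314 951321
    43084103114269079290098549367305448102602502975012405523236506776330639166946034298924900899827218331956083072827392257
    2602960078407299498684897953846766021008917642343624584639951645457614801827875391647092330230968316937319219457
    1073
    86548804097482177651047732936977
    3518401549073 53678865 = true by decide +kernel)

theorem splitsOn_459 : SplitsOn 459 485 :=
  splitsOn_of_certified (show pieceCertified 459 485 676 771 36 951318 957896
    13548902589472227437682747553794138146325154274497703542125219271433616935858134115819991176228677180972474692631030417035087805622623579407384833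
    2603253646230146227838384138921186831488231595595479722844401722308790530610677265630106663329590830714549436673
    279313
    5672184119790213904587098986876305681
    13741789969 209681 = true by decide +kernel)

theorem splitsOn_485 : SplitsOn 485 507 :=
  splitsOn_of_certified (show pieceCertified 485 507 712 771 40 957893 963222
    976301322451620349263940640069644224781696655539840803705149805732460652732856645687809807563474186214003713298642722581933907558857346548283668849162042171457793
    155192255852485675905264223607366373072914788207467546071952065599285997760673180627330640634822002737409
    279313
    22153998161836237044148506107842833
    3517898232593 53678865 = true by decide +kernel)

theorem splitsOn_507 : SplitsOn 507 525 :=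
  splitsOn_of_certified (show pieceCertified 507 525 737 788 46 963219 967432
    63996219320258600050860882570481097712416381152319007521965152965706051129352602467460977787668939731336131386723462986200714212445714036060935869822174494309884100865
    2861853743008612957634648853899296768697730869405653249242170977487761178082305203917025738656489804951160573187436027314433
    279313
    5671423490626551872160301713901752593
    3517898232593 53678865 = true by decide +kernel)

theorem splitsOn_525 : SplitsOn 525 539 :=
  splitsOn_of_certified (show pieceCertified 525 539 752 812 52 967429 970620
    14875193715484728093775591271768505200557188667885267793074421948834644094567108235654328945131160839252873768716041378750406109060334042524862175893267874049
    2861853742968347422035621250256782357110520990814871368031169931661986448182457496604432099882172061457788294198936251400449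
    71577873
    86539054715505038952983221506321
    3517898232593 53678865 = true by decide +kernel)

theorem splitsOn_539 : SplitsOn 539 553 :=
  splitsOn_of_certified (show pieceCertified 539 553 767 828 56 970617 973736
    1071870669985935664642964181047792100489988487255506880580859523061077288229571937722686335386613729467338202033084838716464522102908209110893246517211647552986787164619735297
    732642234352078968935507374207520871316296492042354363389499191695178520209607413286757731336565260167146885534387912184955137
    71577873
    86539054715505038946390446706961
    3517898232593 53678865 = true by decide +kernel)

theorem splitsOn_553 : SplitsOn 553 565 :=
  splitsOn_of_certified (show pieceCertified 553 565 775 858 62 973733 976352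
    19752404524156736736031064693332535511734848416810573663567694874101918508099645536080617900251388775658090546448959360619329898818523488244466166588437995464481212597446950142260877977789333761
    10167453633373606904198662751372507104347687577743841449172480286525951858709787779671217757637354969110675713
    18325115153
    5158086405151907534410001
    3517898232593 209681 = true by decide +kernel)

theorem splitsOn_565 : SplitsOn 565 579 :=
  splitsOn_of_certified (show pieceCertified 565 579 796 850 62 976349 979344
    331697266635071816053792186391909225313636027196986996415405008764208464427758531919583734537592320935415769431246718520886676392029691635822409247508584357198321806609591306356266781936362781274210561
    2602868130143643367475381882139725785681834958450842693348055545102045396295368499431596581271073529438410899713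
    18325115153
    86539054715505038946390446706961
    3517898232593 53678865 = true by decide +kernel)

theorem splitsOn_579 : SplitsOn 579 591 :=
  splitsOn_of_certified (show pieceCertified 579 591 804 872 66 979341 981859
    5564956690050197591083429508870451479675661133247085827411005369167577614642843711416645013109917827234735946640074130558588091157055371347966136349751995125022952799095469457783825452565296706277854435016961
    10167245167941646634252385197935147008943263191357496159975011100776381000518947836144125591791284292000153857
    18325115153
    1320481187836162479721812241
    13741789969 209681 = true by decide +kernel)

theorem splitsOn_591 : SplitsOn 591 605 :=
  splitsOn_of_certified (show pieceCertified 591 605 820 878 68 981856 984736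
    1866225673388358979971458561144590843645084298003534453300983462511380398377381822890559902171614354947061115458964157882596187830185518415316568858072499631562370356454339374048036187859963562373751222505829599203120356563099586430441927537262849
    168115444268620892417014391221097929345079510905606502330687993920733856871259575766307253697557106061052268731433217
    18325115153
    86538283981472493015259922043153
    3517898232593 53678865 = true by decide +kernel)

theorem splitsOn_605 : SplitsOn 605 619 :=
  splitsOn_of_certified (show pieceCertified 605 619 829 901 72 984733 987556
    41618223225190025441327101144637966658184939608854079974604863359627794456259038032518305646211509976406995288932497416916088596472967243968617559955534843105250437541075761111580089092134423881036638292260614935696699625763210732853903194389361577846523722351966244092072459008701195354369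
    14645744110109056105523095989495027440458487676425733575534270399297463612139431916032811546817753070033733800272727232905895234060242342025446660807338230017
    1200959578636561
    95149849045176790894345352929498301057732881
    3517898232593 817 = true by decide +kernel)

theorem splitsOn_619 : SplitsOn 619 633 :=
  splitsOn_of_certified (show pieceCertified 619 633 841 912 74 987553 990321
    162571225439280048370319231146993264484353457563520887538161038824056178562941115333424126103627524233870350038144791256376157064676768312248364559425138589938844491445111117874412439516315333648285680860324706660336353540949699627447216565046871110772487716796068374753891715532213715201
    3749310492187918363014470785450986050849314725849445782819156818785158544977990754977370486958615875533750367596766341970464082476360174692030598753604039868673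
    78706669674592141585
    95149849045176790894345352954146048922620177
    13741789969 817 = true by decide +kernel)

theorem splitsOn_633 : SplitsOn 633 649 :=
  splitsOn_of_certified (show pieceCertified 633 649 861 908 74 990318 993416
    477753345644673186225358370682211800928183287408818994688439936098819065118356501647924560645888399492655833688807422963688036962138451665220845870333135829225102650631443521383201873814834017720286357911133144137696642718520979940888416312380883201
    14644906122113434247716183806271229528584266892269790922990917138046078460141110410995508801957328295677782677117302435560805171189508018730974255197013934337
    1200959578636561
    5671372979012954598456966505778123025
    13741789969 209681 = true by decide +kernel)

theorem splitsOn_649 : SplitsOn 649 667 :=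
  splitsOn_of_certified (show pieceCertified 649 667 868 938 78 993413 996819
    45759679481686582651956809543349818566117585676560916804520980376422662063864567666170461943734757107100450140852463133014296746478814222810967449683915749803948101765389086019685196783204066843741342858347778896772541570227905645945546325645338711361692104051558234021028359496596515273747655136641281
    2050170359207176186540417259997603935651920929935686844555295782441055324710671157879204672321792134519169244835056816599131802126215234405369500710897710170877470550159810451741989842858745366350751455463612429605982468506781198431249022381740823129821806849
    78706669674592141585
    24358372202144889499905350424975192106465235217
    3517898232593 817 = true by decide +kernel)

theorem splitsOn_667 : SplitsOn 667 685 :=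
  splitsOn_of_certified (show pieceCertified 667 685 884 942 78 996816 1000143
    2480782900702140845200471164729393774856964939958012961743554786615978894552061780563609055861159315856715879962455033943506944063182838793090696377069965562700356891827680716028179276147624570208826903513733353681150979621586451696910240310687633064325049823581884085968634677035265
    1402783491058566465092185899332268888300725032160612536110532546882285742696164646956122252387870549030089115583708993368196596905117544769314889271956675335919770924134520861292882518941868994962550539130241041
    78706704790244753681
    371679263338392478941426855796688575070481
    3517898232593 817 = true by decide +kernel)

theorem splitsOn_685 : SplitsOn 685 705 :=
  splitsOn_of_certified (show pieceCertified 685 705 898 952 78 1000140 1003747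
    11711799053809096297638139324777695351621053984669117681137582318714665464660029726374849046604936041608055083690627418604079244797051697712455718228637401152910800100518541442461066474203537150196861893742678086464997812033555925969165421743450067971569732618779913383803507928235876708248044780030787841
    21404772605642557795048447743224565406201882503517733129062747783325317201145137183050559371123371094204772849490838825151250472200289475333481488763263480180465624909055566685971639279753557820714573103121
    78706669674592141585
    24358371521585348380621524455562035808081871121
    13741789969 817 = true by decide +kernel)

theorem splitsOn_705 : SplitsOn 705 725 :=
  splitsOn_of_certified (show pieceCertified 705 725 906 970 78 1003744 1007263
    50301793913943599213356114266433132801028274511518358187712359820997489835632574000233795544211608479004769794958579552078522716865416174109791369614123382625066755768294515835589720244934556852267176186009026257586985660289784992165814548476873363610267900830335433159736352821559798342167519846210531652199776513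
    3294496749321645161503113102178146173135136088813983923359647516988743854704488673433106574451455966078197856901382253529430949101933082192295890997733074865830043064977377474661396618744456587391007249486917031781416011663447735342697660091210114775724063573599706610471439772883086763646109961814340115849474475032593
    78706669674592141585
    1596350238824493525547397943925521632657772619301137
    13741789969 209201 = true by decide +kernel)

theorem splitsOn_725 : SplitsOn 725 747 :=
  splitsOn_of_certified (show pieceCertified 725 747 919 980 77 1007260 1011034
    843924062504709037478246865944412246373131461397500458188810179672613342547097232420573258776504654481204096024288516335409661344403757371343340925849282169967686040736825768259705496196676563422075428398435853687851587012543019357515031758453222289631422909699895890122260942616143898583146630270262248663988834959098113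
    2725143837592096774883622246010395890395731532307863810222912699636469627149038806548059618349233205806845834460373258963522156415725392801281176747077429742276210570167109364839949576873218140826227499596706909237488535417133565810232475798532604670387497788598287563424071093157550809500614673
    78706669674592141585
    1755217419156279099064951160070239937121630430676608914393465105
    13741789969 209201 = true by decide +kernel)

theorem splitsOn_747 : SplitsOn 747 769 :=
  splitsOn_of_certified (show pieceCertified 747 769 928 993 75 1011031 1014709
    56081298673817376607581368903320905785282297581609982107266517339948173140035740928019516156764277347809704319471166974843529289328089365504859274607404845402336660670863161785817444759382320323988623909454185187449329383532120318418820479944052432233596236378423541164005960835681785803224135890915123860276202731946720100609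
    36538197488217516191492619853894107890413867868148930713731036810050978224186859671830939833188087326660707527120673848806879724910384810444244508154294602049822696728615640134709773332087578488901923674323430939419400192090422723492963966429622730870299556228634494180694568720483166717438136065472446597859874764299266129119349735303012441006379001505625269913318581863051364637027747712884363858637682508458683222612361942743851918724284065775633
    78706669674592141585
    449335659304007536772188584274803971956779336824964613173164441873
    13741789969 209201 = true by decide +kernel)

theorem splitsOn_769 : SplitsOn 769 789 :=
  splitsOn_of_certified (show pieceCertified 769 789 933 1000 70 1014706 1017970
    11886557622803661648014158208971208824511019369906971393893001815468570237515272310203690623997473430782380107734336780836174245097300342023654244483610321287501583351663715968541460613060017995827518733478248228646146876518111597625389338713455872739616412282657665556971956246057432361862441182189060353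
    237393456051373097302799319433364189033758148165999144366894430263471157153838844783485971506032003390558936706282230979757290787760299608040126628794026386056318015659829020364888604590958182845569695779126618674671661781805577962190689442089142030889021736831198462884842145035632988226655617106236036620099901944135061292554851975185
    78706669674592141585
    7538601447902058956884667748350441998387181703059437757664749807527330065
    209681 209201 = true by decide +kernel)

theorem splitsOn_789 : SplitsOn 789 807 :=
  splitsOn_of_certified (show pieceCertified 789 807 946 1000 68 1017967 1020845
    37851520786755430421541341181611252279856481003453352417663901657112090816011299537091405827578990864557008692409374992948991788276069917032868800959538107511301738426881613371298506170152833077867954476327583309358536169902889392757321002595072514897556668673179170496525107457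
    959768281026113205866356139078350587034022563229371321316573805789498207132444721695059652753661487656149670977555478822991802910847247023572328596668009103228945
    307445652618674449
    408665674430314735398255145201072153241368190021271825
    53678865 53678385 = true by decide +kernel)

theorem splitsOn_807 : SplitsOn 807 823 :=
  splitsOn_of_certified (show pieceCertified 807 823 948 1000 61 1020842 1023353
    8813006978704902022251824117672495903255110035853945007090214397229794356924847735908938212108406602661605951622521090259447510224833672457700990222950425429598461789598216793981779483186606569779896557636698162947760300879559633195839614447858545815837322970385088769
    203239581283886505588668142776543201043337989111057954766289786514905219438612870995990478071073624006226537453921736958507031744939095556113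
    307445652618674449
    1755205836551163154872113999428215563068897762140260906045538577
    817 53678385 = true by decide +kernel)

theorem splitsOn_823 : SplitsOn 823 837 :=
  splitsOn_of_certified (show pieceCertified 823 837 961 997 59 1023350 1025513
    111210995126868217965881781787867439602846980198002131926680024388903077132920968133230652243562417227204387419895625900541446989798318901345594770347977764883758785894091793056570756214295937943413918880166636576148349907388879604198408449
    597277683043021991152764223546673688933076693723671430659551240973357654296532950625894570034198544401
    78706085777566273553
    2121916195032027578004788816402815301191861568109409189397097311579559763816194934575121
    817 817 = true by decide +kernel)

theorem splitsOn_837 : SplitsOn 837 849 :=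
  splitsOn_of_certified (show pieceCertified 837 849 965 1000 57 1025510 1027340
    124297557131037498734509657570762670066640274190454388228892486532162065877529378195441706235358695957769652200387392744824657822318526206113993859173667524718651606040607856048334316161201430841820886183505237452013366284105025730707465209426448744705
    139064547382998267007767448958727196655964423176195150165139528271784002299165541990060326929
    78706085777566273553
    115030128569635597889879001581524778612759117861462972040263622529041
    817 209201 = true by decide +kernel)

theorem splitsOn_849 : SplitsOn 849 859 :=
  splitsOn_of_certified (show pieceCertified 849 859 967 1000 53 1027337 1028844
    124297557131037498734509657571498327192179568639209120678445205109312243858408979399581957178212473042066173178974761402571180315224349668209529420709533356950167142533921535866934158545382533636273964238420272352498926722902212899255201261108304281857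
    32378140626112052061586791515907439623521595790783996252102594053290700219695038481
    78706085777566273553
    115032320511871072314272653791723628379513507744508240371670760624145
    817 209201 = true by decide +kernel)

theorem splitsOn_859 : SplitsOn 859 866 :=
  splitsOn_of_certified (show pieceCertified 859 866 979 993 53 1028841 1029889
    1771465984502707618691035339626463230308813307466857387396932882495578803128288949239395441513628648057118998840840433832139737359679877764512735811839199352215256945559569952676458344280583082711373109869415285172551054159661071597825
    32378140626112052061581650566613714423006050423041484610462999451137601187178614801
    307444423472648209
    115032320443912462446859080862253964856362183498479310145029141434385
    53678865 817 = true by decide +kernel)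

theorem splitsOn_866 : SplitsOn 866 873 :=
  splitsOn_of_certified (show pieceCertified 866 873 981 993 50 1029886 1030926
    29720267458654578303625137156546532930944186620928133928183985825656994869805684188135793282340524950274167712168473779171741097156341271897742199757870352743043443251469530645308359042444497341355468126099471453266176012957046579096414322945
    494051218049805481896692666093158246993459161694906250644396668376961878331409
    307444423472648209
    104621285976384081047271069798665027891102638373021421585
    817 817 = true by decide +kernel)

theorem splitsOn_873 : SplitsOn 873 882 :=
  splitsOn_of_certified (show pieceCertified 873 882 980 999 48 1030923 1032248
    498623346731618929588832509105006997033563702883623209120199627529746891923148276816412919894684960815624418907246097820999845238632342977571417050878589632252638469063454006887278985758068412464486941434181873925630227919373371373297201332265943297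
    7538623322293174467417795808306225249204524427322688279588982578225348881
    307444423472648209
    6235914586566929879621927130142739569084936032273
    209681 209201 = true by decide +kernel)

theorem splitsOn_mid : SplitsOn 309 882 :=
  splitsOn_309.trans <|
  splitsOn_339.trans <|
  splitsOn_369.trans <|
  splitsOn_399.trans <|
  splitsOn_429.trans <|
  splitsOn_459.trans <|
  splitsOn_485.trans <|
  splitsOn_507.trans <|
  splitsOn_525.trans <|
  splitsOn_539.trans <|
  splitsOn_553.trans <|
  splitsOn_565.trans <|
  splitsOn_579.trans <|
  splitsOn_591.trans <|
  splitsOn_605.trans <|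
  splitsOn_619.trans <|
  splitsOn_633.trans <|
  splitsOn_649.trans <|
  splitsOn_667.trans <|
  splitsOn_685.trans <|
  splitsOn_705.trans <|
  splitsOn_725.trans <|
  splitsOn_747.trans <|
  splitsOn_769.trans <|
  splitsOn_789.trans <|
  splitsOn_807.trans <|
  splitsOn_823.trans <|
  splitsOn_837.trans <|
  splitsOn_849.trans <|
  splitsOn_859.trans <|
  splitsOn_866.trans <|
  splitsOn_873

/-! ### Ratios k close to 1 -/

theorem near_less : checkRE ⟨512, 344, 13, 6, 6, 4096⟩
    (Par.nearLess.lessI .c) ⟨0, 64, 0, 2048, 0, 2048⟩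
    95218182854616812801304741570080064215287205754549605028913711769666406942489583440049465419724397709846466786670995886464211629855519215029954239453397409667921286136403390902249182428215425648230232715080968024156705442309363865144467597328567640353 = true := by decide +kernel

/-- In the chart e ≤ 4u the coordinates u and e/u range up to 1/8 and 4. The third one, (e' - e)/u,
needs only 5/4 below the middle (`Tail.sub_le_of_low`) and 6 above it (`Tail.sub_le_of_high`). -/
theorem near_moreLow : checkRE ⟨512, 384, 13, 9, 7, 4096⟩
    (Par.nearMore.moreLow .c) ⟨0, 64, 0, 2048, 0, 640⟩
    371294601236546628733861614135895980052753 = true := by decide +kernel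

theorem near_moreHigh : checkRE ⟨512, 200, 7, 5, 3, 6144⟩
    (Par.nearMore.moreHigh .c) ⟨0, 64, 0, 2048, 0, 3072⟩
    3447255872739411636678162436252646087896867890436142205113082292092387983368611607211586079318412312181096190436966517844302203292768951156120683026 = true := by decide +kernel

theorem near_moreMid : checkRE ⟨512, 484, 17, 11, 9, 6144⟩
    (Par.nearMore.moreMid .c) ⟨0, 64, 0, 2048, 0, 3072⟩
    1774916636973075264623975589775474264181813478945644913741672482 = true := by decide +kernel

/-- In the chart e ≥ 4u the coordinate u/e is at most 1/4 and e is at most 1, while the difference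
of the deviations is measured in units of u. -/
theorem far_less : checkRE ⟨256, 424, 16, 13, 6, 2048⟩
    (far (Par.farLess.lessI .c)) ⟨0, 64, 0, 256, 0, 1024⟩
    1072739008638756112178803184620719951328434687521578501149337000202739990806503658373848786875562899787917172287125646898336587010349583384581718616648182806390144324022245676670818496103669164695779653003725138121978281204934239776129397802981692846990366697447591111877884983413589608202419261335438373383228807655291938401217645285378569988848560403194161222117753826625025965816739019554518520040325162644994152452701851158723258818074538775131014300178 = true := by decide +kernel

theorem far_moreLow : checkRE ⟨256, 424, 15, 13, 7, 2048⟩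
    (far (Par.farMore.moreLow .c)) ⟨0, 64, 0, 256, 0, 320⟩
    180310638192793356696901760588440440692674578676688691689414930172877416129249526590423203767729781857805218010110295744623936173070844448417052784645986744739161412140574725971275464413513568268722115729712392613499264142891891856955007943675836250852383542011366348438115329 = true := by decide +kernel

theorem far_moreHigh : checkRE ⟨256, 236, 9, 7, 3, 3072⟩
    (far (Par.farMore.moreHigh .c)) ⟨0, 64, 0, 256, 0, 1536⟩
    1377873058769720668428196464865617508752867027063487385450519189138552265571571944802629106634764693333110665350003458705253100450643178222205341013856039787470690387201114880002602670991520350498456784284672090039582340033836237175560383899630092537499434532476565710265110094379696580894972382478217432576776235802262052660364462299766294070482103650428224824597953286269215980067489707041380495653681420056516021309810608740998347675924238141294814392768903873089604201871195006715470718315289185537909100946160678899415180644351099130423290861219984983932492745160847451661828697803387350508887479226410051817763436589161389833068996528211414579091459626300509140138494266475625590816087433263467669320054627380689828112198177753044230039364261095454314702709691626980123719407357698774044757143535381355016330412265881595711367945796657172945980969424770103517971323678830926371128045081295487742592544932975930109192278649596379382558258673625130163257552734047511345347749134798975940921815681053000267775656328423870775307726348972779790666267825510256225596973466719286634947368058616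9197276820089564654107695663329092664478133982847733270084196805724001671876305349394155562032838389516786120088685067902374188296052079448754410813157670282443911730007976318631629033247669961401838088105019253968521205959414635949484035068392541985290456076359359625817549198535740957782522595056107077417049316815142182291871702641431389930313448293812987700309657001727726260721662099939781034472861098326305879037690392655888590427806631885917911366341535056863073526653611115150661603506567376030730574751694059689288804790729924148000762276139360537840468383503508048116929668644475315476916639871103214243519228829393509448424760210051154610665043027077797534572051621046380915258092506678607814775417837557229986850414848455185285011337990426639699857400542446267372157811005386007630918019635130378356727456200723811807826996781693554635696676329449969467029091679922227862802808979291785845762322081385485573514467289894351961194285753736957796608 = true := by decide +kernel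

theorem far_moreMid : checkRE ⟨256, 576, 21, 17, 9, 3072⟩
    (far (Par.farMore.moreMid .c)) ⟨0, 64, 0, 256, 0, 1536⟩
    315207036535512165563566146296053200332579194390579024600168332954149133336988101219529128253037296018556749364620841566854494790196824066397848736967555175246448762404068743294977346239832565776714091669632379542654524909235337498764699693648607478612891789992714805209680984865310787474065508652907285816010056905883338114159591250535450190721467133963802450629784025720985819747984126902379719574815903871404429996078345073975440357537555754864994014695881009881059546122464971421828503393469798319165898902227526144 = true := by decide +kernel

section Eval
variable (x y z : ℝ)

theorem Par.map_nearLess : Par.nearLess.map (RE.eval x y z) =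
    ⟨x, y, z, z - y, ((480 : ℤ) : ℝ) / 1000 - ((600 : ℤ) : ℝ) / 1000 * x, ((1 : ℤ) : ℝ),
      ((1 : ℤ) : ℝ), (((1 : ℤ) : ℝ) - x) * (((1 : ℤ) : ℝ) - x)⟩ := rfl

theorem Par.map_nearMore : Par.nearMore.map (RE.eval x y z) =
    ⟨x, y, y + z, z, ((480 : ℤ) : ℝ) / 1000 - ((600 : ℤ) : ℝ) / 1000 * x, ((1 : ℤ) : ℝ),
      ((1 : ℤ) : ℝ), (((1 : ℤ) : ℝ) - x) * (((1 : ℤ) : ℝ) - x)⟩ := rfl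

theorem Par.map_farLess : Par.farLess.map (RE.eval x y z) =
    ⟨y, ((1 : ℤ) : ℝ), ((1 : ℤ) : ℝ) - x * z, ((-1 : ℤ) : ℝ) * (x * z),
      x * (((480 : ℤ) : ℝ) / 1000 - ((600 : ℤ) : ℝ) / 1000 * (x * y)), ((1 : ℤ) : ℝ),
      ((1 : ℤ) : ℝ), (((1 : ℤ) : ℝ) - x * y) * (((1 : ℤ) : ℝ) - x * y)⟩ := rfl

theorem Par.map_farMore : Par.farMore.map (RE.eval x y z) =
    ⟨y, ((1 : ℤ) : ℝ), ((1 : ℤ) : ℝ) + x * z, x * z,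
      x * (((480 : ℤ) : ℝ) / 1000 - ((600 : ℤ) : ℝ) / 1000 * (x * y)), ((1 : ℤ) : ℝ),
      ((1 : ℤ) : ℝ), (((1 : ℤ) : ℝ) - x * y) * (((1 : ℤ) : ℝ) - x * y)⟩ := rfl

theorem exists_of_far {l : List (List RE)} (hxy : x * y < 3 / 25)
    (h : ∃ cl ∈ far l, ∀ p ∈ cl, 0 ≤ p.eval x y z) : ∃ cl ∈ l, ∀ p ∈ cl, 0 ≤ p.eval x y z := by
  obtain ⟨cl, hcl, hp⟩ := h
  rw [far, List.mem_cons] at hcl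
  rcases hcl with rfl | hcl
  · have h1 : 0 ≤ x * y - ((120 : ℤ) : ℝ) / 1000 := hp _ (List.mem_singleton.2 rfl)
    push_cast at h1; linarith
  · exact ⟨cl, hcl, hp⟩

end Eval

section Near
variable {u e e' η : ℝ}

theorem rep_nearLess (hu : 0 < u) (hη : η = u * (12 / 25 - 3 / 5 * u)) :
    (Par.nearLess.map (RE.eval u (e / u) (e' / u))).Rep e e' η 1 1 ((1 - u) ^ 2) := by
  rw [Par.map_nearLess, hη]
  refine ⟨hu, ?_, ?_, rfl, ?_, ?_, ?_, ?_⟩ <;> push_cast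
  · field_simp
  · field_simp
  · ring
  · rfl
  · rfl
  · ring

theorem rep_nearMore (hu : 0 < u) (hη : η = u * (12 / 25 - 3 / 5 * u)) :
    (Par.nearMore.map (RE.eval u (e / u) ((e' - e) / u))).Rep e e' η 1 1 ((1 - u) ^ 2) := by
  rw [Par.map_nearMore, hη]
  refine ⟨hu, ?_, ?_, ?_, ?_, ?_, ?_, ?_⟩ <;> push_cast
  · field_simp
  · field_simp; ring
  · ring
  · ring
  · rfl
  · rfl
  · ring

theorem rep_farLess (hu : 0 < u) (he : 0 < e) (hη : η = u * (12 / 25 - 3 / 5 * u)) :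
    (Par.farLess.map (RE.eval (u / e) e ((e - e') / u))).Rep e e' η 1 1 ((1 - u) ^ 2) := by
  rw [Par.map_farLess, hη]
  refine ⟨he, ?_, ?_, ?_, ?_, ?_, ?_, ?_⟩ <;> push_cast
  · ring
  · field_simp; ring
  · ring
  · field_simp; ring
  · rfl
  · rfl
  · field_simp

theorem rep_farMore (hu : 0 < u) (he : 0 < e) (hη : η = u * (12 / 25 - 3 / 5 * u)) :
    (Par.farMore.map (RE.eval (u / e) e ((e' - e) / u))).Rep e e' η 1 1 ((1 - u) ^ 2) := by
  rw [Par.map_farMore, hη]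
  refine ⟨he, ?_, ?_, ?_, ?_, ?_, ?_, ?_⟩ <;> push_cast
  · ring
  · field_simp; ring
  · ring
  · field_simp; ring
  · rfl
  · rfl
  · field_simp

theorem mem_near (hu : 0 < u) (hu1 : u ≤ 1 / 8) (he : 0 ≤ e) (he4 : e ≤ 4 * u) {c : ℝ} {n : ℤ}
    (hc0 : 0 ≤ c) (hc : c * 512 ≤ n * u) {w s r s' : ℕ} {b : ℤ} :
    Mem ⟨512, w, s, r, s', b⟩ ⟨0, 64, 0, 2048, 0, n⟩ u (e / u) (c / u) := by
  simp only [Mem]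
  refine ⟨⟨?_, ?_⟩, ⟨?_, ?_⟩, ?_, ?_⟩ <;> push_cast
  · positivity
  · linarith
  · positivity
  · rw [div_mul_eq_mul_div, div_le_iff₀ hu]; linarith
  · positivity
  · rw [div_mul_eq_mul_div, div_le_iff₀ hu]; linarith

theorem mem_far (hu : 0 < u) (he : 0 < e) (he4 : 4 * u ≤ e) (he1 : e ≤ 1) {c : ℝ} {n : ℤ}
    (hc0 : 0 ≤ c) (hc : c * 256 ≤ n * u) {w s r s' : ℕ} {b : ℤ} :
    Mem ⟨256, w, s, r, s', b⟩ ⟨0, 64, 0, 256, 0, n⟩ (u / e) e (c / u) := by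
  simp only [Mem]
  refine ⟨⟨?_, ?_⟩, ⟨?_, ?_⟩, ?_, ?_⟩ <;> push_cast
  · positivity
  · rw [div_mul_eq_mul_div, div_le_iff₀ he]; linarith
  · positivity
  · linarith
  · positivity
  · rw [div_mul_eq_mul_div, div_le_iff₀ hu]; linarith

variable {x y : ℝ}

/-- `C_neg` with a = b = 1 and t = (1 - u)² reads d(5e + 2d) < 3e(1 - t)(1 - e - η) for d = e' - e,
and the right side is at most 6eu. So the rescaled chart stays bounded as u tends to 0. -/
theorem Tail.sub_le_of_low (hu : 0 < u)
    (h : Tail (Par.unit e e' η 1 1 ((1 - u) ^ 2)) ((1 - u) ^ 2) x y) (hlt : e < e')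
    (hlow : x + 2 / 3 * e < 1 / 2) : 5 * (e' - e) ≤ 6 * u := by
  have h1 := h.C_neg (by simpa [Par.unit] using hlt) (by simpa [Par.unit] using hlow)
  have h2 := h.x_lt
  have h3 := h.x_nonneg
  have he := h.pos.es
  have hη := h.pos.cl
  simp only [Par.unit, Par.C, Par.S1, one_mul, mul_one] at h1 h2 he hη
  push_cast at h1
  have hd : 0 < e' - e := sub_pos.2 hlt
  have h5 : (1 - (1 - u) ^ 2) * (1 - (e + η)) ≤ 2 * u := by
    have : 1 - (1 - u) ^ 2 = 2 * u - u ^ 2 := by ring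
    rw [this]
    nlinarith [mul_nonneg (sq_nonneg u) (show 0 ≤ 1 - (e + η) by linarith),
      mul_pos hu (show 0 < e + η by linarith)]
  have h6 : e * (5 * (e' - e)) ≤ e * (6 * u) := by
    have h7 := mul_le_mul_of_nonneg_left h5 he.le
    nlinarith [mul_pos hd hd]
  exact le_of_mul_le_mul_left h6 he

/-- With d = e' - e and j = p - m, `dev_lt` yields d(2e + d)e < 3e²j, and `sub_lt` yields 3j ≤ 6u +
d. -/
theorem Tail.sub_le_of_high (hu : 0 < u)
    (h : Tail (Par.unit e e' η 1 1 ((1 - u) ^ 2)) ((1 - u) ^ 2) x y) (hlt : e < e')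
    (hhigh : 1 / 2 < x + 2 / 3 * e) : e' - e ≤ 6 * u := by
  have hdl : 0 < (Par.unit e e' η 1 1 ((1 - u) ^ 2)).dl := by simpa [Par.unit] using hlt
  have hhigh' : 1 / 2 < x + 2 / 3 * ((Par.unit e e' η 1 1 ((1 - u) ^ 2)).U *
    (Par.unit e e' η 1 1 ((1 - u) ^ 2)).es) := by simpa [Par.unit] using hhigh
  have h1 := h.dev_lt hdl hhigh'
  have h2 := h.x_lt
  have h4 := h.sub_lt hdl
  have he := h.pos.es
  have hη := h.pos.cl
  have h5 := (h.high_mem hdl (by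
    simp only [Par.unit, one_mul] at h2 he hη ⊢; linarith) hhigh').1
  simp only [Par.unit, Par.Q, Par.c3, Par.w3, Par.J3, one_mul, mul_one] at h1 h2 h4 h5 he hη
  push_cast at h1 h4
  set j := x + 2 / 3 * e - (y + 2 / 3 * e') with hj
  set d := e' - e with hd
  have hd0 : 0 < d := sub_pos.2 hlt
  set c := e + 3 * (1 - 1) + 3 * η with hc
  have hce : e < c := by rw [hc]; linarith
  have hc1 : c < 3 / 2 := by rw [hc]; linarith
  have hj0 : 0 < j := by linarith
  have h6 : e ^ 2 * (3 * j * (3 - 2 * c - 3 * j)) ≤ e ^ 2 * (3 * j) * (3 - c) := by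
    have := mul_nonneg (mul_nonneg (sq_nonneg e) hj0.le) (show 0 ≤ c + 3 * j by linarith)
    linarith
  have h7 : d * (2 * e + d) * c < e ^ 2 * (3 * j) := by
    refine lt_of_mul_lt_mul_right ?_ (show 0 ≤ 3 - c by linarith)
    linarith
  have h8 : d * (2 * e + d) * e ≤ d * (2 * e + d) * c :=
    mul_le_mul_of_nonneg_left hce.le (by positivity)
  have h9 : 3 * j ≤ 6 * u + d := by nlinarith [sq_nonneg u]
  have h10 := mul_le_mul_of_nonneg_left h9 (sq_nonneg e)
  have h11 : e ^ 2 * d ≤ e ^ 2 * (6 * u) := by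
    have := mul_pos (mul_pos hd0 hd0) he
    linarith
  exact le_of_mul_le_mul_left h11 (pow_pos he 2)

/-- As u tends to 0 both η and the room in the inequalities vanish, so fixed boxes in (e, e') would
not do. Rescaling by u, separately for e ≤ 4u and e ≥ 4u, gives bounded charts that extend to u = 0.
-/
theorem dominated_near (hu : 0 < u) (hu1 : u < 3 / 25) (hη : η = u * (12 / 25 - 3 / 5 * u)) :
    Dominated ((1 - u) ^ 2) 1 1 η := by
  have hη0 : 0 < η := by rw [hη]; exact mul_pos hu (by linarith)
  have ht1 : (1 - u) ^ 2 ≤ 1 := by nlinarith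
  have bd : ∀ {x e y e' : ℝ}, Tail (Par.unit e e' η 1 1 ((1 - u) ^ 2)) ((1 - u) ^ 2) x y →
      0 < e ∧ e < 1 ∧ 0 < e' ∧ e' < 1 ∧ e + η < 1 := by
    intro x e y e' h
    have h1 := h.x_lt
    have h2 := h.y_lt
    have h3 := h.x_nonneg
    have h4 := h.y_nonneg
    have h5 := h.pos.es
    have h6 := h.pos.ep
    simp only [Par.unit, one_mul] at h1 h2 h5 h6
    exact ⟨h5, by linarith, h6, by linarith, by linarith⟩
  have hxy : ∀ {e : ℝ}, 0 < e → u / e * e < 3 / 25 := fun he => by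
    rw [div_mul_cancel₀ _ he.ne']; exact hu1
  refine dominated_of_clauses one_pos le_rfl one_pos le_rfl hη0 (sq_nonneg _) le_rfl
    (by linarith) ?_ ?_ ?_ ?_ ?_
  · have : ((1 : ℝ) * (1 - u) ^ 2) ^ 2 ≤ 1 ^ 2 := pow_le_pow_left₀ (by positivity) (by linarith) 2
    nlinarith
  · intro x e y e' ht hle hdev
    obtain ⟨he0, he1, he0', he1', heη⟩ := bd ht
    -- The nonnegative deviation says e - e' ≤ (1 - t)(e + η), and 1 - t ≤ 2u.
    have hz : e - e' ≤ 2 * u := by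
      have : (1 - (1 - u) ^ 2) * (e + η) ≤ 2 * u := by
        have h1 : 1 - (1 - u) ^ 2 ≤ 2 * u := by nlinarith [sq_nonneg u]
        have h2 := mul_le_mul_of_nonneg_right h1 (add_pos he0 hη0).le
        nlinarith
      linarith
    rcases le_total e (4 * u) with h4 | h4
    · refine ⟨_, rep_nearLess hu hη, Par.eval_clauses _ _ _ (Par.eval_lessI _ _ _ _)
        (checkRE_sound near_less (mem_near hu (by linarith) he0.le h4 he0'.le ?_))⟩
      push_cast; linarith
    · refine ⟨_, rep_farLess hu he0 hη, Par.eval_clauses _ _ _ (Par.eval_lessI _ _ _ _)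
        (exists_of_far _ _ _ (hxy he0) (checkRE_sound far_less (mem_far hu he0 h4 he1.le
          (sub_nonneg.2 hle) ?_)))⟩
      push_cast; linarith
  · intro x e y e' ht hlt hlow
    obtain ⟨he0, he1, he0', he1', heη⟩ := bd ht
    have hz := ht.sub_le_of_low hu hlt hlow
    rcases le_total e (4 * u) with h4 | h4
    · refine ⟨_, rep_nearMore hu hη, Par.eval_clauses _ _ _ (Par.eval_moreLow _ _ _ _)
        (checkRE_sound near_moreLow (mem_near hu (by linarith) he0.le h4 (sub_pos.2 hlt).le ?_))⟩
      push_cast; linarith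
    · refine ⟨_, rep_farMore hu he0 hη, Par.eval_clauses _ _ _ (Par.eval_moreLow _ _ _ _)
        (exists_of_far _ _ _ (hxy he0) (checkRE_sound far_moreLow (mem_far hu he0 h4 he1.le
          (sub_pos.2 hlt).le ?_)))⟩
      push_cast; linarith
  · intro x e y e' ht hlt hhigh
    obtain ⟨he0, he1, he0', he1', heη⟩ := bd ht
    have hz := ht.sub_le_of_high hu hlt hhigh
    rcases le_total e (4 * u) with h4 | h4
    · refine ⟨_, rep_nearMore hu hη, Par.eval_clauses _ _ _ (Par.eval_moreHigh _ _ _ _)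
        (checkRE_sound near_moreHigh (mem_near hu (by linarith) he0.le h4 (sub_pos.2 hlt).le ?_))⟩
      push_cast; linarith
    · refine ⟨_, rep_farMore hu he0 hη, Par.eval_clauses _ _ _ (Par.eval_moreHigh _ _ _ _)
        (exists_of_far _ _ _ (hxy he0) (checkRE_sound far_moreHigh (mem_far hu he0 h4 he1.le
          (sub_pos.2 hlt).le ?_)))⟩
      push_cast; linarith
  · intro x e y e' ht hlt hhigh
    obtain ⟨he0, he1, he0', he1', heη⟩ := bd ht
    have hz := ht.sub_le_of_high hu hlt hhigh
    have hJ : 3 * (1 - (1 - u) * (1 - u)) + (e' - e) < 3 := by nlinarith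
    rcases le_total e (4 * u) with h4 | h4
    · refine ⟨_, rep_nearMore hu hη, ?_, Par.eval_clauses _ _ _ (Par.eval_moreMid _ _ _ _)
        (checkRE_sound near_moreMid (mem_near hu (by linarith) he0.le h4 (sub_pos.2 hlt).le ?_))⟩
      · rw [Par.map_nearMore, Par.J3]
        push_cast
        rw [mul_div_cancel₀ _ hu.ne']; linarith
      · push_cast; linarith
    · refine ⟨_, rep_farMore hu he0 hη, ?_, Par.eval_clauses _ _ _ (Par.eval_moreMid _ _ _ _)
        (exists_of_far _ _ _ (hxy he0) (checkRE_sound far_moreMid (mem_far hu he0 h4 he1.le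
          (sub_pos.2 hlt).le ?_)))⟩
      · rw [Par.map_farMore, Par.J3]
        push_cast
        have h6 : e * (u / e * ((e' - e) / u)) = e' - e := by field_simp
        have h7 : u / e * e = u := by field_simp
        rw [h6, h7]; linarith
      · push_cast; linarith

end Near

theorem slackFst_near : checkRE ⟨1048576, 176, 5, 4, 1, 2097152⟩
    [[slackFst .c (.c 1 - .x) (.c 1) (.x * (.milli 480 - .milli 600 * .x)) .y]]
    ⟨0, 125830, 0, 1048576, 0, 1048576⟩ 53678865 = true := by decide +kernel

theorem slackNear_near : checkRE ⟨1048576, 176, 5, 4, 1, 2097152⟩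
    [[slackNear .c .x (.x * (.milli 480 - .milli 600 * .x)) .y]]
    ⟨0, 125830, 0, 1048576, 0, 1048576⟩ 817 = true := by decide +kernel

/-- With a = b = 1 all the room is spent on η; the quadratic u(0.48 - 0.6u) fits below what
`slackFst` and `slackNear` allow. -/
theorem splits_near {k : ℝ} (hk : 22 / 25 < k) (hk1 : k < 1) : Splits k := by
  set u := 1 - k with hu
  have hku : k = 1 - u := by rw [hu]; ring
  have hu0 : 0 < u := by linarith
  have hu1 : u < 3 / 25 := by linarith
  have hmem : ∀ {w : ℝ}, w ∈ Set.Icc (0 : ℝ) 1 → Mem ⟨1048576, 176, 5, 4, 1, 2097152⟩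
      ⟨0, 125830, 0, 1048576, 0, 1048576⟩ u w 0 := by
    intro w hw
    have := hw.1
    have := hw.2
    simp only [Mem]
    refine ⟨⟨?_, ?_⟩, ⟨?_, ?_⟩, ?_, ?_⟩ <;> push_cast <;> linarith
  refine ⟨1, 1, u * (12 / 25 - 3 / 5 * u), one_pos, le_rfl, one_pos, le_rfl, ?_, Or.inl ⟨?_, ?_⟩⟩
  · intro ζ α β ς h
    constructor
    · refine h.fst_le zero_le_one fun w hw => Or.inl ?_
      obtain ⟨cl, hcl, hp⟩ := checkRE_sound slackFst_near (hmem hw)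
      rw [List.mem_singleton] at hcl
      subst hcl
      have h1 := hp _ (List.mem_singleton.2 rfl)
      rw [eval_slackFst] at h1
      have h2 : 0 ≤ slackFst (fun n : ℤ => (n : ℝ)) (((1 : ℤ) : ℝ) - u) ((1 : ℤ) : ℝ)
        (u * (((480 : ℤ) : ℝ) / 1000 - ((600 : ℤ) : ℝ) / 1000 * u)) w := h1
      rw [hku]
      convert h2 using 2 <;> push_cast <;> ring
    · refine h.snd_le_near ?_
      obtain ⟨cl, hcl, hp⟩ := checkRE_sound slackNear_near (hmem ⟨h.ζ_nonneg, h.ζ_le⟩)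
      rw [List.mem_singleton] at hcl
      subst hcl
      have h1 := hp _ (List.mem_singleton.2 rfl)
      rw [eval_slackNear] at h1
      have h2 : 0 ≤ slackNear (fun n : ℤ => (n : ℝ)) u
        (u * (((480 : ℤ) : ℝ) / 1000 - ((600 : ℤ) : ℝ) / 1000 * u)) ζ := h1
      convert h2 using 2; push_cast; ring
  · exact mul_pos hu0 (by linarith)
  · rw [hku]; exact dominated_near hu0 hu1 rfl

/-! ### Small ratios: the plain union bound -/

/-- A bound of a power of two with rational exponent. -/
theorem exp_neg_mul_log_two_le {A c : ℝ} {j n : ℕ} (hj : j ≠ 0) (hA : 0 < A) (h : A ^ j ≤ 2 ^ n)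
    (hc : (n : ℝ) ≤ j * c) : Real.exp (-(c * Real.log 2)) ≤ 1 / A := by
  rw [Real.exp_neg, ← one_div]
  refine one_div_le_one_div_of_le hA ?_
  refine le_of_pow_le_pow_left₀ hj (Real.exp_pos _).le (h.trans ?_)
  rw [← Real.exp_nat_mul, ← Real.exp_log (show (0 : ℝ) < 2 ^ n by positivity), Real.exp_le_exp,
    Real.log_pow]
  have := mul_le_mul_of_nonneg_right hc (Real.log_nonneg one_le_two)
  linarith

/-- A is a lower bound of 2^c for c = (4/3)(1/a - 1), obtained from A^j ≤ 2^n with n/j ≤ c; the tail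
at b is bounded by `gain`. -/
theorem splitsOn_of_union {k₀ k₁ a b s₀ s₁ : ℤ} {c₁ c₂ : ℕ}
    (hc : coversCertified k₀ k₁ a b 0 s₀ s₁ c₁ c₂ = true) (hk₀ : 0 < k₀) (ha0 : 0 < a)
    (ha : a < 1000) (hb0 : 0 < b) (hb : b < 1000) {A : ℝ} {j n : ℕ} (hj : j ≠ 0) (hA : 0 < A)
    (h : A ^ j ≤ 2 ^ n) (hn : (n : ℝ) ≤ j * (4 / 3 * (1 / (a / 1000) - 1)))
    (hs : 1 / A + gain (1 / (b / 1000) - 1) < 1) : SplitsOn k₀ k₁ := by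
  intro k hk
  have ha0' : (0 : ℝ) < a := by exact_mod_cast ha0
  have hb0' : (0 : ℝ) < b := by exact_mod_cast hb0
  have ha' : (a : ℝ) < 1000 := by exact_mod_cast ha
  have hb' : (b : ℝ) < 1000 := by exact_mod_cast hb
  refine ⟨a / 1000, b / 1000, 0, by positivity, by linarith, by positivity, by linarith, ?_,
    Or.inr ⟨rfl, by linarith, by linarith, ?_⟩⟩
  · have := covers_of_certified hc hk₀ hb0 hk
    simpa using this
  · have h1 := exp_neg_mul_log_two_le hj hA h hn
    have h2 : Real.exp (-(4 / 3 * (1 / ((b : ℝ) / 1000) - 1) * Real.log 2)) < _ := exp_lt_gain (by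
      rw [sub_pos, lt_div_iff₀ (by positivity)]; linarith)
    linarith

theorem splitsOn_90 : SplitsOn 90 170 := by
  refine splitsOn_of_union (a := 220) (b := 955) (s₀ := 776032) (s₁ := 840247)
    (c₁ := 13744804881) (c₂ := 817) (A := 25) (j := 3) (n := 14) (by decide +kernel)
    ?_ ?_ ?_ ?_ ?_ ?_ ?_ ?_ ?_ ?_ <;> norm_num [gain]

theorem splitsOn_170 : SplitsOn 170 250 := by
  refine splitsOn_of_union (a := 320) (b := 855) (s₀ := 840244) (s₁ := 881745)
    (c₁ := 3518672999441) (c₂ := 817) (A := 7) (j := 6) (n := 17) (by decide +kernel)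
    ?_ ?_ ?_ ?_ ?_ ?_ ?_ ?_ ?_ ?_ <;> norm_num [gain]

theorem splitsOn_250 : SplitsOn 250 309 := by
  refine splitsOn_of_union (a := 400) (b := 755) (s₀ := 881742) (s₁ := 905410)
    (c₁ := 53744401) (c₂ := 53678385) (A := 4) (j := 1) (n := 2) (by decide +kernel)
    ?_ ?_ ?_ ?_ ?_ ?_ ?_ ?_ ?_ ?_ <;> norm_num [gain]

theorem exp_add_exp_lt {k : ℝ} (hk : 0 < k) (hk1 : k ≤ 9 / 100) :
    Real.exp (-(4 / 3 * (1 / (2 * k) - 1) * Real.log 2)) +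
      Real.exp (-(4 / 3 * (1 / (1 - k / 2) - 1) * Real.log 2)) < 1 := by
  set h := 1 / (2 * k) - 1 with hh
  have hkh : k = 1 / (2 * (h + 1)) := by rw [hh]; field_simp; ring
  have h4 : 9 / 2 ≤ h := by
    have : 11 / 2 ≤ 1 / (2 * k) := by rw [le_div_iff₀ (by positivity)]; linarith
    linarith
  -- Splitting the exponent into three equal parts makes the quadratic bound of exp effective for
  -- large h.
  have h1 : Real.exp (-(4 / 3 * h * Real.log 2)) < gain (h / 3) ^ 3 := by
    have : Real.exp (-(4 / 3 * h * Real.log 2)) = Real.exp (-(4 / 3 * (h / 3) * Real.log 2)) ^ 3 := by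
      rw [← Real.exp_nat_mul]; congr 1; push_cast; ring
    rw [this]
    exact pow_lt_pow_left₀ (exp_lt_gain (by linarith)) (Real.exp_pos _).le three_ne_zero
  -- With h = 1/a - 1 for a = 2k, the relative deviation at b = 1 - k/2 is 1/(4h + 3). That tail
  -- misses 1 by at least 0.92/(4h + 3.92), which the other tail must not exceed.
  have e1 : 1 / (1 - k / 2) - 1 = 1 / (4 * h + 3) := by
    rw [hkh]
    have : 0 < 4 * h + 3 := by linarith
    have : 1 - 1 / (2 * (h + 1)) / 2 = (4 * h + 3) / (4 * (h + 1)) := by field_simp; ring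
    rw [this]; field_simp; ring
  have h2 : Real.exp (-(4 / 3 * (1 / (1 - k / 2) - 1) * Real.log 2)) <
      gain (1 / (1 - k / 2) - 1) := exp_lt_gain (by
    rw [e1]; exact one_div_pos.2 (by linarith))
  have h3 : gain (1 / (1 - k / 2) - 1) ≤ (4 * h + 3) / (4 * h + 3.92) := by
    rw [e1, gain, div_le_div_iff₀ (by positivity) (by linarith)]
    have h5 : 0 ≤ 0.4267 * (1 / (4 * h + 3)) ^ 2 := by positivity
    have h6 : 1 / (4 * h + 3) * (4 * h + 3) = 1 := by
      rw [one_div, inv_mul_cancel₀ (by linarith)]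
    have h7 := mul_nonneg h5 (show 0 ≤ 4 * h + 3 by linarith)
    linarith
  have h5 : gain (h / 3) ^ 3 ≤ 0.92 / (4 * h + 3.92) := by
    have h6 : 1 + h / 2 ≤ 1 + 0.92 * (h / 3) + 0.4267 * (h / 3) ^ 2 := by nlinarith
    have h7 : gain (h / 3) ≤ 1 / (1 + h / 2) := one_div_le_one_div_of_le (by linarith) h6
    have h8 : 0 ≤ gain (h / 3) := by rw [gain]; positivity
    refine (pow_le_pow_left₀ h8 h7 3).trans ?_
    rw [one_div, inv_pow, ← one_div, div_le_div_iff₀ (by positivity) (by linarith)]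
    nlinarith [mul_nonneg (sub_nonneg.2 h4) (sub_nonneg.2 h4), mul_nonneg (mul_nonneg
      (sub_nonneg.2 h4) (sub_nonneg.2 h4)) (show 0 ≤ h by linarith)]
  have h6 : (4 * h + 3) / (4 * h + 3.92) + 0.92 / (4 * h + 3.92) = 1 := by
    rw [← add_div, div_eq_one_iff_eq (by linarith)]; ring
  linarith

theorem covers_small {k : ℝ} (hk : 0 < k) (hk1 : k ≤ 9 / 100) : Covers k (2 * k) (1 - k / 2) 0 := by
  intro ζ α β ς h
  constructor
  · refine h.fst_le (by linarith) fun w hw => ?_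
    simp only [slackFst, slackFst', Int.cast_one]
    set τ := 1 - k * k with hτ
    have hτ0 : 0 < τ := by nlinarith
    set b := k * k + τ * w with hb
    have hb0 : 0 < b := by
      have := mul_nonneg hτ0.le hw.1
      have := mul_pos hk hk; linarith
    have hb1 : b ≤ 1 := by
      have := mul_le_mul_of_nonneg_left hw.2 hτ0.le
      rw [hb]; linarith
    -- For β ≤ √k the interpolation defect at ρ is used; for larger β the bound ς ≥ 1 - k.
    rcases le_or_gt (b ^ 2) k with h1 | h1
    · right
      refine ⟨trivial, ?_⟩
      have h2 : b ≤ 3 / 10 := by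
        refine le_of_pow_le_pow_left₀ two_ne_zero (by norm_num) (h1.trans ?_); linarith
      have h3 : 1 / 2 ≤ 1 - (1 - k / 2) * b := by nlinarith
      have h4 := mul_le_mul_of_nonneg_left h3 (mul_pos hk hk).le
      have h5 := mul_le_mul_of_nonneg_left h1 (show 0 ≤ k / 2 by linarith)
      linarith
    · left
      set s := √k with hs
      have hs0 : 0 < s := Real.sqrt_pos.2 hk
      have hs2 : k = s ^ 2 := (Real.sq_sqrt hk.le).symm
      have hs3 : s ≤ 3 / 10 := by
        refine le_of_pow_le_pow_left₀ two_ne_zero (by norm_num) ?_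
        rw [← hs2]; linarith
      have hsb : s ≤ b := by
        refine le_of_pow_le_pow_left₀ two_ne_zero hb0.le ?_
        rw [← hs2]; exact h1.le
      have e1 : τ * w = b - s ^ 4 := by rw [hb, hs2]; ring
      have e2 : τ = 1 - s ^ 4 := by rw [hτ, hs2]; ring
      have hs4 : s ^ 4 ≤ s := by
        have : s ^ 3 ≤ 1 := pow_le_one₀ hs0.le (by linarith)
        nlinarith
      refine nonneg_of_mul_nonneg_right (a := τ) ?_ hτ0
      have h2 : (s - s ^ 4) ^ 2 ≤ (b - s ^ 4) ^ 2 := pow_le_pow_left₀ (by linarith) (by linarith) 2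
      have h3 : (1 - s ^ 2 / 2) * (s - s ^ 4) ^ 2 * b ≤ (1 - s ^ 2 / 2) * (b - s ^ 4) ^ 2 * b :=
        mul_le_mul_of_nonneg_right (mul_le_mul_of_nonneg_left h2 (by nlinarith)) hb0.le
      have h4 : s ^ 4 * (1 - s ^ 4) * b ≤ s ^ 4 * (1 - s ^ 4) :=
        mul_le_of_le_one_right (mul_nonneg (by positivity) (by rw [← e2]; exact hτ0.le)) hb1
      have h5 : 0 ≤ s ^ 2 * ((1 - s ^ 2 / 2) * (1 - s ^ 3) ^ 2 - (1 - s ^ 2) * (1 - s ^ 4)) := by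
        refine mul_nonneg (sq_nonneg s) ?_
        have h6 : 0 ≤ 1 / 2 - 2 * s + s ^ 2 + s ^ 3 - s ^ 6 / 2 := by
          have : s ^ 6 ≤ s ^ 3 := pow_le_pow_of_le_one hs0.le (by linarith) (by norm_num)
          nlinarith [mul_nonneg (sub_nonneg.2 hs3) (sub_nonneg.2 hs3)]
        have := mul_nonneg (sq_nonneg s) h6
        linarith
      have h7 := mul_nonneg h5 hb0.le
      have e3 : τ * (k * k + (1 - k / 2) * (τ * (w * w)) * b - (k + 0) * b) =
          s ^ 4 * (1 - s ^ 4) + (1 - s ^ 2 / 2) * (b - s ^ 4) ^ 2 * b - s ^ 2 * (1 - s ^ 4) * b := by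
        rw [← e1, e2, hs2]; ring
      rw [e3]
      have e4 : (1 - s ^ 2 / 2) * (s - s ^ 4) ^ 2 * b =
        s ^ 2 * ((1 - s ^ 2 / 2) * (1 - s ^ 3) ^ 2) * b := by ring
      rw [e4] at h3
      linarith
  · obtain ⟨hk0, -, hζ0, hζ1, -, -, -, -, hg, -, he⟩ := h
    set v := 1 - ζ with hv
    have hζv : ζ = 1 - v := by rw [hv]; ring
    have hβ0 : 0 ≤ β := (Real.rpow_nonneg hk0.le _).trans hg
    rcases le_or_gt (1 - 2 * v) 0 with h1 | h1
    · have h2 : 0 ≤ (1 - k / 2) * ζ * β := mul_nonneg (mul_nonneg (by linarith) hζ0) hβ0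
      nlinarith
    · set w := 1 - 2 * v with hw
      -- Here k < 1/e, hence k^w ≤ e^(-w) ≤ 1/(1 + w).
      have h2 : k ^ w ≤ 1 / (1 + w) := by
        rw [Real.rpow_def_of_pos hk0]
        have hl : Real.log k ≤ -1 := by
          have h3 := Real.add_one_le_exp (1 : ℝ)
          have h4 := Real.exp_one_lt_d9
          rw [Real.log_le_iff_le_exp hk0, Real.exp_neg, ← one_div, le_div_iff₀ (Real.exp_pos _)]
          nlinarith
        have h5 : Real.exp (Real.log k * w) ≤ Real.exp (-w) := by
          rw [Real.exp_le_exp]; nlinarith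
        refine h5.trans ?_
        rw [Real.exp_neg, ← one_div]
        refine one_div_le_one_div_of_le (by linarith) ?_
        have := Real.add_one_le_exp w; linarith
      have h3 : k = k ^ (2 * v) * k ^ w := by
        rw [← Real.rpow_add hk0, hw, show 2 * v + (1 - 2 * v) = 1 by ring, Real.rpow_one]
      have h4 : k * w ≤ (1 - k / 2) * ζ * β := by
        have h6 : k ^ w * w ≤ (1 - k / 2) * ζ := by
          have h7 : k ^ w * w ≤ 1 / (1 + w) * w := mul_le_mul_of_nonneg_right h2 h1.le
          refine h7.trans ?_
          rw [one_div, inv_mul_le_iff₀ (by linarith)]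
          have : ζ = (1 + w) / 2 := by rw [hw, hv]; ring
          rw [this]
          nlinarith [sq_nonneg (1 - w), mul_nonneg (show 0 ≤ 9 / 100 - k by linarith)
            (sq_nonneg (1 + w))]
        calc k * w = k ^ (2 * v) * (k ^ w * w) := by rw [← mul_assoc, ← h3]
          _ ≤ k ^ (2 * v) * ((1 - k / 2) * ζ) :=
            mul_le_mul_of_nonneg_left h6 (Real.rpow_nonneg hk0.le _)
          _ ≤ β * ((1 - k / 2) * ζ) :=
            mul_le_mul_of_nonneg_right hg (mul_nonneg (by linarith) hζ0)
          _ = _ := by ring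
      have : k * w = k - v * (2 * k) := by rw [hw]; ring
      linarith

theorem splits (k : ℝ) (hk : 0 < k) (hk1 : k < 1) : Splits k := by
  rcases le_or_gt k (9 / 100) with h | h
  · exact ⟨2 * k, 1 - k / 2, 0, by linarith, by linarith, by linarith, by linarith,
      covers_small hk h, Or.inr ⟨rfl, by linarith, by linarith, exp_add_exp_lt hk h⟩⟩
  · rcases le_or_gt k (441 / 500) with h' | h'
    · refine splitsOn_90.trans (splitsOn_170.trans (splitsOn_250.trans splitsOn_mid)) k ⟨?_, ?_⟩ <;>
        push_cast <;> linarith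
    · exact splits_near (by linarith) hk1

/-! ### Passage to the complement and conclusion -/

section Complement
variable {d N m : ℕ} {B Q : Set (Fin d → ℝ)} {ρ : ℝ} {x : ℕ → Fin d → ℝ}

theorem badHits_add_badHits_compl (ℓ : ℕ) :
    badHits B Q ρ x ℓ + badHits B Qᶜ ρ x ℓ = hits B ρ x ℓ := by
  rw [badHits, badHits, hits, ← Finset.sum_add_distrib]
  refine Finset.sum_congr rfl fun k _ => ?_
  by_cases hB : x k ∈ bset B ρ <;> by_cases hQ : x k ∈ Q <;> simp [Set.indicator, hB, hQ]

/-- After completion exactly N samples are counted, and each of them violates exactly one of Q and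
its complement. -/
theorem goodCount_compl {r : Fin m → ℝ} (h : ∃ j, IsDone B N r x j) (i : Fin m) :
    (goodCount B Qᶜ N r (r i) x : ℝ) = N - goodCount B Q N r (r i) x := by
  have hs : IsDone B N r x (stopTime B N r x) := Nat.sInf_mem (s := {j | IsDone B N r x j}) h
  have h1 : numViolations B Q N (r i) x (stopTime B N r x) +
      numViolations B Qᶜ N (r i) x (stopTime B N r x) = N :=
    (badHits_add_badHits_compl _).trans (hs i)
  rw [eq_sub_iff_add_eq, goodCount, goodCount]
  norm_cast
  omega

end Complement

section Main
variable {d m : ℕ} {B Q : Set (Fin d → ℝ)} {N : ℕ} {r : Fin (m + 1) → ℝ} {Ω : Type*}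
  [MeasurableSpace Ω] {μ : Measure Ω} [IsProbabilityMeasure μ] {X : ℕ → Ω → Fin d → ℝ}
  {i : Fin m} {P R t : ℝ}

theorem Run.compl (h : Run μ B Q N r X i P R t) : Run μ B Qᶜ N r X i (1 - P) (1 - R) t where
  measB := h.measB
  measQ := h.measQ.compl
  star := h.star
  vol_ne_zero := h.vol_ne_zero
  vol_ne_top := h.vol_ne_top
  pos := h.pos
  mono := h.mono
  reuse := h.reuse
  prob_fst := by
    rw [robustProb_compl h.vol_ne_zero h.vol_ne_top h.measQ (h.radius_pos _), h.prob_fst]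
  prob_snd := by
    rw [robustProb_compl h.vol_ne_zero h.vol_ne_top h.measQ (h.radius_pos _), h.prob_snd]
  ratio := h.ratio

/-- The upper confidence band fails somewhere on the grid interval with probability less than
`δ / 2`. -/
theorem Run.band_lt (h : Run μ B Q N r X i P R t) (hd : 0 < d) (hN : 0 < N) {δ : ℝ}
    (hδ : δ ∈ Set.Ioo (0 : ℝ) 1) {rs : ℝ}
    (hrs : ∀ x ∈ Set.Icc (r i.castSucc) (r i.succ),
      gfun d (r i.castSucc) (r i.succ) rs ≤ gfun d (r i.castSucc) (r i.succ) x) :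
    μ.real {ω | ∃ ρ ∈ Set.Icc (r i.castSucc) (r i.succ),
      interp (r i.castSucc) (r i.succ)
        (upperLim N δ (goodCount B Q N r (r i.castSucc) fun k => X k ω))
        (upperLim N δ (goodCount B Q N r (r i.succ) fun k => X k ω)) ρ +
        interpErr d (r i.castSucc) (r i.succ) rs ≤ robustProb B Q ρ} < δ / 2 := by
  have hp := h.radius_pos i.castSucc
  have hq := h.radius_pos i.succ
  have hpq : r i.castSucc < r i.succ := h.mono Fin.castSucc_lt_succ
  have ht0 : 0 < t := h.ratio ▸ pow_pos (div_pos hp hq) d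
  have ht1 : t < 1 := h.ratio ▸ pow_lt_one₀ (div_pos hp hq).le ((div_lt_one hq).2 hpq) hd.ne'
  obtain ⟨a, b, η, ha0, ha, hb0, hb, hcov, hη⟩ :=
    splits (√t) (Real.sqrt_pos.2 ht0) ((Real.sqrt_lt' one_pos).2 (by simpa using ht1))
  refine lt_of_le_of_lt (b := μ.real {ω |
      upperLim N δ (goodCount B Q N r (r i.castSucc) fun k => X k ω) ≤ a * P - η ∨
      upperLim N δ (goodCount B Q N r (r i.succ) fun k => X k ω) ≤ b * R - η})
    (measureReal_mono ?_) ?_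
  · rintro ω ⟨ρ, hρ, hle⟩
    by_contra hnot
    simp only [Set.mem_ofPred_eq, not_or, not_le] at hnot
    have harc := arc_of_mem hd hp hpq hrs hρ
    rw [h.ratio] at harc
    obtain ⟨h0, h1⟩ := hcov _ _ _ _ harc
    exact (h.robustProb_lt_of_thresholds hρ hnot.1 hnot.2 hpq rfl hb0.le hb h0 h1).not_ge hle
  · rcases hη with ⟨hη, hdom⟩ | ⟨rfl, ha, hb, hab⟩
    · rw [Real.sq_sqrt ht0.le] at hdom
      exact h.upper_lt_of_dominated hN hδ ha0 ha hb0 hb hη hdom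
    · simpa only [sub_zero] using h.upper_lt_of_union hN hδ ha0 ha hb0 hb hab

end Main

theorem interp_one_sub (p q u w ρ : ℝ) :
    interp p q (1 - u) (1 - w) ρ = 1 - interp p q u w ρ := by
  rw [interp, interp]; ring

end SampleReuse

open SampleReuse in
theorem theorem6 {d : ℕ} (hd : 0 < d)
    (B Q : Set (Fin d → ℝ)) (hB : MeasurableSet B) (hQ : MeasurableSet Q)
    (hstar : ∀ x ∈ B, ∀ c ∈ Set.Icc (0 : ℝ) 1, c • x ∈ B)
    (hB0 : MeasureTheory.volume B ≠ 0) (hBtop : MeasureTheory.volume B ≠ ⊤)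
    (N : ℕ) (hN : 0 < N)
    (m : ℕ) (r : Fin (m + 1) → ℝ) (hr0 : 0 < r 0) (hr : StrictMono r)
    {Ω : Type*} [MeasurableSpace Ω] (μ : MeasureTheory.Measure Ω)
    [MeasureTheory.IsProbabilityMeasure μ]
    (X : ℕ → Ω → Fin d → ℝ) (hX : SampleReuse.IsSampleReuse μ B N r X)
    (δ : ℝ) (hδ : δ ∈ Set.Ioo (0 : ℝ) 1) (i : Fin m) :
    ∃ rstar : ℝ,
      SampleReuse.IsStar d (r i.castSucc) (r i.succ) rstar ∧
      (∀ ρ, SampleReuse.IsStar d (r i.castSucc) (r i.succ) ρ → ρ = rstar) ∧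
      ENNReal.ofReal (1 - δ) <
        μ {ω | (∃ j, SampleReuse.IsDone B N r (fun k => X k ω) j) ∧
          ∀ ρ ∈ Set.Icc (r i.castSucc) (r i.succ),
            SampleReuse.interp (r i.castSucc) (r i.succ)
                (SampleReuse.lowerLim N δ
                  (SampleReuse.numRobust B Q N r (r i.castSucc) (fun k => X k ω)))
                (SampleReuse.lowerLim N δ
                  (SampleReuse.numRobust B Q N r (r i.succ) (fun k => X k ω))) ρ
              - SampleReuse.interpErr d (r i.castSucc) (r i.succ) rstar
              < SampleReuse.robustProb B Q ρ ∧
            SampleReuse.robustProb B Q ρ <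
              SampleReuse.interp (r i.castSucc) (r i.succ)
                (SampleReuse.upperLim N δ
                  (SampleReuse.numRobust B Q N r (r i.castSucc) (fun k => X k ω)))
                (SampleReuse.upperLim N δ
                  (SampleReuse.numRobust B Q N r (r i.succ) (fun k => X k ω))) ρ
              + SampleReuse.interpErr d (r i.castSucc) (r i.succ) rstar} := by
  have hpos : ∀ j, 0 < r j := fun j => hr0.trans_le (hr.monotone (Fin.zero_le j))
  have hpq : r i.castSucc < r i.succ := hr Fin.castSucc_lt_succ
  obtain ⟨rs, hs, hsu, hmin⟩ := exists_isStar hd (hpos i.castSucc) hpq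
  refine ⟨rs, hs, hsu, ?_⟩
  have hrun : Run μ B Q N r X i _ _ _ := ⟨hB, hQ, hstar, hB0, hBtop, hr0, hr, hX, rfl, rfl, rfl⟩
  have hU := hrun.band_lt hd hN hδ hmin
  have hL := hrun.compl.band_lt hd hN hδ hmin
  have hdone := ae_exists_isDone hB hstar hB0 hBtop hr0 hr hX
  set bad₁ := {ω | ∃ ρ ∈ Set.Icc (r i.castSucc) (r i.succ),
    interp (r i.castSucc) (r i.succ)
      (upperLim N δ (goodCount B Q N r (r i.castSucc) fun k => X k ω))
      (upperLim N δ (goodCount B Q N r (r i.succ) fun k => X k ω)) ρ +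
      interpErr d (r i.castSucc) (r i.succ) rs ≤ robustProb B Q ρ}
  set bad₂ := {ω | ∃ ρ ∈ Set.Icc (r i.castSucc) (r i.succ),
    interp (r i.castSucc) (r i.succ)
      (upperLim N δ (goodCount B Qᶜ N r (r i.castSucc) fun k => X k ω))
      (upperLim N δ (goodCount B Qᶜ N r (r i.succ) fun k => X k ω)) ρ +
      interpErr d (r i.castSucc) (r i.succ) rs ≤ robustProb B Qᶜ ρ}
  set good := {ω | (∃ j, IsDone B N r (fun k => X k ω) j) ∧ _}
  -- Almost surely the procedure stops. A failure of the upper side is then the bad event for Q, and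
  -- a failure of the lower side the bad event for the complement of Q.
  have hcover : ∀ᵐ ω ∂μ, ω ∈ (Set.univ : Set Ω) → ω ∈ good ∪ (bad₁ ∪ bad₂) := by
    filter_upwards [hdone] with ω hω _
    by_contra hnot
    simp only [Set.mem_union, not_or] at hnot
    obtain ⟨h0, h1, h2⟩ := hnot
    refine h0 ⟨hω, fun ρ hρ => ⟨?_, ?_⟩⟩
    · by_contra hle
      refine h2 ⟨ρ, hρ, ?_⟩
      rw [numRobust_eq, numRobust_eq, lowerLim_eq hN, lowerLim_eq hN, interp_one_sub,
        ← goodCount_compl hω, ← goodCount_compl hω] at hle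
      rw [robustProb_compl hB0 hBtop hQ ((hpos i.castSucc).trans_le hρ.1)]
      linarith
    · by_contra hle
      rw [numRobust_eq, numRobust_eq] at hle
      exact h1 ⟨ρ, hρ, not_lt.1 hle⟩
  have hle : (1 : ℝ) ≤ μ.real good + (μ.real bad₁ + μ.real bad₂) :=
    calc (1 : ℝ) = μ.real Set.univ := by simp
      _ ≤ μ.real (good ∪ (bad₁ ∪ bad₂)) :=
        ENNReal.toReal_mono (MeasureTheory.measure_ne_top _ _)
          (MeasureTheory.measure_mono_ae hcover)
      _ ≤ _ := (MeasureTheory.measureReal_union_le _ _).trans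
        (add_le_add_right (MeasureTheory.measureReal_union_le _ _) _)
  rw [ENNReal.ofReal_lt_iff_lt_toReal (by linarith [hδ.2]) (MeasureTheory.measure_ne_top _ _)]
  change 1 - δ < μ.real good
  linarith
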